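/- Let $n\ge 1$, $s_0\in(0,1)$, $\gamma>0$. Let $\Omega\subset\mathbb R^n$ be a bounded open set with $C^{2,\gamma}$ boundary, i.e. near each of its boundary points $\Omega$ lies on one side of the graph of a $C^{2,\gamma}$ function. Let $d\in C^{2,\gamma}(\overline\Omega)$ be a function that is positive in $\Omega$ and coincides with $\mathrm{dist}(x,\mathbb R^n\setminus\Omega)$ in a neighborhood of $\partial\Omega$; the functions $d^s$ and $d^s\eta$ below are extended by $0$ outside $\Omega$. For $s\in(0,1)$ and a function $\mu$ on $S^{n-1}$ let $$Lu(x)=(1-s)\int_{\mathbb R^n}\Big(\frac{u(x+y)+u(x-y)}2-u(x)\Big)\frac{\mu(y/|y|)}{|y|^{n+2s}}\,dy .$$ Then for every $M\ge 0$ there is a constant $C$, depending only on $n,s_0,\gamma,\Omega,d$ and $M$, such that for all $s\in(s_0,1)$ with $\gamma\le s$ and all $\mu\in C^{1,\gamma}(S^{n-1})$ with $\|\mu\|_{C^{1,\gamma}(S^{n-1})}\le M$ the following holds. 1. The integral defining $L(d^s)(x)$ converges absolutely for every $x\in\Omega$, the function $L(d^s)$ extends from $\Omega$ to a function in $C^\gamma(\overline\Omega)$,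 and $\|L(d^s)\|_{C^\gamma(\overline\Omega)}\le C$. 2. For every $\eta\in C^{2,\gamma}(\mathbb R^n)$, the integral defining $L(d^s\eta)(x)$ converges absolutely for every $x\in\Omega$, the function $L(d^s\eta)$ extends from $\Omega$ to a function in $C^\gamma(\overline\Omega)$, and $\|L(d^s\eta)\|_{C^\gamma(\overline\Omega)}\le C\,\|\eta\|_{C^{2,\gamma}(\mathbb R^n)}$. In particular this holds for every stable operator of this form whose spectral measure $\mu$ is even and satisfies $\lambda\le\mu\le\Lambda$ with constants $0<\lambda\le\Lambda$; neither condition is needed. -/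

import Mathlib

open MeasureTheory Set Metric
open scoped NNReal ENNReal

/-- `ℝⁿ` with its Euclidean norm. -/
abbrev RSpace (n : ℕ) : Type := EuclideanSpace ℝ (Fin n)

/-- The Hölder norm `‖f‖_{C^{k,γ}(A)} = ∑_{j ≤ k} sup_A |D^j f| + [D^k f]_{γ; A}`, with value `∞`
when one of the terms is infinite. It is used for open sets `A`, and for arbitrary `A` when `k = 0`
(where `D^0 f` is `f` itself), so that the derivatives are the ordinary ones. -/
noncomputable def ckHolderNorm {n : ℕ} (k : ℕ) (γ : ℝ≥0) (A : Set (RSpace n))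
    (f : RSpace n → ℝ) : ℝ≥0∞ :=
  (∑ j ∈ Finset.range (k + 1), ⨆ x ∈ A, ‖iteratedFDeriv ℝ j f x‖ₑ)
    + eHolderNorm γ (fun x : A => iteratedFDeriv ℝ k f (x : RSpace n))

/-- `f ∈ C^{k,γ}` on the open set `A`, with finite norm up to the boundary of `A`; for a bounded
domain `A` with regular boundary this is `f ∈ C^{k,γ}(closure A)`. -/
def MemCkHolder {n : ℕ} (k : ℕ) (γ : ℝ≥0) (A : Set (RSpace n)) (f : RSpace n → ℝ) : Prop :=
  ContDiffOn ℝ k f A ∧ ckHolderNorm k γ A f < ∞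

/-- The projection `y ↦ y / |y|` of a nonzero vector to the unit sphere. -/
noncomputable def toSphere {n : ℕ} (y : RSpace n) (hy : y ≠ 0) : sphere (0 : RSpace n) 1 :=
  ⟨‖y‖⁻¹ • y, by
    rw [mem_sphere_zero_iff_norm, norm_smul, norm_inv, norm_norm,
      inv_mul_cancel₀ (norm_ne_zero_iff.mpr hy)]⟩

open Classical in
/-- The function `y ↦ μ (y / |y|)` on `ℝⁿ \ {0}` (with value `0` at the origin). -/
noncomputable def radialExt {n : ℕ} (μ : sphere (0 : RSpace n) 1 → ℝ) (y : RSpace n) : ℝ :=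
  if hy : y = 0 then 0 else μ (toSphere y hy)

/-- The norm `‖μ‖_{C^{1,γ}(S^{n-1})} = sup |μ| + sup |∇μ| + [∇μ]_γ`. The tangential gradient of `μ`
at `θ ∈ S^{n-1}` is the derivative at `θ` of the `0`-homogeneous extension `y ↦ μ (y / |y|)`. -/
noncomputable def sphereC1HolderNorm {n : ℕ} (γ : ℝ≥0) (μ : sphere (0 : RSpace n) 1 → ℝ) : ℝ≥0∞ :=
  (⨆ θ : sphere (0 : RSpace n) 1, ‖μ θ‖ₑ)
    + (⨆ θ : sphere (0 : RSpace n) 1, ‖fderiv ℝ (radialExt μ) (θ : RSpace n)‖ₑ)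
    + eHolderNorm γ (fun θ : sphere (0 : RSpace n) 1 => fderiv ℝ (radialExt μ) (θ : RSpace n))

/-- `μ` is a `C¹` function on the unit sphere, i.e. its `0`-homogeneous extension is `C¹` away from
the origin. -/
def IsC1Sphere {n : ℕ} (μ : sphere (0 : RSpace n) 1 → ℝ) : Prop :=
  ContDiffOn ℝ 1 (radialExt μ) {0}ᶜ

/-- `Ω` is an open set with `C^{2,γ}` boundary: near each boundary point, `Ω` is the set of points
lying on one side of the graph of a `C^{2,γ}` function `g` over the hyperplane orthogonal to some
unit vector `e`. -/
def IsC2HolderDomain {n : ℕ} (γ : ℝ≥0) (Ω : Set (RSpace n)) : Prop :=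
  IsOpen Ω ∧ ∀ x₀ ∈ frontier Ω, ∃ (e : RSpace n) (g : RSpace n → ℝ) (r : ℝ),
    ‖e‖ = 1 ∧ 0 < r ∧ MemCkHolder 2 γ univ g ∧
      ∀ x ∈ ball x₀ r, x ∈ Ω ↔ g (x - inner ℝ e x • e) < inner ℝ e x

/-- `d` is a `C^{2,γ}(closure Ω)` function, positive in `Ω`, that coincides with the distance to the
complement of `Ω` in a neighborhood of the boundary. Only the values of `d` in `Ω` matter. -/
def IsRegularDistance {n : ℕ} (γ : ℝ≥0) (Ω : Set (RSpace n)) (d : RSpace n → ℝ) : Prop :=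
  MemCkHolder 2 γ Ω d ∧ (∀ x ∈ Ω, 0 < d x) ∧
    ∃ V : Set (RSpace n), IsOpen V ∧ frontier Ω ⊆ V ∧ ∀ x ∈ V ∩ Ω, d x = infDist x Ωᶜ

/-- The integrand in the definition of `L u(x)`. -/
noncomputable def stableIntegrand {n : ℕ} (s : ℝ) (μ : sphere (0 : RSpace n) 1 → ℝ)
    (u : RSpace n → ℝ) (x y : RSpace n) : ℝ :=
  ((u (x + y) + u (x - y)) / 2 - u x) * (radialExt μ y / ‖y‖ ^ ((n : ℝ) + 2 * s))

/-- The stable operator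
`L u(x) = (1 - s) ∫ ((u(x+y) + u(x-y)) / 2 - u(x)) μ(y/|y|) / |y|^{n+2s} dy`. -/
noncomputable def stableOp {n : ℕ} (s : ℝ) (μ : sphere (0 : RSpace n) 1 → ℝ)
    (u : RSpace n → ℝ) (x : RSpace n) : ℝ :=
  (1 - s) * ∫ y, stableIntegrand s μ u x y

/-- `L u` belongs to `C^γ(closure Ω)` with norm at most `B`: at each point of `Ω` the integral
defining `L u` converges absolutely, and `L u` extends from `Ω` to a function on the closure of `Ω`
whose `C^γ` norm there is at most `B`. -/
def StableOpHolderBound {n : ℕ} (s : ℝ) (μ : sphere (0 : RSpace n) 1 → ℝ) (γ : ℝ≥0)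
    (Ω : Set (RSpace n)) (u : RSpace n → ℝ) (B : ℝ≥0∞) : Prop :=
  (∀ x ∈ Ω, Integrable (stableIntegrand s μ u x)) ∧
    ∃ F : RSpace n → ℝ, (∀ x ∈ Ω, F x = stableOp s μ u x) ∧
      ckHolderNorm 0 γ (closure Ω) F ≤ B

/-! The factor `1 - s` pays for exactly one divergence: the weight `min(r, 1) r^(-1-s)` has integral
`1/(1-s) + 1/s` over the half-line. All estimates bring the radial integrands under this weight, or
under a comparable one, with constants independent of `s`. For a `C^{2,γ}` function this follows
from Taylor expansion of the symmetric second difference (`stableOp_bounds_of_ckHolderOn`). A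
partition of unity therefore makes the problem local, and near an interior point `d^s ζ` is itself
`C^{2,γ}`. The work is at the boundary.

Near a boundary point `d` is extended across the boundary by flattening the graph and reflecting to
second order (`exists_ckHolderOn_extend_boundary`). It is then replaced by a global function `E`
that is strictly increasing in a transversal direction `e` (`exists_global_of_local`). A
bi-Lipschitz change of variables `ψ` makes `E ∘ ψ` equal to the linear function `⟨e, ·⟩`
(`exists_isStraightening`). Writing `E_+^s = E(x)^s + (E_+^s - E(x)^s)` splits `L(E_+^s ζ)(x)` into
`E(x)^s Lζ(x)` and a principal value integral (`stableOp_eq_add_flatOp`). The first term is harmless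
because `E^s` is `C^s` and `γ ≤ s`.

In the second term put `x = ψ(X)`, `y = ψ(X + Z) - ψ(X)` and `Z = rθ`. The even part of the kernel
is homogeneous, so it equals `|r|^(-n-2s)` times its value at the difference quotient `(ψ(X + rθ) -
ψ(X)) / r`. That quotient is an average of `Dψ` and is `C^{1,γ}` in `(X, r)` through `r = 0`. What
remains is an integral over directions of the line integrals `∫_0^∞ (P(rτ) G(r) + P(-rτ) G(-r))
r^(-1-2s) dr`. Here `P(t) = (a + t)_+^s - a^s`, `a = ⟨e, X⟩`, `τ = ⟨e, θ⟩`, and `G` is `C^{1,γ}`.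

Expand `G` at `0`. The constant term contributes nothing, because the one-dimensional fractional
Laplacian annihilates `t_+^s` (`integral_posPowDiff_even`). The rest is `O(min(r, 1))`, which gives
the sup bound. For the Hölder bound in `a` the remainder `O(r^(1+γ))` is absorbed by `|P_a - P_b| ≤
2 min(|a-b|, |t|)^s`. The linear term is not: for `s > 1/2` this inequality only yields
`|a-b|^(1-s)`. A second exact identity (`integral_odd_sub`) trades the integral over `(0, 1)` for
one over `(1, ∞)`, where the dependence on `a` is Lipschitz. Both identities come from the
substitution `t = w / (1 + w)`, which turns the integrand into an exact derivative.

A principal value symmetric in `y` is not symmetric in `Z`. The two are reconciled by a Lipschitz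
cutoff at the origin and dominated convergence (`exists_flat_cutoff_le`). -/

/-- `f` is bounded by `C` and `γ`-Hölder with constant `C` on `A`. -/
def HolderBdd {X F : Type*} [PseudoMetricSpace X] [NormedAddCommGroup F] (γ C : ℝ) (A : Set X)
    (f : X → F) : Prop :=
  (∀ x ∈ A, ‖f x‖ ≤ C) ∧ ∀ x ∈ A, ∀ y ∈ A, ‖f x - f y‖ ≤ C * dist x y ^ γ

/-! ### Calculus of Hölder bounds with explicit constants -/

section HolderBdd

variable {X X' F G H : Type*} [PseudoMetricSpace X] [PseudoMetricSpace X']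
  [NormedAddCommGroup F]
  [NormedAddCommGroup G] [NormedSpace ℝ G] [NormedAddCommGroup H] [NormedSpace ℝ H]
  {γ C C₁ C₂ : ℝ} {A : Set X} {f g : X → F}

theorem HolderBdd.mono (h : HolderBdd γ C₁ A f) (hC : C₁ ≤ C₂) : HolderBdd γ C₂ A f :=
  ⟨fun x hx => (h.1 x hx).trans hC, fun x hx y hy => (h.2 x hx y hy).trans (by gcongr)⟩

theorem HolderBdd.mono_set {A' : Set X} (h : HolderBdd γ C A f) (hA : A' ⊆ A) :
    HolderBdd γ C A' f :=
  ⟨fun x hx => h.1 x (hA hx), fun x hx y hy => h.2 x (hA hx) y (hA hy)⟩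

theorem HolderBdd.congr (h : HolderBdd γ C A f) (hfg : ∀ x ∈ A, g x = f x) :
    HolderBdd γ C A g :=
  ⟨fun x hx => by rw [hfg x hx]; exact h.1 x hx,
    fun x hx y hy => by rw [hfg x hx, hfg y hy]; exact h.2 x hx y hy⟩

theorem HolderBdd.add (hf : HolderBdd γ C₁ A f) (hg : HolderBdd γ C₂ A g) :
    HolderBdd γ (C₁ + C₂) A (fun x => f x + g x) := by
  refine ⟨fun x hx => (norm_add_le _ _).trans (add_le_add (hf.1 x hx) (hg.1 x hx)),
    fun x hx y hy => ?_⟩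
  rw [add_sub_add_comm, add_mul]
  exact (norm_add_le _ _).trans (add_le_add (hf.2 x hx y hy) (hg.2 x hx y hy))

theorem HolderBdd.clm [NormedSpace ℝ F] (L : F →L[ℝ] G) (hf : HolderBdd γ C A f) :
    HolderBdd γ (‖L‖ * C) A (fun x => L (f x)) := by
  refine ⟨fun x hx => (L.le_opNorm _).trans (by gcongr; exact hf.1 x hx), fun x hx y hy => ?_⟩
  rw [← map_sub, mul_assoc]
  exact (L.le_opNorm _).trans (by gcongr; exact hf.2 x hx y hy)

theorem HolderBdd.const (c : F) (hc : ‖c‖ ≤ C) : HolderBdd γ C A (fun _ => c) := by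
  refine ⟨fun _ _ => hc, fun x _ y _ => ?_⟩
  rw [sub_self, norm_zero]
  have := (norm_nonneg c).trans hc
  positivity

/-- One constant serves the supremum and the seminorm. The seminorm of a product has two terms,
hence the factor `2`. -/
theorem HolderBdd.bilin [NormedSpace ℝ F] (B : F →L[ℝ] G →L[ℝ] H) {g : X → G} (hC₁ : 0 ≤ C₁) (hC₂ : 0 ≤ C₂)
    (hf : HolderBdd γ C₁ A f) (hg : HolderBdd γ C₂ A g) :
    HolderBdd γ (2 * (‖B‖ * C₁ * C₂)) A (fun x => B (f x) (g x)) := by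
  have hB := norm_nonneg B
  constructor
  · intro x hx
    have : ‖B (f x) (g x)‖ ≤ ‖B‖ * C₁ * C₂ :=
      (B.le_opNorm₂ _ _).trans (by gcongr; exacts [hf.1 x hx, hg.1 x hx])
    have : 0 ≤ ‖B‖ * C₁ * C₂ := by positivity
    linarith
  · intro x hx y hy
    have e : B (f x) (g x) - B (f y) (g y) = B (f x - f y) (g x) + B (f y) (g x - g y) := by
      simp
    rw [e]
    refine (norm_add_le _ _).trans ?_
    have h1 : ‖B (f x - f y) (g x)‖ ≤ ‖B‖ * (C₁ * dist x y ^ γ) * C₂ :=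
      (B.le_opNorm₂ _ _).trans (by gcongr; exacts [hf.2 x hx y hy, hg.1 x hx])
    have h2 : ‖B (f y) (g x - g y)‖ ≤ ‖B‖ * C₁ * (C₂ * dist x y ^ γ) :=
      (B.le_opNorm₂ _ _).trans (by gcongr; exacts [hf.1 y hy, hg.2 x hx y hy])
    calc _ ≤ _ := add_le_add h1 h2
      _ = _ := by ring

theorem HolderBdd.mul {f g : X → ℝ} (hC₁ : 0 ≤ C₁) (hC₂ : 0 ≤ C₂)
    (hf : HolderBdd γ C₁ A f) (hg : HolderBdd γ C₂ A g) :
    HolderBdd γ (2 * (C₁ * C₂)) A (fun x => f x * g x) := by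
  have := HolderBdd.bilin (ContinuousLinearMap.mul ℝ ℝ) hC₁ hC₂ hf hg
  refine HolderBdd.mono (f := fun x => f x * g x) this ?_
  have h : ‖ContinuousLinearMap.mul ℝ ℝ‖ ≤ 1 := ContinuousLinearMap.opNorm_mul_le ℝ ℝ
  have : 0 ≤ C₁ * C₂ := by positivity
  nlinarith

theorem HolderBdd.smul {f : X → ℝ} {g : X → G} (hC₁ : 0 ≤ C₁) (hC₂ : 0 ≤ C₂)
    (hf : HolderBdd γ C₁ A f) (hg : HolderBdd γ C₂ A g) :
    HolderBdd γ (2 * (C₁ * C₂)) A (fun x => f x • g x) := by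
  have := HolderBdd.bilin (ContinuousLinearMap.lsmul ℝ ℝ : ℝ →L[ℝ] G →L[ℝ] G) hC₁ hC₂ hf hg
  refine HolderBdd.mono (f := fun x => f x • g x) this ?_
  have h : ‖(ContinuousLinearMap.lsmul ℝ ℝ : ℝ →L[ℝ] G →L[ℝ] G)‖ ≤ 1 :=
    ContinuousLinearMap.opNorm_lsmul_le
  have : 0 ≤ C₁ * C₂ := by positivity
  nlinarith

theorem HolderBdd.comp_lipschitz {A' : Set X'} {ψ : X' → X} {L : ℝ} (hγ : 0 ≤ γ) (hL : 0 ≤ L)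
    (hC : 0 ≤ C) (hf : HolderBdd γ C A f) (hψ : MapsTo ψ A' A)
    (hLip : ∀ x ∈ A', ∀ y ∈ A', dist (ψ x) (ψ y) ≤ L * dist x y) :
    HolderBdd γ (C * (1 + L ^ γ)) A' (fun x => f (ψ x)) := by
  have hLγ : 0 ≤ L ^ γ := by positivity
  refine ⟨fun x hx => (hf.1 _ (hψ hx)).trans (by nlinarith), fun x hx y hy => ?_⟩
  refine (hf.2 _ (hψ hx) _ (hψ hy)).trans ?_
  rw [mul_assoc]
  gcongr
  calc dist (ψ x) (ψ y) ^ γ ≤ (L * dist x y) ^ γ := by gcongr; exact hLip x hx y hy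
    _ = L ^ γ * dist x y ^ γ := Real.mul_rpow hL dist_nonneg
    _ ≤ _ := by gcongr; linarith

/-- At distance at least `δ` the sup bound suffices, since `2C ≤ (2C / δ^γ) dist^γ`. Estimates on
overlapping regions can thus be glued as soon as any two points closer than `δ` lie in a common
region. -/
theorem HolderBdd.of_local {L δ : ℝ} (hγ : 0 ≤ γ) (hC : 0 ≤ C) (hL : 0 ≤ L)
    (hδ : 0 < δ) (hb : ∀ x ∈ A, ‖f x‖ ≤ C)
    (hl : ∀ x ∈ A, ∀ y ∈ A, dist x y < δ → ‖f x - f y‖ ≤ L * dist x y ^ γ) :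
    HolderBdd γ (C + L + 2 * C / δ ^ γ) A f := by
  have hδγ : 0 < δ ^ γ := by positivity
  have h0 : 0 ≤ 2 * C / δ ^ γ := by positivity
  refine ⟨fun x hx => (hb x hx).trans (by linarith), fun x hx y hy => ?_⟩
  have hd : 0 ≤ dist x y ^ γ := by positivity
  rcases lt_or_ge (dist x y) δ with h | h
  · refine (hl x hx y hy h).trans ?_
    gcongr; linarith
  · have h1 : δ ^ γ ≤ dist x y ^ γ := by gcongr
    have h2 : ‖f x - f y‖ ≤ 2 * C := (norm_sub_le _ _).trans (by linarith [hb x hx, hb y hy])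
    calc ‖f x - f y‖ ≤ 2 * C := h2
      _ = 2 * C / δ ^ γ * δ ^ γ := by field_simp
      _ ≤ 2 * C / δ ^ γ * dist x y ^ γ := by gcongr
      _ ≤ _ := by gcongr; linarith

/-- This is `of_local` with `δ = 1`: below distance `1` one has `dist ≤ dist^γ` because `γ ≤ 1`. -/
theorem HolderBdd.of_lipschitz {L : ℝ} (hγ : 0 ≤ γ) (hγ1 : γ ≤ 1) (hC : 0 ≤ C) (hL : 0 ≤ L)
    (hb : ∀ x ∈ A, ‖f x‖ ≤ C) (hl : ∀ x ∈ A, ∀ y ∈ A, ‖f x - f y‖ ≤ L * dist x y) :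
    HolderBdd γ (3 * C + L) A f := by
  have := HolderBdd.of_local (f := f) (A := A) hγ hC hL one_pos hb (fun x hx y hy h => by
    refine (hl x hx y hy).trans ?_
    gcongr
    rcases eq_or_lt_of_le (dist_nonneg (x := x) (y := y)) with h0 | h0
    · rw [← h0]; positivity
    · calc dist x y = dist x y ^ (1 : ℝ) := (Real.rpow_one _).symm
        _ ≤ dist x y ^ γ := Real.rpow_le_rpow_of_exponent_ge h0 h.le hγ1)
  refine this.mono ?_
  rw [Real.one_rpow]; linarith

theorem HolderBdd.continuousOn (hγ : 0 < γ) (hf : HolderBdd γ C A f) : ContinuousOn f A := by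
  intro x hx
  rw [ContinuousWithinAt, tendsto_iff_norm_sub_tendsto_zero]
  have : Filter.Tendsto (fun y => C * dist y x ^ γ) (nhdsWithin x A) (nhds 0) := by
    have : Filter.Tendsto (fun y => C * dist y x ^ γ) (nhds x) (nhds (C * dist x x ^ γ)) := by
      have hc : Continuous fun y => C * dist y x ^ γ := by
        refine continuous_const.mul ((continuous_id.dist continuous_const).rpow_const ?_)
        intro; right; exact hγ.le
      exact hc.tendsto x
    rw [dist_self, Real.zero_rpow hγ.ne', mul_zero] at this
    exact this.mono_left nhdsWithin_le_nhds
  refine squeeze_zero' (Filter.Eventually.of_forall fun _ => norm_nonneg _) ?_ this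
  filter_upwards [self_mem_nhdsWithin] with y hy
  exact hf.2 y hy x hx

end HolderBdd

/-! ### The classes `C^{k,γ}` and their stability -/

/-- `f` and its derivatives up to order `k` are bounded by `C` and `γ`-Hölder with constant `C`
on `A`. -/
def CkHolderOn {V : Type} [NormedAddCommGroup V] [NormedSpace ℝ V] (γ C : ℝ) (A : Set V) :
    (k : ℕ) → {F : Type} → [NormedAddCommGroup F] → [NormedSpace ℝ F] → (V → F) → Prop
  | 0, _, _, _, f => HolderBdd γ C A f
  | k + 1, _, _, _, f => HolderBdd γ C A f ∧ (∀ x ∈ A, DifferentiableAt ℝ f x) ∧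
      CkHolderOn γ C A k (fderiv ℝ f)

section CkHolderOn

variable {V V' F G H : Type} [NormedAddCommGroup V] [NormedSpace ℝ V]
  [NormedAddCommGroup V'] [NormedSpace ℝ V']
  [NormedAddCommGroup F] [NormedSpace ℝ F]
  [NormedAddCommGroup G] [NormedSpace ℝ G] [NormedAddCommGroup H] [NormedSpace ℝ H]
  {γ C C₁ C₂ : ℝ} {A : Set V}

theorem CkHolderOn.holderBdd {k : ℕ} {f : V → F} (h : CkHolderOn γ C A k f) :
    HolderBdd γ C A f := by
  cases k with
  | zero => exact h
  | succ k => exact h.1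

theorem CkHolderOn.mono {k : ℕ} : ∀ {F : Type} [NormedAddCommGroup F] [NormedSpace ℝ F]
    {f : V → F}, CkHolderOn γ C₁ A k f → C₁ ≤ C₂ → CkHolderOn γ C₂ A k f := by
  induction k with
  | zero => intro F _ _ f h hC; exact HolderBdd.mono h hC
  | succ k ih => intro F _ _ f h hC; exact ⟨h.1.mono hC, h.2.1, ih h.2.2 hC⟩

theorem CkHolderOn.mono_set {k : ℕ} {A' : Set V} (hA : A' ⊆ A) :
    ∀ {F : Type} [NormedAddCommGroup F] [NormedSpace ℝ F]
    {f : V → F}, CkHolderOn γ C A k f → CkHolderOn γ C A' k f := by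
  induction k with
  | zero => intro F _ _ f h; exact HolderBdd.mono_set h hA
  | succ k ih => intro F _ _ f h; exact ⟨h.1.mono_set hA, fun x hx => h.2.1 x (hA hx), ih h.2.2⟩

theorem CkHolderOn.of_succ {k : ℕ} : ∀ {F : Type} [NormedAddCommGroup F] [NormedSpace ℝ F]
    {f : V → F}, CkHolderOn γ C A (k + 1) f → CkHolderOn γ C A k f := by
  induction k with
  | zero => intro F _ _ f h; exact h.1
  | succ k ih => intro F _ _ f h; exact ⟨h.1, h.2.1, ih h.2.2⟩

theorem CkHolderOn.congr {k : ℕ} (hA : IsOpen A) :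
    ∀ {F : Type} [NormedAddCommGroup F] [NormedSpace ℝ F]
    {f g : V → F}, CkHolderOn γ C A k f → (∀ x ∈ A, g x = f x) → CkHolderOn γ C A k g := by
  induction k with
  | zero => intro F _ _ f g h hfg; exact HolderBdd.congr h hfg
  | succ k ih =>
    intro F _ _ f g h hfg
    have he : ∀ x ∈ A, g =ᶠ[nhds x] f := fun x hx => by
      filter_upwards [hA.mem_nhds hx] with y hy using hfg y hy
    exact ⟨h.1.congr hfg, fun x hx => (h.2.1 x hx).congr_of_eventuallyEq (he x hx),
      ih h.2.2 fun x hx => (he x hx).fderiv_eq⟩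

theorem CkHolderOn.const {k : ℕ} : ∀ {F : Type} [NormedAddCommGroup F] [NormedSpace ℝ F]
    (c : F), ‖c‖ ≤ C → CkHolderOn γ C A k (fun _ => c) := by
  induction k with
  | zero => intro F _ _ c hc; exact HolderBdd.const c hc
  | succ k ih =>
    intro F _ _ c hc
    refine ⟨HolderBdd.const c hc, fun x _ => differentiableAt_const c, ?_⟩
    have : fderiv ℝ (fun _ : V => c) = fun _ => 0 := by ext1 x; simp
    rw [this]
    exact ih 0 (by rw [norm_zero]; exact (norm_nonneg c).trans hc)

theorem CkHolderOn.add {k : ℕ} (hA : IsOpen A) :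
    ∀ {F : Type} [NormedAddCommGroup F] [NormedSpace ℝ F]
    {f g : V → F}, CkHolderOn γ C₁ A k f → CkHolderOn γ C₂ A k g →
      CkHolderOn γ (C₁ + C₂) A k (fun x => f x + g x) := by
  induction k with
  | zero => intro F _ _ f g hf hg; exact HolderBdd.add hf hg
  | succ k ih =>
    intro F _ _ f g hf hg
    exact ⟨hf.1.add hg.1, fun x hx => (hf.2.1 x hx).add (hg.2.1 x hx),
      (ih hf.2.2 hg.2.2).congr hA fun x hx => fderiv_fun_add (hf.2.1 x hx) (hg.2.1 x hx)⟩

/-- The new constant is chosen before the function. This order of quantifiers is kept throughout and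
is what makes the final constant uniform in `s`, `μ` and `η`. The target spaces vary in the
induction because the derivative of `L ∘ f` is the image of `Df` under composition with `L`. -/
theorem CkHolderOn.clm {k : ℕ} (hA : IsOpen A) :
    ∀ {F G : Type} [NormedAddCommGroup F] [NormedSpace ℝ F] [NormedAddCommGroup G]
    [NormedSpace ℝ G] (L : F →L[ℝ] G) (C : ℝ), ∃ C', 0 ≤ C' ∧ ∀ f : V → F, CkHolderOn γ C A k f →
      CkHolderOn γ C' A k (fun x => L (f x)) := by
  induction k with
  | zero =>
    intro F G _ _ _ _ L C
    exact ⟨max (‖L‖ * C) 0, le_max_right _ _, fun f hf => (HolderBdd.clm L hf).mono (le_max_left _ _)⟩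
  | succ k ih =>
    intro F G _ _ _ _ L C
    obtain ⟨C', h0, h'⟩ := ih (ContinuousLinearMap.compL ℝ V F G L) C
    refine ⟨max (‖L‖ * C) C', h0.trans (le_max_right _ _), fun f hf => ⟨(HolderBdd.clm L hf.1).mono (le_max_left _ _),
      fun x hx => L.differentiableAt.comp x (hf.2.1 x hx),
      ((h' _ hf.2.2).mono (le_max_right _ _)).congr hA fun x hx => ?_⟩⟩
    exact (L.hasFDerivAt.comp x (hf.2.1 x hx).hasFDerivAt).fderiv

theorem CkHolderOn.bilin {k : ℕ} (hA : IsOpen A) :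
    ∀ {F G H : Type} [NormedAddCommGroup F] [NormedSpace ℝ F] [NormedAddCommGroup G]
    [NormedSpace ℝ G] [NormedAddCommGroup H] [NormedSpace ℝ H] (B : F →L[ℝ] G →L[ℝ] H)
    (C₁ C₂ : ℝ), ∃ C', 0 ≤ C' ∧ ∀ (f : V → F) (g : V → G), CkHolderOn γ C₁ A k f →
      CkHolderOn γ C₂ A k g → CkHolderOn γ C' A k (fun x => B (f x) (g x)) := by
  have base : ∀ {F G H : Type} [NormedAddCommGroup F] [NormedSpace ℝ F] [NormedAddCommGroup G]
    [NormedSpace ℝ G] [NormedAddCommGroup H] [NormedSpace ℝ H] (B : F →L[ℝ] G →L[ℝ] H)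
    (C₁ C₂ : ℝ), ∃ C', 0 ≤ C' ∧ ∀ (f : V → F) (g : V → G), HolderBdd γ C₁ A f →
      HolderBdd γ C₂ A g → HolderBdd γ C' A (fun x => B (f x) (g x)) := by
    intro F G H _ _ _ _ _ _ B C₁ C₂
    refine ⟨_, ?_, fun f g hf hg => HolderBdd.bilin B (le_max_right _ _) (le_max_right _ _)
      (hf.mono (le_max_left C₁ 0)) (hg.mono (le_max_left C₂ 0))⟩
    have := le_max_right C₁ 0
    have := le_max_right C₂ 0
    positivity
  induction k with
  | zero => exact base
  | succ k ih =>
    intro F G H _ _ _ _ _ _ B C₁ C₂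
    obtain ⟨C₀, h0, H0⟩ := base B C₁ C₂
    obtain ⟨C₃, h3, H3⟩ := ih (B.precompR V) C₁ C₂
    obtain ⟨C₄, h4, H4⟩ := ih (B.precompL V) C₁ C₂
    refine ⟨C₀ + (C₃ + C₄), by positivity, fun f g hf hg => ⟨(H0 f g hf.1 hg.1).mono (by linarith),
      fun x hx => ?_, ?_⟩⟩
    · exact (B.hasFDerivAt_of_bilinear (hf.2.1 x hx).hasFDerivAt
        (hg.2.1 x hx).hasFDerivAt).differentiableAt
    · refine CkHolderOn.congr hA (((H3 _ _ hf.of_succ hg.2.2).add hA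
        (H4 _ _ hf.2.2 hg.of_succ)).mono (by linarith)) fun x hx => ?_
      exact B.fderiv_of_bilinear (hf.2.1 x hx) (hg.2.1 x hx)

/-- The chain rule, with hypotheses on `Dψ` only: `ψ` itself may be unbounded, as the straightening
maps and the shears are. -/
theorem CkHolderOn.comp {k : ℕ} {A' : Set V'} (hγ : 0 ≤ γ) (hA' : IsOpen A') :
    ∀ {F : Type} [NormedAddCommGroup F] [NormedSpace ℝ F] (C₁ C₂ L : ℝ), 0 ≤ L → 
    ∃ C', 0 ≤ C' ∧ ∀ (f : V → F) (ψ : V' → V), CkHolderOn γ C₁ A (k + 1) f →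
      MapsTo ψ A' A → (∀ x ∈ A', ∀ y ∈ A', dist (ψ x) (ψ y) ≤ L * dist x y) →
      (∀ x ∈ A', DifferentiableAt ℝ ψ x) → CkHolderOn γ C₂ A' k (fderiv ℝ ψ) →
      CkHolderOn γ C' A' (k + 1) (fun x => f (ψ x)) := by
  have base : ∀ {F : Type} [NormedAddCommGroup F] [NormedSpace ℝ F] (C₁ L : ℝ), 0 ≤ L → 
    ∃ C', 0 ≤ C' ∧ ∀ (f : V → F) (ψ : V' → V), HolderBdd γ C₁ A f →
      MapsTo ψ A' A → (∀ x ∈ A', ∀ y ∈ A', dist (ψ x) (ψ y) ≤ L * dist x y) →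
      HolderBdd γ C' A' (fun x => f (ψ x)) := by
    intro F _ _ C₁ L hL
    refine ⟨_, ?_, fun f ψ hf hψ hl => (hf.mono (le_max_left C₁ 0)).comp_lipschitz hγ hL
      (le_max_right _ _) hψ hl⟩
    have := le_max_right C₁ 0
    positivity
  have key : ∀ {F : Type} [NormedAddCommGroup F] [NormedSpace ℝ F] (f : V → F) (ψ : V' → V)
      (C₁ : ℝ) (k : ℕ), CkHolderOn γ C₁ A (k + 1) f → MapsTo ψ A' A →
      (∀ x ∈ A', DifferentiableAt ℝ ψ x) → ∀ x ∈ A', DifferentiableAt ℝ (fun x => f (ψ x)) x ∧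
      fderiv ℝ (fun x => f (ψ x)) x =
        ContinuousLinearMap.compL ℝ V' V F (fderiv ℝ f (ψ x)) (fderiv ℝ ψ x) := by
    intro F _ _ f ψ C₁ k hf hm hd x hx
    have := (hf.2.1 _ (hm hx)).hasFDerivAt.comp x (hd x hx).hasFDerivAt
    exact ⟨this.differentiableAt, this.fderiv⟩
  induction k with
  | zero =>
    intro F _ _ C₁ C₂ L hL
    obtain ⟨C₀, h0, H0⟩ := base (F := F) C₁ L hL
    obtain ⟨C₃, h3, H3⟩ := base (F := V →L[ℝ] F) C₁ L hL
    obtain ⟨C₄, h4, H4⟩ := CkHolderOn.bilin (k := 0) (γ := γ) hA'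
      (ContinuousLinearMap.compL ℝ V' V F) C₃ C₂
    refine ⟨C₀ + C₄, by positivity, fun f ψ hf hm hl hd hdψ =>
      ⟨(H0 f ψ hf.1 hm hl).mono (by linarith), fun x hx => (key f ψ C₁ 0 hf hm hd x hx).1,
      CkHolderOn.congr hA' ((H4 _ _ (H3 _ ψ hf.2.2 hm hl) hdψ).mono (by linarith))
        fun x hx => (key f ψ C₁ 0 hf hm hd x hx).2⟩⟩
  | succ k ih =>
    intro F _ _ C₁ C₂ L hL
    obtain ⟨C₀, h0, H0⟩ := base (F := F) C₁ L hL
    obtain ⟨C₃, h3, H3⟩ := ih (F := V →L[ℝ] F) C₁ C₂ L hL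
    obtain ⟨C₄, h4, H4⟩ := CkHolderOn.bilin (k := k + 1) (γ := γ) hA'
      (ContinuousLinearMap.compL ℝ V' V F) C₃ C₂
    refine ⟨C₀ + C₄, by positivity, fun f ψ hf hm hl hd hdψ =>
      ⟨(H0 f ψ hf.1 hm hl).mono (by linarith), fun x hx => (key f ψ C₁ (k + 1) hf hm hd x hx).1,
      CkHolderOn.congr hA' ((H4 _ _ (H3 _ ψ hf.2.2 hm hl hd hdψ.of_succ) hdψ).mono (by linarith))
        fun x hx => (key f ψ C₁ (k + 1) hf hm hd x hx).2⟩⟩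

theorem CkHolderOn.of_contDiff_compactSupport {k : ℕ} (hγ : 0 ≤ γ) (hγ1 : γ ≤ 1) :
    ∀ {F : Type} [NormedAddCommGroup F] [NormedSpace ℝ F] (f : V → F), ContDiff ℝ (⊤ : ℕ∞) f →
      HasCompactSupport f → ∃ C, 0 ≤ C ∧ CkHolderOn γ C univ k f := by
  have base : ∀ {F : Type} [NormedAddCommGroup F] [NormedSpace ℝ F] (f : V → F),
      ContDiff ℝ (⊤ : ℕ∞) f → HasCompactSupport f → ∃ C, 0 ≤ C ∧ HolderBdd γ C univ f := by
    intro F _ _ f hf hs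
    obtain ⟨C, hC⟩ := hs.exists_bound_of_continuous hf.continuous
    have h1 : ContDiff ℝ 1 f := hf.of_le (by exact_mod_cast le_top)
    obtain ⟨L, hL⟩ := h1.lipschitzWith_of_hasCompactSupport hs one_ne_zero
    have hC0 : 0 ≤ C := (norm_nonneg _).trans (hC 0)
    exact ⟨3 * C + L, by positivity, HolderBdd.of_lipschitz hγ hγ1 hC0 L.2 (fun x _ => hC x) fun x _ y _ => by
      simpa [dist_eq_norm] using hL.dist_le_mul x y⟩
  induction k with
  | zero => exact base
  | succ k ih =>
    intro F _ _ f hf hs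
    obtain ⟨C, h0, hC⟩ := base f hf hs
    obtain ⟨C', h0', hC'⟩ := ih (fderiv ℝ f)
      (hf.fderiv_right (m := ((⊤ : ℕ∞) : WithTop ℕ∞)) (by exact_mod_cast le_top)) (hs.fderiv ℝ)
    exact ⟨max C C', h0.trans (le_max_left _ _), hC.mono (le_max_left _ _),
      fun x _ => (hf.differentiable (by simp)).differentiableAt, hC'.mono (le_max_right _ _)⟩

/-- Of two points closer than `δ`, either both lie off `K`, where `f` vanishes, or one lies in `K`
and then both lie in `A`. So `HolderBdd.of_local` applies to each derivative. -/
theorem CkHolderOn.univ_of_zero_off {k : ℕ} {K : Set V} {δ : ℝ} (hγ : 0 ≤ γ) (hC : 0 ≤ C)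
    (hδ : 0 < δ) (hK : IsClosed K) (hKA : ∀ x ∈ K, ball x δ ⊆ A) :
    ∀ {F : Type} [NormedAddCommGroup F] [NormedSpace ℝ F] (f : V → F), CkHolderOn γ C A k f →
      (∀ x ∉ K, f x = 0) → CkHolderOn γ (C + C + 2 * C / δ ^ γ) univ k f := by
  have base : ∀ {F : Type} [NormedAddCommGroup F] [NormedSpace ℝ F] (f : V → F),
      HolderBdd γ C A f → (∀ x ∉ K, f x = 0) → HolderBdd γ (C + C + 2 * C / δ ^ γ) univ f := by
    intro F _ _ f hf h0
    refine HolderBdd.of_local hγ hC hC hδ (fun x _ => ?_) fun x _ y _ hxy => ?_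
    · by_cases hx : x ∈ K
      · exact hf.1 x (hKA x hx (mem_ball_self hδ))
      · rw [h0 x hx, norm_zero]; exact hC
    · by_cases hx : x ∈ K
      · exact hf.2 x (hKA x hx (mem_ball_self hδ)) y (hKA x hx (by rwa [mem_ball, dist_comm]))
      · by_cases hy : y ∈ K
        · exact hf.2 x (hKA y hy (by rwa [mem_ball])) y (hKA y hy (mem_ball_self hδ))
        · rw [h0 x hx, h0 y hy, sub_self, norm_zero]; positivity
  induction k with
  | zero => exact base
  | succ k ih =>
    intro F _ _ f hf h0
    have he : ∀ x ∉ K, f =ᶠ[nhds x] fun _ => 0 := fun x hx => by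
      filter_upwards [hK.isOpen_compl.mem_nhds hx] with y hy using h0 y hy
    refine ⟨base f hf.1 h0, fun x _ => ?_, ih _ hf.2.2 fun x hx => ?_⟩
    · by_cases hx : x ∈ K
      · exact hf.2.1 x (hKA x hx (mem_ball_self hδ))
      · exact (differentiableAt_const (0 : F)).congr_of_eventuallyEq (he x hx)
    · rw [(he x hx).fderiv_eq]; simp

end CkHolderOn


/-! ### Elementary estimates for `t ↦ (a + t)_+ ^ s - a ^ s` -/

theorem abs_rpow_sub_rpow_le {x y s : ℝ} (hx : 0 ≤ x) (hy : 0 ≤ y) (hs : 0 ≤ s) (hs1 : s ≤ 1) :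
    |x ^ s - y ^ s| ≤ |x - y| ^ s := by
  wlog h : y ≤ x generalizing x y
  · rw [abs_sub_comm, abs_sub_comm x]
    exact this hy hx (le_of_not_ge h)
  have h1 := Real.rpow_add_le_add_rpow hy (sub_nonneg.2 h) hs hs1
  rw [add_sub_cancel] at h1
  have h2 : y ^ s ≤ x ^ s := by gcongr
  rw [abs_of_nonneg (by linarith), abs_of_nonneg (by linarith)]
  linarith

theorem one_add_rpow_le {c s : ℝ} (hc : -1 ≤ c) (hs : 0 ≤ s) (hs1 : s ≤ 1) :
    (1 + c) ^ s ≤ 1 + s * c :=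
  rpow_one_add_le_one_add_mul_self hc hs hs1

/-- The function `t ↦ (a + t)_+ ^ s - a ^ s`. -/
noncomputable def posPowDiff (s a t : ℝ) : ℝ := max (a + t) 0 ^ s - a ^ s

section posPowDiff

variable {s a b t : ℝ}

theorem abs_posPowDiff_le (hs : 0 ≤ s) (hs1 : s ≤ 1) (ha : 0 ≤ a) : |posPowDiff s a t| ≤ |t| ^ s := by
  refine (abs_rpow_sub_rpow_le (le_max_right _ _) ha hs hs1).trans ?_
  refine Real.rpow_le_rpow (abs_nonneg _) ?_ hs
  calc |max (a + t) 0 - a| = |max (a + t) 0 - max a 0| := by rw [max_eq_left ha]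
    _ ≤ |a + t - a| := abs_max_sub_max_le_abs (a + t) a 0
    _ = |t| := by ring_nf

/-- For small `|a - b|` the powers based at `a` are compared with those based at `b`; for small
`|t|` each difference is estimated alone. The minimum is later interpolated as `|a - b|^γ
|t|^(s-γ)`. -/
theorem abs_posPowDiff_sub_le (hs : 0 ≤ s) (hs1 : s ≤ 1) (ha : 0 ≤ a) (hb : 0 ≤ b) :
    |posPowDiff s a t - posPowDiff s b t| ≤ 2 * min |a - b| |t| ^ s := by
  rcases le_total |a - b| |t| with h | h
  · rw [min_eq_left h]
    have h1 : |max (a + t) 0 ^ s - max (b + t) 0 ^ s| ≤ |a - b| ^ s := by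
      refine (abs_rpow_sub_rpow_le (le_max_right _ _) (le_max_right _ _) hs hs1).trans ?_
      refine Real.rpow_le_rpow (abs_nonneg _)
        ((abs_max_sub_max_le_abs (a + t) (b + t) 0).trans (le_of_eq ?_)) hs
      ring_nf
    have h2 := abs_rpow_sub_rpow_le ha hb hs hs1
    have e : posPowDiff s a t - posPowDiff s b t =
      (max (a + t) 0 ^ s - max (b + t) 0 ^ s) - (a ^ s - b ^ s) := by unfold posPowDiff; ring
    rw [e]
    exact (abs_sub _ _).trans (by linarith)
  · rw [min_eq_right h]
    exact (abs_sub _ _).trans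
      (by linarith [abs_posPowDiff_le (t := t) hs hs1 ha, abs_posPowDiff_le (t := t) hs hs1 hb])

theorem posPowDiff_scale {c : ℝ} (ha : 0 ≤ a) (hc : 0 ≤ c) :
    posPowDiff s (c * a) (c * t) = c ^ s * posPowDiff s a t := by
  unfold posPowDiff
  have : max (c * a + c * t) 0 = c * max (a + t) 0 := by
    rw [← mul_add, mul_max_of_nonneg _ _ hc, mul_zero]
  rw [this, Real.mul_rpow hc (le_max_right _ _), Real.mul_rpow hc ha]
  ring

/-- Scaling reduces to `a = 1`, where `(1 + c)^s` lies between `1` and `1 + c` for `c ≥ -1`. -/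
theorem abs_posPowDiff_le_mul (hs : 0 ≤ s) (hs1 : s ≤ 1) (ha : 0 < a) :
    |posPowDiff s a t| ≤ a ^ (s - 1) * |t| := by
  have key : ∀ c : ℝ, |posPowDiff s 1 c| ≤ |c| := by
    intro c
    unfold posPowDiff
    rw [Real.one_rpow]
    rcases le_total (-1) c with h | h
    · rw [max_eq_left (by linarith)]
      have h1 := one_add_rpow_le h hs hs1
      rcases le_total 0 c with h0 | h0
      · have h2 : (1 : ℝ) ≤ (1 + c) ^ s := Real.one_le_rpow (by linarith) hs
        rw [abs_of_nonneg (by linarith), abs_of_nonneg h0]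
        nlinarith
      · have h2 : (1 + c) ^ s ≤ 1 := Real.rpow_le_one (by linarith) (by linarith) hs
        have h3 : (1 + c) ^ (1 : ℝ) ≤ (1 + c) ^ s := by
          rcases eq_or_lt_of_le h with h4 | h4
          · rw [← h4]; norm_num; positivity
          · exact Real.rpow_le_rpow_of_exponent_ge (by linarith) (by linarith) hs1
        rw [Real.rpow_one] at h3
        rw [abs_of_nonpos (by linarith), abs_of_nonpos h0]
        linarith
    · rw [max_eq_right (by linarith)]
      have h2 : (0 : ℝ) ^ s ≤ 1 := Real.rpow_le_one le_rfl (by norm_num) hs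
      have h3 : (0 : ℝ) ≤ 0 ^ s := by positivity
      rw [abs_of_nonpos (by linarith), abs_of_nonpos (by linarith)]
      linarith
  have e : posPowDiff s a t = a ^ s * posPowDiff s 1 (t / a) := by
    rw [← posPowDiff_scale zero_le_one ha.le, mul_one, mul_div_cancel₀ _ ha.ne']
  rw [e, abs_mul, abs_of_nonneg (by positivity)]
  calc a ^ s * |posPowDiff s 1 (t / a)| ≤ a ^ s * |t / a| :=
        mul_le_mul_of_nonneg_left (key _) (by positivity)
    _ = a ^ (s - 1) * |t| := by rw [abs_div, abs_of_pos ha, Real.rpow_sub_one ha.ne']; ring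

/-- Scaling reduces to `a = 1`. For `|c| ≤ 1` concavity gives `(1+c)^s + (1-c)^s ≤ 2`. From below,
the square of the sum is at least `4 (1-c²)^s ≥ 4 (1-c²) ≥ (2 - 2c²)²`. For `|c| ≥ 1` the trivial
bound `2|c|^s ≤ 2c²` suffices. -/
theorem abs_posPowDiff_add_neg_le (hs : 0 ≤ s) (hs1 : s ≤ 1) (ha : 0 < a) :
    |posPowDiff s a t + posPowDiff s a (-t)| ≤ 2 * a ^ (s - 2) * t ^ 2 := by
  have key : ∀ c : ℝ, |posPowDiff s 1 c + posPowDiff s 1 (-c)| ≤ 2 * c ^ 2 := by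
    intro c
    rcases le_total |c| 1 with h | h
    · obtain ⟨h1, h2⟩ := abs_le.1 h
      unfold posPowDiff
      rw [Real.one_rpow, max_eq_left (by linarith), max_eq_left (by linarith)]
      have u1 := one_add_rpow_le h1 hs hs1
      have u2 := one_add_rpow_le (c := -c) (by linarith) hs hs1
      have p1 : 0 ≤ (1 + c) ^ s := Real.rpow_nonneg (by linarith) _
      have p2 : 0 ≤ (1 + -c) ^ s := Real.rpow_nonneg (by linarith) _
      have hc2 : c ^ 2 ≤ 1 := by nlinarith
      have l1 : 1 - c ^ 2 ≤ (1 + c) ^ s * (1 + -c) ^ s := by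
        rw [← Real.mul_rpow (by linarith) (by linarith)]
        have e : (1 + c) * (1 + -c) = 1 - c ^ 2 := by ring
        rw [e]
        rcases eq_or_lt_of_le hc2 with h4 | h4
        · rw [h4, sub_self]; positivity
        · calc 1 - c ^ 2 = (1 - c ^ 2) ^ (1 : ℝ) := (Real.rpow_one _).symm
            _ ≤ _ := Real.rpow_le_rpow_of_exponent_ge (by linarith) (by nlinarith) hs1
      have l2 : 2 - 2 * c ^ 2 ≤ (1 + c) ^ s + (1 + -c) ^ s := by
        set x := (1 + c) ^ s
        set y := (1 + -c) ^ s
        by_contra hcon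
        push Not at hcon
        nlinarith [sq_nonneg (x - y), sq_nonneg c]
      rw [abs_le]
      constructor <;> nlinarith
    · have e1 := abs_posPowDiff_le (s := s) (a := 1) (t := c) hs hs1 zero_le_one
      have e2 := abs_posPowDiff_le (s := s) (a := 1) (t := -c) hs hs1 zero_le_one
      rw [abs_neg] at e2
      have h3 : |c| ^ s ≤ c ^ 2 := by
        rw [← sq_abs c, ← Real.rpow_natCast |c| 2]
        exact Real.rpow_le_rpow_of_exponent_le h (by push_cast; linarith)
      exact (abs_add_le _ _).trans (by linarith)
  have e : ∀ t, posPowDiff s a t = a ^ s * posPowDiff s 1 (t / a) := fun t => by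
    rw [← posPowDiff_scale zero_le_one ha.le, mul_one, mul_div_cancel₀ _ ha.ne']
  rw [e t, e (-t), neg_div, ← mul_add, abs_mul, abs_of_nonneg (by positivity)]
  calc _ ≤ a ^ s * (2 * (t / a) ^ 2) := mul_le_mul_of_nonneg_left (key _) (by positivity)
    _ = 2 * a ^ (s - 2) * t ^ 2 := by
      rw [Real.rpow_sub ha, div_pow]; norm_cast; ring

theorem continuous_posPowDiff (hs : 0 ≤ s) : Continuous (posPowDiff s a) := by
  unfold posPowDiff
  refine Continuous.sub (Continuous.rpow_const (by fun_prop) fun _ => Or.inr hs) continuous_const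

end posPowDiff

/-! ### The radial weight and its mass -/

/-- The weight `min(r, 1) r^{-1-s}`, which dominates all the radial integrands. -/
noncomputable def radialWeight (s r : ℝ) : ℝ := min r 1 * r ^ (-1 - s)

section radialWeight

variable {s r : ℝ}

theorem radialWeight_nonneg (hr : 0 ≤ r) : 0 ≤ radialWeight s r := by
  unfold radialWeight; positivity

theorem radialWeight_of_le_one (hr : 0 < r) (h : r ≤ 1) : radialWeight s r = r ^ (-s) := by
  unfold radialWeight
  rw [min_eq_left h]
  nth_rw 1 [← Real.rpow_one r]
  rw [← Real.rpow_add hr]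
  ring_nf

theorem radialWeight_of_one_le (h : 1 ≤ r) : radialWeight s r = r ^ (-1 - s) := by
  unfold radialWeight
  rw [min_eq_right h, one_mul]

theorem integrableOn_radialWeight_Ioc (hs1 : s < 1) : IntegrableOn (radialWeight s) (Ioc 0 1) := by
  have h1 : IntegrableOn (fun r : ℝ => r ^ (-s)) (Ioc 0 1) := by
    rw [← intervalIntegrable_iff_integrableOn_Ioc_of_le zero_le_one]
    exact intervalIntegral.intervalIntegrable_rpow' (by linarith)
  exact h1.congr_fun (fun r hr => (radialWeight_of_le_one hr.1 hr.2).symm) measurableSet_Ioc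

theorem integrableOn_radialWeight_Ioi_one (hs : 0 < s) :
    IntegrableOn (radialWeight s) (Ioi 1) :=
  (integrableOn_Ioi_rpow_of_lt (by linarith) one_pos).congr_fun
    (fun r hr => (radialWeight_of_one_le (le_of_lt hr)).symm) measurableSet_Ioi

theorem integrableOn_radialWeight (hs : 0 < s) (hs1 : s < 1) :
    IntegrableOn (radialWeight s) (Ioi 0) := by
  rw [← Ioc_union_Ioi_eq_Ioi (zero_le_one (α := ℝ))]
  exact (integrableOn_radialWeight_Ioc hs1).union (integrableOn_radialWeight_Ioi_one hs)

theorem integral_radialWeight (hs : 0 < s) (hs1 : s < 1) :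
    ∫ r in Ioi 0, radialWeight s r = 1 / (1 - s) + 1 / s := by
  rw [← Ioc_union_Ioi_eq_Ioi (zero_le_one (α := ℝ)), setIntegral_union Ioc_disjoint_Ioi_same
    measurableSet_Ioi (integrableOn_radialWeight_Ioc hs1) (integrableOn_radialWeight_Ioi_one hs)]
  congr 1
  · rw [setIntegral_congr_fun measurableSet_Ioc
      (fun r hr => radialWeight_of_le_one (s := s) hr.1 hr.2),
      ← intervalIntegral.integral_of_le zero_le_one, integral_rpow (Or.inl (by linarith)),
      Real.one_rpow, Real.zero_rpow (by linarith), sub_zero]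
    ring_nf
  · rw [setIntegral_congr_fun measurableSet_Ioi
      (fun r hr => radialWeight_of_one_le (s := s) (le_of_lt hr)),
      integral_Ioi_rpow_of_lt (by linarith) one_pos, Real.one_rpow]
    rw [show (-1 - s + 1 : ℝ) = -s by ring, neg_div_neg_eq]

/-- The normalising factor cancels the mass `1/(1-s)` near the origin. The mass `1/s` at infinity is
controlled by the lower bound `s₀`. -/
theorem one_sub_mul_integral_radialWeight_le {s₀ : ℝ} (hs₀ : 0 < s₀) (hs : s₀ ≤ s) (hs1 : s < 1) :
    (1 - s) * ∫ r in Ioi 0, radialWeight s r ≤ 1 + 1 / s₀ := by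
  have h0 : 0 < s := hs₀.trans_le hs
  rw [integral_radialWeight h0 hs1, mul_add, mul_one_div_cancel (by linarith)]
  gcongr
  rw [mul_one_div]
  calc (1 - s) / s ≤ 1 / s := by gcongr; linarith
    _ ≤ 1 / s₀ := by gcongr

/-- `min(r², r^s) r^{-1-2s} ≤ min(r, 1) r^{-1-s}`. -/
theorem mul_rpow_le_radialWeight {x : ℝ} (hs1 : s ≤ 1) (hr : 0 < r) (h2 : x ≤ r ^ 2)
    (hxs : x ≤ r ^ s) : x * r ^ (-1 - 2 * s) ≤ radialWeight s r := by
  rcases le_total r 1 with h | h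
  · rw [radialWeight_of_le_one hr h]
    calc x * r ^ (-1 - 2 * s) ≤ r ^ (2 : ℕ) * r ^ (-1 - 2 * s) := by gcongr
      _ = r ^ (2 + (-1 - 2 * s)) := by
        rw [Real.rpow_add hr]; norm_cast
      _ ≤ r ^ (-s) := Real.rpow_le_rpow_of_exponent_ge hr h (by linarith)
  · rw [radialWeight_of_one_le h]
    calc x * r ^ (-1 - 2 * s) ≤ r ^ s * r ^ (-1 - 2 * s) := by gcongr
      _ = r ^ (-1 - s) := by rw [← Real.rpow_add hr]; ring_nf

end radialWeight

/-! ### Exact half-line identities by a Möbius substitution -/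

section HalfLineIdentities

open Filter Topology

/-- Principal value identities on the half-line obtained by the substitution `t = w / (1 + w)`,
which turns `p w - m (w / (1 + w)) / (1 + w) ^ 2` into an exact derivative. -/
theorem integral_Ioi_eq_zero_of_substitution {h p m q G : ℝ → ℝ} {C κ σ : ℝ} (hκ : 0 < κ)
    (hσ0 : 0 < σ) (hσ : σ < 1)
    (hp : ContinuousOn p (Ioi 0)) (hm : ContinuousOn m (Ioc 0 1)) (hq : ContinuousOn q (Ici 1))
    (hpm : ∀ t ∈ Ioo (0 : ℝ) 1, h t = p t - m t) (hpq : ∀ t ∈ Ioi (1 : ℝ), h t = p t - q t)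
    (hG : ∀ w ∈ Ioi (0 : ℝ), HasDerivAt G (p w - m (w / (1 + w)) * (1 / (1 + w) ^ 2)) w)
    (hmb : ∀ t ∈ Ioc (0 : ℝ) 1, |m t| ≤ t ^ (-(2 * σ)))
    (hint : IntegrableOn h (Ioi 0))
    (hh : ∀ t ∈ Ioo (0 : ℝ) 1, |h t| ≤ C * t ^ (κ - 1))
    (hGb : ∀ t ∈ Ioo (0 : ℝ) 1, |G t| ≤ C * t ^ κ)
    (hlim : Tendsto (fun R => G R - ∫ t in (1 : ℝ)..R, q t) atTop (𝓝 0)) :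
    ∫ t in Ioi 0, h t = 0 := by
  have hf : ∀ w : ℝ, 0 < w → 0 < w / (1 + w) ∧ w / (1 + w) < 1 := fun w hw =>
    ⟨by positivity, by rw [div_lt_one (by positivity)]; linarith⟩
  have hpi : ∀ a b : ℝ, 0 < a → 0 < b → IntervalIntegrable p volume a b := fun a b ha hb =>
    (hp.mono fun x hx => lt_of_lt_of_le (lt_min ha hb) hx.1).intervalIntegrable
  have hmi : ∀ a b : ℝ, 0 < a → 0 < b → a ≤ 1 → b ≤ 1 → IntervalIntegrable m volume a b :=
    fun a b ha hb ha1 hb1 => (hm.mono fun x hx =>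
      ⟨lt_of_lt_of_le (lt_min ha hb) hx.1, hx.2.trans (max_le ha1 hb1)⟩).intervalIntegrable
  -- the truncated identity
  have trunc : ∀ ε ∈ Ioo (0 : ℝ) 1, ∀ R ∈ Ioi (1 : ℝ), ∫ t in ε..R, h t =
      (G R - ∫ t in (1 : ℝ)..R, q t) - G ε + (∫ t in (ε / (1 + ε))..ε, m t)
        - ∫ t in (R / (1 + R))..1, m t := by
    intro ε hε R hR
    have hR0 : (0 : ℝ) < R := one_pos.trans hR
    have hεR : ε ≤ R := (hε.2.trans hR).le
    have hpos : ∀ x ∈ uIcc ε R, 0 < x := fun x hx => by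
      rw [uIcc_of_le hεR] at hx; exact hε.1.trans_le hx.1
    have hqi : IntervalIntegrable q volume 1 R :=
      (hq.mono fun x hx => by rw [uIcc_of_le (le_of_lt hR)] at hx; exact hx.1).intervalIntegrable
    have i1 : ∫ t in ε..1, h t = ∫ t in ε..1, (p t - m t) :=
      intervalIntegral.integral_congr_Ioo_of_le hε.2.le fun t ht => hpm t ⟨hε.1.trans ht.1, ht.2⟩
    have i2 : ∫ t in (1 : ℝ)..R, h t = ∫ t in (1 : ℝ)..R, (p t - q t) :=
      intervalIntegral.integral_congr_Ioo_of_le (le_of_lt hR) fun t ht => hpq t ht.1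
    have hhi : ∀ a b : ℝ, 0 < a → 0 < b → IntervalIntegrable h volume a b := fun a b ha hb => by
      rw [intervalIntegrable_iff]
      exact hint.mono_set fun x hx => (lt_min ha hb).trans hx.1
    rw [← intervalIntegral.integral_add_adjacent_intervals (hhi ε 1 hε.1 one_pos)
      (hhi 1 R one_pos hR0), i1, i2,
      intervalIntegral.integral_sub (hpi _ _ hε.1 one_pos) (hmi _ _ hε.1 one_pos hε.2.le le_rfl),
      intervalIntegral.integral_sub (hpi _ _ one_pos hR0) hqi]
    have hsub : ∫ w in ε..R, (m ∘ fun w => w / (1 + w)) w * (1 / (1 + w) ^ 2) =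
        ∫ t in (ε / (1 + ε))..(R / (1 + R)), m t := by
      refine intervalIntegral.integral_comp_mul_deriv' (f := fun w : ℝ => w / (1 + w)) ?_ ?_ ?_
      · intro x hx
        have hx0 := hpos x hx
        have := (hasDerivAt_id x).div ((hasDerivAt_id x).const_add 1) (by simp; linarith)
        refine this.congr_deriv ?_
        simp
      · refine ContinuousOn.div continuousOn_const (by fun_prop) fun x hx => ?_
        have hx0 := hpos x hx
        positivity
      · refine hm.mono ?_
        rintro _ ⟨x, hx, rfl⟩
        exact ⟨(hf x (hpos x hx)).1, (hf x (hpos x hx)).2.le⟩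
    have hFTC : ∫ w in ε..R, (p w - m (w / (1 + w)) * (1 / (1 + w) ^ 2)) = G R - G ε := by
      refine intervalIntegral.integral_eq_sub_of_hasDerivAt (fun x hx => hG x (hpos x hx)) ?_
      refine ContinuousOn.intervalIntegrable ?_
      refine (hp.mono fun x hx => hpos x hx).sub (ContinuousOn.mul ?_ ?_)
      · refine hm.comp (ContinuousOn.div continuousOn_id (by fun_prop) fun x hx => ?_) fun x hx =>
          ⟨(hf x (hpos x hx)).1, (hf x (hpos x hx)).2.le⟩
        have hx0 := hpos x hx
        positivity
      · refine ContinuousOn.div continuousOn_const (by fun_prop) fun x hx => ?_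
        have hx0 := hpos x hx
        positivity
    have hmsub : IntervalIntegrable (fun w => m (w / (1 + w)) * (1 / (1 + w) ^ 2)) volume ε R := by
      refine ContinuousOn.intervalIntegrable (ContinuousOn.mul ?_ ?_)
      · refine hm.comp (ContinuousOn.div continuousOn_id (by fun_prop) fun x hx => ?_) fun x hx =>
          ⟨(hf x (hpos x hx)).1, (hf x (hpos x hx)).2.le⟩
        have hx0 := hpos x hx
        positivity
      · refine ContinuousOn.div continuousOn_const (by fun_prop) fun x hx => ?_
        have hx0 := hpos x hx
        positivity
    rw [intervalIntegral.integral_sub (hpi _ _ hε.1 hR0) hmsub] at hFTC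
    simp only [Function.comp_def] at hsub
    rw [hsub] at hFTC
    have a1 := intervalIntegral.integral_add_adjacent_intervals (hpi ε 1 hε.1 one_pos)
      (hpi 1 R one_pos hR0)
    have hfε := hf ε hε.1
    have hfR := hf R hR0
    have a2 := intervalIntegral.integral_add_adjacent_intervals
      (hmi _ _ hfε.1 hε.1 hfε.2.le hε.2.le) (hmi ε 1 hε.1 one_pos hε.2.le le_rfl)
    have a3 := intervalIntegral.integral_add_adjacent_intervals
      (hmi _ _ hfε.1 hfR.1 hfε.2.le hfR.2.le) (hmi _ 1 hfR.1 one_pos hfR.2.le le_rfl)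
    linarith
  -- the limit `R → ∞`
  have mid : ∀ ε ∈ Ioo (0 : ℝ) 1, ∫ t in Ioi ε, h t = - G ε + ∫ t in (ε / (1 + ε))..ε, m t := by
    intro ε hε
    have l1 := intervalIntegral_tendsto_integral_Ioi ε (hint.mono_set (Ioi_subset_Ioi hε.1.le))
      tendsto_id
    have l3 : Tendsto (fun R : ℝ => ∫ t in (R / (1 + R))..1, m t) atTop (𝓝 0) := by
      have hb : ∀ᶠ R : ℝ in atTop, ‖∫ t in (R / (1 + R))..1, m t‖ ≤
          (1 / 2 : ℝ) ^ (-(2 * σ)) * (1 / (1 + R)) := by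
        filter_upwards [eventually_ge_atTop 1] with R hR
        have h1R : (0 : ℝ) < 1 + R := by linarith
        have hfR := hf R (by linarith)
        have hhalf : 1 / 2 ≤ R / (1 + R) := by
          rw [div_le_div_iff₀ (by norm_num) h1R]; linarith
        have e : |1 - R / (1 + R)| = 1 / (1 + R) := by
          rw [abs_of_pos (by linarith [hfR.2])]; field_simp; ring
        rw [← e]
        refine intervalIntegral.norm_integral_le_of_norm_le_const fun t ht => ?_
        rw [uIoc_of_le hfR.2.le] at ht
        refine (hmb t ⟨hfR.1.trans ht.1, ht.2⟩).trans ?_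
        exact Real.rpow_le_rpow_of_nonpos (by norm_num) (hhalf.trans ht.1.le) (by linarith)
      refine squeeze_zero_norm' hb ?_
      have : Tendsto (fun R : ℝ => 1 / (1 + R)) atTop (𝓝 0) :=
        (tendsto_const_nhds (x := (1 : ℝ))).div_atTop (tendsto_atTop_add_const_left _ _ tendsto_id)
      simpa using this.const_mul ((1 / 2 : ℝ) ^ (-(2 * σ)))
    have l2 := ((hlim.sub_const (G ε)).add_const (∫ t in (ε / (1 + ε))..ε, m t)).sub l3
    rw [zero_sub, sub_zero] at l2
    refine tendsto_nhds_unique l1 (l2.congr' ?_)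
    filter_upwards [eventually_gt_atTop 1] with R hR
    exact (trunc ε hε R hR).symm
  have hC : 0 ≤ C := by
    by_contra hc
    have := (abs_nonneg _).trans (hGb (1 / 2) (by norm_num))
    have h2 : (0 : ℝ) < (1 / 2) ^ κ := by positivity
    nlinarith
  -- The substitution moves the cut-off from `ε` to `ε / (1 + ε)`. The gap has length at most `ε²`
  -- and there `|m| ≤ (ε/2)^(-2σ)`, so the mismatch is at most `4 ε^(2-2σ)`, which vanishes because
  -- `σ < 1`.
  have fin : ∀ ε ∈ Ioo (0 : ℝ) 1, |∫ t in Ioi 0, h t| ≤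
      C * (ε ^ κ / κ) + (C * ε ^ κ + 4 * ε ^ (2 - 2 * σ)) := by
    intro ε hε
    have hsplit : ∫ t in Ioi 0, h t = (∫ t in Ioc 0 ε, h t) + ∫ t in Ioi ε, h t := by
      rw [← Ioc_union_Ioi_eq_Ioi hε.1.le, setIntegral_union Ioc_disjoint_Ioi_same
        measurableSet_Ioi (hint.mono_set Ioc_subset_Ioi_self)
        (hint.mono_set (Ioi_subset_Ioi hε.1.le))]
    rw [hsplit, mid ε hε]
    refine (abs_add_le _ _).trans (add_le_add ?_ ((abs_add_le _ _).trans (add_le_add ?_ ?_)))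
    · have hii : IntervalIntegrable (fun t : ℝ => C * t ^ (κ - 1)) volume 0 ε :=
        (intervalIntegral.intervalIntegrable_rpow' (by linarith)).const_mul _
      have := norm_integral_le_of_norm_le (μ := volume.restrict (Ioc 0 ε)) (f := h)
        ((intervalIntegrable_iff_integrableOn_Ioc_of_le hε.1.le).1 hii) (by
          filter_upwards [ae_restrict_mem measurableSet_Ioc] with t ht
          exact hh t ⟨ht.1, ht.2.trans_lt hε.2⟩)
      refine this.trans (le_of_eq ?_)
      rw [← intervalIntegral.integral_of_le hε.1.le, intervalIntegral.integral_const_mul,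
        integral_rpow (Or.inl (by linarith)), sub_add_cancel, Real.zero_rpow hκ.ne', sub_zero]
    · rw [abs_neg]; exact hGb ε hε
    · have h1 : (0 : ℝ) < 1 + ε := by linarith [hε.1]
      have hfε := hf ε hε.1
      have hle : ε / (1 + ε) ≤ ε := div_le_self hε.1.le (by linarith [hε.1])
      have hhalf : ε / 2 ≤ ε / (1 + ε) := by
        have := hε.2
        exact div_le_div_of_nonneg_left hε.1.le h1 (by linarith)
      have e : |ε - ε / (1 + ε)| ≤ ε ^ 2 := by
        rw [abs_of_nonneg (by linarith)]
        have : ε - ε / (1 + ε) = ε ^ 2 / (1 + ε) := by field_simp; ring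
        rw [this]
        exact div_le_self (by positivity) (by linarith [hε.1])
      have hb : ‖∫ t in (ε / (1 + ε))..ε, m t‖ ≤ (ε / 2) ^ (-(2 * σ)) * |ε - ε / (1 + ε)| := by
        refine intervalIntegral.norm_integral_le_of_norm_le_const fun t ht => ?_
        rw [uIoc_of_le hle] at ht
        refine (hmb t ⟨hfε.1.trans ht.1, ht.2.trans hε.2.le⟩).trans ?_
        exact Real.rpow_le_rpow_of_nonpos (by linarith [hε.1]) (hhalf.trans ht.1.le) (by linarith)
      have h4 : ((2 : ℝ)⁻¹) ^ (-(2 * σ)) ≤ 4 := by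
        rw [Real.inv_rpow (by norm_num), ← Real.rpow_neg (by norm_num), neg_neg]
        calc (2 : ℝ) ^ (2 * σ) ≤ 2 ^ (2 : ℝ) :=
              Real.rpow_le_rpow_of_exponent_le (by norm_num) (by linarith)
          _ = 4 := by norm_num
      have hε0 := hε.1
      calc _ ≤ (ε / 2) ^ (-(2 * σ)) * |ε - ε / (1 + ε)| := hb
        _ ≤ (ε / 2) ^ (-(2 * σ)) * ε ^ 2 := by gcongr
        _ = ((2 : ℝ)⁻¹) ^ (-(2 * σ)) * (ε ^ (-(2 * σ)) * ε ^ 2) := by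
          rw [div_eq_mul_inv, Real.mul_rpow hε.1.le (by norm_num)]; ring
        _ = ((2 : ℝ)⁻¹) ^ (-(2 * σ)) * ε ^ (2 - 2 * σ) := by
          rw [← Real.rpow_natCast ε 2, ← Real.rpow_add hε.1]; push_cast; ring_nf
        _ ≤ 4 * ε ^ (2 - 2 * σ) := by gcongr
  have hten : Tendsto (fun ε : ℝ => C * (ε ^ κ / κ) + (C * ε ^ κ + 4 * ε ^ (2 - 2 * σ)))
      (𝓝[>] 0) (𝓝 0) := by
    have z : ∀ e : ℝ, 0 < e → Tendsto (fun ε : ℝ => ε ^ e) (𝓝[>] 0) (𝓝 0) := fun e he => by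
      have := (Real.continuous_rpow_const he.le).tendsto (0 : ℝ)
      rw [Real.zero_rpow he.ne'] at this
      exact this.mono_left nhdsWithin_le_nhds
    have := (((z κ hκ).div_const κ).const_mul C).add (((z κ hκ).const_mul C).add
      ((z (2 - 2 * σ) (by linarith)).const_mul 4))
    simpa using this
  have : |∫ t in Ioi 0, h t| ≤ 0 := by
    refine ge_of_tendsto hten ?_
    filter_upwards [Ioo_mem_nhdsGT (zero_lt_one (α := ℝ))] with ε hε using fin ε hε
  exact abs_nonpos_iff.1 this

end HalfLineIdentities


/-! ### The two identities for powers of the positive part -/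

section Identities

open Filter Topology

variable {s : ℝ}

theorem integrableOn_posPowDiff_even (hs : 0 < s) (hs1 : s < 1) {a τ : ℝ} (ha : 0 < a) :
    IntegrableOn (fun r => (posPowDiff s a (r * τ) + posPowDiff s a (-(r * τ))) *
      r ^ (-1 - 2 * s)) (Ioi 0) := by
  set c : ℝ := 2 * a ^ (s - 2) * τ ^ 2 + 2 * |τ| ^ s with hc
  have hc0 : 0 ≤ c := by positivity
  refine Integrable.mono' ((integrableOn_radialWeight hs hs1).const_mul c) ?_ ?_
  · refine ContinuousOn.aestronglyMeasurable (ContinuousOn.mul ?_ ?_) measurableSet_Ioi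
    · have := continuous_posPowDiff (a := a) hs.le
      fun_prop
    · exact continuousOn_id.rpow_const fun x hx => Or.inl (ne_of_gt hx)
  · filter_upwards [ae_restrict_mem measurableSet_Ioi] with r hr
    have hr0 : (0 : ℝ) < r := hr
    have e1 := abs_posPowDiff_add_neg_le (t := r * τ) hs.le hs1.le ha
    have e2 := abs_posPowDiff_le (t := r * τ) hs.le hs1.le ha.le
    have e3 := abs_posPowDiff_le (t := -(r * τ)) hs.le hs1.le ha.le
    rw [abs_neg] at e3
    have e4 : |r * τ| ^ s = |τ| ^ s * r ^ s := by
      rw [abs_mul, abs_of_pos hr0, Real.mul_rpow hr0.le (abs_nonneg _), mul_comm]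
    rw [e4] at e2 e3
    rw [norm_mul, Real.norm_eq_abs, Real.norm_eq_abs, abs_of_nonneg (a := r ^ _) (by positivity)]
    set x := |posPowDiff s a (r * τ) + posPowDiff s a (-(r * τ))| with hx
    have hx1 : x ≤ c * r ^ 2 := by
      have : 0 ≤ 2 * |τ| ^ s * r ^ 2 := by positivity
      rw [hc]; nlinarith
    have hx2 : x ≤ c * r ^ s := by
      have h1 : 0 ≤ 2 * a ^ (s - 2) * τ ^ 2 * r ^ s := by positivity
      have h2 := abs_add_le (posPowDiff s a (r * τ)) (posPowDiff s a (-(r * τ)))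
      rw [hc]; nlinarith
    rcases eq_or_lt_of_le hc0 with h0 | h0
    · have hx0 : x = 0 := le_antisymm (by rw [← h0, zero_mul] at hx1; exact hx1) (abs_nonneg _)
      rw [hx0, ← h0]; simp
    · have := mul_rpow_le_radialWeight (x := x / c) hs1.le hr0
        (by rw [div_le_iff₀ h0]; linarith) (by rw [div_le_iff₀ h0]; linarith)
      calc x * r ^ (-1 - 2 * s) = c * (x / c * r ^ (-1 - 2 * s)) := by field_simp
        _ ≤ _ := by gcongr

/-- The one-dimensional fractional Laplacian of `t_+ ^ s` vanishes at `1`. -/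
theorem integral_posPowDiff_one (hs : 0 < s) (hs1 : s < 1) :
    ∫ t in Ioi 0, (posPowDiff s 1 t + posPowDiff s 1 (-t)) * t ^ (-1 - 2 * s) = 0 := by
  have hint : IntegrableOn (fun t => (posPowDiff s 1 t + posPowDiff s 1 (-t)) * t ^ (-1 - 2 * s))
      (Ioi 0) := by
    simpa using integrableOn_posPowDiff_even hs hs1 (a := 1) (τ := 1) one_pos
  have hrp : ∀ e : ℝ, ContinuousOn (fun t : ℝ => t ^ e) (Ioi 0) := fun e =>
    continuousOn_id.rpow_const fun x hx => Or.inl (ne_of_gt hx)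
  have hcs : Continuous fun t : ℝ => t ^ s := Real.continuous_rpow_const hs.le
  -- Beyond `t = 1` the term `(1 - t)_+^s` disappears, which leaves `q`. Since `1 - w/(1+w) =
  -- 1/(1+w)`, the combined integrand is `((1+w)^s - 1) (1 - (1+w)^(s-1)) w^(-1-2s)`, and this is
  -- the derivative of `G`.
  refine integral_Ioi_eq_zero_of_substitution (p := fun t => ((1 + t) ^ s - 1) * t ^ (-1 - 2 * s))
    (m := fun t => (1 - (1 - t) ^ s) * t ^ (-1 - 2 * s)) (q := fun t => t ^ (-1 - 2 * s))
    (G := fun w => ((1 + w) ^ s - 1) ^ 2 * w ^ (-(2 * s)) / (2 * s)) (C := 2 + 1 / (2 * s))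
    (κ := 2 - 2 * s) (σ := s) (by linarith) hs hs1 ?_ ?_ ?_ ?_ ?_ ?_ ?_ hint ?_ ?_ ?_
  · refine ContinuousOn.mul ?_ (hrp _)
    exact ((hcs.comp (by fun_prop)).sub continuous_const).continuousOn
  · refine ContinuousOn.mul ?_ ((hrp _).mono fun x hx => hx.1)
    exact (continuous_const.sub (hcs.comp (by fun_prop))).continuousOn
  · exact (hrp _).mono fun x hx => (one_pos.trans_le hx : (0 : ℝ) < x)
  · intro t ht
    unfold posPowDiff
    rw [max_eq_left (by linarith [ht.1]), max_eq_left (by linarith [ht.2]), Real.one_rpow]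
    ring_nf
  · intro t ht
    have ht' : (1 : ℝ) < t := ht
    unfold posPowDiff
    rw [max_eq_left (by linarith), max_eq_right (by linarith), Real.one_rpow,
      Real.zero_rpow hs.ne']
    ring
  · intro w hw
    have hw0 : (0 : ℝ) < w := hw
    have h1w : 0 < 1 + w := by linarith
    have d1 : HasDerivAt (fun w : ℝ => (1 + w) ^ s) (s * (1 + w) ^ (s - 1)) w := by
      have := ((hasDerivAt_id w).const_add 1).rpow_const (p := s) (Or.inl (by simp; linarith))
      simpa using this
    have d2 : HasDerivAt (fun w : ℝ => w ^ (-(2 * s))) (-(2 * s) * w ^ (-(2 * s) - 1)) w :=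
      Real.hasDerivAt_rpow_const (Or.inl hw0.ne')
    have := (((d1.sub_const 1).pow 2).mul d2).div_const (2 * s)
    refine this.congr_deriv ?_
    have e1 : 1 - w / (1 + w) = (1 + w)⁻¹ := by field_simp; ring
    simp only [Pi.pow_apply]
    rw [e1, Real.inv_rpow h1w.le, Real.div_rpow hw0.le h1w.le, Real.rpow_sub_one h1w.ne',
      show -(2 * s) - 1 = -1 - 2 * s by ring, show -(2 * s) = -1 - 2 * s + 1 by ring,
      Real.rpow_add_one hw0.ne', show -1 - 2 * s = -(1 + s + s) by ring,
      Real.rpow_neg h1w.le, Real.rpow_add h1w, Real.rpow_add h1w, Real.rpow_one]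
    have hX : (1 + w) ^ s ≠ 0 := (Real.rpow_pos_of_pos h1w s).ne'
    generalize (1 + w) ^ s = X at *
    generalize w ^ (-(1 + s + s)) = Y
    push_cast
    field_simp
    ring
  · intro t ht
    have h1 : (1 - t) ^ s ≤ 1 := Real.rpow_le_one (by linarith [ht.2]) (by linarith [ht.1]) hs.le
    have h2 : 1 - t ≤ (1 - t) ^ s := by
      have := abs_posPowDiff_le_mul (t := -t) hs.le hs1.le one_pos
      unfold posPowDiff at this
      rw [max_eq_left (by linarith [ht.2]), Real.one_rpow, Real.one_rpow, one_mul, abs_neg,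
        abs_of_pos ht.1] at this
      have := (abs_le.1 this).1
      rw [← sub_eq_add_neg] at this
      linarith
    have ht0 : 0 < t := ht.1
    rw [abs_mul, abs_of_nonneg (by linarith), abs_of_nonneg (by positivity)]
    calc (1 - (1 - t) ^ s) * t ^ (-1 - 2 * s) ≤ t * t ^ (-1 - 2 * s) := by gcongr; linarith
      _ = t ^ (-(2 * s)) := by
        rw [show -(2 * s) = -1 - 2 * s + 1 by ring, Real.rpow_add_one ht0.ne', mul_comm]
  · intro t ht
    have ht0 : 0 < t := ht.1
    have h1 := abs_posPowDiff_add_neg_le (t := t) hs.le hs1.le one_pos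
    rw [Real.one_rpow, mul_one] at h1
    have h3 : 0 ≤ 1 / (2 * s) := by positivity
    rw [abs_mul, abs_of_nonneg (a := t ^ _) (by positivity)]
    calc _ ≤ 2 * t ^ 2 * t ^ (-1 - 2 * s) := by gcongr
      _ = 2 * t ^ (2 - 2 * s - 1) := by
        rw [mul_assoc, ← Real.rpow_natCast t 2, ← Real.rpow_add ht0]; push_cast; ring_nf
      _ ≤ _ := by gcongr; linarith
  · intro t ht
    have ht0 : 0 < t := ht.1
    have h1 := abs_posPowDiff_le_mul (t := t) hs.le hs1.le one_pos
    unfold posPowDiff at h1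
    rw [max_eq_left (by linarith), Real.one_rpow, Real.one_rpow, one_mul, abs_of_pos ht0] at h1
    rw [abs_div, abs_mul, abs_of_nonneg (a := t ^ _) (by positivity), abs_of_pos (a := 2 * s)
      (by positivity), abs_pow]
    calc _ ≤ t ^ 2 * t ^ (-(2 * s)) / (2 * s) := by gcongr
      _ = 1 / (2 * s) * t ^ (2 - 2 * s) := by
        rw [← Real.rpow_natCast t 2, ← Real.rpow_add ht0]; push_cast; ring_nf
      _ ≤ _ := by gcongr; linarith
  -- Both `G R` and `∫_1^R q` tend to `1/(2s)`.
  · have hq : ∀ᶠ R : ℝ in atTop, ((1 + R) ^ s - 1) ^ 2 * R ^ (-(2 * s)) / (2 * s)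
        - ∫ t in (1 : ℝ)..R, t ^ (-1 - 2 * s) =
        ((((1 + R) / R) ^ s - R ^ (-s)) ^ 2 - 1 + R ^ (-s) * R ^ (-s)) / (2 * s) := by
      filter_upwards [eventually_gt_atTop 1] with R hR
      have hR0 : 0 < R := by linarith
      rw [integral_rpow (Or.inr ⟨by linarith, by
        rw [uIcc_of_le hR.le]; intro h; linarith [h.1]⟩), Real.one_rpow,
        Real.div_rpow (by linarith) hR0.le, show -1 - 2 * s + 1 = -s + -s by ring,
        show -(2 * s) = -s + -s by ring, Real.rpow_add hR0, Real.rpow_neg hR0.le]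
      have : R ^ s ≠ 0 := (Real.rpow_pos_of_pos hR0 s).ne'
      field_simp
      ring
    refine (tendsto_congr' hq).2 ?_
    have t1 : Tendsto (fun R : ℝ => R ^ (-s)) atTop (𝓝 0) := tendsto_rpow_neg_atTop hs
    have t2 : Tendsto (fun R : ℝ => (1 + R) / R) atTop (𝓝 1) := by
      have : Tendsto (fun R : ℝ => 1 / R + 1) atTop (𝓝 (0 + 1)) :=
        (tendsto_const_nhds.div_atTop tendsto_id).add_const 1
      rw [zero_add] at this
      refine this.congr' ?_
      filter_upwards [eventually_gt_atTop 0] with R hR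
      field_simp
    have t3 : Tendsto (fun R : ℝ => ((1 + R) / R) ^ s) atTop (𝓝 1) := by
      have := t2.rpow_const (p := s) (Or.inl one_ne_zero)
      rwa [Real.one_rpow] at this
    have := (((((t3.sub t1).pow 2).sub_const 1).add (t1.mul t1)).div_const (2 * s))
    simpa using this

/-- Dilation by `τ / a` reduces to `a = τ = 1`. Along every line through the half-space the constant
term of the density therefore contributes nothing. -/
theorem integral_posPowDiff_even (hs : 0 < s) (hs1 : s < 1) {a : ℝ} (ha : 0 < a) (τ : ℝ) :
    ∫ r in Ioi 0, (posPowDiff s a (r * τ) + posPowDiff s a (-(r * τ))) * r ^ (-1 - 2 * s) = 0 := by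
  wlog h : 0 ≤ τ generalizing τ
  · have := this (-τ) (by linarith)
    simpa [add_comm] using this
  rcases eq_or_lt_of_le h with h0 | h0
  · simp [← h0, posPowDiff, ha.le]
  set c := τ / a with hc
  have hc0 : 0 < c := by positivity
  have key : ∀ r ∈ Ioi (0 : ℝ), (posPowDiff s a (r * τ) + posPowDiff s a (-(r * τ))) *
      r ^ (-1 - 2 * s) = (a ^ s * c ^ (1 + 2 * s)) *
      ((fun t => (posPowDiff s 1 t + posPowDiff s 1 (-t)) * t ^ (-1 - 2 * s)) (c * r)) := by
    intro r hr
    have hr0 : (0 : ℝ) < r := hr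
    have e1 : r * τ = a * (c * r) := by rw [hc]; field_simp
    have e3 := fun t => posPowDiff_scale (s := s) (t := t) zero_le_one ha.le
    simp only [mul_one] at e3
    rw [e1, ← mul_neg, e3, e3]
    simp only
    rw [Real.mul_rpow hc0.le hr0.le, show -1 - 2 * s = -(1 + 2 * s) by ring,
      Real.rpow_neg hc0.le]
    have : c ^ (1 + 2 * s) ≠ 0 := (Real.rpow_pos_of_pos hc0 _).ne'
    field_simp
  have hz := integral_comp_mul_left_Ioi
    (fun t => (posPowDiff s 1 t + posPowDiff s 1 (-t)) * t ^ (-1 - 2 * s)) 0 hc0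
  rw [mul_zero, integral_posPowDiff_one hs hs1, smul_zero] at hz
  rw [setIntegral_congr_fun measurableSet_Ioi key, integral_const_mul, hz, mul_zero]

theorem integrableOn_odd (hs : 0 < s) (hs1 : s < 1) {a : ℝ} (ha : 0 < a) :
    IntegrableOn (fun t => (posPowDiff s a t - posPowDiff s a (-t)) * t ^ (-(2 * s)))
      (Ioc 0 1) := by
  refine Integrable.mono' ((integrableOn_radialWeight_Ioc hs1).const_mul 2) ?_ ?_
  · refine ContinuousOn.aestronglyMeasurable (ContinuousOn.mul ?_ ?_) measurableSet_Ioc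
    · have := continuous_posPowDiff (a := a) hs.le
      fun_prop
    · exact continuousOn_id.rpow_const fun x hx => Or.inl (ne_of_gt hx.1)
  · filter_upwards [ae_restrict_mem measurableSet_Ioc] with t ht
    have ht0 : 0 < t := ht.1
    have e2 := abs_posPowDiff_le (t := t) hs.le hs1.le ha.le
    have e3 := abs_posPowDiff_le (t := -t) hs.le hs1.le ha.le
    rw [abs_neg] at e3
    rw [abs_of_pos ht0] at e2 e3
    rw [radialWeight_of_le_one ht0 ht.2, norm_mul, Real.norm_eq_abs, Real.norm_eq_abs,
      abs_of_nonneg (a := t ^ _) (by positivity)]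
    calc _ ≤ (2 * t ^ s) * t ^ (-(2 * s)) := by
          gcongr; exact (abs_sub _ _).trans (by linarith)
      _ = 2 * t ^ (-s) := by rw [mul_assoc, ← Real.rpow_add ht0]; ring_nf

/-- Subtracting `t^s` removes the leading growth. For `t ≥ a` the bracket is `(t + a)^s - t^s`, of
size `a t^(s-1)`; without the subtraction the integrand would decay only like `t^(-s)`. -/
theorem integrableOn_odd_sub (hs : 0 < s) (hs1 : s < 1) {a : ℝ} (ha : 0 < a) :
    IntegrableOn (fun t => (posPowDiff s a t - posPowDiff s a (-t) - t ^ s) * t ^ (-(2 * s)))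
      (Ioi 0) := by
  refine Integrable.mono' ((integrableOn_radialWeight hs hs1).const_mul (3 * max 1 a)) ?_ ?_
  · refine ContinuousOn.aestronglyMeasurable (ContinuousOn.mul ?_ ?_) measurableSet_Ioi
    · have := continuous_posPowDiff (a := a) hs.le
      have := Real.continuous_rpow_const hs.le
      fun_prop
    · exact continuousOn_id.rpow_const fun x hx => Or.inl (ne_of_gt hx)
  · filter_upwards [ae_restrict_mem measurableSet_Ioi] with t ht
    have ht0 : (0 : ℝ) < t := ht
    have e2 := abs_posPowDiff_le (t := t) hs.le hs1.le ha.le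
    have e3 := abs_posPowDiff_le (t := -t) hs.le hs1.le ha.le
    rw [abs_neg] at e3
    rw [abs_of_pos ht0] at e2 e3
    have hts : 0 ≤ t ^ s := by positivity
    have b1 : |posPowDiff s a t - posPowDiff s a (-t) - t ^ s| ≤ 3 * t ^ s := by
      rw [abs_le] at *
      constructor <;> linarith
    have b2 : |posPowDiff s a t - posPowDiff s a (-t) - t ^ s| ≤ 3 * a * t ^ (s - 1) := by
      rcases le_total t a with h | h
      · refine b1.trans ?_
        rw [Real.rpow_sub_one ht0.ne', mul_assoc]
        gcongr
        rw [mul_div_assoc', le_div_iff₀ ht0, mul_comm]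
        gcongr
      · have e : posPowDiff s a t - posPowDiff s a (-t) - t ^ s = posPowDiff s t a := by
          unfold posPowDiff
          rw [max_eq_left (by linarith), max_eq_right (by linarith), Real.zero_rpow hs.ne',
            max_eq_left (by linarith), add_comm t a]
          ring
        rw [e]
        have := abs_posPowDiff_le_mul (t := a) hs.le hs1.le ht0
        rw [abs_of_pos ha] at this
        refine this.trans ?_
        have : 0 ≤ a * t ^ (s - 1) := by positivity
        linarith
    have hm1 : (1 : ℝ) ≤ max 1 a := le_max_left _ _
    have hm2 : a ≤ max 1 a := le_max_right _ _
    rw [norm_mul, Real.norm_eq_abs, Real.norm_eq_abs, abs_of_nonneg (a := t ^ _) (by positivity)]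
    rcases le_total t 1 with h | h
    · rw [radialWeight_of_le_one ht0 h]
      calc _ ≤ (3 * max 1 a * t ^ s) * t ^ (-(2 * s)) := by
            gcongr; refine b1.trans ?_; gcongr; linarith
        _ = _ := by rw [mul_assoc, ← Real.rpow_add ht0]; ring_nf
    · rw [radialWeight_of_one_le h]
      calc _ ≤ (3 * max 1 a * t ^ (s - 1)) * t ^ (-(2 * s)) := by
            gcongr; refine b2.trans ?_; gcongr
        _ = _ := by rw [mul_assoc, ← Real.rpow_add ht0]; ring_nf

/-- The same substitution turns `m dt` into `(1+w)^(s-2) w^(-2s) dw`, and `p` minus this density is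
the derivative of the stated `G`. Here `q = 0`, since `(1-t)_+^s` vanishes beyond `1`, and `G` tends
to `0` at infinity, so no boundary term survives. -/
theorem integral_odd_sub_one (hs : 0 < s) (hs1 : s < 1) :
    ∫ t in Ioi 0, (posPowDiff s 1 t - posPowDiff s 1 (-t) - t ^ s) * t ^ (-(2 * s)) = 0 := by
  have hrp : ∀ e : ℝ, ContinuousOn (fun t : ℝ => t ^ e) (Ioi 0) := fun e =>
    continuousOn_id.rpow_const fun x hx => Or.inl (ne_of_gt hx)
  have hcs : Continuous fun t : ℝ => t ^ s := Real.continuous_rpow_const hs.le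
  have hs1' : 0 < 1 - s := by linarith
  -- Factor out `w^(1-s)` and use `1 - x^(1-s) ≤ 1 - x` with `x = w/(1+w)`. The single bound gives
  -- the size `w^(1-s)` at the origin and the decay `w^(-s)` at infinity.
  have hGle : ∀ w : ℝ, 0 < w → |(w ^ (1 - s) - w ^ (2 - 2 * s) * (1 + w) ^ (s - 1)) / (1 - s)| ≤
      1 / (1 - s) * (w ^ (1 - s) * (1 / (1 + w))) := by
    intro w hw
    have h1w : 0 < 1 + w := by linarith
    have e1 : w ^ (1 - s) - w ^ (2 - 2 * s) * (1 + w) ^ (s - 1) =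
        w ^ (1 - s) * (1 - (w / (1 + w)) ^ (1 - s)) := by
      rw [Real.div_rpow hw.le h1w.le, show 2 - 2 * s = (1 - s) + (1 - s) by ring,
        Real.rpow_add hw, show s - 1 = -(1 - s) by ring, Real.rpow_neg h1w.le]
      ring
    have hq0 : 0 < w / (1 + w) := by positivity
    have hq1 : w / (1 + w) ≤ 1 := by rw [div_le_one h1w]; linarith
    have h2 : w / (1 + w) ≤ (w / (1 + w)) ^ (1 - s) := by
      calc w / (1 + w) = (w / (1 + w)) ^ (1 : ℝ) := (Real.rpow_one _).symm
        _ ≤ _ := Real.rpow_le_rpow_of_exponent_ge hq0 hq1 (by linarith)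
    have h3 : (w / (1 + w)) ^ (1 - s) ≤ 1 := Real.rpow_le_one hq0.le hq1 hs1'.le
    have h4 : 1 - w / (1 + w) = 1 / (1 + w) := by field_simp; ring
    rw [e1, abs_div, abs_of_pos hs1', abs_mul, abs_of_nonneg (a := w ^ _) (by positivity),
      abs_of_nonneg (by linarith), div_eq_mul_one_div, mul_comm]
    gcongr
    linarith
  have hlim : Tendsto (fun w : ℝ => -((w ^ (1 - s) - w ^ (2 - 2 * s) * (1 + w) ^ (s - 1)) /
      (1 - s))) atTop (𝓝 0) := by
    have t1 : Tendsto (fun R : ℝ => R ^ (-s)) atTop (𝓝 0) := tendsto_rpow_neg_atTop hs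
    refine squeeze_zero_norm' (a := fun R => 1 / (1 - s) * R ^ (-s)) ?_
      (by simpa using t1.const_mul (1 / (1 - s)))
    filter_upwards [eventually_gt_atTop 0] with w hw
    rw [norm_neg]
    refine (hGle w hw).trans ?_
    gcongr
    rw [mul_one_div, div_le_iff₀ (by linarith), sub_eq_add_neg, Real.rpow_add hw, Real.rpow_one,
      mul_comm]
    gcongr
    linarith
  refine integral_Ioi_eq_zero_of_substitution
    (p := fun t => ((1 + t) ^ s - t ^ s) * t ^ (-(2 * s)))
    (m := fun t => (1 - t) ^ s * t ^ (-(2 * s))) (q := fun t => 0)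
    (G := fun w => -((w ^ (1 - s) - w ^ (2 - 2 * s) * (1 + w) ^ (s - 1)) / (1 - s)))
    (C := 3 + 1 / (1 - s)) (κ := 1 - s) (σ := s) (by linarith) hs hs1 ?_ ?_ continuousOn_const
    ?_ ?_ ?_ ?_ (integrableOn_odd_sub hs hs1 one_pos) ?_ ?_ ?_
  · refine ContinuousOn.mul ?_ (hrp _)
    exact ((hcs.comp (by fun_prop)).sub hcs).continuousOn
  · refine ContinuousOn.mul ?_ ((hrp _).mono fun x hx => hx.1)
    exact (hcs.comp (by fun_prop)).continuousOn
  · intro t ht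
    unfold posPowDiff
    rw [max_eq_left (by linarith [ht.1]), max_eq_left (by linarith [ht.2]), Real.one_rpow]
    ring_nf
  · intro t ht
    have ht' : (1 : ℝ) < t := ht
    unfold posPowDiff
    rw [max_eq_left (by linarith), max_eq_right (by linarith), Real.one_rpow,
      Real.zero_rpow hs.ne']
    ring
  · intro w hw
    have hw0 : (0 : ℝ) < w := hw
    have h1w : 0 < 1 + w := by linarith
    have d1 : HasDerivAt (fun w : ℝ => (1 + w) ^ (s - 1)) ((s - 1) * (1 + w) ^ (s - 1 - 1)) w := by
      have := ((hasDerivAt_id w).const_add 1).rpow_const (p := s - 1) (Or.inl (by simp; linarith))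
      simpa using this
    have d2 : HasDerivAt (fun w : ℝ => w ^ (1 - s)) ((1 - s) * w ^ (1 - s - 1)) w :=
      Real.hasDerivAt_rpow_const (Or.inl hw0.ne')
    have d3 : HasDerivAt (fun w : ℝ => w ^ (2 - 2 * s)) ((2 - 2 * s) * w ^ (2 - 2 * s - 1)) w :=
      Real.hasDerivAt_rpow_const (Or.inl hw0.ne')
    have := ((d2.sub (d3.mul d1)).div_const (1 - s)).neg
    refine this.congr_deriv ?_
    have e1 : 1 - w / (1 + w) = (1 + w)⁻¹ := by field_simp; ring
    have hw2 : w ^ (-(2 * s)) = w ^ (-s) * w ^ (-s) := by rw [← Real.rpow_add hw0]; ring_nf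
    have hws : w ^ s = (w ^ (-s))⁻¹ := by rw [Real.rpow_neg hw0.le, inv_inv]
    rw [e1, Real.inv_rpow h1w.le, Real.div_rpow hw0.le h1w.le,
      show 1 - s - 1 = -s by ring, show 2 - 2 * s - 1 = 1 + -(2 * s) by ring,
      show 2 - 2 * s = 2 + -(2 * s) by ring, Real.rpow_add hw0, Real.rpow_add hw0, Real.rpow_one,
      Real.rpow_sub_one h1w.ne' (s - 1), Real.rpow_sub_one h1w.ne' s, Real.rpow_neg h1w.le,
      show 2 * s = s + s by ring, Real.rpow_add h1w, neg_add, Real.rpow_add hw0, hws, Real.rpow_two]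
    have hX : (1 + w) ^ s ≠ 0 := (Real.rpow_pos_of_pos h1w s).ne'
    have hY : w ^ (-s) ≠ 0 := (Real.rpow_pos_of_pos hw0 _).ne'
    generalize (1 + w) ^ s = X at *
    generalize w ^ (-s) = Y at *
    have h1s : 1 - s ≠ 0 := hs1'.ne'
    field_simp
    ring
  · intro t ht
    have ht0 := ht.1
    have h1 : (1 - t) ^ s ≤ 1 := Real.rpow_le_one (by linarith [ht.2]) (by linarith [ht.1]) hs.le
    have h0 : 0 ≤ (1 - t) ^ s := Real.rpow_nonneg (by linarith [ht.2]) _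
    rw [abs_mul, abs_of_nonneg h0, abs_of_nonneg (by positivity)]
    exact mul_le_of_le_one_left (by positivity) h1
  · intro t ht
    have ht0 : 0 < t := ht.1
    have e2 := abs_posPowDiff_le (t := t) hs.le hs1.le zero_le_one
    have e3 := abs_posPowDiff_le (t := -t) hs.le hs1.le zero_le_one
    rw [abs_neg] at e3
    rw [abs_of_pos ht0] at e2 e3
    have hts : 0 ≤ t ^ s := by positivity
    have b1 : |posPowDiff s 1 t - posPowDiff s 1 (-t) - t ^ s| ≤ 3 * t ^ s := by
      rw [abs_le] at *
      constructor <;> linarith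
    have h3 : 0 ≤ 1 / (1 - s) := by positivity
    rw [abs_mul, abs_of_nonneg (a := t ^ _) (by positivity)]
    calc _ ≤ 3 * t ^ s * t ^ (-(2 * s)) := by gcongr
      _ = 3 * t ^ (1 - s - 1) := by rw [mul_assoc, ← Real.rpow_add ht0]; ring_nf
      _ ≤ _ := by gcongr; linarith
  · intro t ht
    have ht0 : 0 < t := ht.1
    rw [abs_neg]
    refine (hGle t ht0).trans ?_
    have h1 : 1 / (1 + t) ≤ 1 := by rw [div_le_one (by linarith)]; linarith
    gcongr ?_ * ?_
    · linarith
    · exact mul_le_of_le_one_right (by positivity) h1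
  · simpa using hlim

theorem integral_odd_sub (hs : 0 < s) (hs1 : s < 1) {a : ℝ} (ha : 0 < a) :
    ∫ t in Ioi 0, (posPowDiff s a t - posPowDiff s a (-t) - t ^ s) * t ^ (-(2 * s)) = 0 := by
  have hc0 : 0 < a⁻¹ := by positivity
  have key : ∀ r ∈ Ioi (0 : ℝ), (posPowDiff s a r - posPowDiff s a (-r) - r ^ s) *
      r ^ (-(2 * s)) = (a ^ s * a⁻¹ ^ (2 * s)) *
      ((fun t => (posPowDiff s 1 t - posPowDiff s 1 (-t) - t ^ s) * t ^ (-(2 * s))) (a⁻¹ * r)) := by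
    intro r hr
    have hr0 : (0 : ℝ) < r := hr
    have e3 := fun t => posPowDiff_scale (s := s) (t := t) zero_le_one ha.le
    simp only [mul_one] at e3
    have e1 : r = a * (a⁻¹ * r) := by field_simp
    have e4 : posPowDiff s a r = a ^ s * posPowDiff s 1 (a⁻¹ * r) := by rw [← e3, ← e1]
    have e5 : posPowDiff s a (-r) = a ^ s * posPowDiff s 1 (-(a⁻¹ * r)) := by
      rw [← e3, mul_neg, ← e1]
    have e6 : r ^ s = a ^ s * (a⁻¹ * r) ^ s := by
      rw [← Real.mul_rpow ha.le (by positivity), ← e1]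
    rw [e4, e5, e6]
    simp only
    rw [Real.mul_rpow (x := a⁻¹) (z := -(2 * s)) hc0.le hr0.le, Real.rpow_neg hc0.le]
    have : a⁻¹ ^ (2 * s) ≠ 0 := (Real.rpow_pos_of_pos hc0 _).ne'
    field_simp
  have hz := integral_comp_mul_left_Ioi
    (fun t => (posPowDiff s 1 t - posPowDiff s 1 (-t) - t ^ s) * t ^ (-(2 * s))) 0 hc0
  rw [mul_zero, integral_odd_sub_one hs hs1, smul_zero] at hz
  rw [setIntegral_congr_fun measurableSet_Ioi key, integral_const_mul, hz, mul_zero]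

end Identities


/-! ### The odd part: dependence on the base point -/

section OddPart

variable {s s₀ γ a b τ : ℝ}

/-- The truncated odd integral `∫₀¹ ((a + t)_+^s - (a - t)_+^s) t^{-2s} dt`. -/
noncomputable def oddCut (s a : ℝ) : ℝ :=
  ∫ t in Ioc 0 1, (posPowDiff s a t - posPowDiff s a (-t)) * t ^ (-(2 * s))

theorem rpow_le_rpow_of_le_one_aux {h : ℝ} (h0 : 0 ≤ h) (h1 : h ≤ 1) (hγ : 0 < γ) (hs : γ ≤ s) :
    h ^ s ≤ h ^ γ := by
  rcases eq_or_lt_of_le h0 with h2 | h2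
  · rw [← h2, Real.zero_rpow hγ.ne', Real.zero_rpow (by linarith)]
  · exact Real.rpow_le_rpow_of_exponent_ge h2 h1 hs

theorem le_rpow_of_le_one_aux {h : ℝ} (h0 : 0 ≤ h) (h1 : h ≤ 1) (hγ : 0 < γ) (hγ1 : γ ≤ 1) :
    h ≤ h ^ γ := by
  simpa using rpow_le_rpow_of_le_one_aux h0 h1 hγ hγ1

theorem abs_oddCut_le (hs : 0 < s) (hs1 : s < 1) (ha : 0 < a) : |(1 - s) * oddCut s a| ≤ 2 := by
  have h1s : 0 < 1 - s := by linarith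
  have h1 : ‖oddCut s a‖ ≤ ∫ t in Ioc (0 : ℝ) 1, 2 * t ^ (-s) := by
    refine norm_integral_le_of_norm_le ?_ ?_
    · rw [← IntegrableOn, ← intervalIntegrable_iff_integrableOn_Ioc_of_le zero_le_one]
      exact (intervalIntegral.intervalIntegrable_rpow' (by linarith)).const_mul _
    · filter_upwards [ae_restrict_mem measurableSet_Ioc] with t ht
      have ht0 : 0 < t := ht.1
      have e2 := abs_posPowDiff_le (t := t) hs.le hs1.le ha.le
      have e3 := abs_posPowDiff_le (t := -t) hs.le hs1.le ha.le
      rw [abs_neg] at e3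
      rw [abs_of_pos ht0] at e2 e3
      rw [norm_mul, Real.norm_eq_abs, Real.norm_eq_abs,
        abs_of_nonneg (a := t ^ _) (by positivity)]
      calc _ ≤ (2 * t ^ s) * t ^ (-(2 * s)) := by
            gcongr; exact (abs_sub _ _).trans (by linarith)
        _ = 2 * t ^ (-s) := by rw [mul_assoc, ← Real.rpow_add ht0]; ring_nf
  rw [← intervalIntegral.integral_of_le zero_le_one, intervalIntegral.integral_const_mul,
    integral_rpow (Or.inl (by linarith)), Real.one_rpow, Real.zero_rpow (by linarith), sub_zero,
    Real.norm_eq_abs] at h1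
  rw [abs_mul, abs_of_pos h1s]
  calc _ ≤ (1 - s) * (2 * (1 / (-s + 1))) := by gcongr
    _ = 2 := by rw [show -s + 1 = 1 - s by ring]; field_simp

/-- By `integral_odd_sub` the integral over `(0, 1]` is a quantity independent of `a` minus an
integral over `(1, ∞)`. On that range, with `a ≤ 1 < t`, only `(a + t)^s` depends on `a`, with slope
at most `t^(s-1)`. The result is Lipschitz up to `a = 0`, which direct estimation on `(0, 1]` does
not give. -/
theorem abs_oddCut_sub_le_of_le_one (hs₀ : 0 < s₀) (hs : s₀ ≤ s) (hs1 : s < 1) (ha : 0 < a)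
    (hb : 0 < b) (ha1 : a ≤ 1) (hb1 : b ≤ 1) :
    |(1 - s) * (oddCut s a - oddCut s b)| ≤ 1 / s₀ * |a - b| := by
  have hs' : 0 < s := hs₀.trans_le hs
  have h1s : 0 < 1 - s := by linarith
  have hio := fun {a : ℝ} (ha : 0 < a) => integrableOn_odd_sub hs' hs1 ha
  have hsp : IntegrableOn (fun t : ℝ => t ^ s * t ^ (-(2 * s))) (Ioc 0 1) := by
    refine (integrableOn_radialWeight_Ioc hs1).congr_fun (fun t ht => ?_) measurableSet_Ioc
    rw [radialWeight_of_le_one ht.1 ht.2, ← Real.rpow_add ht.1]; ring_nf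
  have key : ∀ {a : ℝ}, 0 < a → a ≤ 1 → oddCut s a = (∫ t in Ioc (0 : ℝ) 1, t ^ s * t ^ (-(2 * s)))
      - ∫ t in Ioi (1 : ℝ), (posPowDiff s a t - posPowDiff s a (-t) - t ^ s) * t ^ (-(2 * s)) := by
    intro a ha ha1
    have h0 := integral_odd_sub hs' hs1 ha
    rw [← Ioc_union_Ioi_eq_Ioi (zero_le_one (α := ℝ)), setIntegral_union Ioc_disjoint_Ioi_same
      measurableSet_Ioi ((hio ha).mono_set Ioc_subset_Ioi_self)
      ((hio ha).mono_set (Ioi_subset_Ioi zero_le_one))] at h0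
    have h1 : ∫ t in Ioc (0 : ℝ) 1, (posPowDiff s a t - posPowDiff s a (-t) - t ^ s) *
        t ^ (-(2 * s)) = oddCut s a - ∫ t in Ioc (0 : ℝ) 1, t ^ s * t ^ (-(2 * s)) := by
      unfold oddCut
      rw [← integral_sub (integrableOn_odd hs' hs1 ha) hsp]
      congr 1
      ext t
      ring
    linarith
  rw [key ha ha1, key hb hb1, sub_sub_sub_cancel_left, ← integral_sub
    ((hio hb).mono_set (Ioi_subset_Ioi zero_le_one))
    ((hio ha).mono_set (Ioi_subset_Ioi zero_le_one)), abs_mul, abs_of_pos h1s]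
  have hbd : ‖∫ t in Ioi (1 : ℝ), ((posPowDiff s b t - posPowDiff s b (-t) - t ^ s) *
      t ^ (-(2 * s)) - (posPowDiff s a t - posPowDiff s a (-t) - t ^ s) * t ^ (-(2 * s)))‖ ≤
      ∫ t in Ioi (1 : ℝ), |a - b| * t ^ (-1 - s) := by
    refine norm_integral_le_of_norm_le
      ((integrableOn_Ioi_rpow_of_lt (by linarith) one_pos).const_mul _) ?_
    filter_upwards [ae_restrict_mem measurableSet_Ioi] with t ht
    have ht1 : (1 : ℝ) < t := ht
    have ht0 : 0 < t := by linarith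
    have e : ((posPowDiff s b t - posPowDiff s b (-t) - t ^ s) *
        t ^ (-(2 * s)) - (posPowDiff s a t - posPowDiff s a (-t) - t ^ s) * t ^ (-(2 * s))) =
        ((b + t) ^ s - (a + t) ^ s) * t ^ (-(2 * s)) := by
      unfold posPowDiff
      rw [max_eq_left (a := b + t) (by linarith), max_eq_left (a := a + t) (by linarith),
        max_eq_right (a := b + -t) (by linarith), max_eq_right (a := a + -t) (by linarith)]
      ring
    have hlip : |(b + t) ^ s - (a + t) ^ s| ≤ |a - b| * t ^ (s - 1) := by
      have := abs_posPowDiff_le_mul (a := a + t) (t := b - a) hs'.le hs1.le (by linarith)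
      unfold posPowDiff at this
      rw [show a + t + (b - a) = b + t by ring, max_eq_left (by linarith), abs_sub_comm b a,
        mul_comm] at this
      refine this.trans ?_
      gcongr ?_ * ?_
      exact Real.rpow_le_rpow_of_nonpos ht0 (by linarith) (by linarith)
    rw [e, norm_mul, Real.norm_eq_abs, Real.norm_eq_abs,
      abs_of_nonneg (a := t ^ _) (by positivity)]
    calc _ ≤ |a - b| * t ^ (s - 1) * t ^ (-(2 * s)) := by gcongr
      _ = |a - b| * t ^ (-1 - s) := by rw [mul_assoc, ← Real.rpow_add ht0]; ring_nf
  rw [integral_const_mul, integral_Ioi_rpow_of_lt (by linarith) one_pos, Real.one_rpow,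
    show -1 - s + 1 = -s by ring, neg_div_neg_eq, Real.norm_eq_abs] at hbd
  calc _ ≤ (1 - s) * (|a - b| * (1 / s)) := by gcongr
    _ ≤ 1 * (|a - b| * (1 / s₀)) := by gcongr; linarith
    _ = _ := by ring

/-- Differentiate in `t`. All bases stay at or above `1/2`, where `z^(s-1)` is `4`-Lipschitz, and
two such differences occur. -/
theorem abs_posPow_second_difference_le {t : ℝ} (hs : 0 < s) (hs1 : s < 1) (ha1 : 1 ≤ a)
    (hb1 : 1 ≤ b) (ht : 0 ≤ t) (ht2 : t ≤ 1 / 2) :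
    |((a + t) ^ s - (a - t) ^ s) - ((b + t) ^ s - (b - t) ^ s)| ≤ 8 * |a - b| * t := by
  have d1 : ∀ x ∈ Ici (1 / 2 : ℝ), ∀ y ∈ Ici (1 / 2 : ℝ),
      ‖x ^ (s - 1) - y ^ (s - 1)‖ ≤ 4 * ‖x - y‖ := by
    intro x hx y hy
    refine (convex_Ici _).norm_image_sub_le_of_norm_hasDerivWithin_le
      (f := fun x : ℝ => x ^ (s - 1)) (f' := fun x => (s - 1) * x ^ (s - 1 - 1)) ?_ ?_ hy hx
    · intro z hz
      have hz0 : (1 / 2 : ℝ) ≤ z := hz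
      exact (Real.hasDerivAt_rpow_const (Or.inl (by linarith))).hasDerivWithinAt
    · intro z hz
      have hz0 : (1 / 2 : ℝ) ≤ z := hz
      have hz' : 0 < z := by linarith
      rw [norm_mul, Real.norm_eq_abs, Real.norm_eq_abs, abs_of_nonneg (a := z ^ _) (by positivity),
        abs_of_nonpos (by linarith)]
      have h4 : z ^ (s - 1 - 1) ≤ 4 := by
        calc z ^ (s - 1 - 1) ≤ (1 / 2 : ℝ) ^ (s - 1 - 1) :=
              Real.rpow_le_rpow_of_nonpos (by norm_num) hz0 (by linarith)
          _ ≤ (1 / 2 : ℝ) ^ (-2 : ℝ) :=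
              Real.rpow_le_rpow_of_exponent_ge (by norm_num) (by norm_num) (by linarith)
          _ = 4 := by rw [Real.rpow_neg (by norm_num)]; norm_num
      have : 0 < z ^ (s - 1 - 1) := by positivity
      nlinarith
  have d2 := (convex_Icc (0 : ℝ) (1 / 2)).norm_image_sub_le_of_norm_hasDerivWithin_le
    (f := fun t : ℝ => ((a + t) ^ s - (a - t) ^ s) - ((b + t) ^ s - (b - t) ^ s))
    (f' := fun t => (s * (a + t) ^ (s - 1) + s * (a - t) ^ (s - 1)) -
      (s * (b + t) ^ (s - 1) + s * (b - t) ^ (s - 1))) (C := 8 * |a - b|) (x := 0) (y := t)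
    ?_ ?_ ⟨le_rfl, by norm_num⟩ ⟨ht, ht2⟩
  · simpa [abs_of_nonneg ht] using d2
  · intro z hz
    have p : ∀ c : ℝ, 1 ≤ c → HasDerivAt (fun t : ℝ => (c + t) ^ s) (s * (c + z) ^ (s - 1)) z := by
      intro c hc
      have := ((hasDerivAt_id z).const_add c).rpow_const (p := s)
        (Or.inl (by simp; linarith [hz.1]))
      simpa using this
    have q : ∀ c : ℝ, 1 ≤ c →
        HasDerivAt (fun t : ℝ => (c - t) ^ s) (-(s * (c - z) ^ (s - 1))) z := by
      intro c hc
      have := ((hasDerivAt_id z).const_sub c).rpow_const (p := s)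
        (Or.inl (by simp; linarith [hz.2]))
      simpa using this
    refine (((p a ha1).sub (q a ha1)).sub ((p b hb1).sub (q b hb1))).hasDerivWithinAt.congr_deriv ?_
    ring
  · intro z hz
    have hz1 := hz.1
    have hz2 := hz.2
    have e1 := d1 (a + z) (mem_Ici.2 (by linarith)) (b + z) (mem_Ici.2 (by linarith))
    have e2 := d1 (a - z) (mem_Ici.2 (by linarith)) (b - z) (mem_Ici.2 (by linarith))
    rw [add_sub_add_right_eq_sub] at e1
    rw [sub_sub_sub_cancel_right] at e2
    rw [Real.norm_eq_abs] at *
    rw [Real.norm_eq_abs] at *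
    rw [show (s * (a + z) ^ (s - 1) + s * (a - z) ^ (s - 1)) -
      (s * (b + z) ^ (s - 1) + s * (b - z) ^ (s - 1)) = s * (((a + z) ^ (s - 1) -
      (b + z) ^ (s - 1)) + ((a - z) ^ (s - 1) - (b - z) ^ (s - 1))) by ring, abs_mul,
      abs_of_pos hs]
    calc _ ≤ 1 * (4 * |a - b| + 4 * |a - b|) := by
          gcongr; exact (abs_add_le _ _).trans (add_le_add e1 e2)
      _ = _ := by ring

/-- Far from the boundary point the integrand gains a factor `t`: for `t ≤ 1/2` from the second
difference, for `t ≥ 1/2` at no cost. Then `∫_0^1 t^(1-2s) dt = 1 / (2(1-s))` is what the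
normalisation can pay for. -/
theorem abs_oddCut_sub_le_of_one_le (hs : 0 < s) (hs1 : s < 1) (hγ : 0 < γ) (hγs : γ ≤ s)
    (ha1 : 1 ≤ a) (hb1 : 1 ≤ b) (hab : |a - b| ≤ 1) :
    |(1 - s) * (oddCut s a - oddCut s b)| ≤ 4 * |a - b| ^ γ := by
  have h1s : 0 < 1 - s := by linarith
  have ha : 0 < a := by linarith
  have hb : 0 < b := by linarith
  have hbd : ‖oddCut s a - oddCut s b‖ ≤ ∫ t in Ioc (0 : ℝ) 1, 8 * |a - b| ^ γ * t ^ (1 - 2 * s) := by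
    unfold oddCut
    rw [← integral_sub (integrableOn_odd hs hs1 ha) (integrableOn_odd hs hs1 hb)]
    refine norm_integral_le_of_norm_le ?_ ?_
    · rw [← IntegrableOn, ← intervalIntegrable_iff_integrableOn_Ioc_of_le zero_le_one]
      exact (intervalIntegral.intervalIntegrable_rpow' (by linarith)).const_mul _
    · filter_upwards [ae_restrict_mem measurableSet_Ioc] with t ht
      have ht0 : 0 < t := ht.1
      rw [← sub_mul, norm_mul, Real.norm_eq_abs, Real.norm_eq_abs,
        abs_of_nonneg (a := t ^ _) (by positivity)]
      have key : |posPowDiff s a t - posPowDiff s a (-t) - (posPowDiff s b t - posPowDiff s b (-t))|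
          ≤ 8 * |a - b| ^ γ * t := by
        rcases le_total t (1 / 2) with h | h
        · unfold posPowDiff
          rw [max_eq_left (by linarith), max_eq_left (by linarith), max_eq_left (by linarith),
            max_eq_left (by linarith), sub_sub_sub_cancel_right, sub_sub_sub_cancel_right]
          refine (abs_posPow_second_difference_le hs hs1 ha1 hb1 ht0.le h).trans ?_
          gcongr
          exact le_rpow_of_le_one_aux (abs_nonneg _) hab hγ (by linarith)
        · have e1 := abs_posPowDiff_sub_le (t := t) hs.le hs1.le ha.le hb.le
          have e2 := abs_posPowDiff_sub_le (t := -t) hs.le hs1.le ha.le hb.le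
          have m : ∀ x : ℝ, min |a - b| |x| ^ s ≤ |a - b| ^ γ := fun x =>
            (Real.rpow_le_rpow (le_min (abs_nonneg _) (abs_nonneg _)) (min_le_left _ _) hs.le).trans
              (rpow_le_rpow_of_le_one_aux (abs_nonneg _) hab hγ hγs)
          have e3 := m t
          have e4 := m (-t)
          have h0 : 0 ≤ |a - b| ^ γ := by positivity
          rw [sub_sub_sub_comm]
          refine (abs_sub _ _).trans ?_
          nlinarith
      calc _ ≤ 8 * |a - b| ^ γ * t * t ^ (-(2 * s)) := by gcongr
        _ = _ := by
          rw [show 1 - 2 * s = -(2 * s) + 1 by ring, Real.rpow_add_one ht0.ne']; ring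
  rw [← intervalIntegral.integral_of_le zero_le_one, intervalIntegral.integral_const_mul,
    integral_rpow (Or.inl (by linarith)), Real.one_rpow, Real.zero_rpow (by linarith), sub_zero,
    Real.norm_eq_abs] at hbd
  rw [abs_mul, abs_of_pos h1s]
  calc _ ≤ (1 - s) * (8 * |a - b| ^ γ * (1 / (1 - 2 * s + 1))) := by gcongr
    _ = 4 * |a - b| ^ γ := by rw [show 1 - 2 * s + 1 = 2 * (1 - s) by ring]; field_simp; ring

/-- Base points on opposite sides of `1` are compared through `1`. At distance greater than `1` the
sup bound is enough. -/
theorem abs_oddCut_sub_le (hs₀ : 0 < s₀) (hs : s₀ ≤ s) (hs1 : s < 1) (hγ : 0 < γ) (hγs : γ ≤ s)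
    (ha : 0 < a) (hb : 0 < b) :
    |(1 - s) * (oddCut s a - oddCut s b)| ≤ (4 + 1 / s₀) * |a - b| ^ γ := by
  have hs' : 0 < s := hs₀.trans_le hs
  have hc : 0 ≤ 1 / s₀ := by positivity
  wlog hab : a ≤ b generalizing a b
  · have := this hb ha (le_of_not_ge hab)
    rwa [abs_sub_comm b a, ← neg_sub (oddCut s a), mul_neg, abs_neg] at this
  have hp : 0 ≤ |a - b| ^ γ := by positivity
  rcases le_or_gt |a - b| 1 with h | h
  · have low : ∀ {b}, 0 < b → a ≤ b → b ≤ 1 → |a - b| ≤ 1 →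
        |(1 - s) * (oddCut s a - oddCut s b)| ≤ 1 / s₀ * |a - b| ^ γ := fun hb hab hb1 h =>
      (abs_oddCut_sub_le_of_le_one hs₀ hs hs1 ha hb (hab.trans hb1) hb1).trans
        (by gcongr; exact le_rpow_of_le_one_aux (abs_nonneg _) h hγ (by linarith))
    rcases le_total b 1 with hb1 | hb1
    · refine (low hb hab hb1 h).trans ?_
      gcongr; linarith
    rcases le_total 1 a with ha1 | ha1
    · refine (abs_oddCut_sub_le_of_one_le hs' hs1 hγ hγs ha1 hb1 h).trans ?_
      gcongr; linarith
    · have h1 : |a - 1| ≤ |a - b| := by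
        rw [abs_of_nonpos (by linarith), abs_of_nonpos (by linarith)]; linarith
      have h2 : |1 - b| ≤ |a - b| := by
        rw [abs_of_nonpos (by linarith), abs_of_nonpos (by linarith)]; linarith
      have l1 := low one_pos ha1 le_rfl (h1.trans h)
      have l2 := abs_oddCut_sub_le_of_one_le hs' hs1 hγ hγs le_rfl hb1 (h2.trans h)
      have e : (1 - s) * (oddCut s a - oddCut s b) = (1 - s) * (oddCut s a - oddCut s 1) +
        (1 - s) * (oddCut s 1 - oddCut s b) := by ring
      rw [e]
      refine (abs_add_le _ _).trans ((add_le_add l1 l2).trans ?_)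
      calc _ ≤ 1 / s₀ * |a - b| ^ γ + 4 * |a - b| ^ γ := by gcongr
        _ = _ := by ring
  · have h1 : (1 : ℝ) ≤ |a - b| ^ γ := Real.one_le_rpow h.le hγ.le
    have e1 := abs_oddCut_le hs' hs1 ha
    have e2 := abs_oddCut_le hs' hs1 hb
    rw [mul_sub]
    refine (abs_sub _ _).trans ?_
    nlinarith

/-- Scaling gives `τ^s oddCut s (a/τ)`, hence the bound `τ^(s-γ) |a-b|^γ`. The condition `γ ≤ s`
keeps it uniform as the line becomes parallel to the boundary. -/
theorem abs_integral_odd_sub_le (hs₀ : 0 < s₀) (hs : s₀ ≤ s) (hs1 : s < 1) (hγ : 0 < γ)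
    (hγs : γ ≤ s) (ha : 0 < a) (hb : 0 < b) (hτ : |τ| ≤ 1) :
    |(1 - s) * ((∫ r in Ioc 0 1, (posPowDiff s a (r * τ) - posPowDiff s a (-(r * τ))) *
        r ^ (-(2 * s))) - ∫ r in Ioc 0 1, (posPowDiff s b (r * τ) - posPowDiff s b (-(r * τ))) *
        r ^ (-(2 * s)))| ≤ (4 + 1 / s₀) * |a - b| ^ γ := by
  have hs' : 0 < s := hs₀.trans_le hs
  wlog h : 0 ≤ τ generalizing τ
  · have := this (τ := -τ) (by rwa [abs_neg]) (by linarith)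
    refine le_of_eq_of_le ?_ this
    rw [← abs_neg, ← mul_neg]
    congr 2
    rw [neg_sub', ← integral_neg, ← integral_neg]
    congr 2 <;> · ext r; rw [mul_neg, neg_neg]; ring
  rcases eq_or_lt_of_le h with h0 | h0
  · simp only [← h0, mul_zero, neg_zero, sub_self, zero_mul, integral_zero, abs_zero]
    positivity
  · rw [abs_of_pos h0] at hτ
    have key : ∀ {a : ℝ}, 0 < a → (∫ r in Ioc 0 1, (posPowDiff s a (r * τ) -
        posPowDiff s a (-(r * τ))) * r ^ (-(2 * s))) = τ ^ s * oddCut s (a / τ) := by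
      intro a ha
      unfold oddCut
      rw [← integral_const_mul]
      congr 1
      ext r
      have e := fun t => posPowDiff_scale (s := s) (a := a / τ) (t := t) (by positivity) h0.le
      rw [mul_div_cancel₀ _ h0.ne'] at e
      rw [mul_comm r τ, ← mul_neg, e, e]
      ring
    have h1 := abs_oddCut_sub_le hs₀ hs hs1 hγ hγs (a := a / τ) (b := b / τ) (by positivity)
      (by positivity)
    rw [key ha, key hb, ← mul_sub, mul_left_comm, abs_mul, abs_of_nonneg (by positivity)]
    calc _ ≤ τ ^ s * ((4 + 1 / s₀) * |a / τ - b / τ| ^ γ) := by gcongr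
      _ = (4 + 1 / s₀) * |a - b| ^ γ * τ ^ (s - γ) := by
        rw [← sub_div, abs_div, abs_of_pos h0, Real.div_rpow (abs_nonneg _) h0.le,
          Real.rpow_sub h0]
        ring
      _ ≤ _ := mul_le_of_le_one_right (by positivity)
        (Real.rpow_le_one h0.le hτ (by linarith))

end OddPart

/-! ### Integrals along a line crossing a half-space -/

section RadialIntegral

variable {s s₀ γ a b τ B c h : ℝ} {G G₁ G₂ : ℝ → ℝ}

/-- The integrand of the operator along a line crossing a half-space, with density `G`. -/
noncomputable def radialIntegrand (s a τ : ℝ) (G : ℝ → ℝ) (r : ℝ) : ℝ :=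
  (posPowDiff s a (r * τ) * G r + posPowDiff s a (-(r * τ)) * G (-r)) * r ^ (-1 - 2 * s)

theorem abs_posPowDiff_mul_le {r : ℝ} (hs : 0 ≤ s) (hs1 : s ≤ 1) (ha : 0 ≤ a) (hτ : |τ| ≤ 1)
    (hr : 0 ≤ r) : |posPowDiff s a (r * τ)| ≤ r ^ s ∧ |posPowDiff s a (-(r * τ))| ≤ r ^ s := by
  have h1 : |r * τ| ≤ r := by
    rw [abs_mul, abs_of_nonneg hr]; exact mul_le_of_le_one_right hr hτ
  have h2 : |r * τ| ^ s ≤ r ^ s := Real.rpow_le_rpow (abs_nonneg _) h1 hs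
  refine ⟨(abs_posPowDiff_le hs hs1 ha).trans h2, ?_⟩
  have := abs_posPowDiff_le (t := -(r * τ)) hs hs1 ha
  rw [abs_neg (r * τ)] at this
  exact this.trans h2

theorem abs_radialIntegrand_le {r : ℝ} (hs : 0 ≤ s) (hs1 : s ≤ 1) (ha : 0 ≤ a) (hτ : |τ| ≤ 1)
    (hr : 0 < r) (hG : ∀ r, |G r| ≤ B * min |r| 1) :
    |radialIntegrand s a τ G r| ≤ 2 * B * radialWeight s r := by
  obtain ⟨h1, h2⟩ := abs_posPowDiff_mul_le hs hs1 ha hτ hr.le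
  have g1 := hG r
  have g2 := hG (-r)
  rw [abs_neg] at g2
  rw [abs_of_pos hr] at g1 g2
  have hb : 0 ≤ B * min r 1 := (abs_nonneg _).trans g1
  unfold radialIntegrand radialWeight
  rw [abs_mul, abs_of_nonneg (a := r ^ _) (by positivity)]
  calc _ ≤ (r ^ s * (B * min r 1) + r ^ s * (B * min r 1)) * r ^ (-1 - 2 * s) := by
        gcongr
        refine (abs_add_le _ _).trans ?_
        rw [abs_mul, abs_mul]
        gcongr
    _ = 2 * B * (min r 1 * (r ^ s * r ^ (-1 - 2 * s))) := by ring
    _ = _ := by rw [← Real.rpow_add hr]; ring_nf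

theorem continuousOn_radialIntegrand (hs : 0 ≤ s) (hG : Continuous G) :
    ContinuousOn (radialIntegrand s a τ G) (Ioi 0) := by
  unfold radialIntegrand
  refine ContinuousOn.mul ?_ (continuousOn_id.rpow_const fun x hx => Or.inl (ne_of_gt hx))
  have := continuous_posPowDiff (a := a) hs
  fun_prop

theorem integrableOn_radialIntegrand_of_le (hs : 0 < s) (hs1 : s < 1) (ha : 0 ≤ a) (hτ : |τ| ≤ 1)
    (hGc : AEStronglyMeasurable (radialIntegrand s a τ G) (volume.restrict (Ioi 0)))
    (hG : ∀ r, |G r| ≤ B * min |r| 1) :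
    IntegrableOn (radialIntegrand s a τ G) (Ioi 0) := by
  refine Integrable.mono' ((integrableOn_radialWeight hs hs1).const_mul (2 * B)) hGc ?_
  filter_upwards [ae_restrict_mem measurableSet_Ioi] with r hr
  exact abs_radialIntegrand_le hs.le hs1.le ha hτ hr hG

theorem radialIntegrand_split (r : ℝ) : radialIntegrand s a τ G r =
    G 0 * ((posPowDiff s a (r * τ) + posPowDiff s a (-(r * τ))) * r ^ (-1 - 2 * s)) +
      radialIntegrand s a τ (fun r => G r - G 0) r := by
  unfold radialIntegrand; ring

theorem integrableOn_radialIntegrand (hs : 0 < s) (hs1 : s < 1) (ha : 0 < a) (hτ : |τ| ≤ 1)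
    (hGc : Continuous G) (hG : ∀ r, |G r - G 0| ≤ B * min |r| 1) :
    IntegrableOn (radialIntegrand s a τ G) (Ioi 0) := by
  have h1 := (integrableOn_posPowDiff_even hs hs1 (τ := τ) ha).const_mul (G 0)
  have h2 := integrableOn_radialIntegrand_of_le hs hs1 ha.le hτ
    ((continuousOn_radialIntegrand (a := a) (τ := τ) hs.le
      (hGc.sub continuous_const)).aestronglyMeasurable measurableSet_Ioi) hG
  exact (h1.add h2).congr (Filter.Eventually.of_forall fun r => (radialIntegrand_split r).symm)

/-- The value `G 0` multiplies the integral that vanishes by `integral_posPowDiff_even`. After this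
step the density is `O(min(|r|, 1))` and the radial weight dominates. -/
theorem integral_radialIntegrand_eq (hs : 0 < s) (hs1 : s < 1) (ha : 0 < a) (hτ : |τ| ≤ 1)
    (hGc : Continuous G) (hG : ∀ r, |G r - G 0| ≤ B * min |r| 1) :
    ∫ r in Ioi 0, radialIntegrand s a τ G r =
      ∫ r in Ioi 0, radialIntegrand s a τ (fun r => G r - G 0) r := by
  have h1 := (integrableOn_posPowDiff_even hs hs1 (τ := τ) ha).const_mul (G 0)
  have h2 : IntegrableOn (radialIntegrand s a τ fun r => G r - G 0) (Ioi 0) :=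
    integrableOn_radialIntegrand_of_le hs hs1 ha.le hτ
    ((continuousOn_radialIntegrand (a := a) (τ := τ) hs.le
      (hGc.sub continuous_const)).aestronglyMeasurable measurableSet_Ioi) hG
  rw [setIntegral_congr_fun measurableSet_Ioi fun r _ => radialIntegrand_split r,
    integral_add h1 h2, integral_const_mul, integral_posPowDiff_even hs hs1 ha, mul_zero, zero_add]

theorem abs_integral_radialIntegrand_le (hs₀ : 0 < s₀) (hs : s₀ ≤ s) (hs1 : s < 1) (ha : 0 < a)
    (hτ : |τ| ≤ 1) (hB : 0 ≤ B) (hGc : Continuous G) (hG : ∀ r, |G r - G 0| ≤ B * min |r| 1) :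
    |(1 - s) * ∫ r in Ioi 0, radialIntegrand s a τ G r| ≤ 2 * B * (1 + 1 / s₀) := by
  have hs' : 0 < s := hs₀.trans_le hs
  have h1s : 0 < 1 - s := by linarith
  rw [integral_radialIntegrand_eq hs' hs1 ha hτ hGc hG, abs_mul, abs_of_pos h1s]
  have : ‖∫ r in Ioi 0, radialIntegrand s a τ (fun r => G r - G 0) r‖ ≤
      ∫ r in Ioi 0, 2 * B * radialWeight s r := by
    refine norm_integral_le_of_norm_le ((integrableOn_radialWeight hs' hs1).const_mul _) ?_
    filter_upwards [ae_restrict_mem measurableSet_Ioi] with r hr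
    exact abs_radialIntegrand_le hs'.le hs1.le ha.le hτ hr hG
  rw [integral_const_mul, Real.norm_eq_abs] at this
  calc _ ≤ (1 - s) * (2 * B * ∫ r in Ioi 0, radialWeight s r) := by gcongr
    _ = 2 * B * ((1 - s) * ∫ r in Ioi 0, radialWeight s r) := by ring
    _ ≤ _ := by gcongr; exact one_sub_mul_integral_radialWeight_le hs₀ hs hs1

/-- The density is split into its value at `0`, its linear part and a remainder. The first cancels,
the second is the odd integral treated above, and the third is small enough for absolute estimates.
-/
theorem abs_integral_radialIntegrand_shift_le (hs₀ : 0 < s₀) (hs : s₀ ≤ s) (hs1 : s < 1)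
    (hγ : 0 < γ) (hγs : γ ≤ s) (ha : 0 < a) (hb : 0 < b) (hτ : |τ| ≤ 1) (hB : 0 ≤ B)
    (hGc : Continuous G) (hG : ∀ r, |G r - G 0| ≤ B * min |r| 1)
    (hc : |c| ≤ B) (hG' : ∀ r, |r| ≤ 1 → |G r - G 0 - c * r| ≤ B * |r| ^ (1 + γ)) :
    |(1 - s) * ((∫ r in Ioi 0, radialIntegrand s a τ G r) -
      ∫ r in Ioi 0, radialIntegrand s b τ G r)| ≤ 9 * (1 + 1 / s₀) * B * |a - b| ^ γ := by
  have hs' : 0 < s := hs₀.trans_le hs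
  have h1s : 0 < 1 - s := by linarith
  -- The linear part is truncated at `|r| = 1`, so `R` is of order `|r|^(1+γ)` inside and keeps the
  -- bound `B` outside.
  set R : ℝ → ℝ := fun r => G r - G 0 - c * (if |r| ≤ 1 then r else 0) with hR
  set o : ℝ → ℝ → ℝ := fun a r => (posPowDiff s a (r * τ) - posPowDiff s a (-(r * τ))) *
    r ^ (-(2 * s)) with ho
  -- the odd part of the integrand, restricted to `(0, 1]`
  have hodd_meas : ∀ a, AEStronglyMeasurable (o a) (volume.restrict (Ioc 0 1)) := fun a => by
    refine ContinuousOn.aestronglyMeasurable (ContinuousOn.mul ?_ ?_) measurableSet_Ioc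
    · have := continuous_posPowDiff (a := a) hs'.le
      fun_prop
    · exact continuousOn_id.rpow_const fun x hx => Or.inl (ne_of_gt hx.1)
  have hodd_int : ∀ a, 0 < a → IntegrableOn (o a) (Ioc 0 1) := fun a ha => by
    refine Integrable.mono' ((integrableOn_radialWeight_Ioc hs1).const_mul 2) (hodd_meas a) ?_
    filter_upwards [ae_restrict_mem measurableSet_Ioc] with t ht
    have ht0 : 0 < t := ht.1
    obtain ⟨e2, e3⟩ := abs_posPowDiff_mul_le hs'.le hs1.le ha.le hτ ht0.le
    rw [radialWeight_of_le_one ht0 ht.2, norm_mul, Real.norm_eq_abs, Real.norm_eq_abs,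
      abs_of_nonneg (a := t ^ _) (by positivity)]
    calc _ ≤ (2 * t ^ s) * t ^ (-(2 * s)) := by
          gcongr; exact (abs_sub _ _).trans (by linarith)
      _ = 2 * t ^ (-s) := by rw [mul_assoc, ← Real.rpow_add ht0]; ring_nf
  have hsplit : ∀ a, ∀ r ∈ Ioi (0 : ℝ), radialIntegrand s a τ (fun r => G r - G 0) r =
      c * (Ioc 0 1).indicator (o a) r + radialIntegrand s a τ R r := by
    intro a r hr
    have hr0 : (0 : ℝ) < r := hr
    by_cases h1 : r ≤ 1
    · rw [indicator_of_mem (show r ∈ Ioc (0 : ℝ) 1 from ⟨hr0, h1⟩)]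
      simp only [radialIntegrand, hR, ho, abs_neg, abs_of_pos hr0, h1, if_true]
      rw [show -(2 * s) = -1 - 2 * s + 1 by ring, Real.rpow_add_one hr0.ne']
      ring
    · rw [indicator_of_notMem (show r ∉ Ioc (0 : ℝ) 1 from fun h => h1 h.2)]
      simp only [radialIntegrand, hR, abs_neg, abs_of_pos hr0, h1, if_false]
      ring
  have hint1 : ∀ a, 0 < a → IntegrableOn (fun r => c * (Ioc 0 1).indicator (o a) r) (Ioi 0) :=
    fun a ha => ((((hodd_int a ha).integrable_indicator measurableSet_Ioc).integrableOn)).const_mul c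
  have hint0 : ∀ a, 0 < a → IntegrableOn (radialIntegrand s a τ (fun r => G r - G 0)) (Ioi 0) :=
    fun a ha => integrableOn_radialIntegrand_of_le hs' hs1 ha.le hτ
      ((continuousOn_radialIntegrand hs'.le
        (hGc.sub continuous_const)).aestronglyMeasurable measurableSet_Ioi) hG
  have hint2 : ∀ a, 0 < a → IntegrableOn (radialIntegrand s a τ R) (Ioi 0) := fun a ha =>
    ((hint0 a ha).sub (hint1 a ha)).congr_fun (fun r hr => by
      simp only [Pi.sub_apply]; rw [hsplit a r hr]; ring) measurableSet_Ioi
  have key : ∀ a, 0 < a → ∫ r in Ioi 0, radialIntegrand s a τ G r =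
      c * (∫ r in Ioc 0 1, o a r) + ∫ r in Ioi 0, radialIntegrand s a τ R r := by
    intro a ha
    rw [integral_radialIntegrand_eq hs' hs1 ha hτ hGc hG,
      setIntegral_congr_fun measurableSet_Ioi (hsplit a), integral_add (hint1 a ha) (hint2 a ha),
      integral_const_mul, setIntegral_indicator measurableSet_Ioc,
      inter_eq_self_of_subset_right Ioc_subset_Ioi_self]
  have hRb : ∀ r, 0 < |r| → |R r| ≤ B * min (|r| ^ (1 + γ)) 1 := by
    intro r hr
    by_cases h1 : |r| ≤ 1
    · rw [min_eq_left (Real.rpow_le_one (abs_nonneg _) h1 (by linarith))]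
      simp only [hR, h1, if_true]
      exact hG' r h1
    · push Not at h1
      rw [min_eq_right (Real.one_le_rpow h1.le (by linarith))]
      have := hG r
      rw [min_eq_right h1.le] at this
      simpa only [hR, not_le.2 h1, if_false, mul_zero, sub_zero] using this
  have hpt : ∀ r ∈ Ioi (0 : ℝ), ‖radialIntegrand s a τ R r - radialIntegrand s b τ R r‖ ≤
      4 * B * |a - b| ^ γ * radialWeight s r := by
    intro r hr
    have hr0 : (0 : ℝ) < r := hr
    have hτr : |r * τ| ≤ r := by
      rw [abs_mul, abs_of_pos hr0]; exact mul_le_of_le_one_right hr0.le hτ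
    -- Interpolation: `min^s = min^γ min^(s-γ)`, with the two factors bounded by `|a-b|^γ` and
    -- `r^(s-γ)`. For `r ≤ 1`, multiplied by `r^(1+γ) r^(-1-2s)` this is `|a-b|^γ r^(-s)`, the
    -- radial weight with no loss.
    have hm : ∀ t, |t| ≤ r → |posPowDiff s a t - posPowDiff s b t| ≤
        2 * (|a - b| ^ γ * r ^ (s - γ)) := by
      intro t ht
      refine (abs_posPowDiff_sub_le hs'.le hs1.le ha.le hb.le).trans ?_
      gcongr
      have hmn : 0 ≤ min |a - b| |t| := le_min (abs_nonneg _) (abs_nonneg _)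
      calc min |a - b| |t| ^ s = min |a - b| |t| ^ γ * min |a - b| |t| ^ (s - γ) := by
            rw [← Real.rpow_add' hmn (by linarith)]; ring_nf
        _ ≤ _ := by
          gcongr
          · exact min_le_left _ _
          · exact (min_le_right _ _).trans ht
    have m1 := hm _ hτr
    have m2 := hm (-(r * τ)) (by rwa [abs_neg])
    have r1 := hRb r (by rwa [abs_of_pos hr0])
    have r2 := hRb (-r) (by rwa [abs_neg, abs_of_pos hr0])
    rw [abs_neg] at r2
    rw [abs_of_pos hr0] at r1 r2
    have e : radialIntegrand s a τ R r - radialIntegrand s b τ R r =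
        ((posPowDiff s a (r * τ) - posPowDiff s b (r * τ)) * R r +
        (posPowDiff s a (-(r * τ)) - posPowDiff s b (-(r * τ))) * R (-r)) * r ^ (-1 - 2 * s) := by
      unfold radialIntegrand; ring
    rw [e, norm_mul, Real.norm_eq_abs, Real.norm_eq_abs,
      abs_of_nonneg (a := r ^ _) (by positivity)]
    calc _ ≤ (2 * (|a - b| ^ γ * r ^ (s - γ)) * (B * min (r ^ (1 + γ)) 1) +
          2 * (|a - b| ^ γ * r ^ (s - γ)) * (B * min (r ^ (1 + γ)) 1)) * r ^ (-1 - 2 * s) := by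
          gcongr
          refine (abs_add_le _ _).trans ?_
          rw [abs_mul, abs_mul]
          gcongr
      _ = 4 * B * |a - b| ^ γ * (r ^ (s - γ) * min (r ^ (1 + γ)) 1 * r ^ (-1 - 2 * s)) := by ring
      _ ≤ _ := by
        gcongr
        rcases le_total r 1 with h | h
        · rw [radialWeight_of_le_one hr0 h, min_eq_left (Real.rpow_le_one hr0.le h (by linarith)),
            ← Real.rpow_add hr0, ← Real.rpow_add hr0]
          apply le_of_eq; ring_nf
        · rw [radialWeight_of_one_le h, min_eq_right (Real.one_le_rpow h (by linarith)), mul_one,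
            ← Real.rpow_add hr0]
          exact Real.rpow_le_rpow_of_exponent_le h (by linarith)
  have hI : |(1 - s) * ((∫ r in Ioi 0, radialIntegrand s a τ R r) -
      ∫ r in Ioi 0, radialIntegrand s b τ R r)| ≤ 4 * B * |a - b| ^ γ * (1 + 1 / s₀) := by
    rw [← integral_sub (hint2 a ha) (hint2 b hb), abs_mul, abs_of_pos h1s]
    have := norm_integral_le_of_norm_le (μ := volume.restrict (Ioi 0))
      ((integrableOn_radialWeight hs' hs1).const_mul (4 * B * |a - b| ^ γ))
      ((ae_restrict_mem measurableSet_Ioi).mono hpt)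
    rw [integral_const_mul, Real.norm_eq_abs] at this
    calc _ ≤ (1 - s) * (4 * B * |a - b| ^ γ * ∫ r in Ioi 0, radialWeight s r) := by gcongr
      _ = 4 * B * |a - b| ^ γ * ((1 - s) * ∫ r in Ioi 0, radialWeight s r) := by ring
      _ ≤ _ := by gcongr; exact one_sub_mul_integral_radialWeight_le hs₀ hs hs1
  have hO := abs_integral_odd_sub_le hs₀ hs hs1 hγ hγs ha hb hτ
  have e : (1 - s) * ((∫ r in Ioi 0, radialIntegrand s a τ G r) -
      ∫ r in Ioi 0, radialIntegrand s b τ G r) =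
      c * ((1 - s) * ((∫ r in Ioc 0 1, o a r) - ∫ r in Ioc 0 1, o b r)) +
      (1 - s) * ((∫ r in Ioi 0, radialIntegrand s a τ R r) -
      ∫ r in Ioi 0, radialIntegrand s b τ R r) := by
    rw [key a ha, key b hb]; ring
  rw [e]
  have hp : 0 ≤ |a - b| ^ γ := by positivity
  have hs₀' : 0 ≤ 1 / s₀ := by positivity
  calc _ ≤ B * ((4 + 1 / s₀) * |a - b| ^ γ) + 4 * B * |a - b| ^ γ * (1 + 1 / s₀) := by
        refine (abs_add_le _ _).trans (add_le_add ?_ hI)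
        rw [abs_mul]
        gcongr
    _ = (8 + 5 * (1 / s₀)) * (B * |a - b| ^ γ) := by ring
    _ ≤ 9 * (1 + 1 / s₀) * (B * |a - b| ^ γ) := by gcongr; linarith
    _ = _ := by ring

/-- Hölder dependence of the line integral on the base point and on the density. -/
theorem abs_integral_radialIntegrand_sub_le (hs₀ : 0 < s₀) (hs : s₀ ≤ s) (hs1 : s < 1)
    (hγ : 0 < γ) (hγs : γ ≤ s) (ha : 0 < a) (hb : 0 < b) (hτ : |τ| ≤ 1) (hB : 0 ≤ B)
    (hab : |a - b| ≤ h) (hG₁c : Continuous G₁) (hG₂c : Continuous G₂)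
    (hG₁ : ∀ r, |G₁ r - G₁ 0| ≤ B * min |r| 1) (hG₂ : ∀ r, |G₂ r - G₂ 0| ≤ B * min |r| 1)
    (hc : |c| ≤ B) (hG' : ∀ r, |r| ≤ 1 → |G₂ r - G₂ 0 - c * r| ≤ B * |r| ^ (1 + γ))
    (hd : ∀ r, |(G₁ r - G₁ 0) - (G₂ r - G₂ 0)| ≤ B * h ^ γ * min |r| 1) :
    |(1 - s) * ((∫ r in Ioi 0, radialIntegrand s a τ G₁ r) -
      ∫ r in Ioi 0, radialIntegrand s b τ G₂ r)| ≤ 11 * (1 + 1 / s₀) * B * h ^ γ := by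
  have hs' : 0 < s := hs₀.trans_le hs
  have hh : 0 ≤ h := (abs_nonneg _).trans hab
  have h1 := abs_integral_radialIntegrand_shift_le hs₀ hs hs1 hγ hγs ha hb hτ hB hG₂c hG₂ hc hG'
  have h2 := abs_integral_radialIntegrand_le (G := fun r => G₁ r - G₂ r) (B := B * h ^ γ) hs₀ hs hs1
    ha hτ (by positivity) (hG₁c.sub hG₂c) (fun r => by
      have := hd r
      rwa [show G₁ r - G₁ 0 - (G₂ r - G₂ 0) = G₁ r - G₂ r - (G₁ 0 - G₂ 0) by ring] at this)
  have e : ∫ r in Ioi 0, radialIntegrand s a τ (fun r => G₁ r - G₂ r) r =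
      (∫ r in Ioi 0, radialIntegrand s a τ G₁ r) - ∫ r in Ioi 0, radialIntegrand s a τ G₂ r := by
    rw [← integral_sub (integrableOn_radialIntegrand hs' hs1 ha hτ hG₁c hG₁)
      (integrableOn_radialIntegrand hs' hs1 ha hτ hG₂c hG₂)]
    congr 1
    ext r
    unfold radialIntegrand
    ring
  rw [e] at h2
  have e2 : (1 - s) * ((∫ r in Ioi 0, radialIntegrand s a τ G₁ r) -
      ∫ r in Ioi 0, radialIntegrand s b τ G₂ r) =
      (1 - s) * ((∫ r in Ioi 0, radialIntegrand s a τ G₁ r) -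
        ∫ r in Ioi 0, radialIntegrand s a τ G₂ r) +
      (1 - s) * ((∫ r in Ioi 0, radialIntegrand s a τ G₂ r) -
        ∫ r in Ioi 0, radialIntegrand s b τ G₂ r) := by ring
  rw [e2]
  calc _ ≤ 2 * (B * h ^ γ) * (1 + 1 / s₀) + 9 * (1 + 1 / s₀) * B * h ^ γ := by
        refine (abs_add_le _ _).trans (add_le_add h2 (h1.trans ?_))
        gcongr
    _ = _ := by ring

end RadialIntegral


/-! ### From extended norms to real inequalities -/

section ENNRealNorms

theorem enorm_le_coe_iff_norm_le {F : Type*} [SeminormedAddGroup F] {x : F} {C : ℝ≥0} :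
    ‖x‖ₑ ≤ C ↔ ‖x‖ ≤ C := by
  rw [enorm_le_coe]; exact Iff.rfl

theorem norm_sub_le_of_eHolderNorm_le {X F : Type*} [MetricSpace X] [NormedAddCommGroup F]
    {γ C : ℝ≥0} {f : X → F} (h : eHolderNorm γ f ≤ C) (x y : X) :
    ‖f x - f y‖ ≤ C * dist x y ^ (γ : ℝ) := by
  have hf : MemHolder γ f := by
    rw [← eHolderNorm_lt_top]; exact h.trans_lt ENNReal.coe_lt_top
  have h1 := hf.holderWith.dist_le x y
  rw [dist_eq_norm] at h1
  refine h1.trans ?_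
  gcongr
  rw [← ENNReal.coe_le_coe, hf.coe_nnHolderNorm_eq_eHolderNorm]
  exact h

end ENNRealNorms

/-! ### Regularity of the kernel on annuli -/

section Kernel

variable {n : ℕ} {γ M : ℝ≥0} {μ : sphere (0 : RSpace n) 1 → ℝ}

theorem sphere_bounds_of_sphereC1HolderNorm_le (h : sphereC1HolderNorm γ μ ≤ M) :
    (∀ θ, ‖μ θ‖ ≤ M) ∧
    (∀ θ : sphere (0 : RSpace n) 1, ‖fderiv ℝ (radialExt μ) (θ : RSpace n)‖ ≤ M) ∧
    ∀ θ θ' : sphere (0 : RSpace n) 1, ‖fderiv ℝ (radialExt μ) (θ : RSpace n) -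
      fderiv ℝ (radialExt μ) (θ' : RSpace n)‖ ≤ M * dist θ θ' ^ (γ : ℝ) := by
  unfold sphereC1HolderNorm at h
  refine ⟨fun θ => ?_, fun θ => ?_, fun θ θ' => ?_⟩
  · rw [← enorm_le_coe_iff_norm_le]
    exact (le_iSup (fun θ => ‖μ θ‖ₑ) θ).trans ((le_self_add.trans le_self_add).trans h)
  · rw [← enorm_le_coe_iff_norm_le]
    exact (le_iSup (fun θ : sphere (0 : RSpace n) 1 =>
      ‖fderiv ℝ (radialExt μ) (θ : RSpace n)‖ₑ) θ).trans ((le_add_self.trans le_self_add).trans h)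
  · exact norm_sub_le_of_eHolderNorm_le (f := fun θ : sphere (0 : RSpace n) 1 =>
      fderiv ℝ (radialExt μ) (θ : RSpace n)) (le_add_self.trans h) θ θ'

theorem norm_radialExt_le (h : ∀ θ, ‖μ θ‖ ≤ M) (y : RSpace n) : ‖radialExt μ y‖ ≤ M := by
  unfold radialExt
  split_ifs
  · simp
  · exact h _

theorem radialExt_smul {c : ℝ} (hc : 0 < c) (y : RSpace n) :
    radialExt μ (c • y) = radialExt μ y := by
  unfold radialExt
  by_cases hy : y = 0
  · simp [hy]
  · rw [dif_neg hy, dif_neg (by simp [hc.ne', hy])]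
    congr 1
    apply Subtype.ext
    simp only [toSphere]
    rw [norm_smul, Real.norm_of_nonneg hc.le, smul_smul]
    congr 1
    have : ‖y‖ ≠ 0 := norm_ne_zero_iff.2 hy
    field_simp

theorem differentiableAt_radialExt (h : IsC1Sphere μ) {y : RSpace n} (hy : y ≠ 0) :
    DifferentiableAt ℝ (radialExt μ) y :=
  (h.differentiableOn one_ne_zero).differentiableAt (isOpen_compl_singleton.mem_nhds hy)

/-- The derivative of a `0`-homogeneous function is homogeneous of degree `-1`, so bounds on the
sphere control every annulus. -/
theorem fderiv_radialExt (y : RSpace n) (hy : y ≠ 0) :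
    fderiv ℝ (radialExt μ) y = ‖y‖⁻¹ • fderiv ℝ (radialExt μ) (toSphere y hy : RSpace n) := by
  have hc : 0 < ‖y‖⁻¹ := inv_pos.2 (norm_pos_iff.2 hy)
  have h := fderiv_comp_smul (f := radialExt μ) (x := y) ‖y‖⁻¹
  have e : (fun z : RSpace n => radialExt μ (‖y‖⁻¹ • z)) = radialExt μ := by
    ext z; exact radialExt_smul hc z
  have e2 : (radialExt μ <| ‖y‖⁻¹ • · ) = radialExt μ := e
  rw [e2] at h
  exact h

/-- The open annulus `{c < ‖y‖ < R}`. -/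
def annulus (n : ℕ) (c R : ℝ) : Set (RSpace n) := {y | c < ‖y‖ ∧ ‖y‖ < R}

theorem isOpen_annulus {c R : ℝ} : IsOpen (annulus n c R) :=
  (isOpen_lt continuous_const continuous_norm).inter (isOpen_lt continuous_norm continuous_const)

/-- The constant depends only on a bound `Q` for the exponent, so it serves all `s` at once. Powers
of `‖y‖²` are used because its derivative `2⟨y, ·⟩` is linear in `y`. -/
theorem holderBdd_rpow_normSq {γ c R Q : ℝ} (hγ : 0 ≤ γ) (hγ1 : γ ≤ 1) (hc : 0 < c) :
    ∃ C, 0 ≤ C ∧ ∀ q : ℝ, |q| ≤ Q →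
      HolderBdd γ C (annulus n c R) (fun y => (‖y‖ ^ 2) ^ q) := by
  rcases lt_or_ge R 0 with hR | hR
  · refine ⟨0, le_rfl, fun q _ => ⟨fun y hy => ?_, fun y hy => ?_⟩⟩ <;>
    · exact absurd (hy.2.trans hR) (not_lt.2 (norm_nonneg y))
  rcases lt_or_ge Q 0 with hQ | hQ
  · exact ⟨0, le_rfl, fun q hq => absurd (hq.trans_lt hQ) (not_lt.2 (abs_nonneg q))⟩
  -- `T` dominates both `t` and `1/t` on `[c², R²]`, so `t^q ≤ T^|q|` for either sign of `q`.
  set T : ℝ := max ((c ^ 2)⁻¹) (1 + R ^ 2) with hT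
  have hT1 : 1 ≤ T := le_max_of_le_right (by nlinarith)
  have bound : ∀ q : ℝ, ∀ Q' : ℝ, |q| ≤ Q' → ∀ t ∈ Icc (c ^ 2) (R ^ 2), t ^ q ≤ T ^ Q' := by
    intro q Q' hq t ht
    have ht0 : 0 < t := (by positivity : 0 < c ^ 2).trans_le ht.1
    have hTt : t ≤ T := ht.2.trans ((by linarith : R ^ 2 ≤ 1 + R ^ 2).trans (le_max_right _ _))
    have hTt' : t⁻¹ ≤ T := (inv_anti₀ (by positivity) ht.1).trans (le_max_left _ _)
    rcases le_total 0 q with h | h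
    · calc t ^ q ≤ T ^ q := by gcongr
        _ ≤ T ^ Q' := Real.rpow_le_rpow_of_exponent_le hT1 ((le_abs_self q).trans hq)
    · calc t ^ q = t⁻¹ ^ (-q) := by rw [Real.inv_rpow ht0.le, Real.rpow_neg ht0.le, inv_inv]
        _ ≤ T ^ (-q) := Real.rpow_le_rpow (by positivity) hTt' (by linarith)
        _ ≤ T ^ Q' := Real.rpow_le_rpow_of_exponent_le hT1 ((neg_le_abs q).trans hq)
  refine ⟨3 * T ^ Q + Q * T ^ (Q + 1) * (2 * R), by positivity, fun q hq => ?_⟩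
  have hmem : ∀ y ∈ annulus n c R, ‖y‖ ^ 2 ∈ Icc (c ^ 2) (R ^ 2) := fun y hy =>
    ⟨by have := hy.1; gcongr, by have := hy.2; gcongr⟩
  refine HolderBdd.of_lipschitz hγ hγ1 (by positivity) (by positivity) (fun y hy => ?_)
    fun x hx y hy => ?_
  · rw [Real.norm_of_nonneg (by positivity)]
    exact bound q Q hq _ (hmem y hy)
  · have h1 := (convex_Icc (c ^ 2) (R ^ 2)).norm_image_sub_le_of_norm_hasDerivWithin_le
      (f := fun t : ℝ => t ^ q) (f' := fun t => q * t ^ (q - 1)) (C := Q * T ^ (Q + 1))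
      (fun t ht => (Real.hasDerivAt_rpow_const (Or.inl
        ((by positivity : 0 < c ^ 2).trans_le ht.1).ne')).hasDerivWithinAt)
      (fun t ht => ?_) (hmem y hy) (hmem x hx)
    · refine h1.trans ?_
      rw [mul_assoc (Q * T ^ (Q + 1))]
      gcongr
      have e : ‖x‖ ^ 2 - ‖y‖ ^ 2 = (‖x‖ + ‖y‖) * (‖x‖ - ‖y‖) := by ring
      rw [e, Real.norm_eq_abs, abs_mul, abs_of_nonneg (by positivity)]
      gcongr
      · linarith [hx.2, hy.2]
      · exact (abs_norm_sub_norm_le x y).trans (dist_eq_norm x y).ge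
    · have ht0 : 0 < t := (by positivity : 0 < c ^ 2).trans_le ht.1
      rw [norm_mul, Real.norm_eq_abs, Real.norm_eq_abs,
        abs_of_nonneg (a := t ^ _) (by positivity)]
      gcongr
      refine bound (q - 1) (Q + 1) ?_ t ht
      exact (abs_sub _ _).trans (by rw [abs_one]; linarith)

theorem ckHolderOn_rpow_normSq {γ c R Q : ℝ} (hγ : 0 ≤ γ) (hγ1 : γ ≤ 1) (hc : 0 < c) :
    ∃ C, 0 ≤ C ∧ ∀ q : ℝ, |q| ≤ Q →
      CkHolderOn γ C (annulus n c R) 1 (fun y => (‖y‖ ^ 2) ^ q) := by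
  obtain ⟨C₁, h1, H1⟩ := holderBdd_rpow_normSq (n := n) (R := R) (Q := Q) hγ hγ1 hc
  obtain ⟨C₂, h2, H2⟩ := holderBdd_rpow_normSq (n := n) (R := R) (Q := Q + 1) hγ hγ1 hc
  rcases lt_or_ge Q 0 with hQ | hQ
  · exact ⟨0, le_rfl, fun q hq => absurd (hq.trans_lt hQ) (not_lt.2 (abs_nonneg q))⟩
  rcases lt_or_ge R 0 with hR | hR
  · have hA : annulus n c R = ∅ := by
      ext y; exact ⟨fun hy => absurd (hy.2.trans hR) (not_lt.2 (norm_nonneg y)), fun h => h.elim⟩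
    rw [hA]
    refine ⟨0, le_rfl, fun q _ => ⟨⟨?_, ?_⟩, ?_, ?_, ?_⟩⟩ <;> exact fun x hx => hx.elim
  have H3 : HolderBdd γ (2 * (3 * R + 1)) (annulus n c R)
      (fun y : RSpace n => (2 : ℝ) • innerSL ℝ y) := by
    refine (HolderBdd.of_lipschitz (C := 2 * R) (L := 2) hγ hγ1 (by positivity) (by positivity)
      (fun y hy => ?_) fun x hx y hy => ?_).mono (by linarith)
    · rw [norm_smul, innerSL_apply_norm, Real.norm_of_nonneg (by norm_num)]
      linarith [hy.2]
    · rw [← smul_sub, ← map_sub, norm_smul, innerSL_apply_norm, dist_eq_norm,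
        Real.norm_of_nonneg (by norm_num)]
  refine ⟨max C₁ (2 * (Q * C₂ * (2 * (3 * R + 1)))), by positivity, fun q hq =>
    ⟨(H1 q hq).mono (le_max_left _ _), fun y hy => ?_, HolderBdd.mono (f := fderiv ℝ _) ?_ (le_max_right _ _)⟩⟩
  · have hy0 : ‖y‖ ^ 2 ≠ 0 := by have := hc.trans hy.1; positivity
    exact ((hasStrictFDerivAt_norm_sq y).hasFDerivAt.rpow_const (p := q)
      (Or.inl hy0)).differentiableAt
  · have hq2 := H2 (q - 1) ((abs_sub _ _).trans (by rw [abs_one]; linarith))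
    have h4 : HolderBdd γ (Q * C₂) (annulus n c R) (fun y => q * (‖y‖ ^ 2) ^ (q - 1)) := by
      refine ⟨fun x hx => ?_, fun x hx y hy => ?_⟩
      · rw [norm_mul]
        exact mul_le_mul hq (hq2.1 x hx) (norm_nonneg _) hQ
      · rw [← mul_sub, norm_mul, mul_assoc]
        exact mul_le_mul hq (hq2.2 x hx y hy) (norm_nonneg _) hQ
    refine (HolderBdd.smul (by positivity) (by positivity) h4 H3).congr fun y hy => ?_
    have hy0 : ‖y‖ ^ 2 ≠ 0 := by have := hc.trans hy.1; positivity
    rw [((hasStrictFDerivAt_norm_sq y).hasFDerivAt.rpow_const (p := q) (Or.inl hy0)).fderiv]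
    rw [two_smul, two_smul]

theorem dist_toSphere_le {c : ℝ} (hc : 0 < c) {x y : RSpace n} (hx : c ≤ ‖x‖) (hy : c ≤ ‖y‖)
    (hx0 : x ≠ 0) (hy0 : y ≠ 0) :
    dist (toSphere x hx0) (toSphere y hy0) ≤ 2 / c * dist x y := by
  have hx' : 0 < ‖x‖ := norm_pos_iff.2 hx0
  have hy' : 0 < ‖y‖ := norm_pos_iff.2 hy0
  rw [Subtype.dist_eq, dist_eq_norm, dist_eq_norm]
  simp only [toSphere]
  have e : ‖x‖⁻¹ • x - ‖y‖⁻¹ • y = ‖x‖⁻¹ • ((x - y) + ((‖y‖ - ‖x‖) * ‖y‖⁻¹) • y) := by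
    rw [smul_add, smul_sub, smul_smul, sub_add, ← sub_smul]
    congr 2
    field_simp
    ring
  rw [e, norm_smul, norm_inv, norm_norm]
  have h1 : ‖((‖y‖ - ‖x‖) * ‖y‖⁻¹) • y‖ ≤ ‖x - y‖ := by
    rw [norm_smul, norm_mul, norm_inv, norm_norm, mul_assoc, inv_mul_cancel₀ hy'.ne', mul_one,
      norm_sub_rev]
    exact abs_norm_sub_norm_le x y
  calc _ ≤ c⁻¹ * (‖x - y‖ + ‖x - y‖) := by
        gcongr
        exact (norm_add_le _ _).trans (by gcongr)
    _ = _ := by ring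

/-- An annulus is not convex, so the mean value inequality is applied on balls of radius `c/2`,
which avoid the origin, and distant points are handled by `HolderBdd.of_local`. The gradient is its
value on the sphere divided by `‖y‖`. -/
theorem ckHolderOn_radialExt {c R : ℝ} (hγ1 : γ ≤ 1) (hc : 0 < c) :
    ∃ C, 0 ≤ C ∧ ∀ μ : sphere (0 : RSpace n) 1 → ℝ, IsC1Sphere μ → sphereC1HolderNorm γ μ ≤ M →
      CkHolderOn γ C (annulus n c R) 1 (radialExt μ) := by
  have hγ0 : (0 : ℝ) ≤ γ := γ.2
  have hγ1' : (γ : ℝ) ≤ 1 := by exact_mod_cast hγ1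
  have hne : ∀ y : RSpace n, c / 2 < ‖y‖ → y ≠ 0 := fun y hy h => by
    rw [h, norm_zero] at hy; linarith
  have Hinv : HolderBdd γ (3 * c⁻¹ + c⁻¹ * c⁻¹) (annulus n c R) (fun y => ‖y‖⁻¹) := by
    refine HolderBdd.of_lipschitz hγ0 hγ1' (by positivity) (by positivity) (fun y hy => ?_)
      fun x hx y hy => ?_
    · rw [norm_inv, norm_norm]
      exact inv_anti₀ hc hy.1.le
    · have hx' := hc.trans hx.1
      have hy' := hc.trans hy.1
      rw [inv_sub_inv hx'.ne' hy'.ne', norm_div, norm_mul, norm_norm, norm_norm, div_eq_inv_mul,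
        mul_inv, norm_sub_rev]
      gcongr
      · exact hx.1.le
      · exact hy.1.le
      · exact (abs_norm_sub_norm_le x y).trans (dist_eq_norm x y).ge
  refine ⟨max (M + (3 * (2 * M) + 2 * M / c) + 2 * M / min 1 (c / 2) ^ (γ : ℝ))
    (2 * ((3 * c⁻¹ + c⁻¹ * c⁻¹) * (M * (1 + (2 / c) ^ (γ : ℝ))))), ?_, fun μ hμ hM => ?_⟩
  · exact le_max_of_le_right (by positivity)
  · obtain ⟨b0, b1, b2⟩ := sphere_bounds_of_sphereC1HolderNorm_le hM
    have hfd : ∀ y : RSpace n, c / 2 < ‖y‖ → ‖fderiv ℝ (radialExt μ) y‖ ≤ 2 * M / c := by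
      intro y hy
      rw [fderiv_radialExt y (hne y hy), norm_smul, norm_inv, norm_norm]
      calc ‖y‖⁻¹ * _ ≤ (c / 2)⁻¹ * M := by gcongr; exact b1 _
        _ = _ := by field_simp
    have h0 : HolderBdd γ (M + (3 * (2 * M) + 2 * M / c) + 2 * M / min 1 (c / 2) ^ (γ : ℝ))
        (annulus n c R) (radialExt μ) := by
      refine HolderBdd.of_local hγ0 (NNReal.coe_nonneg M) (by positivity)
        (lt_min one_pos (by positivity)) (fun y _ => norm_radialExt_le b0 y) fun x hx y hy hxy => ?_
      have hxy' : dist x y < c / 2 := hxy.trans_le (min_le_right _ _)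
      have hball : ∀ z ∈ ball x (c / 2), c / 2 < ‖z‖ := fun z hz => by
        have := norm_sub_norm_le x z
        rw [mem_ball, dist_comm, dist_eq_norm] at hz
        linarith [hx.1]
      have h1 := (convex_ball x (c / 2)).norm_image_sub_le_of_norm_fderiv_le (𝕜 := ℝ)
        (f := radialExt μ) (C := 2 * M / c)
        (fun z hz => differentiableAt_radialExt hμ (hne z (hball z hz)))
        (fun z hz => hfd z (hball z hz)) (x := y) (y := x)
        (by rwa [mem_ball, dist_comm]) (mem_ball_self (by positivity))
      have hd1 : dist x y ≤ dist x y ^ (γ : ℝ) := by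
        have hd : dist x y ≤ 1 := (hxy.trans_le (min_le_left _ _)).le
        rcases eq_or_lt_of_le (dist_nonneg (x := x) (y := y)) with h | h
        · rw [← h]; positivity
        · simpa using Real.rpow_le_rpow_of_exponent_ge h hd hγ1'
      rw [← dist_eq_norm x y] at h1
      refine h1.trans ?_
      gcongr
      have : (0 : ℝ) ≤ 3 * (2 * M) := by positivity
      linarith
    have h1 : HolderBdd γ (M * (1 + (2 / c) ^ (γ : ℝ))) (annulus n c R)
        (fun y => fderiv ℝ (radialExt μ) (‖y‖⁻¹ • y)) := by
      have hcomp := HolderBdd.comp_lipschitz (X' := annulus n c R) (A' := univ)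
        (f := fun θ : sphere (0 : RSpace n) 1 => fderiv ℝ (radialExt μ) (θ : RSpace n))
        (γ := γ) (C := M) (L := 2 / c) (A := univ)
        (ψ := fun y => toSphere y.1 (hne _ (by linarith [y.2.1]))) hγ0 (by positivity) M.2
        ⟨fun θ _ => b1 θ, fun θ _ θ' _ => b2 θ θ'⟩ (mapsTo_univ _ _)
        (fun x _ y _ => dist_toSphere_le hc x.2.1.le y.2.1.le _ _)
      exact ⟨fun x hx => hcomp.1 ⟨x, hx⟩ trivial,
        fun x hx y hy => hcomp.2 ⟨x, hx⟩ trivial ⟨y, hy⟩ trivial⟩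
    have h2 := (HolderBdd.smul (by positivity) (by positivity) Hinv h1).congr
      (g := fderiv ℝ (radialExt μ))
      fun y hy => fderiv_radialExt y (hne y (by linarith [hy.1]))
    exact ⟨h0.mono (le_max_left _ _), fun y hy => differentiableAt_radialExt hμ
      (hne y (by linarith [hy.1])), HolderBdd.mono h2 (le_max_right _ _)⟩

/-- The even part of `y ↦ μ (y / |y|) / |y| ^ (n + 2 s)`. -/
noncomputable def evenKernel (s : ℝ) (μ : sphere (0 : RSpace n) 1 → ℝ) (y : RSpace n) : ℝ :=
  (radialExt μ y + radialExt μ (-y)) / 2 * (‖y‖ ^ 2) ^ (-((n : ℝ) / 2 + s))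

theorem evenKernel_neg (s : ℝ) (y : RSpace n) : evenKernel s μ (-y) = evenKernel s μ y := by
  unfold evenKernel; rw [neg_neg, norm_neg, add_comm]

theorem normSq_rpow (s : ℝ) (y : RSpace n) :
    (‖y‖ ^ 2) ^ (-((n : ℝ) / 2 + s)) = (‖y‖ ^ ((n : ℝ) + 2 * s))⁻¹ := by
  rw [← Real.rpow_natCast, ← Real.rpow_mul (norm_nonneg y), ← Real.rpow_neg (norm_nonneg y)]
  congr 1
  push_cast
  ring

theorem evenKernel_eq (s : ℝ) (y : RSpace n) :
    evenKernel s μ y = ((radialExt μ y / ‖y‖ ^ ((n : ℝ) + 2 * s)) +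
      (radialExt μ (-y) / ‖-y‖ ^ ((n : ℝ) + 2 * s))) / 2 := by
  unfold evenKernel
  rw [normSq_rpow, norm_neg]
  ring

theorem evenKernel_smul {s c : ℝ} (hc : 0 < c) (y : RSpace n) :
    evenKernel s μ (c • y) = c ^ (-((n : ℝ) + 2 * s)) * evenKernel s μ y := by
  unfold evenKernel
  rw [← smul_neg, radialExt_smul hc, radialExt_smul hc, normSq_rpow, normSq_rpow, norm_smul,
    Real.norm_of_nonneg hc.le, Real.mul_rpow hc.le (norm_nonneg _), Real.rpow_neg hc.le, mul_inv]
  ring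

theorem abs_evenKernel_le (h : ∀ θ, ‖μ θ‖ ≤ M) (s : ℝ) (y : RSpace n) :
    |evenKernel s μ y| ≤ M * (‖y‖ ^ ((n : ℝ) + 2 * s))⁻¹ := by
  unfold evenKernel
  rw [normSq_rpow, abs_mul, abs_of_nonneg (a := (_)⁻¹) (by positivity)]
  gcongr
  have h1 := norm_radialExt_le h y
  have h2 := norm_radialExt_le h (-y)
  rw [Real.norm_eq_abs] at h1 h2
  rw [abs_div, abs_two, div_le_iff₀ two_pos]
  exact (abs_add_le _ _).trans (by linarith)

theorem ckHolderOn_evenKernel {c R : ℝ} (hγ1 : γ ≤ 1) (hc : 0 < c) :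
    ∃ C, 0 ≤ C ∧ ∀ s : ℝ, 0 < s → s < 1 → ∀ μ : sphere (0 : RSpace n) 1 → ℝ,
      IsC1Sphere μ → sphereC1HolderNorm γ μ ≤ M →
      CkHolderOn γ C (annulus n c R) 1 (evenKernel s μ) := by
  have hγ0 : (0 : ℝ) ≤ γ := γ.2
  have hγ1' : (γ : ℝ) ≤ 1 := by exact_mod_cast hγ1
  obtain ⟨C₁, h1, H1⟩ := ckHolderOn_radialExt (n := n) (R := R) (M := M) hγ1 hc
  obtain ⟨C₂, h2, H2⟩ := CkHolderOn.comp (k := 0) (γ := γ) (A := annulus n c R)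
    (A' := annulus n c R) hγ0 isOpen_annulus (F := ℝ) C₁
    ‖-ContinuousLinearMap.id ℝ (RSpace n)‖ 1 zero_le_one
  obtain ⟨C₃, h3, H3⟩ := ckHolderOn_rpow_normSq (n := n) (R := R) (Q := n / 2 + 1) hγ0 hγ1' hc
  obtain ⟨C₄, h4, H4⟩ := CkHolderOn.clm (k := 1) (γ := γ) (A := annulus n c R) isOpen_annulus
    ((1 / 2 : ℝ) • ContinuousLinearMap.id ℝ ℝ) (C₁ + C₂)
  obtain ⟨C₅, h5, H5⟩ := CkHolderOn.bilin (k := 1) (γ := γ) (A := annulus n c R) isOpen_annulus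
    (ContinuousLinearMap.mul ℝ ℝ) C₄ C₃
  refine ⟨C₅, h5, fun s hs hs1 μ hμ hM => ?_⟩
  have a1 := H1 μ hμ hM
  have hdn : fderiv ℝ (fun y : RSpace n => -y) = fun _ => -ContinuousLinearMap.id ℝ (RSpace n) := by
    ext1 y; exact (hasFDerivAt_id y).neg.fderiv
  have a2 := H2 (radialExt μ) (fun y => -y) a1 (fun y hy => by
    simpa [annulus] using hy) (fun x _ y _ => by rw [dist_neg_neg, one_mul])
    (fun y _ => differentiableAt_id.neg) (by rw [hdn]; exact CkHolderOn.const _ le_rfl)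
  have a3 := H3 (-((n : ℝ) / 2 + s)) (by rw [abs_neg, abs_of_nonneg (by positivity)]; linarith)
  have a4 := H4 _ (a1.add isOpen_annulus a2)
  have a5 := H5 _ _ a4 a3
  refine a5.congr isOpen_annulus fun y _ => ?_
  simp only [evenKernel, ContinuousLinearMap.mul_apply', smul_apply,
    ContinuousLinearMap.id_apply, smul_eq_mul]
  ring

end Kernel


/-! ### Polar coordinates and the weight on `ℝⁿ` -/

section Polar

variable {n : ℕ}

theorem nontrivial_rspace (hn : 1 ≤ n) : Nontrivial (RSpace n) := by
  have : Nonempty (Fin n) := ⟨⟨0, hn⟩⟩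
  infer_instance

theorem homeomorphUnitSphereProd_symm_polar (f : RSpace n → ℝ) (x : ({(0)}ᶜ : Set (RSpace n))) :
    (fun p : sphere (0 : RSpace n) 1 × Ioi (0 : ℝ) => f (p.2.1 • p.1.1))
      (homeomorphUnitSphereProd (RSpace n) x) = f x := by
  have hx : ‖(x : RSpace n)‖ ≠ 0 := norm_ne_zero_iff.2 x.2
  simp [smul_smul, mul_inv_cancel₀ hx]

/-- Integration in polar coordinates. -/
theorem integral_polar (hn : 1 ≤ n) {f : RSpace n → ℝ} (hf : Integrable f) :
    Integrable (fun θ : sphere (0 : RSpace n) 1 => ∫ r in Ioi (0 : ℝ), r ^ (n - 1) * f (r • θ.1))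
      (volume : Measure (RSpace n)).toSphere ∧
    ∫ x, f x = ∫ θ : sphere (0 : RSpace n) 1, (∫ r in Ioi (0 : ℝ), r ^ (n - 1) * f (r • θ.1))
      ∂(volume : Measure (RSpace n)).toSphere := by
  have := nontrivial_rspace hn
  have hdim : Module.finrank ℝ (RSpace n) = n := finrank_euclideanSpace_fin
  have MP := (volume : Measure (RSpace n)).measurePreserving_homeomorphUnitSphereProd
  have ME := (homeomorphUnitSphereProd (RSpace n)).measurableEmbedding
  set g : sphere (0 : RSpace n) 1 × Ioi (0 : ℝ) → ℝ := fun p => f (p.2.1 • p.1.1) with hg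
  have hgi : Integrable g ((volume : Measure (RSpace n)).toSphere.prod
      (.volumeIoiPow (Module.finrank ℝ (RSpace n) - 1))) := by
    rw [← MP.integrable_comp_emb ME]
    have h1 : (g ∘ homeomorphUnitSphereProd (RSpace n)) = f ∘ Subtype.val := by
      ext x; exact homeomorphUnitSphereProd_symm_polar f x
    rw [h1, ← integrableOn_iff_comap_subtypeVal (measurableSet_singleton _).compl, IntegrableOn,
      restrict_compl_singleton]
    exact hf
  have hinner : ∀ θ : sphere (0 : RSpace n) 1,
      ∫ r : Ioi (0 : ℝ), f (r.1 • θ.1) ∂(.volumeIoiPow (Module.finrank ℝ (RSpace n) - 1)) =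
      ∫ r in Ioi (0 : ℝ), r ^ (n - 1) * f (r • θ.1) := by
    intro θ
    simp only [Measure.volumeIoiPow, ENNReal.ofReal]
    rw [integral_withDensity_eq_integral_smul,
      integral_subtype_comap measurableSet_Ioi
        fun a ↦ Real.toNNReal (a ^ (Module.finrank ℝ (RSpace n) - 1)) • f (a • θ.1),
      setIntegral_congr_fun measurableSet_Ioi fun x hx ↦ ?_]
    · rw [NNReal.smul_def, Real.coe_toNNReal _ (pow_nonneg hx.out.le _), hdim, smul_eq_mul]
    · exact (measurable_subtype_coe.pow_const _).real_toNNReal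
  refine ⟨?_, ?_⟩
  · have := hgi.integral_prod_left
    refine this.congr (Filter.Eventually.of_forall fun θ => ?_)
    exact hinner θ
  · calc ∫ x, f x = ∫ x : ↥({(0)}ᶜ : Set (RSpace n)), f x.1 ∂(volume.comap Subtype.val) := by
          rw [integral_subtype_comap (measurableSet_singleton _).compl f,
            restrict_compl_singleton]
      _ = ∫ p, g p ∂((volume : Measure (RSpace n)).toSphere.prod
            (.volumeIoiPow (Module.finrank ℝ (RSpace n) - 1))) := by
          rw [← MP.integral_comp ME]
          congr 1
          ext x
          exact (homeomorphUnitSphereProd_symm_polar f x).symm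
      _ = _ := by
          rw [integral_prod _ hgi]
          congr 1
          ext θ
          exact hinner θ

/-- The weight on `ℝⁿ` whose radial density is `radialWeight`. -/
noncomputable def ballWeight (n : ℕ) (s : ℝ) (Z : RSpace n) : ℝ :=
  radialWeight s ‖Z‖ * (‖Z‖ ^ (n - 1))⁻¹

theorem ballWeight_nonneg {s : ℝ} (Z : RSpace n) : 0 ≤ ballWeight n s Z := by
  unfold ballWeight
  have := radialWeight_nonneg (s := s) (norm_nonneg Z)
  positivity

theorem integrable_ballWeight (hn : 1 ≤ n) {s : ℝ} (hs : 0 < s) (hs1 : s < 1) :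
    Integrable (ballWeight n s) := by
  have := nontrivial_rspace hn
  have := (integrable_fun_norm_addHaar (volume : Measure (RSpace n))
    (f := fun r => radialWeight s r * (r ^ (n - 1))⁻¹)).2 (by
      rw [finrank_euclideanSpace_fin]
      refine (integrableOn_radialWeight hs hs1).congr_fun (fun r hr => ?_) measurableSet_Ioi
      have : r ^ (n - 1) ≠ 0 := pow_ne_zero _ (ne_of_gt hr)
      simp only [smul_eq_mul]
      field_simp)
  exact this

/-- The surface measure of the unit sphere. -/
noncomputable def sphereArea (n : ℕ) : ℝ := n * (volume : Measure (RSpace n)).real (ball 0 1)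

theorem sphereArea_nonneg : 0 ≤ sphereArea n := by unfold sphereArea; positivity

theorem integral_ballWeight_le (hn : 1 ≤ n) {s s₀ : ℝ} (hs₀ : 0 < s₀) (hs : s₀ ≤ s) (hs1 : s < 1) :
    (1 - s) * ∫ Z, ballWeight n s Z ≤ sphereArea n * (1 + 1 / s₀) := by
  have := nontrivial_rspace hn
  have := integral_fun_norm_addHaar (volume : Measure (RSpace n))
    (fun r => radialWeight s r * (r ^ (n - 1))⁻¹)
  have e : ∫ y in Ioi (0 : ℝ), y ^ (n - 1) • (radialWeight s y * (y ^ (n - 1))⁻¹) =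
      ∫ y in Ioi (0 : ℝ), radialWeight s y := by
    refine setIntegral_congr_fun measurableSet_Ioi fun r hr => ?_
    have : r ^ (n - 1) ≠ 0 := pow_ne_zero _ (ne_of_gt hr)
    simp only [smul_eq_mul]
    field_simp
  rw [finrank_euclideanSpace_fin, e] at this
  unfold ballWeight
  rw [this, nsmul_eq_mul, smul_eq_mul]
  calc _ = sphereArea n * ((1 - s) * ∫ y in Ioi (0 : ℝ), radialWeight s y) := by
        unfold sphereArea; ring
    _ ≤ _ := by
        gcongr
        · exact sphereArea_nonneg
        · exact one_sub_mul_integral_radialWeight_le hs₀ hs hs1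

theorem norm_rpow_inv_eq (hn : 1 ≤ n) {s r : ℝ} (hr : 0 < r) :
    (r ^ ((n : ℝ) + 2 * s))⁻¹ = r ^ (-1 - 2 * s) * (r ^ (n - 1))⁻¹ := by
  rw [← Real.rpow_natCast, ← Real.rpow_neg hr.le, ← Real.rpow_neg hr.le, ← Real.rpow_add hr]
  congr 1
  push_cast [hn]
  ring

/-- The standard way to dominate `x |y|^(-n-2s)`: the bound `x ≤ |y|²` serves near the origin and `x
≤ |y|^s` serves at infinity. -/
theorem mul_inv_le_ballWeight (hn : 1 ≤ n) {s x : ℝ} (hs1 : s ≤ 1) {y : RSpace n} (hy : y ≠ 0)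
    (h2 : x ≤ ‖y‖ ^ 2) (hxs : x ≤ ‖y‖ ^ s) :
    x * (‖y‖ ^ ((n : ℝ) + 2 * s))⁻¹ ≤ ballWeight n s y := by
  have hr := norm_pos_iff.2 hy
  rw [norm_rpow_inv_eq hn hr, ← mul_assoc]
  unfold ballWeight
  gcongr
  exact mul_rpow_le_radialWeight hs1 hr h2 hxs

theorem min_sq_one_le_rpow {r s : ℝ} (hr : 0 < r) (hs : 0 ≤ s) (hs1 : s ≤ 1) :
    min (r ^ 2) 1 ≤ r ^ s := by
  rcases le_total r 1 with h | h
  · refine (min_le_left _ _).trans ?_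
    rw [← Real.rpow_natCast]
    exact Real.rpow_le_rpow_of_exponent_ge hr h (by push_cast; linarith)
  · exact (min_le_right _ _).trans (Real.one_le_rpow h hs)

end Polar

/-! ### The operator on `C^{2,γ}` functions -/

section StableOp

variable {n : ℕ} {γ M : ℝ≥0} {μ : sphere (0 : RSpace n) 1 → ℝ} {s s₀ : ℝ} {u : RSpace n → ℝ}

/-- The symmetric second difference `(u(x+y) + u(x-y)) / 2 - u(x)`. -/
noncomputable def secondDiff (u : RSpace n → ℝ) (x y : RSpace n) : ℝ :=
  (u (x + y) + u (x - y)) / 2 - u x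

theorem ae_ne_zero (hn : 1 ≤ n) : ∀ᵐ y : RSpace n, y ≠ 0 := by
  have := nontrivial_rspace hn
  exact Measure.ae_ne volume 0

theorem aestronglyMeasurable_radialExt (hn : 1 ≤ n) (h : IsC1Sphere μ) :
    AEStronglyMeasurable (radialExt μ) := by
  have := nontrivial_rspace hn
  have := h.continuousOn.aestronglyMeasurable (μ := volume)
    (measurableSet_singleton (0 : RSpace n)).compl
  rwa [restrict_compl_singleton] at this

theorem aestronglyMeasurable_kernel (hn : 1 ≤ n) (h : IsC1Sphere μ) :
    AEStronglyMeasurable (fun y : RSpace n => radialExt μ y / ‖y‖ ^ ((n : ℝ) + 2 * s)) := by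
  have h2 : Measurable fun y : RSpace n => ‖y‖ ^ ((n : ℝ) + 2 * s) :=
    measurable_norm.pow_const _
  exact (aestronglyMeasurable_radialExt hn h).div₀ h2.aestronglyMeasurable

theorem integrable_comp_neg {f : RSpace n → ℝ} (h : Integrable f) : Integrable fun y => f (-y) :=
  h.comp_neg

theorem measurable_secondDiff (hu : Measurable u) (x : RSpace n) : Measurable (secondDiff u x) := by
  unfold secondDiff
  have h1 := hu.comp (measurable_const_add x)
  have h2 := hu.comp (measurable_const_sub x)
  exact ((h1.add h2).div_const 2).sub_const _

theorem secondDiff_neg (x y : RSpace n) : secondDiff u x (-y) = secondDiff u x y := by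
  unfold secondDiff
  rw [sub_neg_eq_add, ← sub_eq_add_neg, add_comm (u (x - y))]

theorem integrable_stableIntegrand (hn : 1 ≤ n) (hs : 0 < s) (hs1 : s < 1) (hμ : IsC1Sphere μ)
    (hb : ∀ θ, ‖μ θ‖ ≤ M) (hu : Measurable u) {x : RSpace n} {D : ℝ} (hD : 0 ≤ D)
    (h : ∀ y, |secondDiff u x y| ≤ D * min (‖y‖ ^ 2) 1) : Integrable (stableIntegrand s μ u x) := by
  refine Integrable.mono' ((integrable_ballWeight hn hs hs1).const_mul (D * M)) ?_ ?_
  · exact (measurable_secondDiff hu x).aestronglyMeasurable.mul (aestronglyMeasurable_kernel hn hμ)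
  · filter_upwards [ae_ne_zero hn] with y hy
    have hr := norm_pos_iff.2 hy
    unfold stableIntegrand
    rw [norm_mul, norm_div, Real.norm_of_nonneg (r := ‖y‖ ^ _) (by positivity), div_eq_mul_inv ‖radialExt μ y‖,
      Real.norm_eq_abs]
    calc _ ≤ (D * min (‖y‖ ^ 2) 1) * (M * (‖y‖ ^ ((n : ℝ) + 2 * s))⁻¹) := by
          gcongr
          · exact h y
          · exact norm_radialExt_le hb y
      _ = D * M * (min (‖y‖ ^ 2) 1 * (‖y‖ ^ ((n : ℝ) + 2 * s))⁻¹) := by ring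
      _ ≤ _ := by
        gcongr
        exact mul_inv_le_ballWeight hn hs1.le hy (min_le_left _ _)
          (min_sq_one_le_rpow hr hs.le hs1.le)

/-- The second difference is even in `y`, so only the even part of the kernel acts. Arguments that
rely on an even kernel thereby apply to every `μ`. -/
theorem integral_stableIntegrand (hi : Integrable (stableIntegrand s μ u x)) :
    Integrable (fun y => secondDiff u x y * evenKernel s μ y) ∧
    stableOp s μ u x = (1 - s) * ∫ y, secondDiff u x y * evenKernel s μ y := by
  have hi2 := integrable_comp_neg hi
  have e : (fun y => secondDiff u x y * evenKernel s μ y) =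
      fun y => (stableIntegrand s μ u x y + stableIntegrand s μ u x (-y)) / 2 := by
    ext y
    have h1 : ∀ y, stableIntegrand s μ u x y =
      secondDiff u x y * (radialExt μ y / ‖y‖ ^ ((n : ℝ) + 2 * s)) := fun y => rfl
    rw [h1, h1, secondDiff_neg, evenKernel_eq]
    ring
  rw [e]
  refine ⟨(hi.add hi2).div_const 2, ?_⟩
  unfold stableOp
  rw [integral_div, integral_add hi hi2, integral_neg_eq_self]
  ring

/-- The first-order terms `±Df(x) y` cancel. The gradient is compared only with its value at the
centre, so the same lemma serves global and pointwise bounds. -/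
theorem norm_secondDiff_le_of_fderiv {f : RSpace n → ℝ} {C : ℝ} {x y : RSpace n}
    (hd : ∀ z ∈ closedBall x ‖y‖, DifferentiableAt ℝ f z)
    (hl : ∀ z ∈ closedBall x ‖y‖, ‖fderiv ℝ f z - fderiv ℝ f x‖ ≤ C * ‖z - x‖) (hC : 0 ≤ C) :
    |secondDiff f x y| ≤ C * ‖y‖ ^ 2 := by
  have key : ∀ w : RSpace n, ‖w‖ = ‖y‖ → ‖f (x + w) - f x - fderiv ℝ f x w‖ ≤ C * ‖y‖ * ‖y‖ := by
    intro w hw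
    have h := (convex_closedBall x ‖y‖).norm_image_sub_le_of_norm_fderiv_le' (𝕜 := ℝ) (f := f)
      (φ := fderiv ℝ f x) (C := C * ‖y‖) hd (fun z hz => (hl z hz).trans (by
        gcongr; rw [← dist_eq_norm]; exact hz)) (x := x) (y := x + w)
      (mem_closedBall_self (norm_nonneg y)) (by simp [mem_closedBall, dist_eq_norm, hw])
    rwa [add_sub_cancel_left, hw] at h
  have h1 := key y rfl
  have h2 := key (-y) (norm_neg y)
  rw [map_neg, Real.norm_eq_abs] at h2
  rw [Real.norm_eq_abs] at h1
  unfold secondDiff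
  rw [abs_le] at *
  rw [← sub_eq_add_neg] at h2
  constructor <;> nlinarith [h1.1, h1.2, h2.1, h2.2]

/-- For the difference between `x` and `z`, apply the second-order estimate at `0` to `w ↦ f(x + w)
- f(z + w)`, whose Hessian is bounded by `C |x - z|^γ`. -/
theorem secondDiff_bounds_of_ckHolderOn {γ C : ℝ} {f : RSpace n → ℝ} (hC : 0 ≤ C)
    (h : CkHolderOn γ C univ 2 f) (x z y : RSpace n) :
    |secondDiff f x y| ≤ 2 * C * min (‖y‖ ^ 2) 1 ∧
    |secondDiff f x y - secondDiff f z y| ≤ 2 * C * dist x z ^ γ * min (‖y‖ ^ 2) 1 := by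
  have hb := fun x => h.1.1 x trivial
  have hd : Differentiable ℝ f := fun x => h.2.1 x trivial
  have hd2 : Differentiable ℝ (fderiv ℝ f) := fun x => h.2.2.2.1 x trivial
  have hb2 : ∀ x, ‖fderiv ℝ (fderiv ℝ f) x‖ ≤ C := fun x => h.2.2.2.2.1 x trivial
  have hl : ∀ x z, ‖fderiv ℝ f z - fderiv ℝ f x‖ ≤ C * ‖z - x‖ := fun x z =>
    (convex_univ).norm_image_sub_le_of_norm_fderiv_le (𝕜 := ℝ) (fun w _ => hd2 w)
      (fun w _ => hb2 w) trivial trivial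
  have hdz : 0 ≤ dist x z ^ γ := by positivity
  constructor
  · rw [mul_min_of_nonneg _ _ (by positivity)]
    refine le_min ?_ ?_
    · refine (norm_secondDiff_le_of_fderiv (fun z _ => hd z) (fun z _ => hl x z) hC).trans ?_
      have : 0 ≤ C * ‖y‖ ^ 2 := by positivity
      nlinarith
    · unfold secondDiff
      have h1 := abs_le.1 (hb (x + y))
      have h2 := abs_le.1 (hb (x - y))
      have h3 := abs_le.1 (hb x)
      rw [abs_le]
      constructor <;> linarith [h1.1, h1.2, h2.1, h2.2, h3.1, h3.2]
  · rw [mul_min_of_nonneg _ _ (by positivity)]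
    refine le_min ?_ ?_
    · set g : RSpace n → ℝ := fun w => f (x + w) - f (z + w) with hg
      have hsame : secondDiff f x y - secondDiff f z y = secondDiff g 0 y := by
        simp only [secondDiff, hg, zero_add, add_zero, zero_sub, ← sub_eq_add_neg]
        ring
      have hgd : ∀ w, HasFDerivAt g (fderiv ℝ f (x + w) - fderiv ℝ f (z + w)) w := fun w => by
        have p : ∀ a : RSpace n, HasFDerivAt (fun w => f (a + w)) (fderiv ℝ f (a + w)) w :=
          fun a => by
            have := (hd (a + w)).hasFDerivAt.comp w ((hasFDerivAt_id w).const_add a)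
            rw [ContinuousLinearMap.comp_id] at this
            exact this
        exact (p x).sub (p z)
      have hgd2 : ∀ w, HasFDerivAt (fun w => fderiv ℝ f (x + w) - fderiv ℝ f (z + w))
          (fderiv ℝ (fderiv ℝ f) (x + w) - fderiv ℝ (fderiv ℝ f) (z + w)) w := fun w => by
        have p : ∀ a : RSpace n, HasFDerivAt (fun w => fderiv ℝ f (a + w))
            (fderiv ℝ (fderiv ℝ f) (a + w)) w := fun a => by
            have := (hd2 (a + w)).hasFDerivAt.comp w ((hasFDerivAt_id w).const_add a)
            rw [ContinuousLinearMap.comp_id] at this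
            exact this
        exact (p x).sub (p z)
      have hgl : ∀ w, ‖fderiv ℝ g w - fderiv ℝ g 0‖ ≤ C * dist x z ^ γ * ‖w - 0‖ := by
        intro w
        rw [(hgd w).fderiv, (hgd 0).fderiv]
        refine (convex_univ).norm_image_sub_le_of_norm_hasFDerivWithin_le (𝕜 := ℝ)
          (f := fun w => fderiv ℝ f (x + w) - fderiv ℝ f (z + w))
          (fun w _ => (hgd2 w).hasFDerivWithinAt) (fun w _ => ?_) trivial trivial
        have := h.2.2.2.2.2 (x + w) trivial (z + w) trivial
        rwa [dist_add_right] at this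
      rw [hsame]
      refine (norm_secondDiff_le_of_fderiv (fun w _ => (hgd w).differentiableAt)
        (fun w _ => hgl w) (by positivity)).trans ?_
      have : 0 ≤ C * dist x z ^ γ * ‖y‖ ^ 2 := by positivity
      nlinarith
    · unfold secondDiff
      have h1 := h.1.2 (x + y) trivial (z + y) trivial
      have h2 := h.1.2 (x - y) trivial (z - y) trivial
      have h3 := h.1.2 x trivial z trivial
      rw [dist_add_right, Real.norm_eq_abs, abs_le] at h1
      rw [dist_sub_right, Real.norm_eq_abs, abs_le] at h2
      rw [Real.norm_eq_abs, abs_le] at h3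
      rw [abs_le]
      constructor <;> linarith [h1.1, h1.2, h2.1, h2.2, h3.1, h3.2]

/-- A qualitative bound whose constant may degenerate with `x`. It gives absolute convergence at
each point of `Ω`, where `d^s ζ` is `C²` without uniform control. -/
theorem exists_secondDiff_le_of_contDiffAt {x : RSpace n} {B : ℝ} (hB : ∀ y, |u y| ≤ B)
    (h : ContDiffAt ℝ 2 u x) :
    ∃ D, 0 ≤ D ∧ ∀ y, |secondDiff u x y| ≤ D * min (‖y‖ ^ 2) 1 := by
  have hB0 : 0 ≤ B := (abs_nonneg _).trans (hB x)
  have h1 : ContDiffAt ℝ 1 (fderiv ℝ u) x := h.fderiv_right (by norm_num)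
  obtain ⟨L, t, ht, hL⟩ := h1.exists_lipschitzOnWith
  have hde : ∀ᶠ y in nhds x, DifferentiableAt ℝ u y :=
    (h.eventually (by simp)).mono fun y hy => hy.differentiableAt (by simp)
  obtain ⟨δ, hδ, hsub⟩ := Metric.nhds_basis_closedBall.mem_iff.1 (Filter.inter_mem ht hde)
  have hmin : 0 < min (δ ^ 2) 1 := by positivity
  refine ⟨L + 2 * B / min (δ ^ 2) 1, by positivity, fun y => ?_⟩
  have hp : 0 ≤ 2 * B / min (δ ^ 2) 1 := by positivity
  have hbd : |secondDiff u x y| ≤ 2 * B := by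
    unfold secondDiff
    have h1 := abs_le.1 (hB (x + y))
    have h2 := abs_le.1 (hB (x - y))
    have h3 := abs_le.1 (hB x)
    rw [abs_le]
    constructor <;> linarith [h1.1, h1.2, h2.1, h2.2, h3.1, h3.2]
  have hm0 : 0 ≤ min (‖y‖ ^ 2) 1 := by positivity
  by_cases hy : ‖y‖ ≤ δ ∧ ‖y‖ ≤ 1
  · have hcb : closedBall x ‖y‖ ⊆ closedBall x δ := closedBall_subset_closedBall hy.1
    have := norm_secondDiff_le_of_fderiv (f := u) (C := L) (x := x) (y := y)
      (fun z hz => (hsub (hcb hz)).2) (fun z hz => by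
        have := hL.dist_le_mul z (hsub (hcb hz)).1 x
          (hsub (mem_closedBall_self hδ.le)).1
        rwa [dist_eq_norm, dist_eq_norm] at this) L.2
    have hy2 : min (‖y‖ ^ 2) 1 = ‖y‖ ^ 2 := min_eq_left (pow_le_one₀ (norm_nonneg _) hy.2)
    rw [hy2] at hm0 ⊢
    nlinarith
  · have hmm : min (δ ^ 2) 1 ≤ min (‖y‖ ^ 2) 1 := by
      by_cases h3 : ‖y‖ ≤ δ
      · have h4 : 1 < ‖y‖ := not_le.1 fun h => hy ⟨h3, h⟩
        exact le_min ((min_le_right _ _).trans (one_le_pow₀ h4.le)) (min_le_right _ _)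
      · push Not at h3
        exact min_le_min_right _ (by gcongr)
    calc _ ≤ 2 * B := hbd
      _ = 2 * B / min (δ ^ 2) 1 * min (δ ^ 2) 1 := by field_simp
      _ ≤ 2 * B / min (δ ^ 2) 1 * min (‖y‖ ^ 2) 1 := by gcongr
      _ ≤ _ := by gcongr; linarith [L.2]

/-- The operator maps `C^{2,γ}` functions to `C^γ` functions. -/
theorem stableOp_bounds_of_ckHolderOn (hn : 1 ≤ n) (hs₀ : 0 < s₀) (hs : s₀ ≤ s) (hs1 : s < 1)
    (hμ : IsC1Sphere μ) (hb : ∀ θ, ‖μ θ‖ ≤ M) {γ C : ℝ} (hC : 0 ≤ C)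
    (h : CkHolderOn γ C univ 2 u) (hu : Measurable u) :
    (∀ x, Integrable (stableIntegrand s μ u x)) ∧
    HolderBdd γ (2 * C * M * (sphereArea n * (1 + 1 / s₀))) univ (stableOp s μ u) := by
  have hs' : 0 < s := hs₀.trans_le hs
  have h1s : 0 < 1 - s := by linarith
  have hsd := secondDiff_bounds_of_ckHolderOn hC h
  have hi : ∀ x, Integrable (stableIntegrand s μ u x) := fun x =>
    integrable_stableIntegrand hn hs' hs1 hμ hb hu (D := 2 * C) (by positivity) fun y => (hsd x x y).1
  have key : ∀ (F : RSpace n → ℝ) (D : ℝ), 0 ≤ D → (∀ y, |F y| ≤ D * min (‖y‖ ^ 2) 1) →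
      |(1 - s) * ∫ y, F y * evenKernel s μ y| ≤ D * M * (sphereArea n * (1 + 1 / s₀)) := by
    intro F D hD hF
    have : ‖∫ y, F y * evenKernel s μ y‖ ≤ ∫ y, D * M * ballWeight n s y := by
      refine norm_integral_le_of_norm_le ((integrable_ballWeight hn hs' hs1).const_mul _) ?_
      filter_upwards [ae_ne_zero hn] with y hy
      rw [norm_mul]
      calc _ ≤ (D * min (‖y‖ ^ 2) 1) * (M * (‖y‖ ^ ((n : ℝ) + 2 * s))⁻¹) := by
            gcongr
            · exact hF y
            · exact abs_evenKernel_le hb s y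
        _ = D * M * (min (‖y‖ ^ 2) 1 * (‖y‖ ^ ((n : ℝ) + 2 * s))⁻¹) := by ring
        _ ≤ _ := by
          gcongr
          exact mul_inv_le_ballWeight hn hs1.le hy (min_le_left _ _)
            (min_sq_one_le_rpow (norm_pos_iff.2 hy) hs'.le hs1.le)
    rw [integral_const_mul, Real.norm_eq_abs] at this
    rw [abs_mul, abs_of_pos h1s]
    calc _ ≤ (1 - s) * (D * M * ∫ y, ballWeight n s y) := by gcongr
      _ = D * M * ((1 - s) * ∫ y, ballWeight n s y) := by ring
      _ ≤ _ := mul_le_mul_of_nonneg_left (integral_ballWeight_le hn hs₀ hs hs1) (by positivity)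
  refine ⟨hi, fun x _ => ?_, fun x _ z _ => ?_⟩
  · rw [(integral_stableIntegrand (hi x)).2]
    exact key _ _ (by positivity) fun y => (hsd x x y).1
  · obtain ⟨i1, e1⟩ := integral_stableIntegrand (hi x)
    obtain ⟨i2, e2⟩ := integral_stableIntegrand (hi z)
    rw [e1, e2, ← mul_sub, ← integral_sub i1 i2]
    simp only [← sub_mul]
    refine (key _ (2 * C * dist x z ^ γ) (by positivity) fun y => (hsd x z y).2).trans (le_of_eq ?_)
    ring

end StableOp


/-! ### Straightening the level sets -/

theorem ckHolderOn_inv {γ c R : ℝ} (hγ : 0 ≤ γ) (hγ1 : γ ≤ 1) (hc : 0 < c) :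
    ∃ C, 0 ≤ C ∧ CkHolderOn γ C (Ioo c R) 1 (fun x : ℝ => x⁻¹) := by
  have hb : ∀ x ∈ Ioo c R, |x⁻¹| ≤ c⁻¹ := fun x hx => by
    rw [abs_of_pos (inv_pos.2 (hc.trans hx.1))]
    exact inv_anti₀ hc hx.1.le
  have hl : ∀ x ∈ Ioo c R, ∀ y ∈ Ioo c R, |x⁻¹ - y⁻¹| ≤ c⁻¹ * c⁻¹ * dist x y := fun x hx y hy => by
    have hx0 : x ≠ 0 := (hc.trans hx.1).ne'
    have hy0 : y ≠ 0 := (hc.trans hy.1).ne'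
    have : x⁻¹ - y⁻¹ = x⁻¹ * y⁻¹ * (y - x) := by field_simp
    rw [this, abs_mul, abs_mul, dist_comm, Real.dist_eq]
    gcongr
    · exact hb x hx
    · exact hb y hy
  have h1 : HolderBdd γ (3 * c⁻¹ + c⁻¹ * c⁻¹) (Ioo c R) (fun x : ℝ => x⁻¹) :=
    HolderBdd.of_lipschitz hγ hγ1 (by positivity) (by positivity) hb hl
  have h2 := HolderBdd.clm (-((ContinuousLinearMap.smulRightL ℝ ℝ ℝ)
    (1 : ℝ →L[ℝ] ℝ))) (HolderBdd.mul (by positivity) (by positivity) h1 h1)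
  refine ⟨_, ?_, h1.mono (le_max_left _ _), fun x hx =>
    differentiableAt_inv (hc.trans hx.1).ne', HolderBdd.congr (h2.mono (le_max_right _ _)) ?_⟩
  · exact le_max_of_le_left (by positivity)
  · intro x hx
    ext
    simp [fderiv_inv, sq]

section Straightening

variable {n : ℕ}

/-- A bi-Lipschitz `C^{2,γ}` diffeomorphism `ψ` of `ℝⁿ` with Jacobian `J` which straightens the
level sets of `E`: `E ∘ ψ` is the linear function `⟨e, ·⟩`. -/
structure IsStraightening (γ L : ℝ) (e : RSpace n) (E : RSpace n → ℝ) (ψ : RSpace n → RSpace n)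
    (J : RSpace n → ℝ) : Prop where
  norm_dir : ‖e‖ = 1
  bijective : Function.Bijective ψ
  height : ∀ X, E (ψ X) = inner ℝ e X
  lip : ∀ X Y, dist (ψ X) (ψ Y) ≤ L * dist X Y
  antilip : ∀ X Y, dist X Y ≤ L * dist (ψ X) (ψ Y)
  differentiable : Differentiable ℝ ψ
  ckHolderOn_fderiv : CkHolderOn γ L univ 1 (fderiv ℝ ψ)
  abs_det : ∀ X, |(fderiv ℝ ψ X).det| = J X
  ckHolderOn_jac : CkHolderOn γ L univ 1 J

/-- Take `ψ` to be the inverse of `Φ(x) = x + (E(x) - ⟨e, x⟩) e`, which moves points along `e` only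
and satisfies `⟨e, Φ(x)⟩ = E(x)`. On each line parallel to `e` the slope of `E` is at least `c`, so
`Φ` is bijective with Lipschitz inverse. Its derivative is a rank-one perturbation of the identity,
so `Dψ` is explicit and its determinant is `1 / ∂_e E`. -/
theorem exists_isStraightening {γ c C : ℝ} (hγ : 0 ≤ γ) (hγ1 : γ ≤ 1) {E : RSpace n → ℝ}
    {e : RSpace n} (he : ‖e‖ = 1) (hc : 0 < c) (hE : Differentiable ℝ E)
    (hC : CkHolderOn γ C univ 1 (fderiv ℝ E)) (hpos : ∀ x, c ≤ fderiv ℝ E x e) :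
    ∃ L ψ J, 0 < L ∧ IsStraightening γ L e E ψ J := by
  have hC0 : 0 ≤ C := (norm_nonneg _).trans (hC.1.1 0 trivial)
  set l : RSpace n →L[ℝ] ℝ := innerSL ℝ e with hl
  have hl1 : ‖l‖ = 1 := by rw [hl, innerSL_apply_norm, he]
  have hle : l e = 1 := by simp [hl, he]
  have hlx : ∀ x, |l x| ≤ ‖x‖ := fun x => by
    have := l.le_opNorm x
    rwa [hl1, one_mul] at this
  have hElip : ∀ x y, |E x - E y| ≤ C * ‖x - y‖ := fun x y =>
    convex_univ.norm_image_sub_le_of_norm_fderiv_le (𝕜 := ℝ) (fun w _ => hE w)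
      (fun w _ => hC.1.1 w trivial) trivial trivial
  have hline : ∀ x t, HasDerivAt (fun t : ℝ => E (x + t • e)) (fderiv ℝ E (x + t • e) e) t := by
    intro x t
    have h1 : HasDerivAt (fun t : ℝ => x + t • e) e t := by
      simpa using ((hasDerivAt_id t).smul_const e).const_add x
    exact (hE _).hasFDerivAt.comp_hasDerivAt t h1
  have hmono : ∀ x, ∀ t t' : ℝ, t ≤ t' → c * (t' - t) ≤ E (x + t' • e) - E (x + t • e) := by
    intro x t t' h
    exact mul_sub_le_image_sub_of_le_deriv (f := fun t : ℝ => E (x + t • e))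
      (fun t => (hline x t).differentiableAt) (fun t => by rw [(hline x t).deriv]; exact hpos _) h
  have habs : ∀ x (t : ℝ), c * |t| ≤ |E (x + t • e) - E x| := by
    intro x t
    rcases le_total 0 t with h | h
    · have := hmono x 0 t h
      rw [zero_smul, add_zero, sub_zero] at this
      rw [abs_of_nonneg h]
      exact this.trans (le_abs_self _)
    · have := hmono x t 0 h
      rw [zero_smul, add_zero, zero_sub] at this
      rw [abs_of_nonpos h, abs_sub_comm]
      exact this.trans (le_abs_self _)
  set Φ : RSpace n → RSpace n := fun x => x + (E x - l x) • e with hΦ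
  have hΦl : ∀ x, l (Φ x) = E x := fun x => by simp [hΦ, hle]
  have hΦsurj : Function.Surjective Φ := by
    intro X
    have hs : Function.Surjective fun t : ℝ => E ((X - l X • e) + t • e) := by
      refine Continuous.surjective (Differentiable.continuous fun t =>
        (hline _ t).differentiableAt (𝕜 := ℝ)) ?_ ?_
      · refine Filter.tendsto_atTop_mono' Filter.atTop (f₁ := fun t : ℝ => E (X - l X • e) + c * t)
          ?_ (Filter.tendsto_atTop_add_const_left _ _
            (Filter.tendsto_id.const_mul_atTop hc))
        filter_upwards [Filter.eventually_ge_atTop (0 : ℝ)] with t ht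
        have := hmono (X - l X • e) 0 t ht
        rw [zero_smul, add_zero, sub_zero] at this
        linarith
      · refine Filter.tendsto_atBot_mono' Filter.atBot (f₁ := fun t : ℝ => E (X - l X • e) + c * t)
          ?_ (Filter.tendsto_atBot_add_const_left _ _
            (Filter.tendsto_id.const_mul_atBot hc))
        filter_upwards [Filter.eventually_le_atBot (0 : ℝ)] with t ht
        have := hmono (X - l X • e) t 0 ht
        rw [zero_smul, add_zero, zero_sub] at this
        linarith
    obtain ⟨t, ht⟩ := hs (l X)
    refine ⟨(X - l X • e) + t • e, ?_⟩
    simp only at ht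
    simp only [hΦ, ht]
    have : l ((X - l X • e) + t • e) = t := by simp [hle]
    rw [this, sub_smul]
    abel
  -- The part of `x - y` orthogonal to `e` is read off from `Φ x - Φ y`, because `Φ` leaves it
  -- unchanged. The component `t` along `e` is then recovered from the monotonicity of `E` on the
  -- line through `y`.
  have hanti : ∀ x y, ‖x - y‖ ≤ (2 + (2 * C + 1) / c) * ‖Φ x - Φ y‖ := by
    intro x y
    set D := Φ x - Φ y with hD
    set t := l (x - y) with ht
    have hlD : l D = E x - E y := by rw [hD, map_sub, hΦl, hΦl]
    have hp : x - (y + t • e) = D - l D • e := by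
      rw [hlD, hD, ht, map_sub]
      simp only [hΦ, sub_smul]
      abel
    have hpn : ‖x - (y + t • e)‖ ≤ 2 * ‖D‖ := by
      rw [hp]
      refine (norm_sub_le _ _).trans ?_
      rw [norm_smul, he, mul_one, Real.norm_eq_abs]
      linarith [hlx D]
    have h1 : c * |t| ≤ (2 * C + 1) * ‖D‖ := by
      refine (habs y t).trans ?_
      have h2 := hElip (y + t • e) x
      rw [norm_sub_rev] at h2
      have h3 := hlx D
      rw [hlD] at h3
      have h4 : E (y + t • e) - E y = (E (y + t • e) - E x) + (E x - E y) := by ring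
      rw [h4]
      refine (abs_add_le _ _).trans ?_
      have : C * ‖x - (y + t • e)‖ ≤ C * (2 * ‖D‖) := by gcongr
      linarith
    have h2 : |t| ≤ (2 * C + 1) / c * ‖D‖ := by
      rw [div_mul_eq_mul_div, le_div_iff₀ hc]
      linarith
    calc ‖x - y‖ = ‖(x - (y + t • e)) + t • e‖ := by congr 1; abel
      _ ≤ 2 * ‖D‖ + |t| := by
        refine (norm_add_le _ _).trans ?_
        rw [norm_smul, he, mul_one, Real.norm_eq_abs]
        gcongr
      _ ≤ _ := by linarith
  have hΦinj : Function.Injective Φ := by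
    intro x y h
    have := hanti x y
    rw [h, sub_self, norm_zero, mul_zero] at this
    exact sub_eq_zero.1 (norm_le_zero_iff.1 this)
  set ψ : RSpace n → RSpace n := ⇑(Equiv.ofBijective Φ ⟨hΦinj, hΦsurj⟩).symm with hψ
  have hΦψ : ∀ X, Φ (ψ X) = X := fun X => (Equiv.ofBijective Φ ⟨hΦinj, hΦsurj⟩).apply_symm_apply X
  set L₁ := 2 + (2 * C + 1) / c with hL₁
  have hL₁0 : 0 < L₁ := by positivity
  have hψlip : ∀ X Y, dist (ψ X) (ψ Y) ≤ L₁ * dist X Y := fun X Y => by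
    have := hanti (ψ X) (ψ Y)
    rwa [hΦψ, hΦψ, ← dist_eq_norm, ← dist_eq_norm] at this
  have hψanti : ∀ X Y, dist X Y ≤ (2 + C) * dist (ψ X) (ψ Y) := fun X Y => by
    have key : ∀ x y, ‖Φ x - Φ y‖ ≤ (2 + C) * ‖x - y‖ := fun x y => by
      have : Φ x - Φ y = (x - y) + ((E x - E y) - l (x - y)) • e := by
        rw [map_sub]
        simp only [hΦ, sub_smul]
        abel
      rw [this]
      refine (norm_add_le _ _).trans ?_
      rw [norm_smul, he, mul_one, Real.norm_eq_abs]
      have := abs_sub (E x - E y) (l (x - y))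
      linarith [hElip x y, hlx (x - y)]
    have := key (ψ X) (ψ Y)
    rwa [hΦψ, hΦψ, ← dist_eq_norm, ← dist_eq_norm] at this
  set R : (RSpace n →L[ℝ] ℝ) →L[ℝ] (RSpace n →L[ℝ] RSpace n) :=
    (ContinuousLinearMap.smulRightL ℝ (RSpace n) (RSpace n)).flip e with hR
  -- The inverse of `DΦ = id + (DE - l) ⊗ e` by the Sherman–Morrison formula; the denominator is `1
  -- + (DE - l)(e) = ∂_e E`.
  set S : RSpace n → (RSpace n →L[ℝ] RSpace n) := fun x =>
    ContinuousLinearMap.id ℝ _ + (-(ContinuousLinearMap.lsmul ℝ ℝ :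
      ℝ →L[ℝ] (RSpace n →L[ℝ] RSpace n) →L[ℝ] (RSpace n →L[ℝ] RSpace n)))
      (fderiv ℝ E x e)⁻¹ (R (fderiv ℝ E x + -l)) with hS
  have hSapp : ∀ x w, S x w = w - ((fderiv ℝ E x e)⁻¹ * (fderiv ℝ E x w - l w)) • e := by
    intro x w
    simp [hS, hR, smul_smul, sub_eq_add_neg]
    module
  have hψd : ∀ X, HasFDerivAt ψ (S (ψ X)) X := by
    intro X
    have hΦd : HasFDerivAt Φ (ContinuousLinearMap.id ℝ _ +
        (fderiv ℝ E (ψ X) - l).smulRight e) (ψ X) :=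
      (hasFDerivAt_id _).add (((hE _).hasFDerivAt.sub l.hasFDerivAt).smul_const e)
    have hcont : ContinuousAt ψ X := by
      have : LipschitzWith L₁.toNNReal ψ := LipschitzWith.of_dist_le_mul fun X Y => by
        rw [Real.coe_toNNReal _ hL₁0.le]; exact hψlip X Y
      exact this.continuous.continuousAt
    have := HasFDerivAt.of_comp_of_leftInverse (f'symm := S (ψ X)) hcont hΦd (hasFDerivAt_id X)
      (Filter.Eventually.of_forall hΦψ) (by
        intro w
        have hq : fderiv ℝ E (ψ X) e ≠ 0 := (hc.trans_le (hpos _)).ne'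
        rw [hSapp]
        simp only [add_apply, ContinuousLinearMap.id_apply,
          ContinuousLinearMap.smulRight_apply, sub_apply, map_add, map_smul,
          smul_eq_mul, hle, mul_one]
        have : (fderiv ℝ E (ψ X) e)⁻¹ * (fderiv ℝ E (ψ X) w +
          (fderiv ℝ E (ψ X) w - l w) * fderiv ℝ E (ψ X) e -
            (l w + (fderiv ℝ E (ψ X) w - l w))) = fderiv ℝ E (ψ X) w - l w := by
          field_simp; ring
        rw [this]
        abel)
    rwa [ContinuousLinearMap.comp_id] at this
  have hfψ : fderiv ℝ ψ = fun X => S (ψ X) := funext fun X => (hψd X).fderiv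
  obtain ⟨C₁, hC₁, H₁⟩ := CkHolderOn.clm (γ := γ) (k := 1) (A := (univ : Set (RSpace n)))
    isOpen_univ (ContinuousLinearMap.apply ℝ ℝ e : (RSpace n →L[ℝ] ℝ) →L[ℝ] ℝ) C
  have hDe : CkHolderOn γ C₁ univ 1 (fun x => fderiv ℝ E x e) := H₁ _ hC
  obtain ⟨C₂, hC₂, H₂⟩ := ckHolderOn_inv (R := C + 1) hγ hγ1 (half_pos hc)
  have hDelip : ∀ x y, dist (fderiv ℝ E x e) (fderiv ℝ E y e) ≤ C₁ * dist x y := fun x y => by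
    rw [dist_eq_norm, dist_eq_norm]
    exact convex_univ.norm_image_sub_le_of_norm_fderiv_le (𝕜 := ℝ)
      (f := fun x => fderiv ℝ E x e) (fun w _ => hDe.2.1 w trivial)
      (fun w _ => hDe.2.2.1 w trivial) trivial trivial
  have hDele : ∀ x, fderiv ℝ E x e < C + 1 := fun x => by
    have h1 := (fderiv ℝ E x).le_opNorm e
    rw [he, mul_one] at h1
    linarith [(le_abs_self _).trans h1, hC.1.1 x trivial]
  obtain ⟨C₃, hC₃, H₃⟩ := CkHolderOn.comp (k := 0) (γ := γ) (A := Ioo (c / 2) (C + 1))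
    (A' := (univ : Set (RSpace n))) hγ isOpen_univ (F := ℝ) C₂ C₁ C₁ hC₁
  have hq : CkHolderOn γ C₃ univ 1 (fun x => (fderiv ℝ E x e)⁻¹) :=
    H₃ (fun x => x⁻¹) _ H₂ (fun x _ => ⟨by linarith [hpos x], hDele x⟩)
      (fun x _ y _ => hDelip x y) hDe.2.1 hDe.2.2
  have h4 : CkHolderOn γ (C + ‖-l‖) univ 1 (fun x => fderiv ℝ E x + -l) :=
    hC.add isOpen_univ (CkHolderOn.const _ le_rfl)
  obtain ⟨C₅, hC₅, H₅⟩ := CkHolderOn.clm (γ := γ) (k := 1) (A := (univ : Set (RSpace n)))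
    isOpen_univ R (C + ‖-l‖)
  obtain ⟨C₆, hC₆, H₆⟩ := CkHolderOn.bilin (γ := γ) (k := 1) (A := (univ : Set (RSpace n)))
    isOpen_univ (-(ContinuousLinearMap.lsmul ℝ ℝ :
      ℝ →L[ℝ] (RSpace n →L[ℝ] RSpace n) →L[ℝ] (RSpace n →L[ℝ] RSpace n))) C₃ C₅
  have hSck : CkHolderOn γ (‖ContinuousLinearMap.id ℝ (RSpace n)‖ + C₆) univ 1 S :=
    (CkHolderOn.const _ le_rfl).add isOpen_univ (H₆ _ _ hq (H₅ _ h4))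
  set C₇ := ‖ContinuousLinearMap.id ℝ (RSpace n)‖ + C₆ with hC₇
  have hC₇0 : 0 ≤ C₇ := by positivity
  -- A bootstrap: `Dψ = S ∘ ψ` is first only Hölder, since `ψ` is Lipschitz. That is the input the
  -- chain rule needs to make `S ∘ ψ` a `C^{1,γ}` map.
  have hDψ0 : HolderBdd γ (C₇ * (1 + L₁ ^ γ)) univ (fderiv ℝ ψ) := by
    rw [hfψ]
    exact hSck.1.comp_lipschitz hγ hL₁0.le hC₇0 (mapsTo_univ _ _) fun x _ y _ => hψlip x y
  have compψ : ∀ {F : Type} [NormedAddCommGroup F] [NormedSpace ℝ F] (C : ℝ) (f : RSpace n → F),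
      CkHolderOn γ C univ 1 f → ∃ C', 0 ≤ C' ∧ CkHolderOn γ C' univ 1 fun X => f (ψ X) := by
    intro F _ _ C f hf
    obtain ⟨C', hC', H⟩ := CkHolderOn.comp (k := 0) (γ := γ) (A := (univ : Set (RSpace n)))
      (A' := (univ : Set (RSpace n))) hγ isOpen_univ (F := F) C (C₇ * (1 + L₁ ^ γ)) L₁ hL₁0.le
    exact ⟨C', hC', H f ψ hf (mapsTo_univ _ _) (fun x _ y _ => hψlip x y)
      (fun X _ => (hψd X).differentiableAt) hDψ0⟩
  obtain ⟨C₈, hC₈, H₈⟩ := compψ _ _ hSck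
  obtain ⟨C₉, hC₉, H₉⟩ := compψ _ _ hq
  refine ⟨L₁ + (2 + C) + C₈ + C₉, ψ, fun X => (fderiv ℝ E (ψ X) e)⁻¹, by positivity, ?_⟩
  refine ⟨he, Equiv.bijective _, fun X => ?_, fun X Y => (hψlip X Y).trans ?_,
    fun X Y => (hψanti X Y).trans ?_, fun X => (hψd X).differentiableAt, ?_, fun X => ?_,
    H₉.mono (by linarith)⟩
  · rw [← hΦl, hΦψ]; rfl
  · exact mul_le_mul_of_nonneg_right (by linarith) dist_nonneg
  · exact mul_le_mul_of_nonneg_right (by linarith) dist_nonneg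
  · rw [hfψ]; exact H₈.mono (by linarith)
  · have hpX := hc.trans_le (hpos (ψ X))
    have : ((fderiv ℝ ψ X : RSpace n →L[ℝ] RSpace n) : RSpace n →ₗ[ℝ] RSpace n) =
        LinearMap.transvection
          (-((fderiv ℝ E (ψ X) e)⁻¹ • ((fderiv ℝ E (ψ X) - l : RSpace n →L[ℝ] ℝ) :
            RSpace n →ₗ[ℝ] ℝ))) e := by
      ext1 w
      rw [hfψ]
      simp only [ContinuousLinearMap.coe_coe, hSapp]
      simp [LinearMap.transvection, sub_eq_add_neg]
      module
    rw [ContinuousLinearMap.det, this, LinearMap.transvection.det]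
    simp only [LinearMap.neg_apply, LinearMap.smul_apply, ContinuousLinearMap.coe_coe,
      sub_apply, hle, smul_eq_mul]
    rw [mul_sub, inv_mul_cancel₀ hpX.ne', mul_one, neg_sub, add_sub_cancel,
      abs_of_pos (inv_pos.2 hpX)]

end Straightening


/-! ### Averages along segments -/

section RayAverage

variable {n : ℕ} {γ C : ℝ} {F : Type} [NormedAddCommGroup F] [NormedSpace ℝ F]

theorem CkHolderOn.continuous {V : Type} [NormedAddCommGroup V] [NormedSpace ℝ V] {k : ℕ}
    {f : V → F} (h : CkHolderOn γ C univ (k + 1) f) : Continuous f :=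
  Differentiable.continuous (𝕜 := ℝ) fun x => h.2.1 x trivial

theorem CkHolderOn.continuous_fderiv {V : Type} [NormedAddCommGroup V] [NormedSpace ℝ V] {k : ℕ}
    {f : V → F} (hγ : 0 < γ) (h : CkHolderOn γ C univ (k + 1) f) : Continuous (fderiv ℝ f) :=
  continuousOn_univ.1 (h.2.2.holderBdd.continuousOn hγ)

theorem CkHolderOn.norm_sub_le {V : Type} [NormedAddCommGroup V] [NormedSpace ℝ V] {k : ℕ}
    {f : V → F} (h : CkHolderOn γ C univ (k + 1) f) (x y : V) : ‖f x - f y‖ ≤ C * ‖x - y‖ :=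
  convex_univ.norm_image_sub_le_of_norm_fderiv_le (𝕜 := ℝ) (fun w _ => h.2.1 w trivial)
    (fun w _ => h.2.2.holderBdd.1 w trivial) trivial trivial

/-- The linear map `(X, r) ↦ X + τ r θ`. -/
noncomputable def rayMap (θ : RSpace n) (τ : ℝ) : RSpace n × ℝ →L[ℝ] RSpace n :=
  ContinuousLinearMap.fst ℝ _ _ + τ • (ContinuousLinearMap.snd ℝ _ _).smulRight θ

theorem rayMap_apply (θ : RSpace n) (τ : ℝ) (p : RSpace n × ℝ) :
    rayMap θ τ p = p.1 + (τ * p.2) • θ := by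
  simp [rayMap, smul_smul]

theorem norm_rayMap_apply_le {θ : RSpace n} (hθ : ‖θ‖ = 1) {τ : ℝ} (hτ : |τ| ≤ 1)
    (p : RSpace n × ℝ) : ‖rayMap θ τ p‖ ≤ 2 * ‖p‖ := by
  rw [rayMap_apply]
  refine (norm_add_le _ _).trans ?_
  rw [norm_smul, hθ, mul_one, norm_mul]
  have h1 := norm_fst_le p
  have h2 := norm_snd_le p
  have : ‖τ‖ * ‖p.2‖ ≤ 1 * ‖p‖ := by gcongr; exact hτ
  linarith

theorem norm_rayMap_le {θ : RSpace n} (hθ : ‖θ‖ = 1) {τ : ℝ} (hτ : |τ| ≤ 1) :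
    ‖rayMap θ τ‖ ≤ 2 :=
  ContinuousLinearMap.opNorm_le_bound _ zero_le_two (norm_rayMap_apply_le hθ hτ)

theorem dist_rayMap_le {θ : RSpace n} (hθ : ‖θ‖ = 1) {τ : ℝ} (hτ : |τ| ≤ 1)
    (p q : RSpace n × ℝ) : dist (rayMap θ τ p) (rayMap θ τ q) ≤ 2 * dist p q := by
  rw [dist_eq_norm, ← map_sub, dist_eq_norm]
  exact norm_rayMap_apply_le hθ hτ _

theorem continuous_rayMap (θ : RSpace n) : Continuous (rayMap θ) := by
  unfold rayMap
  fun_prop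

/-- The average of `f` over the segment from `X` to `X + r θ`. -/
noncomputable def rayAverage (f : RSpace n → F) (θ : RSpace n) (p : RSpace n × ℝ) : F :=
  ∫ τ in Icc (0 : ℝ) 1, f (rayMap θ τ p)

theorem norm_integral_Icc_le {g : ℝ → F} {D : ℝ} (h : ∀ τ ∈ Icc (0 : ℝ) 1, ‖g τ‖ ≤ D) :
    ‖∫ τ in Icc (0 : ℝ) 1, g τ‖ ≤ D := by
  have := norm_setIntegral_le_of_norm_le_const (μ := volume) (s := Icc (0 : ℝ) 1) (f := g)
    (by simp) h
  simpa using this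

/-- Differentiation under the integral sign. The ray maps have norm at most `2`, which costs one
factor in the distance (`(2d)^γ ≤ 2 d^γ`) and one in the derivative. -/
theorem ckHolderOn_rayAverage (hγ : 0 < γ) (hγ1 : γ ≤ 1) (hC : 0 ≤ C) {f : RSpace n → F}
    (hf : CkHolderOn γ C univ 1 f) {θ : RSpace n} (hθ : ‖θ‖ = 1) :
    CkHolderOn γ (4 * C) univ 1 (rayAverage f θ) := by
  have hfc : Continuous f := hf.continuous
  have hfc' : Continuous (fderiv ℝ f) := hf.continuous_fderiv hγ
  have habs : ∀ τ ∈ Icc (0 : ℝ) 1, |τ| ≤ 1 := fun τ h => by rw [abs_of_nonneg h.1]; exact h.2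
  have hray : ∀ p, Continuous fun τ => rayMap θ τ p := fun p =>
    (continuous_rayMap θ).clm_apply continuous_const
  have hh : ∀ (p q : RSpace n × ℝ), ∀ τ ∈ Icc (0 : ℝ) 1,
      C * dist (rayMap θ τ p) (rayMap θ τ q) ^ γ ≤ C * (2 * dist p q ^ γ) := by
    intro p q τ hτ
    gcongr
    calc _ ≤ (2 * dist p q) ^ γ := by gcongr; exact dist_rayMap_le hθ (habs τ hτ) p q
      _ = 2 ^ γ * dist p q ^ γ := Real.mul_rpow zero_le_two dist_nonneg
      _ ≤ 2 ^ (1 : ℝ) * dist p q ^ γ := by gcongr; norm_num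
      _ = _ := by rw [Real.rpow_one]
  have hd0 : ∀ p q : RSpace n × ℝ, 0 ≤ C * dist p q ^ γ := fun p q => by positivity
  have hint : ∀ p, IntegrableOn (fun τ => f (rayMap θ τ p)) (Icc 0 1) := fun p =>
    (hfc.comp (hray p)).integrableOn_Icc
  have hint' : ∀ p, IntegrableOn (fun τ => (fderiv ℝ f (rayMap θ τ p)).comp (rayMap θ τ))
      (Icc 0 1) := fun p =>
    ((hfc'.comp (hray p)).clm_comp (continuous_rayMap θ)).integrableOn_Icc
  have hder : ∀ p, HasFDerivAt (rayAverage f θ)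
      (∫ τ in Icc (0 : ℝ) 1, (fderiv ℝ f (rayMap θ τ p)).comp (rayMap θ τ)) p := by
    intro p
    refine hasFDerivAt_integral_of_dominated_of_fderiv_le (bound := fun _ => C * 2)
      (F' := fun p τ => (fderiv ℝ f (rayMap θ τ p)).comp (rayMap θ τ))
      (s := univ) Filter.univ_mem (Filter.Eventually.of_forall fun q => (hint q).1) (hint p)
      (hint' p).1 ?_ ?_ ?_
    · filter_upwards [ae_restrict_mem measurableSet_Icc] with τ hτ q _
      refine (ContinuousLinearMap.opNorm_comp_le _ _).trans ?_
      exact mul_le_mul (hf.2.2.1 _ trivial) (norm_rayMap_le hθ (habs τ hτ)) (norm_nonneg _) hC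
    · exact integrable_const _
    · filter_upwards with τ q _
      exact (hf.2.1 _ trivial).hasFDerivAt.comp q (rayMap θ τ).hasFDerivAt
  have hfd : fderiv ℝ (rayAverage f θ) = fun p =>
      ∫ τ in Icc (0 : ℝ) 1, (fderiv ℝ f (rayMap θ τ p)).comp (rayMap θ τ) :=
    funext fun p => (hder p).fderiv
  refine ⟨⟨fun p _ => ?_, fun p _ q _ => ?_⟩, fun p _ => (hder p).differentiableAt, ?_⟩
  · exact (norm_integral_Icc_le fun τ _ => hf.1.1 _ trivial).trans (by linarith)
  · unfold rayAverage
    rw [← integral_sub (hint p) (hint q)]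
    refine (norm_integral_Icc_le fun τ hτ =>
      (hf.1.2 _ trivial _ trivial).trans (hh p q τ hτ)).trans ?_
    linarith [hd0 p q]
  · rw [hfd]
    refine ⟨fun p _ => ?_, fun p _ q _ => ?_⟩
    · refine (norm_integral_Icc_le (D := C * 2) fun τ hτ => ?_).trans (by linarith)
      refine (ContinuousLinearMap.opNorm_comp_le _ _).trans ?_
      exact mul_le_mul (hf.2.2.1 _ trivial) (norm_rayMap_le hθ (habs τ hτ)) (norm_nonneg _) hC
    · rw [← integral_sub (hint' p) (hint' q)]
      refine (norm_integral_Icc_le (D := C * (2 * dist p q ^ γ) * 2) fun τ hτ => ?_).trans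
        (by linarith)
      rw [← ContinuousLinearMap.sub_comp]
      refine (ContinuousLinearMap.opNorm_comp_le _ _).trans ?_
      exact mul_le_mul ((hf.2.2.2 _ trivial _ trivial).trans (hh p q τ hτ))
        (norm_rayMap_le hθ (habs τ hτ)) (norm_nonneg _) (by linarith [hd0 p q])

end RayAverage

/-! ### Chords and the density along a ray -/

section Profile

variable {n : ℕ} {γ L : ℝ} {e : RSpace n} {E : RSpace n → ℝ} {ψ : RSpace n → RSpace n}
  {J : RSpace n → ℝ}

/-- The difference quotient `(ψ(X + r θ) - ψ(X)) / r`, extended to `r = 0`. -/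
noncomputable def chord (ψ : RSpace n → RSpace n) (θ : RSpace n) (p : RSpace n × ℝ) : RSpace n :=
  rayAverage (fderiv ℝ ψ) θ p θ

/-- The fundamental theorem of calculus on the segment, for `r` of either sign. Expressing the
quotient as an average of `Dψ` shows its regularity in `(X, r)` without dividing by `r`. -/
theorem IsStraightening.sub_eq_smul_chord (h : IsStraightening γ L e E ψ J) (hγ : 0 < γ)
    (θ X : RSpace n) (r : ℝ) : ψ (X + r • θ) - ψ X = r • chord ψ θ (X, r) := by
  have hc' : Continuous (fderiv ℝ ψ) := h.ckHolderOn_fderiv.continuous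
  have hray : Continuous fun τ => rayMap θ τ (X, r) :=
    (continuous_rayMap θ).clm_apply continuous_const
  have hd : ∀ τ : ℝ, HasDerivAt (fun τ => ψ (rayMap θ τ (X, r)))
      (fderiv ℝ ψ (rayMap θ τ (X, r)) (r • θ)) τ := by
    intro τ
    refine (h.differentiable _).hasFDerivAt.comp_hasDerivAt τ ?_
    have e1 : (fun τ => rayMap θ τ (X, r)) = fun τ : ℝ => X + (τ * r) • θ := by
      ext1 τ; rw [rayMap_apply]
    rw [e1]
    have := (((hasDerivAt_id τ).mul_const r).smul_const θ).const_add X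
    simpa using this
  have hcont : Continuous fun τ => fderiv ℝ ψ (rayMap θ τ (X, r)) (r • θ) :=
    (hc'.comp hray).clm_apply continuous_const
  have h1 := intervalIntegral.integral_eq_sub_of_hasDerivAt (a := 0) (b := 1)
    (fun τ _ => hd τ) (hcont.intervalIntegrable 0 1)
  simp only [rayMap_apply, one_mul, zero_mul, zero_smul, add_zero] at h1
  have h2 : (∫ τ in Icc (0 : ℝ) 1, fderiv ℝ ψ (rayMap θ τ (X, r))) θ =
      ∫ τ in Icc (0 : ℝ) 1, fderiv ℝ ψ (rayMap θ τ (X, r)) θ :=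
    ContinuousLinearMap.integral_apply (hc'.comp hray).integrableOn_Icc θ
  rw [← h1, chord, rayAverage, h2, ← integral_smul, integral_Icc_eq_integral_Ioc,
    intervalIntegral.integral_of_le zero_le_one]
  refine setIntegral_congr_fun measurableSet_Ioc fun τ _ => ?_
  simp only [rayMap_apply, map_smul]

theorem exists_ckHolderOn_chord (hγ : 0 < γ) (hγ1 : γ ≤ 1) (hL : 0 < L) :
    ∃ C, 0 ≤ C ∧ ∀ (e : RSpace n) (E : RSpace n → ℝ) (ψ : RSpace n → RSpace n) (J : RSpace n → ℝ),
      IsStraightening γ L e E ψ J → ∀ θ : RSpace n, ‖θ‖ = 1 →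
      CkHolderOn γ C univ 1 (chord ψ θ) := by
  obtain ⟨C, hC, H⟩ := CkHolderOn.bilin (γ := γ) (k := 1) (A := (univ : Set (RSpace n × ℝ)))
    isOpen_univ (ContinuousLinearMap.id ℝ (RSpace n →L[ℝ] RSpace n)) (4 * L) 1
  refine ⟨C, hC, fun e E ψ J h θ hθ => ?_⟩
  exact H _ (fun _ => θ) (ckHolderOn_rayAverage hγ hγ1 hL.le h.ckHolderOn_fderiv hθ)
    (CkHolderOn.const θ hθ.le)

/-- For `r ≠ 0` this is the bi-Lipschitz property, and `r = 0` follows by continuity. Chords thus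
stay in a fixed annulus, on which the kernel is `C^{1,γ}`. -/
theorem IsStraightening.norm_chord_bounds (h : IsStraightening γ L e E ψ J) (hγ : 0 < γ)
    (hγ1 : γ ≤ 1) (hL : 0 < L) {θ : RSpace n} (hθ : ‖θ‖ = 1) (p : RSpace n × ℝ) :
    L⁻¹ ≤ ‖chord ψ θ p‖ ∧ ‖chord ψ θ p‖ ≤ L := by
  obtain ⟨C, hC, H⟩ := exists_ckHolderOn_chord (n := n) hγ hγ1 hL
  have hcont : Continuous (chord ψ θ) := (H e E ψ J h θ hθ).continuous
  have key : ∀ X, ∀ r : ℝ, r ≠ 0 → chord ψ θ (X, r) ∈ {Y : RSpace n | L⁻¹ ≤ ‖Y‖ ∧ ‖Y‖ ≤ L} := by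
    intro X r hr
    have h0 := h.sub_eq_smul_chord hγ θ X r
    have hr' : 0 < |r| := abs_pos.2 hr
    have hdist : dist (X + r • θ) X = |r| := by
      rw [dist_eq_norm, add_sub_cancel_left, norm_smul, hθ, mul_one, Real.norm_eq_abs]
    have h1 := h.lip (X + r • θ) X
    have h2 := h.antilip (X + r • θ) X
    rw [dist_eq_norm (ψ _), h0, norm_smul, hdist, Real.norm_eq_abs] at h1 h2
    constructor
    · rw [inv_le_iff_one_le_mul₀ hL]
      nlinarith
    · nlinarith
  have hcl : IsClosed {Y : RSpace n | L⁻¹ ≤ ‖Y‖ ∧ ‖Y‖ ≤ L} :=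
    (isClosed_le continuous_const continuous_norm).inter
      (isClosed_le continuous_norm continuous_const)
  obtain ⟨X, r⟩ := p
  by_cases hr : r = 0
  · subst hr
    have ht : Filter.Tendsto (fun r : ℝ => chord ψ θ (X, r)) (nhdsWithin 0 {0}ᶜ)
        (nhds (chord ψ θ (X, 0))) :=
      ((hcont.comp (Continuous.prodMk_right X)).tendsto 0).mono_left nhdsWithin_le_nhds
    exact hcl.mem_of_tendsto ht (by
      filter_upwards [self_mem_nhdsWithin] with r hr
      exact key X r hr)
  · exact key X r hr

/-- The density of the flattened kernel along the ray through `X` in direction `θ`. -/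
noncomputable def profile (s : ℝ) (μ : sphere (0 : RSpace n) 1 → ℝ) (ψ : RSpace n → RSpace n)
    (Q : RSpace n → ℝ) (θ : RSpace n) (p : RSpace n × ℝ) : ℝ :=
  Q (p.1 + p.2 • θ) * evenKernel s μ (chord ψ θ p)

theorem exists_ckHolderOn_profile {γ M : ℝ≥0} (hγ : 0 < γ) (hγ1 : γ ≤ 1) (hL : 0 < L) (N : ℝ) :
    ∃ C, 0 ≤ C ∧ ∀ (e : RSpace n) (E : RSpace n → ℝ) (ψ : RSpace n → RSpace n) (J : RSpace n → ℝ),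
      IsStraightening γ L e E ψ J → ∀ Q : RSpace n → ℝ, CkHolderOn γ N univ 1 Q →
      ∀ s : ℝ, 0 < s → s < 1 → ∀ μ : sphere (0 : RSpace n) 1 → ℝ, IsC1Sphere μ →
      sphereC1HolderNorm γ μ ≤ M → ∀ θ : RSpace n, ‖θ‖ = 1 →
      CkHolderOn γ C univ 1 (profile s μ ψ Q θ) := by
  have hγ' : (0 : ℝ) < γ := hγ
  have hγ1' : (γ : ℝ) ≤ 1 := by exact_mod_cast hγ1
  obtain ⟨C₁, hC₁, H₁⟩ := exists_ckHolderOn_chord (n := n) hγ' hγ1' hL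
  obtain ⟨C₂, hC₂, H₂⟩ := ckHolderOn_evenKernel (n := n) (M := M) (c := L⁻¹ / 2) (R := 2 * L) hγ1
    (by positivity)
  obtain ⟨C₃, hC₃, H₃⟩ := CkHolderOn.comp (k := 0) (γ := γ) (A := annulus n (L⁻¹ / 2) (2 * L))
    (A' := (univ : Set (RSpace n × ℝ))) hγ'.le isOpen_univ (F := ℝ) C₂ C₁ C₁ hC₁
  obtain ⟨C₄, hC₄, H₄⟩ := CkHolderOn.comp (k := 0) (γ := γ) (A := (univ : Set (RSpace n)))
    (A' := (univ : Set (RSpace n × ℝ))) hγ'.le isOpen_univ (F := ℝ) N 2 2 zero_le_two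
  obtain ⟨C₅, hC₅, H₅⟩ := CkHolderOn.bilin (γ := γ) (k := 1) (A := (univ : Set (RSpace n × ℝ)))
    isOpen_univ (ContinuousLinearMap.mul ℝ ℝ) C₄ C₃
  refine ⟨C₅, hC₅, fun e E ψ J h Q hQ s hs hs1 μ hμ hM θ hθ => ?_⟩
  have hch := H₁ e E ψ J h θ hθ
  have h3 := H₃ (evenKernel s μ) (chord ψ θ) (H₂ s hs hs1 μ hμ hM) (fun p _ => by
      have := h.norm_chord_bounds hγ' hγ1' hL hθ p
      have hLi : 0 < L⁻¹ := by positivity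
      exact ⟨by linarith [this.1], by linarith [this.2]⟩)
    (fun p _ q _ => by rw [dist_eq_norm, dist_eq_norm]; exact hch.norm_sub_le p q) hch.2.1 hch.2.2
  have h4 := H₄ Q (rayMap θ 1) hQ (mapsTo_univ _ _)
    (fun p _ q _ => dist_rayMap_le hθ (by simp) p q) (fun p _ => (rayMap θ 1).differentiableAt)
    ((HolderBdd.const (rayMap θ 1) (norm_rayMap_le hθ (by simp))).congr fun p _ =>
      (rayMap θ 1).fderiv)
  have := H₅ _ _ h4 h3
  refine CkHolderOn.congr isOpen_univ this fun p _ => ?_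
  simp [profile, rayMap_apply]

/-- The four conclusions are the hypotheses on the density in `abs_integral_radialIntegrand_sub_le`:
continuity, increments from `r = 0`, the first-order expansion with Hölder remainder, and Hölder
dependence of the increments on `X`. -/
theorem CkHolderOn.slice_bounds {C : ℝ} (hγ : 0 < γ) (hC : 0 ≤ C) {Γ : RSpace n × ℝ → ℝ}
    (h : CkHolderOn γ C univ 1 Γ) (X : RSpace n) :
    Continuous (fun r => Γ (X, r)) ∧
    (∀ r, |Γ (X, r) - Γ (X, 0)| ≤ 2 * C * min |r| 1) ∧
    (∃ c, |c| ≤ 2 * C ∧ ∀ r, |r| ≤ 1 → |Γ (X, r) - Γ (X, 0) - c * r| ≤ 2 * C * |r| ^ (1 + γ)) ∧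
    ∀ (X' : RSpace n) (r : ℝ), |(Γ (X', r) - Γ (X', 0)) - (Γ (X, r) - Γ (X, 0))| ≤
      2 * C * dist X' X ^ γ * min |r| 1 := by
  have hd : ∀ X r, HasDerivAt (fun r => Γ (X, r)) (fderiv ℝ Γ (X, r) (0, 1)) r := fun X r =>
    (h.2.1 (X, r) trivial).hasFDerivAt.comp_hasDerivAt r
      ((hasDerivAt_const r X).prodMk (hasDerivAt_id r))
  have hn : ‖((0, 1) : RSpace n × ℝ)‖ = 1 := by simp [Prod.norm_def]
  have hap : ∀ A : RSpace n × ℝ →L[ℝ] ℝ, |A (0, 1)| ≤ ‖A‖ := fun A => by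
    have := A.le_opNorm (0, 1)
    rwa [hn, mul_one] at this
  refine ⟨Differentiable.continuous (𝕜 := ℝ) fun r => (hd X r).differentiableAt, fun r => ?_,
    ⟨fderiv ℝ Γ (X, 0) (0, 1), (hap _).trans ((h.2.2.1 _ trivial).trans (by linarith)),
      fun r hr => ?_⟩, fun X' r => ?_⟩
  · rw [mul_min_of_nonneg _ _ (by positivity)]
    refine le_min ?_ ?_
    · have := h.norm_sub_le (X, r) (X, 0)
      rw [Prod.mk_sub_mk, sub_self, sub_zero, Prod.norm_def] at this
      simp only [norm_zero, Real.norm_eq_abs, max_eq_right (abs_nonneg r)] at this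
      have h0 : 0 ≤ C * |r| := by positivity
      linarith
    · have h1 := h.1.1 (X, r) trivial
      have h2 := h.1.1 (X, 0) trivial
      rw [Real.norm_eq_abs] at h1 h2
      have := abs_sub (Γ (X, r)) (Γ (X, 0))
      linarith
  · have h1 : ∀ t, HasDerivAt (fun t => Γ (X, t) - fderiv ℝ Γ (X, 0) (0, 1) * t)
        (fderiv ℝ Γ (X, t) (0, 1) - fderiv ℝ Γ (X, 0) (0, 1)) t := fun t => by
      have := (hd X t).sub ((hasDerivAt_id t).const_mul (fderiv ℝ Γ (X, 0) (0, 1)))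
      rwa [mul_one] at this
    have := (convex_closedBall (0 : ℝ) |r|).norm_image_sub_le_of_norm_hasDerivWithin_le
      (f := fun t => Γ (X, t) - fderiv ℝ Γ (X, 0) (0, 1) * t) (C := C * |r| ^ γ)
      (fun t _ => (h1 t).hasDerivWithinAt) (fun t ht => ?_)
      (mem_closedBall_self (abs_nonneg r)) (y := r) (by simp)
    · rw [mul_zero, sub_zero, sub_zero, Real.norm_eq_abs, Real.norm_eq_abs] at this
      rw [sub_right_comm]
      refine this.trans ?_
      rcases eq_or_ne r 0 with rfl | hr0
      · simp only [abs_zero, mul_zero]; positivity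
      · rw [Real.rpow_add (abs_pos.2 hr0), Real.rpow_one]
        have : 0 ≤ C * (|r| * |r| ^ γ) := by positivity
        linarith
    · rw [← sub_apply]
      refine (hap _).trans ((h.2.2.2 _ trivial _ trivial).trans ?_)
      gcongr
      rw [Prod.dist_eq, dist_self]
      simp only [dist_nonneg, sup_of_le_right]
      exact ht
  · have hdn : 0 ≤ dist X' X ^ γ := by positivity
    rw [mul_min_of_nonneg _ _ (by positivity)]
    have hdist : ∀ t : ℝ, dist ((X', t) : RSpace n × ℝ) (X, t) = dist X' X := fun t => by
      rw [Prod.dist_eq, dist_self]; simp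
    refine le_min ?_ ?_
    · have := convex_univ.norm_image_sub_le_of_norm_hasDerivWithin_le
        (f := fun t => Γ (X', t) - Γ (X, t)) (C := C * dist X' X ^ γ)
        (fun t _ => ((hd X' t).sub (hd X t)).hasDerivWithinAt) (fun t _ => ?_)
        (mem_univ (0 : ℝ)) (mem_univ r)
      · rw [sub_zero, Real.norm_eq_abs, Real.norm_eq_abs] at this
        rw [sub_sub_sub_comm]
        refine this.trans ?_
        have : 0 ≤ C * dist X' X ^ γ * |r| := by positivity
        linarith
      · rw [← sub_apply]
        refine (hap _).trans ((h.2.2.2 _ trivial _ trivial).trans ?_)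
        rw [hdist]
    · have h1 := h.1.2 (X', r) trivial (X, r) trivial
      have h2 := h.1.2 (X', 0) trivial (X, 0) trivial
      rw [hdist, Real.norm_eq_abs] at h1 h2
      rw [sub_sub_sub_comm]
      have := abs_sub (Γ (X', r) - Γ (X, r)) (Γ (X', 0) - Γ (X, 0))
      linarith

end Profile


/-! ### The singular part in flattened coordinates -/

section Flat

variable {n : ℕ} {γ L B s s₀ : ℝ} {e : RSpace n} {E : RSpace n → ℝ} {ψ : RSpace n → RSpace n}
  {J Q : RSpace n → ℝ} {μ : sphere (0 : RSpace n) 1 → ℝ} {X : RSpace n}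

/-- The integrand, in flattened coordinates, of the singular part of the operator. -/
noncomputable def flatIntegrand (s : ℝ) (μ : sphere (0 : RSpace n) 1 → ℝ) (e : RSpace n)
    (ψ : RSpace n → RSpace n) (Q : RSpace n → ℝ) (X Z : RSpace n) : ℝ :=
  posPowDiff s (inner ℝ e X) (inner ℝ e Z) * (Q (X + Z) * evenKernel s μ (ψ (X + Z) - ψ X))

theorem flatIntegrand_smul (h : IsStraightening γ L e E ψ J) (hγ : 0 < γ) (θ : RSpace n) {r : ℝ}
    (hr : 0 < r) : flatIntegrand s μ e ψ Q X (r • θ) =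
      posPowDiff s (inner ℝ e X) (r * inner ℝ e θ) * profile s μ ψ Q θ (X, r) *
        (r ^ ((n : ℝ) + 2 * s))⁻¹ := by
  unfold flatIntegrand profile
  rw [h.sub_eq_smul_chord hγ, evenKernel_smul hr, inner_smul_right, Real.rpow_neg hr.le]
  ring

/-- Evenness of the kernel allows the profile in direction `θ` to be continued to negative `r`. The
points `rθ` and `-rθ` are then governed by one `C^{1,γ}` density on the whole line. -/
theorem flatIntegrand_neg_smul (h : IsStraightening γ L e E ψ J) (hγ : 0 < γ) (θ : RSpace n)
    {r : ℝ} (hr : 0 < r) : flatIntegrand s μ e ψ Q X (-(r • θ)) =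
      posPowDiff s (inner ℝ e X) (-(r * inner ℝ e θ)) * profile s μ ψ Q θ (X, -r) *
        (r ^ ((n : ℝ) + 2 * s))⁻¹ := by
  unfold flatIntegrand profile
  rw [← neg_smul, h.sub_eq_smul_chord hγ, neg_smul r (chord _ _ _), evenKernel_neg,
    evenKernel_smul hr, inner_smul_right, Real.rpow_neg hr.le, neg_mul]
  ring

theorem exists_smul_eq {Z : RSpace n} (hZ : Z ≠ 0) :
    ∃ θ : RSpace n, ‖θ‖ = 1 ∧ Z = ‖Z‖ • θ := by
  have hr : ‖Z‖ ≠ 0 := norm_ne_zero_iff.2 hZ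
  refine ⟨‖Z‖⁻¹ • Z, ?_, ?_⟩
  · rw [norm_smul, norm_inv, norm_norm, inv_mul_cancel₀ hr]
  · rw [smul_smul, mul_inv_cancel₀ hr, one_smul]

theorem abs_inner_le_one {θ : RSpace n} (he : ‖e‖ = 1) (hθ : ‖θ‖ = 1) : |inner ℝ e θ| ≤ 1 := by
  have := abs_real_inner_le_norm e θ
  rwa [he, hθ, one_mul] at this

theorem abs_flatIntegrand_le (h : IsStraightening γ L e E ψ J) (hγ : 0 < γ)
    (hB : ∀ θ : RSpace n, ‖θ‖ = 1 → CkHolderOn γ B univ 1 (profile s μ ψ Q θ)) {Z : RSpace n}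
    (hZ : Z ≠ 0) : |flatIntegrand s μ e ψ Q X Z| ≤
      |posPowDiff s (inner ℝ e X) (inner ℝ e Z)| * B * (‖Z‖ ^ ((n : ℝ) + 2 * s))⁻¹ := by
  obtain ⟨θ, hθ, hZθ⟩ := exists_smul_eq hZ
  have hr := norm_pos_iff.2 hZ
  set r := ‖Z‖ with hrdef
  rw [hZθ, flatIntegrand_smul h hγ θ hr, abs_mul, abs_mul, inner_smul_right,
    abs_of_nonneg (a := (_)⁻¹) (by positivity)]
  gcongr
  exact (hB θ hθ).1.1 (X, r) trivial

/-- Split the density into its value at `0` and its increment: the first multiplies the even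
combination `P(rτ) + P(-rτ)`, the second multiplies each `P` separately, and both are `O(r²)`. The
constant blows up as `X` approaches the boundary, so the lemma serves integrability only. -/
theorem abs_flatIntegrand_add_neg_le (hn : 1 ≤ n) (h : IsStraightening γ L e E ψ J) (hγ : 0 < γ)
    (hs : 0 < s) (hs1 : s < 1) (hB0 : 0 ≤ B)
    (hB : ∀ θ : RSpace n, ‖θ‖ = 1 → CkHolderOn γ B univ 1 (profile s μ ψ Q θ))
    (ha : 0 < inner ℝ e X) {Z : RSpace n} (hZ : Z ≠ 0) :
    |flatIntegrand s μ e ψ Q X Z + flatIntegrand s μ e ψ Q X (-Z)| ≤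
      (B * (2 * (inner ℝ e X) ^ (s - 2) + 4 * (inner ℝ e X) ^ (s - 1) + 6)) *
        ballWeight n s Z := by
  obtain ⟨θ, hθ, hZθ⟩ := exists_smul_eq hZ
  have hr := norm_pos_iff.2 hZ
  obtain ⟨-, hG, -, -⟩ := (hB θ hθ).slice_bounds hγ hB0 X
  have hG0 : |profile s μ ψ Q θ (X, 0)| ≤ B := (hB θ hθ).1.1 _ trivial
  have hτ := abs_inner_le_one h.norm_dir hθ
  set r := ‖Z‖ with hrdef
  set τ := inner ℝ e θ with hτdef
  set a := inner ℝ e X with hadef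
  set P := posPowDiff s a with hP
  set G : ℝ → ℝ := fun r => profile s μ ψ Q θ (X, r) with hGdef
  have e1 : flatIntegrand s μ e ψ Q X Z + flatIntegrand s μ e ψ Q X (-Z) =
      (G 0 * (P (r * τ) + P (-(r * τ))) + (P (r * τ) * (G r - G 0) +
        P (-(r * τ)) * (G (-r) - G 0))) * (r ^ ((n : ℝ) + 2 * s))⁻¹ := by
    rw [hZθ, flatIntegrand_smul h hγ θ hr, flatIntegrand_neg_smul h hγ θ hr]
    ring
  have hrτ : |r * τ| ≤ r := by
    rw [abs_mul, abs_of_pos hr]; nlinarith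
  have hrτ' : |-(r * τ)| ≤ r := by rwa [abs_neg]
  have hP1 : ∀ t, |t| ≤ r → |P t| ≤ a ^ (s - 1) * r := fun t ht =>
    (abs_posPowDiff_le_mul hs.le hs1.le ha).trans (by gcongr)
  have hP2 : ∀ t, |t| ≤ r → |P t| ≤ r ^ s := fun t ht =>
    (abs_posPowDiff_le hs.le hs1.le ha.le).trans (by gcongr)
  have hGr : ∀ t, |t| = r → |G t - G 0| ≤ 2 * B * r ∧ |G t - G 0| ≤ 2 * B := fun t ht => by
    have := hG t
    rw [ht] at this
    exact ⟨this.trans (by gcongr; exact min_le_left _ _),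
      this.trans (mul_le_of_le_one_right (by positivity) (min_le_right _ _))⟩
  set D := 2 * a ^ (s - 2) + 4 * a ^ (s - 1) + 6 with hD
  have hD0 : 0 < D := by positivity
  set x := G 0 * (P (r * τ) + P (-(r * τ))) + (P (r * τ) * (G r - G 0) +
        P (-(r * τ)) * (G (-r) - G 0)) with hx
  have hx3 : |x| ≤ |G 0| * |P (r * τ) + P (-(r * τ))| + (|P (r * τ)| * |G r - G 0| +
        |P (-(r * τ))| * |G (-r) - G 0|) := by
    rw [hx, ← abs_mul, ← abs_mul, ← abs_mul]
    exact (abs_add_le _ _).trans (add_le_add le_rfl (abs_add_le _ _))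
  have g1 := hGr r (abs_of_pos hr)
  have g2 := hGr (-r) (by rw [abs_neg, abs_of_pos hr])
  have ha1 : 0 < a ^ (s - 1) := by positivity
  have ha2 : 0 < a ^ (s - 2) := by positivity
  have b1 : |x| ≤ B * D * r ^ 2 := by
    have h1 : |P (r * τ) + P (-(r * τ))| ≤ 2 * a ^ (s - 2) * r ^ 2 := by
      refine (abs_posPowDiff_add_neg_le hs.le hs1.le ha).trans ?_
      gcongr 2 * a ^ (s - 2) * ?_
      rw [← sq_abs]; gcongr
    calc |x| ≤ B * (2 * a ^ (s - 2) * r ^ 2) + ((a ^ (s - 1) * r) * (2 * B * r) +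
          (a ^ (s - 1) * r) * (2 * B * r)) := by
          refine hx3.trans ?_
          gcongr
          · exact hP1 _ hrτ
          · exact g1.1
          · exact hP1 _ hrτ'
          · exact g2.1
      _ ≤ B * D * r ^ 2 := by
          have : 0 ≤ B * r ^ 2 := by positivity
          rw [hD]; nlinarith
  have b2 : |x| ≤ B * D * r ^ s := by
    have hrs : 0 ≤ B * r ^ s := by positivity
    calc |x| ≤ B * (r ^ s + r ^ s) + (r ^ s * (2 * B) + r ^ s * (2 * B)) := by
          refine hx3.trans ?_
          gcongr
          · exact (abs_add_le _ _).trans (add_le_add (hP2 _ hrτ) (hP2 _ hrτ'))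
          · exact hP2 _ hrτ
          · exact g1.2
          · exact hP2 _ hrτ'
          · exact g2.2
      _ = B * r ^ s * 6 := by ring
      _ ≤ B * r ^ s * D := by gcongr; rw [hD]; linarith
      _ = _ := by ring
  rw [e1, abs_mul, abs_of_nonneg (a := (_)⁻¹) (by positivity)]
  rcases hB0.eq_or_lt with h0 | hBpos
  · rw [← h0, zero_mul, zero_mul] at b1
    rw [← h0, zero_mul, zero_mul]
    nlinarith [abs_nonneg x, inv_nonneg.2 (Real.rpow_nonneg hr.le ((n : ℝ) + 2 * s))]
  · have := mul_inv_le_ballWeight hn hs1.le hZ (x := |x| / (B * D))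
      (by rw [div_le_iff₀ (by positivity)]; linarith)
      (by rw [div_le_iff₀ (by positivity)]; linarith)
    rw [div_mul_eq_mul_div, div_le_iff₀ (by positivity)] at this
    linarith

theorem aestronglyMeasurable_evenKernel (hn : 1 ≤ n) (hμ : IsC1Sphere μ) :
    AEStronglyMeasurable (evenKernel s μ) := by
  have h1 := aestronglyMeasurable_kernel (s := s) hn hμ
  have h2 : AEStronglyMeasurable fun y : RSpace n =>
      radialExt μ (-y) / ‖-y‖ ^ ((n : ℝ) + 2 * s) :=
    h1.comp_quasiMeasurePreserving (Measure.measurePreserving_neg volume).quasiMeasurePreserving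
  refine ((h1.add h2).mul_const (1 / 2)).congr (Filter.Eventually.of_forall fun y => ?_)
  rw [evenKernel_eq]
  simp only [Pi.add_apply]
  ring

theorem continuousOn_evenKernel (hμ : IsC1Sphere μ) :
    ContinuousOn (evenKernel s μ) {0}ᶜ := by
  unfold evenKernel
  have h1 : ContinuousOn (radialExt μ) {0}ᶜ := hμ.continuousOn
  have h2 : ContinuousOn (fun y => radialExt μ (-y)) {0}ᶜ :=
    h1.comp continuous_neg.continuousOn fun y hy => by simpa using hy
  have h3 : ContinuousOn (fun y : RSpace n => (‖y‖ ^ 2) ^ (-((n : ℝ) / 2 + s))) {0}ᶜ :=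
    ContinuousOn.rpow_const (by fun_prop) fun y hy => Or.inl
      (pow_ne_zero _ (norm_ne_zero_iff.2 hy))
  exact ((h1.add h2).div_const 2).mul h3

theorem IsStraightening.continuous (h : IsStraightening γ L e E ψ J) : Continuous ψ :=
  h.differentiable.continuous

theorem aestronglyMeasurable_flatIntegrand (hn : 1 ≤ n) (h : IsStraightening γ L e E ψ J)
    (hs : 0 ≤ s) (hμ : IsC1Sphere μ) (hQ : Continuous Q) :
    AEStronglyMeasurable (flatIntegrand s μ e ψ Q X) := by
  have := nontrivial_rspace hn
  have h1 : ContinuousOn (flatIntegrand s μ e ψ Q X) {0}ᶜ := by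
    have hk : ContinuousOn (fun Z => evenKernel s μ (ψ (X + Z) - ψ X)) {0}ᶜ := by
      refine (continuousOn_evenKernel hμ).comp (Continuous.continuousOn
        ((h.continuous.comp (continuous_const_add X)).sub continuous_const)) fun Z hZ => ?_
      rw [mem_compl_singleton_iff] at hZ ⊢
      intro h0
      have := h.bijective.1 (sub_eq_zero.1 h0)
      exact hZ (by simpa using this)
    have hp : Continuous fun Z => posPowDiff s (inner ℝ e X) (inner ℝ e Z) :=
      (continuous_posPowDiff hs).comp (continuous_const.inner continuous_id)
    exact hp.continuousOn.mul ((hQ.comp (continuous_const_add X)).continuousOn.mul hk)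
  have h2 := h1.aestronglyMeasurable (μ := volume) (measurableSet_singleton (0 : RSpace n)).compl
  rwa [restrict_compl_singleton] at h2

theorem integrable_flatIntegrand_add_neg (hn : 1 ≤ n) (h : IsStraightening γ L e E ψ J)
    (hγ : 0 < γ) (hs : 0 < s) (hs1 : s < 1) (hB0 : 0 ≤ B) (hμ : IsC1Sphere μ) (hQ : Continuous Q)
    (hB : ∀ θ : RSpace n, ‖θ‖ = 1 → CkHolderOn γ B univ 1 (profile s μ ψ Q θ))
    (ha : 0 < inner ℝ e X) :
    Integrable fun Z => (flatIntegrand s μ e ψ Q X Z + flatIntegrand s μ e ψ Q X (-Z)) / 2 := by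
  have h1 : AEStronglyMeasurable (flatIntegrand s μ e ψ Q X) :=
    aestronglyMeasurable_flatIntegrand hn h hs.le hμ hQ
  have h2 : AEStronglyMeasurable fun Z => flatIntegrand s μ e ψ Q X (-Z) :=
    h1.comp_quasiMeasurePreserving (Measure.measurePreserving_neg volume).quasiMeasurePreserving
  have h3 : Integrable fun Z => flatIntegrand s μ e ψ Q X Z + flatIntegrand s μ e ψ Q X (-Z) := by
    refine Integrable.mono' ((integrable_ballWeight hn hs hs1).const_mul
      (B * (2 * (inner ℝ e X) ^ (s - 2) + 4 * (inner ℝ e X) ^ (s - 1) + 6))) (h1.add h2) ?_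
    filter_upwards [ae_ne_zero hn] with Z hZ
    exact abs_flatIntegrand_add_neg_le hn h hγ hs hs1 hB0 hB ha hZ
  exact h3.div_const 2

/-- The singular part of the operator in flattened coordinates. -/
noncomputable def flatOp (s : ℝ) (μ : sphere (0 : RSpace n) 1 → ℝ) (e : RSpace n)
    (ψ : RSpace n → RSpace n) (Q : RSpace n → ℝ) (X : RSpace n) : ℝ :=
  (1 - s) * ∫ Z, (flatIntegrand s μ e ψ Q X Z + flatIntegrand s μ e ψ Q X (-Z)) / 2

/-- On the ray through `θ` the symmetrised integrand is half a `radialIntegrand`. The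
one-dimensional estimates, uniform in `θ`, can then be integrated over the sphere. -/
theorem flatOp_polar (hn : 1 ≤ n) (h : IsStraightening γ L e E ψ J)
    (hγ : 0 < γ) (hs : 0 < s) (hs1 : s < 1) (hB0 : 0 ≤ B) (hμ : IsC1Sphere μ) (hQ : Continuous Q)
    (hB : ∀ θ : RSpace n, ‖θ‖ = 1 → CkHolderOn γ B univ 1 (profile s μ ψ Q θ))
    (ha : 0 < inner ℝ e X) :
    Integrable (fun θ : sphere (0 : RSpace n) 1 => (1 - s) * ∫ r in Ioi (0 : ℝ),
      radialIntegrand s (inner ℝ e X) (inner ℝ e θ.1) (fun r => profile s μ ψ Q θ.1 (X, r)) r)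
      (volume : Measure (RSpace n)).toSphere ∧
    flatOp s μ e ψ Q X = (∫ θ : sphere (0 : RSpace n) 1, ((1 - s) * ∫ r in Ioi (0 : ℝ),
      radialIntegrand s (inner ℝ e X) (inner ℝ e θ.1) (fun r => profile s μ ψ Q θ.1 (X, r)) r)
      ∂(volume : Measure (RSpace n)).toSphere) / 2 := by
  obtain ⟨i1, e1⟩ := integral_polar hn
    (integrable_flatIntegrand_add_neg hn h hγ hs hs1 hB0 hμ hQ hB ha)
  have hin : ∀ θ : sphere (0 : RSpace n) 1, (∫ r in Ioi (0 : ℝ), r ^ (n - 1) *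
      ((flatIntegrand s μ e ψ Q X (r • θ.1) + flatIntegrand s μ e ψ Q X (-(r • θ.1))) / 2)) =
      (∫ r in Ioi (0 : ℝ), radialIntegrand s (inner ℝ e X) (inner ℝ e θ.1)
        (fun r => profile s μ ψ Q θ.1 (X, r)) r) / 2 := by
    intro θ
    rw [← integral_div]
    refine setIntegral_congr_fun measurableSet_Ioi fun r hr => ?_
    have hr' : (0 : ℝ) < r := hr
    have hrn : r ^ (n - 1) ≠ 0 := pow_ne_zero _ hr'.ne'
    simp only [flatIntegrand_smul h hγ _ hr', flatIntegrand_neg_smul h hγ _ hr', radialIntegrand,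
      norm_rpow_inv_eq hn hr']
    field_simp
  simp only [hin] at i1 e1
  refine ⟨(i1.const_mul (2 * (1 - s))).congr (Filter.Eventually.of_forall fun θ => ?_), ?_⟩
  · simp only; ring
  · rw [flatOp, e1, integral_const_mul, integral_div]
    ring

theorem abs_flatOp_le (hn : 1 ≤ n) (h : IsStraightening γ L e E ψ J)
    (hγ : 0 < γ) (hs₀ : 0 < s₀) (hs : s₀ ≤ s) (hs1 : s < 1) (hB0 : 0 ≤ B) (hμ : IsC1Sphere μ)
    (hQ : Continuous Q)
    (hB : ∀ θ : RSpace n, ‖θ‖ = 1 → CkHolderOn γ B univ 1 (profile s μ ψ Q θ))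
    (ha : 0 < inner ℝ e X) :
    |flatOp s μ e ψ Q X| ≤ 4 * B * (1 + 1 / s₀) * sphereArea n := by
  obtain ⟨-, e1⟩ := flatOp_polar hn h hγ (hs₀.trans_le hs) hs1 hB0 hμ hQ hB ha
  have hm : (volume : Measure (RSpace n)).toSphere.real univ = sphereArea n := by
    rw [Measure.toSphere_real_apply_univ, finrank_euclideanSpace_fin, sphereArea]
  have := norm_integral_le_of_norm_le_const (μ := (volume : Measure (RSpace n)).toSphere)
    (f := fun θ : sphere (0 : RSpace n) 1 => (1 - s) * ∫ r in Ioi (0 : ℝ),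
      radialIntegrand s (inner ℝ e X) (inner ℝ e θ.1) (fun r => profile s μ ψ Q θ.1 (X, r)) r)
    (C := 2 * (2 * B) * (1 + 1 / s₀)) (Filter.Eventually.of_forall fun θ => by
      have hθ : ‖θ.1‖ = 1 := mem_sphere_zero_iff_norm.1 θ.2
      obtain ⟨h1, h2, -, -⟩ := (hB θ.1 hθ).slice_bounds hγ hB0 X
      exact abs_integral_radialIntegrand_le hs₀ hs hs1 ha (abs_inner_le_one h.norm_dir hθ)
        (by positivity) h1 h2)
  rw [hm, Real.norm_eq_abs] at this
  rw [e1, abs_div, abs_two, div_le_iff₀ two_pos]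
  refine this.trans ?_
  have : 0 ≤ B * (1 + 1 / s₀) * sphereArea n := by
    have := sphereArea_nonneg (n := n)
    positivity
  linarith

theorem abs_flatOp_sub_le (hn : 1 ≤ n) (h : IsStraightening γ L e E ψ J)
    (hγ : 0 < γ) (hγs : γ ≤ s) (hs₀ : 0 < s₀) (hs : s₀ ≤ s) (hs1 : s < 1) (hB0 : 0 ≤ B)
    (hμ : IsC1Sphere μ) (hQ : Continuous Q)
    (hB : ∀ θ : RSpace n, ‖θ‖ = 1 → CkHolderOn γ B univ 1 (profile s μ ψ Q θ))
    {X' : RSpace n} (ha : 0 < inner ℝ e X) (ha' : 0 < inner ℝ e X') :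
    |flatOp s μ e ψ Q X - flatOp s μ e ψ Q X'| ≤
      11 * (1 + 1 / s₀) * B * sphereArea n * dist X X' ^ γ := by
  obtain ⟨i1, e1⟩ := flatOp_polar hn h hγ (hs₀.trans_le hs) hs1 hB0 hμ hQ hB ha
  obtain ⟨i2, e2⟩ := flatOp_polar hn h hγ (hs₀.trans_le hs) hs1 hB0 hμ hQ hB ha'
  have hm : (volume : Measure (RSpace n)).toSphere.real univ = sphereArea n := by
    rw [Measure.toSphere_real_apply_univ, finrank_euclideanSpace_fin, sphereArea]
  have hab : |inner ℝ e X - inner ℝ e X'| ≤ dist X X' := by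
    rw [← inner_sub_right, dist_eq_norm]
    have := abs_real_inner_le_norm e (X - X')
    rwa [h.norm_dir, one_mul] at this
  have := norm_integral_le_of_norm_le_const (μ := (volume : Measure (RSpace n)).toSphere)
    (f := fun θ : sphere (0 : RSpace n) 1 => ((1 - s) * ∫ r in Ioi (0 : ℝ),
      radialIntegrand s (inner ℝ e X) (inner ℝ e θ.1) (fun r => profile s μ ψ Q θ.1 (X, r)) r) -
      (1 - s) * ∫ r in Ioi (0 : ℝ),
      radialIntegrand s (inner ℝ e X') (inner ℝ e θ.1) (fun r => profile s μ ψ Q θ.1 (X', r)) r)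
    (C := 11 * (1 + 1 / s₀) * (2 * B) * dist X X' ^ γ) (Filter.Eventually.of_forall fun θ => by
      have hθ : ‖θ.1‖ = 1 := mem_sphere_zero_iff_norm.1 θ.2
      obtain ⟨c1, b1, -, -⟩ := (hB θ.1 hθ).slice_bounds hγ hB0 X
      obtain ⟨c2, b2, ⟨c, hc, hcr⟩, hd⟩ := (hB θ.1 hθ).slice_bounds hγ hB0 X'
      rw [← mul_sub]
      exact abs_integral_radialIntegrand_sub_le hs₀ hs hs1 hγ hγs ha ha'
        (abs_inner_le_one h.norm_dir hθ) (by positivity) hab c1 c2 b1 b2 hc hcr (hd X))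
  rw [hm, integral_sub i1 i2, Real.norm_eq_abs] at this
  rw [e1, e2, ← sub_div, abs_div, abs_two, div_le_iff₀ two_pos]
  refine this.trans (le_of_eq ?_)
  ring

end Flat


/-! ### A cutoff at the origin -/

section Cutoff

variable {n : ℕ}

/-- A Lipschitz function vanishing on the ball of radius `ε` and equal to `1` off the ball of
radius `2 ε`. -/
noncomputable def originCutoff (ε : ℝ) (y : RSpace n) : ℝ := min 1 (max 0 (‖y‖ / ε - 1))

theorem originCutoff_nonneg (ε : ℝ) (y : RSpace n) : 0 ≤ originCutoff ε y :=
  le_min zero_le_one (le_max_left _ _)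

theorem originCutoff_le_one (ε : ℝ) (y : RSpace n) : originCutoff ε y ≤ 1 := min_le_left _ _

theorem originCutoff_neg (ε : ℝ) (y : RSpace n) : originCutoff ε (-y) = originCutoff ε y := by
  unfold originCutoff; rw [norm_neg]

theorem originCutoff_of_two_mul_le {ε : ℝ} (hε : 0 < ε) {y : RSpace n} (h : 2 * ε ≤ ‖y‖) :
    originCutoff ε y = 1 := by
  have : 2 ≤ ‖y‖ / ε := by rwa [le_div_iff₀ hε]
  exact min_eq_left (le_max_of_le_right (by linarith))

theorem originCutoff_of_le {ε : ℝ} (hε : 0 < ε) {y : RSpace n} (h : ‖y‖ ≤ ε) :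
    originCutoff ε y = 0 := by
  have : ‖y‖ / ε ≤ 1 := by rwa [div_le_one hε]
  unfold originCutoff
  rw [max_eq_left (by linarith), min_eq_right zero_le_one]

theorem abs_originCutoff_sub_le {ε : ℝ} (hε : 0 < ε) (y z : RSpace n) :
    |originCutoff ε y - originCutoff ε z| ≤ |‖y‖ - ‖z‖| / ε := by
  unfold originCutoff
  refine (abs_min_sub_min_le_max _ _ _ _).trans ?_
  rw [sub_self, abs_zero]
  refine max_le (by positivity) ((abs_max_sub_max_le_max _ _ _ _).trans ?_)
  rw [sub_self, abs_zero]
  refine max_le (by positivity) (le_of_eq ?_)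
  rw [sub_sub_sub_cancel_right, ← sub_div, abs_div, abs_of_pos hε]

theorem continuous_originCutoff (ε : ℝ) : Continuous (originCutoff (n := n) ε) := by
  unfold originCutoff; fun_prop

theorem tendsto_originCutoff {y : RSpace n} (hy : y ≠ 0) :
    Filter.Tendsto (fun k : ℕ => originCutoff (1 / ((k : ℝ) + 1)) y) Filter.atTop (nhds 1) := by
  refine tendsto_const_nhds.congr' ?_
  have hr := norm_pos_iff.2 hy
  have h0 := tendsto_one_div_add_atTop_nhds_zero_nat (𝕜 := ℝ)
  filter_upwards [h0.eventually (gt_mem_nhds (half_pos hr))] with k hk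
  exact (originCutoff_of_two_mul_le (by positivity) (by linarith)).symm

end Cutoff

/-! ### The principal value under the change of variables -/

section Identity

variable {n : ℕ} {γ L B s : ℝ} {e : RSpace n} {E : RSpace n → ℝ} {ψ : RSpace n → RSpace n}
  {J ζ : RSpace n → ℝ} {μ : sphere (0 : RSpace n) 1 → ℝ} {X : RSpace n}

theorem IsStraightening.norm_bounds (h : IsStraightening γ L e E ψ J) (X Z : RSpace n) :
    ‖ψ (X + Z) - ψ X‖ ≤ L * ‖Z‖ ∧ ‖Z‖ ≤ L * ‖ψ (X + Z) - ψ X‖ := by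
  have h1 := h.lip (X + Z) X
  have h2 := h.antilip (X + Z) X
  rw [dist_eq_norm, dist_eq_norm, add_sub_cancel_left] at h1 h2
  exact ⟨h1, h2⟩

theorem abs_posPowDiff_inner_le (he : ‖e‖ = 1) (hs : 0 < s) (hs1 : s < 1)
    (ha : 0 < inner ℝ e X) (Z : RSpace n) :
    |posPowDiff s (inner ℝ e X) (inner ℝ e Z)| ≤ ‖Z‖ ^ s ∧
    |posPowDiff s (inner ℝ e X) (inner ℝ e Z)| ≤ (inner ℝ e X) ^ (s - 1) * ‖Z‖ := by
  have h1 := abs_real_inner_le_norm e Z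
  rw [he, one_mul] at h1
  exact ⟨(abs_posPowDiff_le hs.le hs1.le ha.le).trans (by gcongr),
    (abs_posPowDiff_le_mul hs.le hs1.le ha).trans (by gcongr)⟩

/-- By the Lipschitz bound on `ψ` the cutoff vanishes for `‖Z‖ ≤ ε/L`. Away from the origin no
symmetrisation is needed for integrability. -/
theorem integrable_flatIntegrand_mul_cutoff (hn : 1 ≤ n) (h : IsStraightening γ L e E ψ J)
    (hγ : 0 < γ) (hL : 0 < L) (hs : 0 < s) (hs1 : s < 1) (hB0 : 0 ≤ B) (hμ : IsC1Sphere μ)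
    {Q : RSpace n → ℝ} (hQ : Continuous Q)
    (hB : ∀ θ : RSpace n, ‖θ‖ = 1 → CkHolderOn γ B univ 1 (profile s μ ψ Q θ))
    (ha : 0 < inner ℝ e X) {ε : ℝ} (hε : 0 < ε) :
    Integrable fun Z => flatIntegrand s μ e ψ Q X Z * originCutoff ε (ψ (X + Z) - ψ X) := by
  set δ := ε / L with hδdef
  have hδ : 0 < δ := by positivity
  set D := 1 + δ ^ (s - 2) with hD
  have hD1 : 1 ≤ D := by
    have : 0 < δ ^ (s - 2) := by positivity
    linarith
  have hD0 : 0 < D := by linarith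
  refine Integrable.mono' ((integrable_ballWeight hn hs hs1).const_mul (B * D)) ?_ ?_
  · exact (aestronglyMeasurable_flatIntegrand hn h hs.le hμ hQ).mul
      ((continuous_originCutoff ε).comp ((h.continuous.comp (continuous_const_add X)).sub
        continuous_const)).aestronglyMeasurable
  · filter_upwards [ae_ne_zero hn] with Z hZ
    have hr := norm_pos_iff.2 hZ
    have hbw := ballWeight_nonneg (s := s) Z
    rw [norm_mul, Real.norm_of_nonneg (originCutoff_nonneg _ _)]
    rcases le_or_gt ‖Z‖ δ with hle | hlt
    · rw [originCutoff_of_le hε, mul_zero]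
      · positivity
      · refine (h.norm_bounds X Z).1.trans ?_
        calc L * ‖Z‖ ≤ L * δ := by gcongr
          _ = ε := by rw [hδdef]; field_simp
    · have h1 : ‖flatIntegrand s μ e ψ Q X Z‖ ≤
          B * (‖Z‖ ^ s * (‖Z‖ ^ ((n : ℝ) + 2 * s))⁻¹) := by
        refine (abs_flatIntegrand_le h hγ hB hZ).trans ?_
        calc _ ≤ ‖Z‖ ^ s * B * (‖Z‖ ^ ((n : ℝ) + 2 * s))⁻¹ := by
              gcongr
              exact (abs_posPowDiff_inner_le h.norm_dir hs hs1 ha Z).1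
          _ = _ := by ring
      have h2 := mul_inv_le_ballWeight hn hs1.le hZ (x := ‖Z‖ ^ s / D) (by
        rw [div_le_iff₀ hD0]
        have : ‖Z‖ ^ s = ‖Z‖ ^ 2 * ‖Z‖ ^ (s - 2) := by
          rw [← Real.rpow_natCast, ← Real.rpow_add hr]; norm_num
        rw [this]
        gcongr
        have : ‖Z‖ ^ (s - 2) ≤ δ ^ (s - 2) :=
          Real.rpow_le_rpow_of_nonpos hδ hlt.le (by linarith)
        linarith) (div_le_self (by positivity) hD1)
      rw [div_mul_eq_mul_div, div_le_iff₀ hD0] at h2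
      calc _ ≤ (B * (‖Z‖ ^ s * (‖Z‖ ^ ((n : ℝ) + 2 * s))⁻¹)) * 1 := by
            gcongr
            · exact originCutoff_nonneg _ _
            · exact originCutoff_le_one _ _
        _ ≤ (B * (ballWeight n s Z * D)) * 1 := by gcongr
        _ = _ := by ring

/-- The cutoff is even in `y` but not in `Z`. The lengths `‖ψ(X ± Z) - ψ(X)‖` differ by `O(‖Z‖²)`,
and the two cutoffs agree once `‖Z‖ ≥ 2Lε`, so their difference is at most `O(‖Z‖²/ε) = O(‖Z‖)`.
This extra factor makes the asymmetric part integrable uniformly in `ε`. -/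
theorem exists_flat_cutoff_le (hn : 1 ≤ n) (h : IsStraightening γ L e E ψ J)
    (hγ : 0 < γ) (hγ1 : γ ≤ 1) (hL : 0 < L) (hs : 0 < s) (hs1 : s < 1) (hB0 : 0 ≤ B)
    {Q : RSpace n → ℝ}
    (hB : ∀ θ : RSpace n, ‖θ‖ = 1 → CkHolderOn γ B univ 1 (profile s μ ψ Q θ))
    (ha : 0 < inner ℝ e X) :
    ∃ D, ∀ ε : ℝ, 0 < ε → ∀ Z ≠ 0,
      |flatIntegrand s μ e ψ Q X Z * originCutoff ε (ψ (X + Z) - ψ X) +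
        flatIntegrand s μ e ψ Q X (-Z) * originCutoff ε (ψ (X + -Z) - ψ X)| ≤
        D * ballWeight n s Z := by
  obtain ⟨C₁, hC₁, H₁⟩ := exists_ckHolderOn_chord (n := n) hγ hγ1 hL
  set a := inner ℝ e X with hadef
  set D₁ := B * (2 * a ^ (s - 2) + 4 * a ^ (s - 1) + 6) with hD₁
  set D₂ := 1 + a ^ (s - 1) * (4 * L * C₁) with hD₂
  have ha1 : 0 < a ^ (s - 1) := by positivity
  have hD₂1 : 1 ≤ D₂ := by
    have : 0 ≤ a ^ (s - 1) * (4 * L * C₁) := by positivity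
    linarith
  have hD₂0 : 0 < D₂ := by linarith
  refine ⟨D₁ + B * D₂, fun ε hε Z hZ => ?_⟩
  have hr := norm_pos_iff.2 hZ
  set c₁ := originCutoff ε (ψ (X + Z) - ψ X) with hc₁
  set c₂ := originCutoff ε (ψ (X + -Z) - ψ X) with hc₂
  have e1 : flatIntegrand s μ e ψ Q X Z * c₁ + flatIntegrand s μ e ψ Q X (-Z) * c₂ =
      (flatIntegrand s μ e ψ Q X Z + flatIntegrand s μ e ψ Q X (-Z)) * c₁ +
        flatIntegrand s μ e ψ Q X (-Z) * (c₂ - c₁) := by ring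
  have hΔ1 : |c₂ - c₁| ≤ 1 := by
    have h1 := originCutoff_nonneg ε (ψ (X + Z) - ψ X)
    have h2 := originCutoff_nonneg ε (ψ (X + -Z) - ψ X)
    have h3 := originCutoff_le_one ε (ψ (X + Z) - ψ X)
    have h4 := originCutoff_le_one ε (ψ (X + -Z) - ψ X)
    rw [abs_le]
    constructor <;> linarith
  have hΔ2 : |c₂ - c₁| ≤ 4 * L * C₁ * ‖Z‖ := by
    obtain ⟨b1, b2⟩ := h.norm_bounds X Z
    obtain ⟨b3, b4⟩ := h.norm_bounds X (-Z)
    rw [norm_neg] at b4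
    by_cases hbig : 2 * ε ≤ ‖Z‖ / L
    · rw [hc₁, hc₂, originCutoff_of_two_mul_le hε, originCutoff_of_two_mul_le hε, sub_self,
        abs_zero]
      · positivity
      · refine hbig.trans ?_
        rw [div_le_iff₀ hL]; linarith
      · refine hbig.trans ?_
        rw [div_le_iff₀ hL]; linarith
    · push Not at hbig
      obtain ⟨θ, hθ, hZθ⟩ := exists_smul_eq hZ
      refine (abs_originCutoff_sub_le hε _ _).trans ?_
      have hnn : |‖ψ (X + -Z) - ψ X‖ - ‖ψ (X + Z) - ψ X‖| ≤ ‖Z‖ * (C₁ * (2 * ‖Z‖)) := by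
        have y1 := h.sub_eq_smul_chord hγ θ X ‖Z‖
        have y2 := h.sub_eq_smul_chord hγ θ X (-‖Z‖)
        rw [neg_smul, ← hZθ] at y2
        rw [← hZθ] at y1
        rw [y1, y2, norm_smul, norm_smul, norm_neg, norm_norm, ← mul_sub, abs_mul,
          abs_of_pos hr]
        gcongr
        refine (abs_norm_sub_norm_le _ _).trans (((H₁ e E ψ J h θ hθ).norm_sub_le _ _).trans ?_)
        gcongr
        rw [Prod.mk_sub_mk, sub_self, Prod.norm_def, norm_zero]
        refine max_le (by positivity) (le_of_eq ?_)
        rw [Real.norm_eq_abs, show -‖Z‖ - ‖Z‖ = -(2 * ‖Z‖) by ring, abs_neg,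
          abs_of_pos (by positivity)]
      rw [div_le_iff₀ hε]
      refine hnn.trans ?_
      rw [div_lt_iff₀ hL] at hbig
      have : 0 ≤ C₁ * ‖Z‖ := by positivity
      nlinarith
  have hN : |flatIntegrand s μ e ψ Q X (-Z) * (c₂ - c₁)| ≤ B * D₂ * ballWeight n s Z := by
    have h1 := abs_flatIntegrand_le (X := X) h hγ hB (neg_ne_zero.2 hZ)
    rw [norm_neg] at h1
    obtain ⟨p1, p2⟩ := abs_posPowDiff_inner_le h.norm_dir hs hs1 ha (-Z)
    rw [norm_neg] at p1 p2
    set p := |posPowDiff s a (inner ℝ e (-Z))| with hp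
    have hp0 : 0 ≤ p := abs_nonneg _
    have h2 := mul_inv_le_ballWeight hn hs1.le hZ (x := p * |c₂ - c₁| / D₂) (by
      rw [div_le_iff₀ hD₂0]
      calc p * |c₂ - c₁| ≤ (a ^ (s - 1) * ‖Z‖) * (4 * L * C₁ * ‖Z‖) := by gcongr
        _ = ‖Z‖ ^ 2 * (D₂ - 1) := by rw [hD₂]; ring
        _ ≤ _ := by gcongr; linarith) (by
      rw [div_le_iff₀ hD₂0]
      calc p * |c₂ - c₁| ≤ ‖Z‖ ^ s * 1 := by gcongr
        _ ≤ _ := by gcongr)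
    rw [div_mul_eq_mul_div, div_le_iff₀ hD₂0] at h2
    rw [abs_mul]
    calc _ ≤ (p * B * (‖Z‖ ^ ((n : ℝ) + 2 * s))⁻¹) * |c₂ - c₁| := by gcongr
      _ = B * (p * |c₂ - c₁| * (‖Z‖ ^ ((n : ℝ) + 2 * s))⁻¹) := by ring
      _ ≤ B * (ballWeight n s Z * D₂) := by gcongr
      _ = _ := by ring
  rw [e1]
  refine (abs_add_le _ _).trans ?_
  rw [add_mul D₁]
  refine add_le_add ?_ hN
  rw [abs_mul, abs_of_nonneg (originCutoff_nonneg _ _)]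
  exact (mul_le_of_le_one_right (abs_nonneg _) (originCutoff_le_one _ _)).trans
    (abs_flatIntegrand_add_neg_le hn h hγ hs hs1 hB0 hB ha hZ)

/-- Change of variables to straightened coordinates centered at `X`. -/
theorem IsStraightening.integral_comp (h : IsStraightening γ L e E ψ J) (X : RSpace n)
    (g : RSpace n → ℝ) :
    (Integrable g ↔ Integrable fun Z => J (X + Z) * g (ψ (X + Z) - ψ X)) ∧
    ∫ y, g y = ∫ Z, J (X + Z) * g (ψ (X + Z) - ψ X) := by
  set f : RSpace n → RSpace n := fun Z => ψ (X + Z) - ψ X with hf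
  have hd : ∀ Z ∈ (univ : Set (RSpace n)),
      HasFDerivWithinAt f (fderiv ℝ ψ (X + Z)) univ Z := fun Z _ => by
    have h1 := (h.differentiable (X + Z)).hasFDerivAt.comp Z ((hasFDerivAt_id Z).const_add X)
    rw [ContinuousLinearMap.comp_id] at h1
    exact (h1.sub_const (ψ X)).hasFDerivWithinAt
  have hinj : InjOn f univ := fun Z _ W _ hZW => by
    have := h.bijective.1 (sub_left_injective hZW)
    exact add_left_cancel this
  have himg : f '' univ = univ := by
    rw [image_univ]
    refine Set.range_eq_univ.2 fun y => ?_
    obtain ⟨W, hW⟩ := h.bijective.2 (y + ψ X)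
    exact ⟨W - X, by simp [hf, hW]⟩
  have h1 := integrableOn_image_iff_integrableOn_abs_det_fderiv_smul volume MeasurableSet.univ
    hd hinj g
  have h2 := integral_image_eq_integral_abs_det_fderiv_smul volume MeasurableSet.univ hd hinj g
  rw [himg] at h1 h2
  simp only [h.abs_det, smul_eq_mul, integrableOn_univ, Measure.restrict_univ] at h1 h2
  exact ⟨h1, h2⟩

/-- The operator applied to `(E₊)ˢ ζ` splits into a regular part and a part which is explicit in
straightened coordinates. -/
theorem stableOp_eq_add_flatOp (hn : 1 ≤ n) (h : IsStraightening γ L e E ψ J)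
    (hγ : 0 < γ) (hγ1 : γ ≤ 1) (hL : 0 < L) (hs : 0 < s) (hs1 : s < 1) (hB0 : 0 ≤ B)
    (hμ : IsC1Sphere μ) (hζ : Continuous ζ) (hJ : Continuous J)
    (hB : ∀ θ : RSpace n, ‖θ‖ = 1 →
      CkHolderOn γ B univ 1 (profile s μ ψ (fun Y => ζ (ψ Y) * J Y) θ))
    (ha : 0 < inner ℝ e X)
    (hiu : Integrable (stableIntegrand s μ (fun y => max (E y) 0 ^ s * ζ y) (ψ X)))
    (hiζ : Integrable (stableIntegrand s μ ζ (ψ X))) :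
    stableOp s μ (fun y => max (E y) 0 ^ s * ζ y) (ψ X) =
      (inner ℝ e X) ^ s * stableOp s μ ζ (ψ X) + flatOp s μ e ψ (fun Y => ζ (ψ Y) * J Y) X := by
  set Q : RSpace n → ℝ := fun Y => ζ (ψ Y) * J Y with hQdef
  have hQ : Continuous Q := (hζ.comp h.continuous).mul hJ
  set a := inner ℝ e X with hadef
  set x := ψ X with hx
  set u : RSpace n → ℝ := fun y => max (E y) 0 ^ s * ζ y with hu
  have hEx : E x = a := h.height X
  obtain ⟨i1, e1⟩ := integral_stableIntegrand hiu
  obtain ⟨i2, e2⟩ := integral_stableIntegrand hiζ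
  -- The part left after removing `a^s` times the integrand for `ζ`. Only its symmetrisation is
  -- known to be integrable: `m` itself may be singular like `|y|^(1-n-2s)`, which is not integrable
  -- when `s ≥ 1/2`.
  set m : RSpace n → ℝ := fun y =>
    (max (E (x + y)) 0 ^ s - a ^ s) * ζ (x + y) * evenKernel s μ y with hm
  have hS : ∀ y, secondDiff u x y * evenKernel s μ y -
      a ^ s * (secondDiff ζ x y * evenKernel s μ y) = (m y + m (-y)) / 2 := by
    intro y
    have : max (E x) 0 = a := by rw [hEx, max_eq_left ha.le]
    simp only [secondDiff, hu, hm, evenKernel_neg, this, ← sub_eq_add_neg]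
    ring
  have iS : Integrable fun y => (m y + m (-y)) / 2 :=
    (i1.sub (i2.const_mul (a ^ s))).congr (Filter.Eventually.of_forall hS)
  have eS : stableOp s μ u x = a ^ s * stableOp s μ ζ x + (1 - s) * ∫ y, (m y + m (-y)) / 2 := by
    rw [e1, e2]
    simp only [← hS]
    rw [integral_sub i1 (i2.const_mul _), integral_const_mul]
    ring
  rw [eS, flatOp]
  congr 2
  have hmN : ∀ Z, J (X + Z) * m (ψ (X + Z) - x) = flatIntegrand s μ e ψ Q X Z := by
    intro Z
    simp only [hm, flatIntegrand, hQdef, add_sub_cancel, h.height, posPowDiff, inner_add_right]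
    ring
  -- With the cutoff in place the unsymmetrised functions are integrable. Symmetrising in `y` on one
  -- side and in `Z` on the other then leaves the integral unchanged, and the change of variables is
  -- legitimate.
  have hcut : ∀ ε : ℝ, 0 < ε → ∫ y, (m y + m (-y)) / 2 * originCutoff ε y =
      ∫ Z, (flatIntegrand s μ e ψ Q X Z * originCutoff ε (ψ (X + Z) - ψ X) +
        flatIntegrand s μ e ψ Q X (-Z) * originCutoff ε (ψ (X + -Z) - ψ X)) / 2 := by
    intro ε hε
    have iN := integrable_flatIntegrand_mul_cutoff hn h hγ hL hs hs1 hB0 hμ hQ hB ha hε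
    obtain ⟨c1, c2⟩ := h.integral_comp X (fun y => m y * originCutoff ε y)
    simp only [← mul_assoc, ← hx, hmN] at c1 c2 iN ⊢
    have im := c1.2 iN
    have hsym : ∀ {g : RSpace n → ℝ}, Integrable g → ∫ y, (g y + g (-y)) / 2 = ∫ y, g y := by
      intro g hg
      rw [integral_div, integral_add hg (integrable_comp_neg hg), integral_neg_eq_self]
      ring
    rw [hsym iN, ← c2, ← hsym im]
    refine integral_congr_ae (Filter.Eventually.of_forall fun y => ?_)
    simp only [originCutoff_neg]
    ring
  have t1 : Filter.Tendsto (fun k : ℕ => ∫ y, (m y + m (-y)) / 2 *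
      originCutoff (1 / ((k : ℝ) + 1)) y) Filter.atTop (nhds (∫ y, (m y + m (-y)) / 2)) := by
    refine tendsto_integral_of_dominated_convergence (fun y => ‖(m y + m (-y)) / 2‖)
      (fun k => iS.1.mul (continuous_originCutoff _).aestronglyMeasurable) iS.norm
      (fun k => Filter.Eventually.of_forall fun y => ?_) ?_
    · rw [norm_mul, Real.norm_of_nonneg (originCutoff_nonneg _ _)]
      exact mul_le_of_le_one_right (norm_nonneg _) (originCutoff_le_one _ _)
    · filter_upwards [ae_ne_zero hn] with y hy
      simpa using (tendsto_originCutoff hy).const_mul ((m y + m (-y)) / 2)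
  have t2 : Filter.Tendsto (fun k : ℕ => ∫ Z, (flatIntegrand s μ e ψ Q X Z *
      originCutoff (1 / ((k : ℝ) + 1)) (ψ (X + Z) - ψ X) + flatIntegrand s μ e ψ Q X (-Z) *
        originCutoff (1 / ((k : ℝ) + 1)) (ψ (X + -Z) - ψ X)) / 2) Filter.atTop
      (nhds (∫ Z, (flatIntegrand s μ e ψ Q X Z + flatIntegrand s μ e ψ Q X (-Z)) / 2)) := by
    obtain ⟨D, hD⟩ := exists_flat_cutoff_le (μ := μ) (X := X) hn h hγ hγ1 hL hs hs1 hB0 hB ha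
    have hne : ∀ Z ≠ 0, ψ (X + Z) - ψ X ≠ 0 := fun Z hZ h0 => by
      have := (h.norm_bounds X Z).2
      rw [h0, norm_zero, mul_zero] at this
      exact hZ (norm_le_zero_iff.1 this)
    refine tendsto_integral_of_dominated_convergence (fun Z => D * ballWeight n s Z)
      (fun k => ?_) ((integrable_ballWeight hn hs hs1).const_mul D) (fun k => ?_) ?_
    · have iN := integrable_flatIntegrand_mul_cutoff (ε := 1 / ((k : ℝ) + 1)) hn h hγ hL hs hs1
        hB0 hμ hQ hB ha (by positivity)
      exact ((iN.add (integrable_comp_neg iN)).div_const 2).1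
    · filter_upwards [ae_ne_zero hn] with Z hZ
      have := hD (1 / ((k : ℝ) + 1)) (by positivity) Z hZ
      rw [norm_div, Real.norm_two, Real.norm_eq_abs]
      linarith [abs_nonneg (flatIntegrand s μ e ψ Q X Z *
        originCutoff (1 / ((k : ℝ) + 1)) (ψ (X + Z) - ψ X) + flatIntegrand s μ e ψ Q X (-Z) *
        originCutoff (1 / ((k : ℝ) + 1)) (ψ (X + -Z) - ψ X))]
    · filter_upwards [ae_ne_zero hn] with Z hZ
      have l1 := (tendsto_originCutoff (hne Z hZ)).const_mul (flatIntegrand s μ e ψ Q X Z)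
      have l2 := (tendsto_originCutoff (hne (-Z) (neg_ne_zero.2 hZ))).const_mul
        (flatIntegrand s μ e ψ Q X (-Z))
      have := (l1.add l2).div_const 2
      rwa [mul_one, mul_one] at this
  refine tendsto_nhds_unique t1 (t2.congr fun k => (hcut _ (by positivity)).symm)

end Identity


/-! ### Absolute convergence, and points away from the support -/

section Indicator

variable {n : ℕ} {γ M : ℝ≥0} {s s₀ : ℝ} {Ω : Set (RSpace n)} {d ζ : RSpace n → ℝ}
  {μ : sphere (0 : RSpace n) 1 → ℝ}

theorem measurable_indicator_rpow_mul (hΩ : IsOpen Ω) (hd : ContinuousOn d Ω)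
    (hpos : ∀ x ∈ Ω, 0 < d x) (hζ : Continuous ζ) :
    Measurable (Ω.indicator fun x => d x ^ s * ζ x) := by
  have h1 : ContinuousOn (fun x => d x ^ s * ζ x) Ω :=
    (hd.rpow_const fun x hx => Or.inl (hpos x hx).ne').mul hζ.continuousOn
  classical
  rw [← piecewise_eq_indicator]
  exact h1.measurable_piecewise continuousOn_const hΩ.measurableSet

theorem abs_indicator_rpow_mul_le {D N : ℝ} (hD0 : 0 ≤ D) (hs : 0 ≤ s) (hs1 : s ≤ 1) (hD : ∀ x ∈ Ω, |d x| ≤ D)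
    (hpos : ∀ x ∈ Ω, 0 < d x) (hN : ∀ x, |ζ x| ≤ N) (x : RSpace n) :
    |Ω.indicator (fun x => d x ^ s * ζ x) x| ≤ (1 + D) * N := by
  have hN0 : 0 ≤ N := (abs_nonneg _).trans (hN x)
  by_cases hx : x ∈ Ω
  · rw [indicator_of_mem hx, abs_mul]
    have h0 := hpos x hx
    have hDx : d x ≤ D := (le_abs_self _).trans (hD x hx)
    have : |d x ^ s| ≤ 1 + D := by
      rw [abs_of_pos (by positivity)]
      calc d x ^ s ≤ (1 + D) ^ s := by gcongr; linarith
        _ ≤ (1 + D) ^ (1 : ℝ) := by gcongr; linarith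
        _ = _ := Real.rpow_one _
    exact mul_le_mul this (hN x) (abs_nonneg _) (by linarith)
  · rw [indicator_of_notMem hx, abs_zero]
    positivity

theorem integrable_stableIntegrand_indicator (hn : 1 ≤ n) (hs : 0 < s) (hs1 : s < 1)
    (hμ : IsC1Sphere μ) (hb : ∀ θ, ‖μ θ‖ ≤ M) (hΩ : IsOpen Ω) (hd : ContDiffOn ℝ 2 d Ω)
    (hpos : ∀ x ∈ Ω, 0 < d x) {D N : ℝ} (hD0 : 0 ≤ D) (hD : ∀ x ∈ Ω, |d x| ≤ D) (hζ : ContDiff ℝ 2 ζ)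
    (hN : ∀ x, |ζ x| ≤ N) {x : RSpace n} (hx : x ∈ Ω) :
    Integrable (stableIntegrand s μ (Ω.indicator fun x => d x ^ s * ζ x) x) := by
  have hc : ContDiffAt ℝ 2 (Ω.indicator fun x => d x ^ s * ζ x) x := by
    have h1 : ContDiffAt ℝ 2 (fun x => d x ^ s * ζ x) x :=
      ((hd.contDiffAt (hΩ.mem_nhds hx)).rpow_const_of_ne (hpos x hx).ne').mul hζ.contDiffAt
    refine h1.congr_of_eventuallyEq ?_
    filter_upwards [hΩ.mem_nhds hx] with y hy
    rw [indicator_of_mem hy]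
  obtain ⟨C, hC, hCb⟩ := exists_secondDiff_le_of_contDiffAt
    (abs_indicator_rpow_mul_le hD0 hs.le hs1.le hD hpos hN) hc
  exact integrable_stableIntegrand hn hs hs1 hμ hb
    (measurable_indicator_rpow_mul hΩ hd.continuousOn hpos hζ.continuous) hC hCb

/-- Away from the support of `u`, the function `L u` is Hölder continuous. -/
theorem exists_holderBdd_stableOp_far (hn : 1 ≤ n) (hγ1 : γ ≤ 1) (x₀ : RSpace n) {ρ δ R U : ℝ}
    (hδ : 0 < δ) (hU : 0 ≤ U) :
    ∃ C, 0 ≤ C ∧ ∀ s, 0 < s → s < 1 → ∀ μ : sphere (0 : RSpace n) 1 → ℝ, IsC1Sphere μ →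
      sphereC1HolderNorm γ μ ≤ M → ∀ u : RSpace n → ℝ, Measurable u → (∀ x, |u x| ≤ U) →
      (∀ x ∉ closedBall x₀ ρ, u x = 0) → ∀ A : Set (RSpace n),
      (∀ x ∈ A, ρ + δ ≤ dist x x₀ ∧ dist x x₀ ≤ R) →
      (∀ x ∈ A, Integrable (stableIntegrand s μ u x)) → HolderBdd γ C A (stableOp s μ u) := by
  obtain ⟨C, hC, H⟩ := ckHolderOn_evenKernel (n := n) (M := M) (c := δ / 2) (R := R + ρ + 1) hγ1
    (by positivity)
  set W := volume.real (closedBall x₀ ρ) with hW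
  refine ⟨U * C * W, by positivity, fun s hs hs1 μ hμ hM u hu hUb hu0 A hA hi => ?_⟩
  have hK := (H s hs hs1 μ hμ hM).1
  have hmem : ∀ x ∈ A, ∀ w ∈ closedBall x₀ ρ, w - x ∈ annulus n (δ / 2) (R + ρ + 1) := by
    intro x hx w hw
    obtain ⟨h1, h2⟩ := hA x hx
    rw [mem_closedBall] at hw
    have h3 := dist_triangle x w x₀
    have h4 := dist_triangle_right w x x₀
    rw [dist_comm x w] at h3
    rw [dist_eq_norm w x] at h3 h4
    constructor <;> linarith
  have hKm := aestronglyMeasurable_evenKernel (s := s) hn hμ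
  have hgm : ∀ x, AEStronglyMeasurable fun w => u w * evenKernel s μ (w - x) := fun x =>
    hu.aestronglyMeasurable.mul (hKm.comp_quasiMeasurePreserving
      (measurePreserving_sub_right volume x).quasiMeasurePreserving)
  have hsupp : ∀ (f : RSpace n → ℝ) (D : ℝ), AEStronglyMeasurable f → (∀ w ∈ closedBall x₀ ρ,
      |f w| ≤ D) → (∀ w ∉ closedBall x₀ ρ, f w = 0) → Integrable f ∧ |∫ w, f w| ≤ D * W := by
    intro f D hf hb h0
    have e : (closedBall x₀ ρ).indicator f = f := by
      ext w
      by_cases hw : w ∈ closedBall x₀ ρ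
      · rw [indicator_of_mem hw]
      · rw [indicator_of_notMem hw, h0 w hw]
    have hfin : volume (closedBall x₀ ρ) < ∞ := measure_closedBall_lt_top
    constructor
    · rw [← e, integrable_indicator_iff measurableSet_closedBall]
      exact Measure.integrableOn_of_bounded hfin.ne hf (M := D) (by
        filter_upwards [ae_restrict_mem measurableSet_closedBall] with w hw
        exact hb w hw)
    · rw [← e, integral_indicator measurableSet_closedBall]
      exact norm_setIntegral_le_of_norm_le_const (f := f) hfin hb
  -- Since `u x = 0`, the second difference is the average of `u (x ± y)`. The operator becomes an
  -- integral of `u` against the kernel away from its singularity, and its regularity in `x` is that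
  -- of the kernel, not of `u`.
  have hx1 : ∀ x ∈ A, Integrable (fun w => u w * evenKernel s μ (w - x)) ∧
      stableOp s μ u x = (1 - s) * ∫ w, u w * evenKernel s μ (w - x) := by
    intro x hx
    obtain ⟨i1, -⟩ := hsupp _ (U * C) (hgm x) (fun w hw => by
      rw [abs_mul]
      exact mul_le_mul (hUb w) (hK.1 _ (hmem x hx w hw)) (abs_nonneg _) hU)
      (fun w hw => by rw [hu0 w hw, zero_mul])
    refine ⟨i1, ?_⟩
    have hux : u x = 0 := hu0 x fun h => by
      have := (hA x hx).1
      rw [mem_closedBall] at h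
      linarith
    rw [(integral_stableIntegrand (hi x hx)).2]
    congr 1
    have i2 : Integrable fun y => u (x + y) * evenKernel s μ y := by
      simpa using i1.comp_add_left x
    have e2 : ∫ w, u w * evenKernel s μ (w - x) = ∫ y, u (x + y) * evenKernel s μ y := by
      rw [← integral_add_left_eq_self _ x]
      simp
    rw [e2]
    have e3 : ∀ y, secondDiff u x y * evenKernel s μ y =
        (u (x + y) * evenKernel s μ y + u (x + -y) * evenKernel s μ (-y)) / 2 := fun y => by
      rw [secondDiff, hux, evenKernel_neg, ← sub_eq_add_neg]
      ring
    simp only [e3]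
    rw [integral_div, integral_add i2 (integrable_comp_neg i2),
      integral_neg_eq_self (fun y => u (x + y) * evenKernel s μ y)]
    ring
  have h1s : |1 - s| ≤ 1 := by rw [abs_of_pos (by linarith)]; linarith
  refine ⟨fun x hx => ?_, fun x hx z hz => ?_⟩
  · obtain ⟨i1, e1⟩ := hx1 x hx
    rw [e1, Real.norm_eq_abs, abs_mul]
    have := (hsupp _ (U * C) (hgm x) (fun w hw => by
      rw [abs_mul]
      exact mul_le_mul (hUb w) (hK.1 _ (hmem x hx w hw)) (abs_nonneg _) hU)
      (fun w hw => by rw [hu0 w hw, zero_mul])).2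
    exact (mul_le_of_le_one_left (abs_nonneg _) h1s).trans this
  · obtain ⟨i1, e1⟩ := hx1 x hx
    obtain ⟨i2, e2⟩ := hx1 z hz
    rw [e1, e2, ← mul_sub, ← integral_sub i1 i2, Real.norm_eq_abs, abs_mul]
    refine (mul_le_of_le_one_left (abs_nonneg _) h1s).trans ?_
    have := (hsupp (fun w => u w * evenKernel s μ (w - x) - u w * evenKernel s μ (w - z))
      (U * (C * dist x z ^ (γ : ℝ))) ((hgm x).sub (hgm z)) (fun w hw => by
        rw [← mul_sub, abs_mul]
        refine mul_le_mul (hUb w) ?_ (abs_nonneg _) hU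
        have := hK.2 _ (hmem x hx w hw) _ (hmem z hz w hw)
        rwa [dist_sub_left] at this) (fun w hw => by rw [hu0 w hw]; ring)).2
    refine this.trans (le_of_eq ?_)
    ring

end Indicator

/-! ### Local estimates near the boundary -/

section Local

variable {n : ℕ} {γ M : ℝ≥0} {s₀ L : ℝ} {Ω : Set (RSpace n)} {d : RSpace n → ℝ}

/-- Uniform Hölder bounds for `L (d ^ s ζ)` on `Ω`, for `C^{2,γ}` functions `ζ` supported in a
small ball centered at `x₀`. -/
def LocalHolderBound (γ M : ℝ≥0) (s₀ : ℝ) (Ω : Set (RSpace n)) (d : RSpace n → ℝ)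
    (x₀ : RSpace n) : Prop :=
  ∃ ρ, 0 < ρ ∧ ∀ N : ℝ, ∃ C, 0 ≤ C ∧ ∀ s, s₀ ≤ s → s < 1 → γ ≤ s →
    ∀ μ : sphere (0 : RSpace n) 1 → ℝ, IsC1Sphere μ → sphereC1HolderNorm γ μ ≤ M →
    ∀ ζ : RSpace n → ℝ, ContDiff ℝ 2 ζ → CkHolderOn γ N univ 2 ζ →
    (∀ x ∉ closedBall x₀ ρ, ζ x = 0) →
    HolderBdd γ C Ω (stableOp s μ (Ω.indicator fun x => d x ^ s * ζ x))

theorem IsStraightening.abs_sub_le {γ : ℝ} {e : RSpace n} {E : RSpace n → ℝ}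
    {ψ : RSpace n → RSpace n} {J : RSpace n → ℝ} (h : IsStraightening γ L e E ψ J)
    (x y : RSpace n) : |E x - E y| ≤ L * dist x y := by
  obtain ⟨X, rfl⟩ := h.bijective.2 x
  obtain ⟨Y, rfl⟩ := h.bijective.2 y
  rw [h.height, h.height, ← inner_sub_right]
  have := abs_real_inner_le_norm e (X - Y)
  rw [h.norm_dir, one_mul, ← dist_eq_norm] at this
  exact this.trans (h.antilip X Y)

/-- The splitting `E^s Lζ + flatOp` is estimated term by term. The second term is evaluated at the
straightened point `Φ x`, and `Φ` is Lipschitz by the lower bound on `ψ`. -/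
theorem exists_holderBdd_stableOp_near (hn : 1 ≤ n) (hγ : 0 < γ) (hγ1 : γ ≤ 1) (hs₀ : 0 < s₀)
    (hL : 0 < L) {e : RSpace n} {E : RSpace n → ℝ} {ψ : RSpace n → RSpace n} {J : RSpace n → ℝ}
    (h : IsStraightening γ L e E ψ J) (x₀ : RSpace n) {R : ℝ} (hR : 0 < R) (N : ℝ) :
    ∃ C, 0 ≤ C ∧ ∀ s, s₀ ≤ s → s < 1 → γ ≤ s →
      ∀ μ : sphere (0 : RSpace n) 1 → ℝ, IsC1Sphere μ → sphereC1HolderNorm γ μ ≤ M →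
      ∀ ζ : RSpace n → ℝ, CkHolderOn γ N univ 2 ζ → ∀ A : Set (RSpace n), A ⊆ ball x₀ R →
      (∀ x ∈ A, 0 < E x) →
      (∀ x ∈ A, Integrable (stableIntegrand s μ (fun y => max (E y) 0 ^ s * ζ y) x)) →
      HolderBdd γ C A (stableOp s μ fun y => max (E y) 0 ^ s * ζ y) := by
  have hγ' : (0 : ℝ) < γ := hγ
  have hγ1' : (γ : ℝ) ≤ 1 := by exact_mod_cast hγ1
  obtain ⟨C₁, hC₁, H₁⟩ := CkHolderOn.comp (k := 0) (γ := γ) (A := (univ : Set (RSpace n)))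
    (A' := (univ : Set (RSpace n))) hγ'.le isOpen_univ (F := ℝ) N L L hL.le
  obtain ⟨C₂, hC₂, H₂⟩ := CkHolderOn.bilin (γ := γ) (k := 1) (A := (univ : Set (RSpace n)))
    isOpen_univ (ContinuousLinearMap.mul ℝ ℝ) C₁ L
  obtain ⟨B, hB0, HB⟩ := exists_ckHolderOn_profile (n := n) (M := M) hγ hγ1 hL C₂
  have hA0 : 0 ≤ sphereArea n := sphereArea_nonneg
  set S := sphereArea n * (1 + 1 / s₀) with hS
  have hS0 : 0 ≤ S := by positivity
  set V := (1 + (|E x₀| + L * R)) + (1 + L) * (1 + 2 * R) with hV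
  have hV0 : 0 ≤ V := by positivity
  set C₃ := 2 * |N| * M * S with hC₃
  have hC₃0 : 0 ≤ C₃ := by positivity
  set C₄ := 11 * B * S * (1 + L ^ (γ : ℝ)) with hC₄
  have hLγ : 0 ≤ L ^ (γ : ℝ) := by positivity
  have hC₄0 : 0 ≤ C₄ := by positivity
  refine ⟨2 * (V * C₃) + C₄, by positivity, fun s hs hs1 hγs μ hμ hM ζ hζ A hAR hE hi => ?_⟩
  have hs' : 0 < s := hs₀.trans_le hs
  have hb := (sphere_bounds_of_sphereC1HolderNorm_le hM).1
  have hζc : Continuous ζ := hζ.continuous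
  have hJc : Continuous J := h.ckHolderOn_jac.continuous
  have hN0 : 0 ≤ N := (norm_nonneg _).trans (hζ.1.1 x₀ trivial)
  obtain ⟨iζ, bζ⟩ := stableOp_bounds_of_ckHolderOn hn hs₀ hs hs1 hμ hb hN0 hζ hζc.measurable
  have hQ : CkHolderOn γ C₂ univ 1 (fun Y => ζ (ψ Y) * J Y) :=
    H₂ _ J (H₁ ζ ψ hζ.of_succ (mapsTo_univ _ _) (fun x _ y _ => h.lip x y)
      (fun X _ => h.differentiable X) h.ckHolderOn_fderiv.1) h.ckHolderOn_jac
  have hprof : ∀ θ : RSpace n, ‖θ‖ = 1 →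
      CkHolderOn γ B univ 1 (profile s μ ψ (fun Y => ζ (ψ Y) * J Y) θ) := fun θ hθ =>
    HB e E ψ J h _ hQ s hs' hs1 μ hμ hM θ hθ
  have hQc : Continuous fun Y => ζ (ψ Y) * J Y := hQ.continuous
  set Φ := Function.surjInv h.bijective.2 with hΦ
  have hψΦ : ∀ x, ψ (Φ x) = x := Function.surjInv_eq h.bijective.2
  have hinner : ∀ x, inner ℝ e (Φ x) = E x := fun x => by rw [← h.height, hψΦ]
  have hid : ∀ x ∈ A, stableOp s μ (fun y => max (E y) 0 ^ s * ζ y) x =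
      E x ^ s * stableOp s μ ζ x + flatOp s μ e ψ (fun Y => ζ (ψ Y) * J Y) (Φ x) := by
    intro x hx
    have hix := hi x hx
    have := stableOp_eq_add_flatOp (X := Φ x) hn h hγ' hγ1' hL hs' hs1 hB0 hμ hζc hJc hprof
      (by rw [hinner]; exact hE x hx) (by rw [hψΦ]; exact hix) (iζ _)
    rwa [hψΦ, hinner] at this
  have hEb : ∀ x ∈ A, |E x| ≤ |E x₀| + L * R := fun x hx => by
    have h1 := h.abs_sub_le x x₀
    have h2 : dist x x₀ ≤ R := le_of_lt (hAR hx)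
    have h3 : E x = (E x - E x₀) + E x₀ := by ring
    rw [h3]
    refine (abs_add_le _ _).trans ?_
    have : L * dist x x₀ ≤ L * R := by gcongr
    linarith
  -- The power `t^s` is `s`-Hölder and `E` is Lipschitz. Lowering the exponent from `s` to `γ` costs
  -- a power of the diameter, which is finite because `A` lies in a ball.
  have hv : HolderBdd γ V A fun x => E x ^ s := by
    refine ⟨fun x hx => ?_, fun x hx y hy => ?_⟩
    · have h0 := hE x hx
      rw [Real.norm_of_nonneg (by positivity)]
      have h1 : E x ≤ 1 + (|E x₀| + L * R) := by linarith [le_abs_self (E x), hEb x hx]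
      calc E x ^ s ≤ (1 + (|E x₀| + L * R)) ^ s := by gcongr
        _ ≤ (1 + (|E x₀| + L * R)) ^ (1 : ℝ) := by
          gcongr
          have : 0 ≤ |E x₀| + L * R := by positivity
          linarith
        _ = 1 + (|E x₀| + L * R) := Real.rpow_one _
        _ ≤ V := by rw [hV]; have : 0 ≤ (1 + L) * (1 + 2 * R) := by positivity
                    linarith
    · have hd0 : 0 ≤ dist x y := dist_nonneg
      have hd2 : dist x y ≤ 1 + 2 * R := by
        have h1 : dist x x₀ < R := hAR hx
        have h2 : dist y x₀ < R := hAR hy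
        have := dist_triangle_right x y x₀
        linarith
      calc ‖E x ^ s - E y ^ s‖ ≤ |E x - E y| ^ s :=
            abs_rpow_sub_rpow_le (hE x hx).le (hE y hy).le hs'.le hs1.le
        _ ≤ (L * dist x y) ^ s := by gcongr; exact h.abs_sub_le x y
        _ = L ^ s * dist x y ^ s := Real.mul_rpow hL.le hd0
        _ ≤ (1 + L) * ((1 + 2 * R) * dist x y ^ (γ : ℝ)) := by
          gcongr
          · calc L ^ s ≤ (1 + L) ^ s := by gcongr; linarith
              _ ≤ (1 + L) ^ (1 : ℝ) := by gcongr; linarith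
              _ = 1 + L := Real.rpow_one _
          · rcases hd0.eq_or_lt with h0 | h0
            · rw [← h0, Real.zero_rpow hs'.ne', Real.zero_rpow hγ'.ne', mul_zero]
            · have : dist x y ^ s = dist x y ^ (s - γ) * dist x y ^ (γ : ℝ) := by
                rw [← Real.rpow_add h0]; congr 1; ring
              rw [this]
              gcongr
              calc dist x y ^ (s - γ) ≤ (1 + 2 * R) ^ (s - γ) := by
                    gcongr
                _ ≤ (1 + 2 * R) ^ (1 : ℝ) := by gcongr <;> linarith
                _ = _ := Real.rpow_one _
        _ ≤ V * dist x y ^ (γ : ℝ) := by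
          rw [← mul_assoc]
          gcongr
          rw [hV]
          have : 0 ≤ |E x₀| + L * R := by positivity
          linarith
  have hLζ : HolderBdd γ C₃ A (stableOp s μ ζ) :=
    (bζ.mono (le_of_eq (by rw [hC₃, abs_of_nonneg hN0]))).mono_set (subset_univ A)
  have hT : HolderBdd γ C₄ A fun x => flatOp s μ e ψ (fun Y => ζ (ψ Y) * J Y) (Φ x) := by
    have hBS : 0 ≤ B * S := by positivity
    refine ⟨fun x hx => ?_, fun x hx y hy => ?_⟩
    · have := abs_flatOp_le (X := Φ x) hn h hγ' hs₀ hs hs1 hB0 hμ hQc hprof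
        (by rw [hinner]; exact hE x hx)
      refine this.trans ?_
      have h1 : 4 * B * (1 + 1 / s₀) * sphereArea n = 4 * (B * S) := by rw [hS]; ring
      rw [h1, hC₄]
      have : 0 ≤ B * S * L ^ (γ : ℝ) := by positivity
      nlinarith
    · have := abs_flatOp_sub_le (X := Φ x) (X' := Φ y) hn h hγ' hγs hs₀ hs hs1 hB0 hμ hQc hprof
        (by rw [hinner]; exact hE x hx) (by rw [hinner]; exact hE y hy)
      refine this.trans ?_
      have h1 : dist (Φ x) (Φ y) ≤ L * dist x y := by
        have := h.antilip (Φ x) (Φ y)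
        rwa [hψΦ, hψΦ] at this
      calc _ ≤ 11 * (1 + 1 / s₀) * B * sphereArea n * (L * dist x y) ^ (γ : ℝ) := by gcongr
        _ = 11 * B * S * L ^ (γ : ℝ) * dist x y ^ (γ : ℝ) := by
          rw [Real.mul_rpow hL.le dist_nonneg, hS]; ring
        _ ≤ _ := by
          rw [hC₄]
          gcongr
          linarith
  exact HolderBdd.congr ((hv.mul hV0 hC₃0 hLζ).add hT) hid

/-- Boundary case of the local bounds. -/
theorem localHolderBound_of_isStraightening (hn : 1 ≤ n) (hγ : 0 < γ) (hγ1 : γ ≤ 1)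
    (hs₀ : 0 < s₀) (hΩ : IsOpen Ω) (hΩb : Bornology.IsBounded Ω) (hd : ContDiffOn ℝ 2 d Ω)
    (hpos : ∀ x ∈ Ω, 0 < d x) {D : ℝ} (hD0 : 0 ≤ D) (hD : ∀ x ∈ Ω, |d x| ≤ D) (hL : 0 < L)
    {e : RSpace n} {E : RSpace n → ℝ} {ψ : RSpace n → RSpace n} {J : RSpace n → ℝ}
    (h : IsStraightening γ L e E ψ J) {x₀ : RSpace n} {R : ℝ} (hR : 0 < R)
    (hE : ∀ x ∈ ball x₀ R, x ∈ Ω ↔ 0 < E x) (hEd : ∀ x ∈ ball x₀ R, x ∈ Ω → d x = E x) :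
    LocalHolderBound γ M s₀ Ω d x₀ := by
  have hγ' : (0 : ℝ) < γ := hγ
  obtain ⟨R', hR'⟩ := hΩb.subset_closedBall x₀
  refine ⟨R / 2, half_pos hR, fun N => ?_⟩
  obtain ⟨C₁, hC₁, H₁⟩ := exists_holderBdd_stableOp_near (M := M) hn hγ hγ1 hs₀ hL h x₀ hR N
  obtain ⟨C₂, hC₂, H₂⟩ := exists_holderBdd_stableOp_far (M := M) hn hγ1 x₀ (ρ := R / 2)
    (δ := R / 8) (R := R') (U := (1 + D) * |N|) (by positivity) (by positivity)
  -- The support has radius `R/2`. The near estimate holds up to radius `R` and the far estimate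
  -- from `5R/8` on, so any two points of `Ω` closer than `R/8` fall under a common estimate.
  refine ⟨_, ?_, fun s hs hs1 hγs μ hμ hM ζ hζ hζN hζ0 => HolderBdd.of_local (C := C₁ + C₂)
    (L := C₁ + C₂) (δ := R / 8) hγ'.le (by positivity) (by positivity) (by positivity) ?_ ?_⟩
  · positivity
  all_goals
    have hs' : 0 < s := hs₀.trans_le hs
    have hb := (sphere_bounds_of_sphereC1HolderNorm_le hM).1
    have hζb : ∀ x, |ζ x| ≤ |N| := fun x => (hζN.1.1 x trivial).trans (le_abs_self N)
    have hi : ∀ x ∈ Ω, Integrable (stableIntegrand s μ (Ω.indicator fun x => d x ^ s * ζ x) x) :=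
      fun x hx => integrable_stableIntegrand_indicator hn hs' hs1 hμ hb hΩ hd hpos hD0 hD hζ hζb hx
    -- On the support of `ζ` the set `Ω` is `{E > 0}` and `d = E` there; off the support both sides
    -- vanish. Hence the global function `E` may replace `d`.
    have hu : (Ω.indicator fun x => d x ^ s * ζ x) = fun x => max (E x) 0 ^ s * ζ x := by
      ext x
      by_cases hx : x ∈ closedBall x₀ (R / 2)
      · have hxR : x ∈ ball x₀ R := by
          rw [mem_closedBall] at hx; rw [mem_ball]; linarith
        by_cases hxΩ : x ∈ Ω
        · rw [indicator_of_mem hxΩ, hEd x hxR hxΩ, max_eq_left ((hE x hxR).1 hxΩ).le]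
        · rw [indicator_of_notMem hxΩ, max_eq_right (not_lt.1 fun h => hxΩ ((hE x hxR).2 h)),
            Real.zero_rpow hs'.ne', zero_mul]
      · by_cases hxΩ : x ∈ Ω
        · rw [indicator_of_mem hxΩ, hζ0 x hx, mul_zero, mul_zero]
        · rw [indicator_of_notMem hxΩ, hζ0 x hx, mul_zero]
    have hnear : HolderBdd γ C₁ (Ω ∩ ball x₀ R)
        (stableOp s μ (Ω.indicator fun x => d x ^ s * ζ x)) := by
      rw [hu] at hi ⊢
      exact H₁ s hs hs1 hγs μ hμ hM ζ hζN _ inter_subset_right (fun x hx => (hE x hx.2).1 hx.1)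
        fun x hx => hi x hx.1
    have hfar : HolderBdd γ C₂ (Ω ∩ {x | R / 2 + R / 8 ≤ dist x x₀})
        (stableOp s μ (Ω.indicator fun x => d x ^ s * ζ x)) := by
      refine H₂ s hs' hs1 μ hμ hM _
        (measurable_indicator_rpow_mul hΩ hd.continuousOn hpos hζ.continuous)
        (abs_indicator_rpow_mul_le hD0 hs'.le hs1.le hD hpos hζb) (fun x hx => ?_) _
        (fun x hx => ⟨hx.2, hR' hx.1⟩) fun x hx => hi x hx.1
      by_cases hxΩ : x ∈ Ω
      · rw [indicator_of_mem hxΩ, hζ0 x hx, mul_zero]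
      · rw [indicator_of_notMem hxΩ]
  · intro x hx
    by_cases hxR : x ∈ ball x₀ R
    · exact (hnear.1 x ⟨hx, hxR⟩).trans (by linarith)
    · rw [mem_ball, not_lt] at hxR
      exact (hfar.1 x ⟨hx, by simp only [mem_setOf_eq]; linarith⟩).trans (by linarith)
  · intro x hx y hy hxy
    have hdn : 0 ≤ dist x y ^ (γ : ℝ) := by positivity
    by_cases hxR : dist x x₀ < R - R / 8
    · refine (hnear.2 x ⟨hx, by rw [mem_ball]; linarith⟩ y ⟨hy, ?_⟩).trans
        (by gcongr; linarith)
      have := dist_triangle_left y x₀ x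
      rw [mem_ball]; linarith
    · refine (hfar.2 x ⟨hx, by simp only [mem_setOf_eq]; linarith⟩ y ⟨hy, ?_⟩).trans
        (by gcongr; linarith)
      have := dist_triangle x y x₀
      simp only [mem_setOf_eq]; linarith

end Local


/-! ### Powers on an interval, and conversion from the stated norms -/

theorem ckHolderOn_rpow {γ c R : ℝ} (hγ : 0 ≤ γ) (hγ1 : γ ≤ 1) (hc : 0 < c) (k : ℕ) :
    ∀ P : ℝ, ∃ C, 0 ≤ C ∧ ∀ q : ℝ, |q| ≤ P → CkHolderOn γ C (Ioo c R) k (fun x : ℝ => x ^ q) := by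
  set T := 1 + c⁻¹ + |R| with hT
  have hT1 : 1 ≤ T := by
    have : 0 ≤ c⁻¹ + |R| := by positivity
    linarith
  have hb : ∀ P q : ℝ, |q| ≤ P → ∀ x ∈ Ioo c R, |x ^ q| ≤ T ^ P := by
    intro P q hq x hx
    have hx0 : 0 < x := hc.trans hx.1
    have hxT : x ≤ T := by
      have : 0 < c⁻¹ := by positivity
      linarith [hx.2, le_abs_self R]
    have hxT' : x⁻¹ ≤ T := by
      have := inv_anti₀ hc hx.1.le
      linarith [abs_nonneg R]
    rw [abs_of_pos (by positivity)]
    rcases le_total 0 q with h | h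
    · rw [abs_of_nonneg h] at hq
      calc x ^ q ≤ T ^ q := by gcongr
        _ ≤ T ^ P := by gcongr
    · rw [abs_of_nonpos h] at hq
      calc x ^ q = x⁻¹ ^ (-q) := by rw [Real.inv_rpow hx0.le, Real.rpow_neg hx0.le, inv_inv]
        _ ≤ T ^ (-q) := by gcongr; linarith
        _ ≤ T ^ P := by gcongr
  have hder : ∀ q x : ℝ, x ∈ Ioo c R → HasDerivAt (fun x : ℝ => x ^ q) (q * x ^ (q - 1)) x :=
    fun q x hx => Real.hasDerivAt_rpow_const (Or.inl (hc.trans hx.1).ne')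
  have hdb : ∀ P q : ℝ, |q| ≤ P → ∀ x ∈ Ioo c R, |q * x ^ (q - 1)| ≤ P * T ^ (P + 1) := by
    intro P q hq x hx
    have hP : 0 ≤ P := (abs_nonneg q).trans hq
    rw [abs_mul]
    refine mul_le_mul hq (hb _ _ ?_ x hx) (abs_nonneg _) hP
    refine (abs_sub _ _).trans ?_
    rw [abs_one]; linarith
  have hbase : ∀ P : ℝ, 0 ≤ P → ∀ q : ℝ, |q| ≤ P →
      HolderBdd γ (3 * T ^ P + P * T ^ (P + 1)) (Ioo c R) (fun x : ℝ => x ^ q) := by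
    intro P hP q hq
    refine HolderBdd.of_lipschitz hγ hγ1 (by positivity) (by positivity) (hb P q hq) ?_
    intro x hx y hy
    rw [dist_eq_norm]
    exact (convex_Ioo c R).norm_image_sub_le_of_norm_hasDerivWithin_le
      (fun z hz => (hder q z hz).hasDerivWithinAt) (fun z hz => hdb P q hq z hz) hy hx
  induction k with
  | zero =>
    intro P
    rcases lt_or_ge P 0 with h | h
    · exact ⟨0, le_rfl, fun q hq => absurd ((abs_nonneg q).trans hq) (not_le.2 h)⟩
    · exact ⟨_, by positivity, fun q hq => hbase P h q hq⟩
  | succ k ih =>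
    intro P
    rcases lt_or_ge P 0 with h | h
    · exact ⟨0, le_rfl, fun q hq => absurd ((abs_nonneg q).trans hq) (not_le.2 h)⟩
    obtain ⟨C₁, hC₁, H₁⟩ := ih (P + 1)
    set l : ℝ →L[ℝ] (ℝ →L[ℝ] ℝ) := (ContinuousLinearMap.smulRightL ℝ ℝ ℝ) (1 : ℝ →L[ℝ] ℝ) with hl
    obtain ⟨C₂, hC₂, H₂⟩ := CkHolderOn.bilin (γ := γ) (k := k) (A := Ioo c R) isOpen_Ioo
      (ContinuousLinearMap.mul ℝ ℝ) P C₁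
    obtain ⟨C₃, hC₃, H₃⟩ := CkHolderOn.clm (γ := γ) (k := k) (A := Ioo c R) isOpen_Ioo l C₂
    refine ⟨3 * T ^ P + P * T ^ (P + 1) + C₃, by positivity, fun q hq =>
      ⟨(hbase P h q hq).mono (by linarith), fun x hx => (hder q x hx).differentiableAt, ?_⟩⟩
    have h1 := H₃ _ (H₂ (fun _ => q) _ (CkHolderOn.const q hq) (H₁ (q - 1) (by
      refine (abs_sub _ _).trans ?_
      rw [abs_one]; linarith)))
    refine CkHolderOn.mono (CkHolderOn.congr isOpen_Ioo h1 fun x hx => ?_)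
      (le_add_of_nonneg_left (by positivity))
    rw [(hder q x hx).hasFDerivAt.fderiv]
    ext
    simp [hl]

section Convert

variable {n : ℕ} {γ : ℝ≥0} {A : Set (RSpace n)} {f : RSpace n → ℝ}

theorem bounds_of_ckHolderNorm_two_le {N : ℝ≥0} (h : ckHolderNorm 2 γ A f ≤ N) :
    (∀ x ∈ A, ‖f x‖ ≤ N) ∧ (∀ x ∈ A, ‖fderiv ℝ f x‖ ≤ N) ∧
    (∀ x ∈ A, ‖fderiv ℝ (fderiv ℝ f) x‖ ≤ N) ∧
    ∀ x ∈ A, ∀ y ∈ A, ‖fderiv ℝ (fderiv ℝ f) x - fderiv ℝ (fderiv ℝ f) y‖ ≤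
      N * dist x y ^ (γ : ℝ) := by
  unfold ckHolderNorm at h
  have hj : ∀ j < 3, ∀ x ∈ A, ‖iteratedFDeriv ℝ j f x‖ ≤ N := by
    intro j hj x hx
    rw [← enorm_le_coe_iff_norm_le]
    refine le_trans ?_ (le_self_add.trans h)
    refine le_trans ?_ (Finset.single_le_sum (f := fun j => ⨆ x ∈ A, ‖iteratedFDeriv ℝ j f x‖ₑ)
      (fun _ _ => zero_le) (Finset.mem_range.2 hj))
    exact le_iSup₂ (f := fun x _ => ‖iteratedFDeriv ℝ j f x‖ₑ) x hx
  have e2 : ∀ x, iteratedFDeriv ℝ 2 f x =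
      (continuousMultilinearCurryRightEquiv' ℝ 1 (RSpace n) ℝ).symm
        (iteratedFDeriv ℝ 1 (fderiv ℝ f) x) := fun x => by
    rw [iteratedFDeriv_succ_eq_comp_right]; rfl
  have e1 : ∀ x, iteratedFDeriv ℝ 1 (fderiv ℝ f) x =
      (continuousMultilinearCurryRightEquiv' ℝ 0 (RSpace n) (RSpace n →L[ℝ] ℝ)).symm
        (iteratedFDeriv ℝ 0 (fderiv ℝ (fderiv ℝ f)) x) := fun x => by
    rw [iteratedFDeriv_succ_eq_comp_right]; rfl
  have h2 : ∀ x y, ‖iteratedFDeriv ℝ 2 f x - iteratedFDeriv ℝ 2 f y‖ =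
      ‖fderiv ℝ (fderiv ℝ f) x - fderiv ℝ (fderiv ℝ f) y‖ := by
    intro x y
    have i2 := (continuousMultilinearCurryRightEquiv' ℝ 1 (RSpace n) ℝ).symm.isometry.dist_eq
      (iteratedFDeriv ℝ 1 (fderiv ℝ f) x) (iteratedFDeriv ℝ 1 (fderiv ℝ f) y)
    have i1 := (continuousMultilinearCurryRightEquiv' ℝ 0 (RSpace n)
      (RSpace n →L[ℝ] ℝ)).symm.isometry.dist_eq (iteratedFDeriv ℝ 0 (fderiv ℝ (fderiv ℝ f)) x)
      (iteratedFDeriv ℝ 0 (fderiv ℝ (fderiv ℝ f)) y)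
    have i0 : ‖iteratedFDeriv ℝ 0 (fderiv ℝ (fderiv ℝ f)) x -
        iteratedFDeriv ℝ 0 (fderiv ℝ (fderiv ℝ f)) y‖ =
        ‖fderiv ℝ (fderiv ℝ f) x - fderiv ℝ (fderiv ℝ f) y‖ := by
      have i := (continuousMultilinearCurryFin0 ℝ (RSpace n)
        (RSpace n →L[ℝ] RSpace n →L[ℝ] ℝ)).symm.isometry.dist_eq
        (fderiv ℝ (fderiv ℝ f) x) (fderiv ℝ (fderiv ℝ f) y)
      rw [dist_eq_norm, dist_eq_norm] at i
      exact i
    rw [dist_eq_norm, dist_eq_norm] at i1 i2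
    rw [e2, e2]
    refine i2.trans ?_
    rw [e1, e1]
    exact i1.trans i0
  have h2' : ∀ x, ‖iteratedFDeriv ℝ 2 f x‖ = ‖fderiv ℝ (fderiv ℝ f) x‖ := by
    intro x
    rw [e2, LinearIsometryEquiv.norm_map, norm_iteratedFDeriv_one]
  refine ⟨fun x hx => ?_, fun x hx => ?_, fun x hx => ?_, fun x hx y hy => ?_⟩
  · have := hj 0 (by norm_num) x hx
    rwa [norm_iteratedFDeriv_zero] at this
  · have := hj 1 (by norm_num) x hx
    rwa [norm_iteratedFDeriv_one] at this
  · rw [← h2']; exact hj 2 (by norm_num) x hx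
  · rw [← h2]
    exact norm_sub_le_of_eHolderNorm_le (f := fun x : A => iteratedFDeriv ℝ 2 f (x : RSpace n))
      (le_add_self.trans h) ⟨x, hx⟩ ⟨y, hy⟩

/-- The norm `ckHolderNorm 2` records a Hölder seminorm only for the top derivative. The lower ones
are obtained from the mean value inequality, which is why `A'` is convex; they cost `3N + N`. -/
theorem ckHolderOn_of_ckHolderNorm_le {N : ℝ≥0} (hγ1 : γ ≤ 1) (hA : IsOpen A)
    (hf : ContDiffOn ℝ 2 f A) (h : ckHolderNorm 2 γ A f ≤ N) {A' : Set (RSpace n)} (hA' : A' ⊆ A)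
    (hconv : Convex ℝ A') : CkHolderOn γ (4 * N) A' 2 f := by
  have hγ1' : (γ : ℝ) ≤ 1 := by exact_mod_cast hγ1
  have hN : (0 : ℝ) ≤ N := N.2
  obtain ⟨h0, h1, h2, h3⟩ := bounds_of_ckHolderNorm_two_le h
  have d1 : ∀ x ∈ A', DifferentiableAt ℝ f x := fun x hx =>
    (hf.contDiffAt (hA.mem_nhds (hA' hx))).differentiableAt (by norm_num)
  have d2 : ∀ x ∈ A', DifferentiableAt ℝ (fderiv ℝ f) x := fun x hx =>
    ((hf.contDiffAt (hA.mem_nhds (hA' hx))).fderiv_right (m := 1) (by norm_num)).differentiableAt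
      (by norm_num)
  have e : 3 * (N : ℝ) + N = 4 * N := by ring
  refine ⟨?_, d1, ?_, d2, ⟨fun x hx => (h2 x (hA' hx)).trans (by linarith), fun x hx y hy =>
    (h3 x (hA' hx) y (hA' hy)).trans (by gcongr; linarith)⟩⟩
  · rw [← e]
    refine HolderBdd.of_lipschitz γ.2 hγ1' hN hN (fun x hx => h0 x (hA' hx)) fun x hx y hy => ?_
    rw [dist_eq_norm]
    exact hconv.norm_image_sub_le_of_norm_fderiv_le (𝕜 := ℝ) d1 (fun z hz => h1 z (hA' hz)) hy hx
  · rw [← e]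
    refine HolderBdd.of_lipschitz γ.2 hγ1' hN hN (fun x hx => h1 x (hA' hx)) fun x hx y hy => ?_
    rw [dist_eq_norm]
    exact hconv.norm_image_sub_le_of_norm_fderiv_le (𝕜 := ℝ) d2 (fun z hz => h2 z (hA' hz)) hy hx

end Convert

/-! ### Local estimates at an interior point -/

section Interior

variable {n : ℕ} {γ M : ℝ≥0} {s₀ : ℝ} {Ω : Set (RSpace n)} {d : RSpace n → ℝ}

/-- Interior case of the local bounds. -/
theorem localHolderBound_of_mem (hn : 1 ≤ n) (hγ1 : γ ≤ 1) (hs₀ : 0 < s₀) (hΩ : IsOpen Ω)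
    (hd : ContDiffOn ℝ 2 d Ω) (hpos : ∀ x ∈ Ω, 0 < d x) {N₀ : ℝ≥0}
    (hN₀ : ckHolderNorm 2 γ Ω d ≤ N₀) {x₀ : RSpace n} (hx₀ : x₀ ∈ Ω) :
    LocalHolderBound γ M s₀ Ω d x₀ := by
  have hγ1' : (γ : ℝ) ≤ 1 := by exact_mod_cast hγ1
  have hcont : ContinuousAt d x₀ := (hd.contDiffAt (hΩ.mem_nhds hx₀)).continuousAt
  have hev : ∀ᶠ x in nhds x₀, x ∈ Ω ∧ d x₀ / 2 < d x :=
    (hΩ.eventually_mem hx₀).and (hcont.eventually (lt_mem_nhds (half_lt_self (hpos x₀ hx₀))))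
  obtain ⟨r, hr, hball⟩ := Metric.eventually_nhds_iff_ball.1 hev
  have hc : 0 < d x₀ / 2 := half_pos (hpos x₀ hx₀)
  have hsub : ball x₀ r ⊆ Ω := fun x hx => (hball x hx).1
  have hdck := ckHolderOn_of_ckHolderNorm_le hγ1 hΩ hd hN₀ hsub (convex_ball x₀ r)
  obtain ⟨b0, b1, -, -⟩ := bounds_of_ckHolderNorm_two_le hN₀
  obtain ⟨C₁, hC₁, H₁⟩ := ckHolderOn_rpow (R := N₀ + 1) γ.2 hγ1' hc 2 1
  obtain ⟨C₂, hC₂, H₂⟩ := CkHolderOn.comp (k := 1) (γ := γ) (A := Ioo (d x₀ / 2) (N₀ + 1))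
    (A' := ball x₀ r) γ.2 isOpen_ball (F := ℝ) C₁ (4 * N₀) N₀ N₀.2
  refine ⟨r / 2, half_pos hr, fun N => ?_⟩
  obtain ⟨C₃, hC₃, H₃⟩ := CkHolderOn.bilin (γ := γ) (k := 2) (A := ball x₀ r)
    isOpen_ball (ContinuousLinearMap.mul ℝ ℝ) C₂ N
  set C₄ := C₃ + C₃ + 2 * C₃ / (r / 2) ^ (γ : ℝ) with hC₄
  have hS : 0 ≤ sphereArea n := sphereArea_nonneg
  refine ⟨2 * C₄ * M * (sphereArea n * (1 + 1 / s₀)), by positivity,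
    fun s hs hs1 hγs μ hμ hM ζ hζ hζN hζ0 => ?_⟩
  have hs' : 0 < s := hs₀.trans_le hs
  have hb := (sphere_bounds_of_sphereC1HolderNorm_le hM).1
  have h1 : CkHolderOn γ C₂ (ball x₀ r) 2 (fun x => d x ^ s) := by
    refine H₂ (fun x => x ^ s) d (H₁ s (by rw [abs_of_pos hs']; exact hs1.le)) (fun x hx => ?_)
      (fun x hx y hy => ?_) (fun x hx => hdck.2.1 x hx) hdck.2.2
    · have := b0 x (hsub hx)
      rw [Real.norm_eq_abs] at this
      exact ⟨(hball x hx).2, by linarith [le_abs_self (d x)]⟩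
    · rw [dist_eq_norm, dist_eq_norm]
      exact (convex_ball x₀ r).norm_image_sub_le_of_norm_fderiv_le (𝕜 := ℝ)
        (fun z hz => hdck.2.1 z hz) (fun z hz => b1 z (hsub hz)) hy hx
  have h2 : CkHolderOn γ C₃ (ball x₀ r) 2 (Ω.indicator fun x => d x ^ s * ζ x) := by
    refine CkHolderOn.congr isOpen_ball (H₃ _ _ h1 (hζN.mono_set (subset_univ _))) fun x hx => ?_
    rw [indicator_of_mem (hsub hx)]
    rfl
  have h3 : CkHolderOn γ C₄ univ 2 (Ω.indicator fun x => d x ^ s * ζ x) := by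
    refine CkHolderOn.univ_of_zero_off γ.2 hC₃ (half_pos hr) isClosed_closedBall
      (K := closedBall x₀ (r / 2)) (fun x hx => ?_) _ h2 fun x hx => ?_
    · refine ball_subset_ball' ?_
      rw [mem_closedBall] at hx
      linarith
    · by_cases hxΩ : x ∈ Ω
      · rw [indicator_of_mem hxΩ, hζ0 x hx, mul_zero]
      · rw [indicator_of_notMem hxΩ]
  exact (stableOp_bounds_of_ckHolderOn hn hs₀ hs hs1 hμ hb (by positivity) h3
    (measurable_indicator_rpow_mul hΩ hd.continuousOn hpos hζ.continuous)).2.mono_set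
    (subset_univ _)

end Interior


/-! ### Removing a hyperplane -/

section Removable

variable {V : Type} [NormedAddCommGroup V] [NormedSpace ℝ V] {γ C r : ℝ} {l : V →L[ℝ] ℝ} {e X₀ : V}

theorem eventually_add_smul_mem {U : Set V} (hU : IsOpen U) (hle : l e = 1) {x : V} (hx : x ∈ U) :
    ∀ᶠ t : ℝ in nhdsWithin 0 (Ioi 0), x + t • e ∈ U ∩ {y | l y ≠ 0} ∧
      (l x = 0 → x + t • e ∈ U ∩ {y | 0 < l y}) := by
  have hcont : Continuous fun t : ℝ => x + t • e := by fun_prop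
  have h1 : ∀ᶠ t : ℝ in nhdsWithin 0 (Ioi 0), x + t • e ∈ U := by
    refine nhdsWithin_le_nhds (hcont.continuousAt.eventually (hU.mem_nhds ?_))
    simpa using hx
  have h2 : ∀ᶠ t : ℝ in nhdsWithin 0 (Ioi 0), l x ≠ 0 → t < |l x| := by
    by_cases h0 : l x = 0
    · exact Filter.Eventually.of_forall fun t h => absurd h0 h
    · filter_upwards [nhdsWithin_le_nhds (gt_mem_nhds (abs_pos.2 h0))] with t ht _ using ht
  filter_upwards [h1, h2, self_mem_nhdsWithin] with t ht1 ht2 ht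
  have ht0 : (0 : ℝ) < t := ht
  have hlt : l (x + t • e) = l x + t := by simp [hle]
  refine ⟨⟨ht1, ?_⟩, fun h0 => ⟨ht1, ?_⟩⟩
  · rw [mem_setOf_eq, hlt]
    intro h0
    by_cases hlx : l x = 0
    · rw [hlx, zero_add] at h0; exact ht0.ne' h0
    · have h3 := ht2 hlx
      have h4 : l x = -t := by linarith
      rw [h4, abs_neg, abs_of_pos ht0] at h3
      exact lt_irrefl _ h3
  · rw [mem_setOf_eq, hlt, h0, zero_add]; exact ht0

/-- The bound also compares points on opposite sides, so `f (x + t e)` is Cauchy as `t ↓ 0`.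
Shifting two points by the same `t e` preserves their distance, hence the constant. -/
theorem HolderBdd.exists_extend {F : Type*} [NormedAddCommGroup F] [CompleteSpace F] {U : Set V}
    (hγ : 0 < γ) (hC : 0 ≤ C) (hU : IsOpen U) (hle : l e = 1) {f : V → F}
    (hf : HolderBdd γ C (U ∩ {y | l y ≠ 0}) f) :
    ∃ g : V → F, HolderBdd γ C U g ∧ ∀ x ∈ U ∩ {y | l y ≠ 0}, g x = f x := by
  have hex : ∀ x ∈ U, ∃ y, Filter.Tendsto (fun t : ℝ => f (x + t • e)) (nhdsWithin 0 (Ioi 0))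
      (nhds y) := by
    intro x hx
    refine cauchy_map_iff_exists_tendsto.1 (Metric.cauchy_iff.2 ⟨inferInstance, fun ε hε => ?_⟩)
    have h0 : Filter.Tendsto (fun t : ℝ => C * (2 * t * ‖e‖) ^ γ) (nhdsWithin 0 (Ioi 0))
        (nhds 0) := by
      have hc : Continuous fun t : ℝ => C * (2 * t * ‖e‖) ^ γ :=
        continuous_const.mul (Continuous.rpow_const (by fun_prop) fun _ => Or.inr hγ.le)
      have := hc.tendsto 0
      rw [mul_zero, zero_mul, Real.zero_rpow hγ.ne', mul_zero] at this
      exact this.mono_left nhdsWithin_le_nhds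
    obtain ⟨b, hb, hbU⟩ := (mem_nhdsGT_iff_exists_Ioo_subset' (zero_lt_one (α := ℝ))).1
      ((h0.eventually (gt_mem_nhds hε)).and (eventually_add_smul_mem hU hle hx))
    refine ⟨(fun t : ℝ => f (x + t • e)) '' Ioo 0 b,
      Filter.image_mem_map (Ioo_mem_nhdsGT hb), ?_⟩
    rintro _ ⟨t, ht, rfl⟩ _ ⟨t', ht', rfl⟩
    have key : ∀ t ∈ Ioo 0 b, ∀ t' ∈ Ioo 0 b, t ≤ t' →
        dist (f (x + t • e)) (f (x + t' • e)) < ε := by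
      intro t ht t' ht' hle
      rw [dist_eq_norm]
      refine (hf.2 _ (hbU ht).2.1 _ (hbU ht').2.1).trans_lt (lt_of_le_of_lt ?_ (hbU ht').1)
      gcongr
      rw [dist_add_left, dist_eq_norm, ← sub_smul, norm_smul]
      gcongr
      rw [Real.norm_eq_abs, abs_of_nonpos (by linarith)]
      linarith [ht.1, ht'.1]
    rcases le_total t t' with h | h
    · exact key t ht t' ht' h
    · rw [dist_comm]; exact key t' ht' t ht h
  choose! g hg using hex
  refine ⟨g, ⟨fun x hx => ?_, fun x hx y hy => ?_⟩, fun x hx => ?_⟩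
  · refine le_of_tendsto (hg x hx).norm ?_
    filter_upwards [eventually_add_smul_mem hU hle hx] with t ht using hf.1 _ ht.1
  · refine le_of_tendsto ((hg x hx).sub (hg y hy)).norm ?_
    filter_upwards [eventually_add_smul_mem hU hle hx, eventually_add_smul_mem hU hle hy]
      with t ht ht'
    have := hf.2 _ ht.1 _ ht'.1
    rwa [dist_add_right] at this
  · refine tendsto_nhds_unique (hg x hx.1) ?_
    have hop : IsOpen (U ∩ {y | l y ≠ 0}) := hU.inter (isOpen_ne_fun l.continuous continuous_const)
    have hc : ContinuousAt f x := (hf.continuousOn hγ).continuousAt (hop.mem_nhds hx)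
    have h1 : Filter.Tendsto (fun t : ℝ => x + t • e) (nhdsWithin 0 (Ioi 0)) (nhds x) := by
      have hcont : Continuous fun t : ℝ => x + t • e := by fun_prop
      have := hcont.tendsto 0
      rw [zero_smul, add_zero] at this
      exact this.mono_left nhdsWithin_le_nhds
    exact hc.tendsto.comp h1

/-- A function which is `C^{k,γ}` off a hyperplane, with Hölder bounds across it, extends to a
`C^{k,γ}` function. -/
theorem CkHolderOn.exists_extend {U : Set V} (hγ : 0 < γ) (hC : 0 ≤ C) (hU : IsOpen U)
    (hle : l e = 1) {k : ℕ} : ∀ {F : Type} [NormedAddCommGroup F] [NormedSpace ℝ F]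
    [CompleteSpace F] {f : V → F}, CkHolderOn γ C (U ∩ {y | l y ≠ 0}) k f →
    ∃ g : V → F, CkHolderOn γ C U k g ∧ ∀ x ∈ U ∩ {y | l y ≠ 0}, g x = f x := by
  have hop : IsOpen (U ∩ {y | l y ≠ 0}) := hU.inter (isOpen_ne_fun l.continuous continuous_const)
  induction k with
  | zero => intro F _ _ _ f hf; exact HolderBdd.exists_extend hγ hC hU hle hf
  | succ k ih =>
    intro F _ _ _ f hf
    obtain ⟨g, hg, hgf⟩ := HolderBdd.exists_extend hγ hC hU hle hf.1
    obtain ⟨G, hG, hGf⟩ := ih hf.2.2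
    have hA : ∀ x ∈ U ∩ {y | l y ≠ 0}, HasFDerivAt g (G x) x := by
      intro x hx
      rw [hGf x hx]
      refine (hf.2.1 x hx).hasFDerivAt.congr_of_eventuallyEq ?_
      filter_upwards [hop.mem_nhds hx] with y hy using hgf y hy
    have hgc : ∀ x ∈ U, ContinuousAt g x := fun x hx =>
      (hg.continuousOn hγ).continuousAt (hU.mem_nhds hx)
    have hGc : ∀ x ∈ U, ContinuousAt G x := fun x hx =>
      (hG.holderBdd.continuousOn hγ).continuousAt (hU.mem_nhds hx)
    have hder : ∀ x ∈ U, HasFDerivAt g (G x) x := by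
      intro x hx
      by_cases hlx : l x = 0
      · obtain ⟨δ, hδ, hδU⟩ := Metric.nhds_basis_closedBall.mem_iff.1 (hU.mem_nhds hx)
        -- On each open half-ball the derivative of `g` has the limit `G x` at `x`, so `g` is
        -- differentiable within the closed half-ball. The two closed half-balls cover a
        -- neighbourhood of `x`.
        have side : ∀ P : Set V, IsOpen P → Convex ℝ P → (∀ y ∈ P, l y ≠ 0) →
            HasFDerivWithinAt g (G x) (closure (ball x δ ∩ P)) x := by
          intro P hP hPc hPl
          have hsub : ball x δ ∩ P ⊆ U ∩ {y | l y ≠ 0} := fun y hy =>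
            ⟨hδU (ball_subset_closedBall hy.1), hPl y hy.2⟩
          refine hasFDerivWithinAt_closure_of_tendsto_fderiv
            (fun y hy => (hA y (hsub hy)).differentiableAt.differentiableWithinAt)
            ((convex_ball x δ).inter hPc) (isOpen_ball.inter hP) (fun y hy => ?_) ?_
          · refine (hgc y (hδU ?_)).continuousWithinAt
            exact closure_ball_subset_closedBall (closure_mono inter_subset_left hy)
          · refine ((hGc x hx).tendsto.mono_left nhdsWithin_le_nhds).congr' ?_
            filter_upwards [self_mem_nhdsWithin] with y hy
            exact (hA y (hsub hy)).fderiv.symm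
        have h1 := side {y | 0 < l y} (isOpen_lt continuous_const l.continuous)
          (convex_halfSpace_gt l.toLinearMap.isLinear 0) fun y hy => ne_of_gt hy
        have h2 := side {y | l y < 0} (isOpen_lt l.continuous continuous_const)
          (convex_halfSpace_lt l.toLinearMap.isLinear 0) fun y hy => ne_of_lt hy
        refine (h1.union h2).hasFDerivAt (Filter.mem_of_superset (ball_mem_nhds x hδ) ?_)
        intro y hy
        rcases lt_trichotomy (l y) 0 with h | h | h
        · exact Or.inr (subset_closure ⟨hy, h⟩)
        · left
          have ht : Filter.Tendsto (fun t : ℝ => y + t • e) (nhdsWithin 0 (Ioi 0)) (nhds y) := by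
            have hcont : Continuous fun t : ℝ => y + t • e := by fun_prop
            have := hcont.tendsto 0
            rw [zero_smul, add_zero] at this
            exact this.mono_left nhdsWithin_le_nhds
          refine mem_closure_of_tendsto ht ?_
          filter_upwards [eventually_add_smul_mem isOpen_ball hle hy] with t ht using ht.2 h
        · exact Or.inl (subset_closure ⟨hy, h⟩)
      · exact hA x ⟨hx, hlx⟩
    exact ⟨g, ⟨hg, fun x hx => (hder x hx).differentiableAt,
      hG.congr hU fun x hx => (hder x hx).fderiv⟩, hgf⟩

end Removable

/-! ### Extension by higher-order reflection -/

section Reflection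

variable {V : Type} [NormedAddCommGroup V] [NormedSpace ℝ V] {γ R : ℝ} {l : V →L[ℝ] ℝ} {e X₀ : V}

/-- The map which is the identity where `l > 0` and a dilated reflection where `l < 0`. -/
noncomputable def foldMap (l : V →L[ℝ] ℝ) (e : V) (k : ℝ) (X : V) : V := X - (k * min (l X) 0) • e

theorem foldMap_of_pos {k : ℝ} {X : V} (h : 0 < l X) : foldMap l e k X = X := by
  rw [foldMap, min_eq_right h.le, mul_zero, zero_smul, sub_zero]

theorem dist_foldMap_le (he : ‖e‖ ≤ 1) (hl : ∀ x, |l x| ≤ ‖x‖) {k : ℝ} (hk0 : 0 ≤ k) (hk : k ≤ 4)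
    (X Y : V) : dist (foldMap l e k X) (foldMap l e k Y) ≤ 5 * dist X Y := by
  have h1 : foldMap l e k X - foldMap l e k Y =
      (X - Y) - (k * (min (l X) 0 - min (l Y) 0)) • e := by
    simp only [foldMap, mul_sub, sub_smul]; abel
  rw [dist_eq_norm, h1, dist_eq_norm]
  refine (norm_sub_le _ _).trans ?_
  have h2 : |min (l X) 0 - min (l Y) 0| ≤ ‖X - Y‖ := by
    refine (abs_min_sub_min_le_max _ _ _ _).trans ?_
    rw [sub_self, abs_zero, ← map_sub]
    exact max_le (hl _) (norm_nonneg _)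
  rw [norm_smul, norm_mul, Real.norm_of_nonneg hk0, Real.norm_eq_abs]
  have h3 : k * |min (l X) 0 - min (l Y) 0| * ‖e‖ ≤ 4 * ‖X - Y‖ * 1 := by gcongr
  linarith

theorem foldMap_mem (he : ‖e‖ ≤ 1) (hl : ∀ x, |l x| ≤ ‖x‖) (hle : l e = 1) (hX₀ : l X₀ = 0) {k : ℝ}
    (hk0 : 1 < k) (hk : k ≤ 4) {X : V} (hX : X ∈ ball X₀ (R / 5) ∩ {y | l y ≠ 0}) :
    foldMap l e k X ∈ ball X₀ R ∩ {y | 0 < l y} := by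
  constructor
  · have h1 := dist_foldMap_le he hl (by linarith) hk X X₀
    have h2 : foldMap l e k X₀ = X₀ := by simp [foldMap, hX₀]
    have h3 := hX.1
    rw [h2] at h1
    rw [mem_ball] at h3 ⊢
    linarith
  · rw [mem_setOf_eq]
    rcases lt_or_gt_of_ne hX.2 with h | h
    · rw [foldMap, min_eq_left h.le, map_sub, map_smul, hle, smul_eq_mul, mul_one]
      nlinarith
    · rwa [foldMap_of_pos h]

theorem exists_hasFDerivAt_foldMap {k : ℝ} {X : V} (hX : l X ≠ 0) :
    ∃ b : ℝ, (0 < l X → b = 0) ∧ (l X < 0 → b = 1) ∧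
      HasFDerivAt (foldMap l e k) (ContinuousLinearMap.id ℝ V - (k * b) • l.smulRight e) X := by
  rcases lt_or_gt_of_ne hX with h | h
  · refine ⟨1, fun h' => absurd h' h.not_gt, fun _ => rfl, ?_⟩
    have h1 : HasFDerivAt (fun X : V => X - (k * l X) • e)
        (ContinuousLinearMap.id ℝ V - (k • l).smulRight e) X :=
      (hasFDerivAt_id X).sub ((l.hasFDerivAt.const_mul k).smul_const e)
    have e1 : (k • l).smulRight e = (k * 1) • l.smulRight e := by
      ext v; simp [smul_smul]
    rw [e1] at h1
    refine h1.congr_of_eventuallyEq ?_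
    filter_upwards [(isOpen_lt l.continuous continuous_const).mem_nhds h] with Y hY
    rw [foldMap, min_eq_left (le_of_lt hY)]
  · refine ⟨0, fun _ => rfl, fun h' => absurd h' h.not_gt, ?_⟩
    rw [mul_zero, zero_smul, sub_zero]
    refine (hasFDerivAt_id X).congr_of_eventuallyEq ?_
    filter_upwards [(isOpen_lt continuous_const l.continuous).mem_nhds h] with Y hY
    rw [foldMap_of_pos hY, id]

/-- The extension by a combination of dilated reflections; the coefficients `c = (6, -8, 3)` at
`k = (2, 3, 4)` satisfy `∑ c = 1` and `∑ k c = ∑ k² c = 0`. -/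
noncomputable def reflectExt {F : Type*} [AddCommGroup F] [Module ℝ F] (l : V →L[ℝ] ℝ) (e : V)
    (m : ℕ) (f : V → F) (X : V) : F :=
  (2 ^ m * 6 : ℝ) • f (foldMap l e 2 X) + ((3 ^ m * (-8) : ℝ) • f (foldMap l e 3 X) +
    (4 ^ m * 3 : ℝ) • f (foldMap l e 4 X))

theorem reflectExt_zero_of_pos {F : Type*} [AddCommGroup F] [Module ℝ F] {f : V → F} {X : V}
    (h : 0 < l X) : reflectExt l e 0 f X = f X := by
  simp only [reflectExt, foldMap_of_pos h, ← add_smul]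
  norm_num

theorem reflectExt_succ_of_pos {F : Type*} [AddCommGroup F] [Module ℝ F] {f : V → F} {X : V}
    {m : ℕ} (hm : m + 1 ≤ 2) (h : 0 < l X) : reflectExt l e (m + 1) f X = 0 := by
  simp only [reflectExt, foldMap_of_pos h, ← add_smul]
  have hm' : m ≤ 1 := by omega
  interval_cases m <;> norm_num

/-- For `1 < k ≤ 4` the fold maps are `5`-Lipschitz across the hyperplane and land in `l > 0`.
Composition with them keeps Hölder bounds on both sides at once, with no matching condition; the
factor `5` explains the radius `R/5`. -/
theorem holderBdd_reflectExt {F : Type*} [NormedAddCommGroup F] [NormedSpace ℝ F] (hγ : 0 ≤ γ)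
    (he : ‖e‖ ≤ 1) (hl : ∀ x, |l x| ≤ ‖x‖) (hle : l e = 1) (hX₀ : l X₀ = 0) (m : ℕ) {C : ℝ}
    (hC : 0 ≤ C) : ∃ C', 0 ≤ C' ∧ ∀ f : V → F,
      HolderBdd γ C (ball X₀ R ∩ {y | 0 < l y}) f →
      HolderBdd γ C' (ball X₀ (R / 5) ∩ {y | l y ≠ 0}) (reflectExt l e m f) := by
  have term : ∀ (w k : ℝ), 1 < k → k ≤ 4 → ∀ f : V → F,
      HolderBdd γ C (ball X₀ R ∩ {y | 0 < l y}) f →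
      HolderBdd γ (‖w • ContinuousLinearMap.id ℝ F‖ * (C * (1 + 5 ^ γ)))
        (ball X₀ (R / 5) ∩ {y | l y ≠ 0}) (fun X => w • f (foldMap l e k X)) := by
    intro w k hk hk4 f hf
    exact (hf.comp_lipschitz hγ (by norm_num) hC (fun X hX => foldMap_mem he hl hle hX₀ hk hk4 hX)
      (fun X _ Y _ => dist_foldMap_le he hl (by linarith) hk4 X Y)).clm
        (w • ContinuousLinearMap.id ℝ F)
  refine ⟨_, ?_, fun f hf => (term _ 2 (by norm_num) (by norm_num) f hf).add
    ((term _ 3 (by norm_num) (by norm_num) f hf).add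
      (term _ 4 (by norm_num) (by norm_num) f hf))⟩
  positivity

/-- Where `l < 0`, differentiating `f` composed with the fold map brings down a factor `k`, which
raises the weights from `k^m` to `k^(m+1)`. Where `l > 0` this term is absent, and `reflectExt l e
(m + 1)` vanishes there by the moment conditions. So one formula, built from the same extension
operators, holds on both sides. -/
theorem hasFDerivAt_reflectExt {F : Type*} [NormedAddCommGroup F] [NormedSpace ℝ F]
    (he : ‖e‖ ≤ 1) (hl : ∀ x, |l x| ≤ ‖x‖) (hle : l e = 1) (hX₀ : l X₀ = 0) {m : ℕ}
    (hm : m + 1 ≤ 2) {f : V → F}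
    (hf : ∀ x ∈ ball X₀ R ∩ {y | 0 < l y}, DifferentiableAt ℝ f x) {X : V}
    (hX : X ∈ ball X₀ (R / 5) ∩ {y | l y ≠ 0}) :
    HasFDerivAt (reflectExt l e m f) (reflectExt l e m (fderiv ℝ f) X -
      l.smulRight (reflectExt l e (m + 1) (fun x => fderiv ℝ f x e) X)) X := by
  have term : ∀ (w k : ℝ), 1 < k → k ≤ 4 → ∃ b : ℝ, (0 < l X → b = 0) ∧ (l X < 0 → b = 1) ∧
      HasFDerivAt (fun X => w • f (foldMap l e k X)) (w • (fderiv ℝ f (foldMap l e k X) -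
        (k * b) • l.smulRight (fderiv ℝ f (foldMap l e k X) e))) X := by
    intro w k hk hk4
    obtain ⟨b, hb0, hb1, hb⟩ := exists_hasFDerivAt_foldMap (e := e) (k := k) hX.2
    refine ⟨b, hb0, hb1, ?_⟩
    have h1 := (hf _ (foldMap_mem he hl hle hX₀ hk hk4 hX)).hasFDerivAt.comp X hb
    refine HasFDerivAt.congr_fderiv (h1.const_smul w) ?_
    ext v
    simp
  obtain ⟨b₂, p₂, q₂, h₂⟩ := term (2 ^ m * 6) 2 (by norm_num) (by norm_num)
  obtain ⟨b₃, p₃, q₃, h₃⟩ := term (3 ^ m * (-8)) 3 (by norm_num) (by norm_num)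
  obtain ⟨b₄, p₄, q₄, h₄⟩ := term (4 ^ m * 3) 4 (by norm_num) (by norm_num)
  have h := h₂.add (h₃.add h₄)
  refine HasFDerivAt.congr_fderiv h ?_
  rcases lt_or_gt_of_ne hX.2 with h | h
  · rw [q₂ h, q₃ h, q₄ h]
    ext v
    simp only [reflectExt, add_apply, sub_apply, smul_apply, ContinuousLinearMap.smulRight_apply]
    module
  · rw [p₂ h, p₃ h, p₄ h, reflectExt_succ_of_pos hm h]
    ext v
    simp only [reflectExt, add_apply, sub_apply, smul_apply, ContinuousLinearMap.smulRight_apply]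
    module

/-- Each differentiation raises `m` by at most one, and the moment conditions reach up to `m = 2`;
hence the restriction `m + k ≤ 2`. -/
theorem ckHolderOn_reflectExt (hγ : 0 ≤ γ) (he : ‖e‖ ≤ 1) (hl : ∀ x, |l x| ≤ ‖x‖) (hle : l e = 1)
    (hX₀ : l X₀ = 0) {k : ℕ} : ∀ {F : Type} [NormedAddCommGroup F] [NormedSpace ℝ F] (m : ℕ),
      m + k ≤ 2 → ∀ C : ℝ, 0 ≤ C → ∃ C', 0 ≤ C' ∧ ∀ f : V → F,
      CkHolderOn γ C (ball X₀ R ∩ {y | 0 < l y}) k f →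
      CkHolderOn γ C' (ball X₀ (R / 5) ∩ {y | l y ≠ 0}) k (reflectExt l e m f) := by
  have hop : IsOpen (ball X₀ (R / 5) ∩ {y | l y ≠ 0}) :=
    isOpen_ball.inter (isOpen_ne_fun l.continuous continuous_const)
  have hop' : IsOpen (ball X₀ R ∩ {y | 0 < l y}) :=
    isOpen_ball.inter (isOpen_lt continuous_const l.continuous)
  induction k with
  | zero =>
    intro F _ _ m _ C hC
    exact holderBdd_reflectExt hγ he hl hle hX₀ m hC
  | succ k ih =>
    intro F _ _ m hm C hC
    obtain ⟨C₁, hC₁, H₁⟩ := holderBdd_reflectExt (F := F) (R := R) hγ he hl hle hX₀ m hC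
    obtain ⟨C₂, hC₂, H₂⟩ := ih (F := V →L[ℝ] F) m (by omega) C hC
    obtain ⟨C₃, hC₃, H₃⟩ := CkHolderOn.clm (γ := γ) (k := k) (A := ball X₀ R ∩ {y | 0 < l y}) hop'
      (ContinuousLinearMap.apply ℝ F e) C
    obtain ⟨C₄, hC₄, H₄⟩ := ih (F := F) (m + 1) (by omega) C₃ hC₃
    obtain ⟨C₅, hC₅, H₅⟩ := CkHolderOn.clm (γ := γ) (k := k)
      (A := ball X₀ (R / 5) ∩ {y | l y ≠ 0}) hop
      (-(ContinuousLinearMap.smulRightL ℝ V F l)) C₄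
    refine ⟨C₁ + (C₂ + C₅), by positivity, fun f hf => ⟨(H₁ f hf.1).mono (by linarith),
      fun x hx => (hasFDerivAt_reflectExt he hl hle hX₀ (by omega) hf.2.1 hx).differentiableAt,
      ?_⟩⟩
    have h5 := H₅ _ (H₄ _ (H₃ _ hf.2.2))
    refine CkHolderOn.mono (CkHolderOn.congr hop ((H₂ _ hf.2.2).add hop h5) fun x hx => ?_)
      (le_add_of_nonneg_left hC₁)
    rw [(hasFDerivAt_reflectExt he hl hle hX₀ (by omega) hf.2.1 hx).fderiv, sub_eq_add_neg]
    rfl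

/-- A `C^{2,γ}` function on a half ball extends to a smaller full ball. -/
theorem exists_ckHolderOn_extend_halfBall [CompleteSpace V] (hγ : 0 < γ) (he : ‖e‖ ≤ 1)
    (hl : ∀ x, |l x| ≤ ‖x‖) (hle : l e = 1) (hX₀ : l X₀ = 0) {C : ℝ} (hC : 0 ≤ C) {f : V → ℝ}
    (hf : CkHolderOn γ C (ball X₀ R ∩ {y | 0 < l y}) 2 f) :
    ∃ C' g, 0 ≤ C' ∧ CkHolderOn γ C' (ball X₀ (R / 5)) 2 g ∧
      ∀ x ∈ ball X₀ (R / 5), 0 < l x → g x = f x := by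
  obtain ⟨C', hC', H⟩ := ckHolderOn_reflectExt (R := R) hγ.le he hl hle hX₀ (F := ℝ) (k := 2) 0
    le_rfl C hC
  obtain ⟨g, hg, hgf⟩ := CkHolderOn.exists_extend hγ hC' isOpen_ball hle (H f hf)
  refine ⟨C', g, hC', hg, fun x hx hlx => ?_⟩
  rw [hgf x ⟨hx, hlx.ne'⟩, reflectExt_zero_of_pos hlx]

end Reflection


/-! ### Extending the distance function across the boundary -/

section GraphShift

variable {n : ℕ}

/-- The shear `x ↦ x + a G(x) e`. -/
noncomputable def graphShift (a : ℝ) (G : RSpace n → ℝ) (e x : RSpace n) : RSpace n :=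
  x + (a * G x) • e

theorem exists_graphShift_bounds {γ C a : ℝ} {G : RSpace n → ℝ} {e : RSpace n}
    (hG : CkHolderOn γ C univ 2 G) :
    ∃ L, 1 ≤ L ∧ (∀ x y, dist (graphShift a G e x) (graphShift a G e y) ≤ L * dist x y) ∧
      (∀ x, DifferentiableAt ℝ (graphShift a G e) x) ∧
      (∀ x, ‖fderiv ℝ (graphShift a G e) x‖ ≤ L) ∧
      CkHolderOn γ L univ 1 (fderiv ℝ (graphShift a G e)) := by
  have hd : ∀ x, HasFDerivAt (graphShift a G e) (ContinuousLinearMap.id ℝ _ +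
      (a • fderiv ℝ G x).smulRight e) x := fun x =>
    (hasFDerivAt_id x).add (((hG.2.1 x trivial).hasFDerivAt.const_mul a).smul_const e)
  have hfd : fderiv ℝ (graphShift a G e) = fun x => ContinuousLinearMap.id ℝ _ +
      (a • (ContinuousLinearMap.smulRightL ℝ (RSpace n) (RSpace n)).flip e) (fderiv ℝ G x) := by
    ext1 x
    rw [(hd x).fderiv]
    ext1 v
    simp [smul_smul]
  obtain ⟨C₁, hC₁, H₁⟩ := CkHolderOn.clm (γ := γ) (k := 1) (A := (univ : Set (RSpace n)))
    isOpen_univ (a • (ContinuousLinearMap.smulRightL ℝ (RSpace n) (RSpace n)).flip e) C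
  have hck : CkHolderOn γ (‖ContinuousLinearMap.id ℝ (RSpace n)‖ + C₁) univ 1
      (fderiv ℝ (graphShift a G e)) := by
    rw [hfd]
    exact (CkHolderOn.const _ le_rfl).add isOpen_univ (H₁ _ hG.2.2)
  have hn : ∀ x, ‖fderiv ℝ (graphShift a G e) x‖ ≤
      ‖ContinuousLinearMap.id ℝ (RSpace n)‖ + C₁ := fun x => hck.1.1 x trivial
  have hle : ‖ContinuousLinearMap.id ℝ (RSpace n)‖ + C₁ ≤
      1 + (‖ContinuousLinearMap.id ℝ (RSpace n)‖ + C₁) := by linarith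
  refine ⟨1 + (‖ContinuousLinearMap.id ℝ (RSpace n)‖ + C₁), ?_, fun x y => ?_,
    fun x => (hd x).differentiableAt, fun x => (hn x).trans hle, hck.mono hle⟩
  · have : 0 ≤ ‖ContinuousLinearMap.id ℝ (RSpace n)‖ + C₁ := by positivity
    linarith
  · rw [dist_eq_norm, dist_eq_norm]
    exact convex_univ.norm_image_sub_le_of_norm_fderiv_le (𝕜 := ℝ)
      (fun w _ => (hd w).differentiableAt) (fun w _ => (hn w).trans hle) trivial trivial

theorem CkHolderOn.comp_proj {γ C : ℝ} (hγ : 0 ≤ γ) {g : RSpace n → ℝ}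
    (hg : CkHolderOn γ C univ 2 g) (e : RSpace n) :
    ∃ C', 0 ≤ C' ∧ CkHolderOn γ C' univ 2 fun x => g (x - inner ℝ e x • e) := by
  set P : RSpace n →L[ℝ] RSpace n := ContinuousLinearMap.id ℝ _ - (innerSL ℝ e).smulRight e with hP
  obtain ⟨C', hC', H⟩ := CkHolderOn.comp (k := 1) (γ := γ) (A := (univ : Set (RSpace n)))
    (A' := (univ : Set (RSpace n))) hγ isOpen_univ (F := ℝ) C ‖P‖ ‖P‖ (norm_nonneg P)
  refine ⟨C', hC', ?_⟩
  have := H g P hg (mapsTo_univ _ _) (fun x _ y _ => P.dist_le_opNorm x y)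
    (fun x _ => P.differentiableAt)
    (CkHolderOn.congr isOpen_univ (CkHolderOn.const P le_rfl) fun x _ => P.fderiv)
  refine CkHolderOn.congr isOpen_univ this fun x _ => ?_
  simp [hP]

end GraphShift

section Extension

variable {n : ℕ} {γ : ℝ≥0} {Ω : Set (RSpace n)} {d : RSpace n → ℝ}

/-- A function in `C^{2,γ}` up to the boundary of `Ω` extends across a boundary point. -/
theorem exists_ckHolderOn_extend_boundary (hγ : 0 < γ) (hγ1 : γ ≤ 1) (hΩ : IsOpen Ω)
    (hd : ContDiffOn ℝ 2 d Ω) {N : ℝ≥0} (hN : ckHolderNorm 2 γ Ω d ≤ N) {e x₀ : RSpace n}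
    (he : ‖e‖ = 1) {g : RSpace n → ℝ} {Cg : ℝ} (hg : CkHolderOn γ Cg univ 2 g) {r : ℝ} (hr : 0 < r)
    (hgr : ∀ x ∈ ball x₀ r, x ∈ Ω ↔ g (x - inner ℝ e x • e) < inner ℝ e x)
    (hx₀ : g (x₀ - inner ℝ e x₀ • e) = inner ℝ e x₀) :
    ∃ ρ C F, 0 < ρ ∧ 0 ≤ C ∧ CkHolderOn γ C (ball x₀ ρ) 2 F ∧
      ∀ x ∈ ball x₀ ρ, x ∈ Ω → F x = d x := by
  have hγ' : (0 : ℝ) < γ := hγ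
  have hγ1' : (γ : ℝ) ≤ 1 := by exact_mod_cast hγ1
  set l : RSpace n →L[ℝ] ℝ := innerSL ℝ e with hl
  have hlx : ∀ x, l x = inner ℝ e x := fun x => rfl
  have hle : l e = 1 := by rw [hlx, real_inner_self_eq_norm_sq, he, one_pow]
  have hlabs : ∀ x, |l x| ≤ ‖x‖ := fun x => by
    have := abs_real_inner_le_norm e x
    rwa [he, one_mul] at this
  obtain ⟨C₀, hC₀, hG⟩ := hg.comp_proj hγ'.le e
  set G : RSpace n → ℝ := fun x => g (x - inner ℝ e x • e) with hGdef
  have hGshift : ∀ x (t : ℝ), G (x + t • e) = G x := fun x t => by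
    have : inner ℝ e (x + t • e) = inner ℝ e x + t := by
      rw [← hlx, map_add, map_smul, hle, smul_eq_mul, mul_one, hlx]
    simp only [hGdef, this, add_smul]
    congr 1
    abel
  obtain ⟨L₁, hL₁1, lip₁, diff₁, -, ck₁⟩ := exists_graphShift_bounds (a := -1) (e := e) hG
  obtain ⟨L₂, hL₂1, lip₂, diff₂, nrm₂, ck₂⟩ := exists_graphShift_bounds (a := 1) (e := e) hG
  set Ξ := graphShift (-1) G e with hΞ
  set T := graphShift 1 G e with hT
  have hL₁0 : 0 < L₁ := by linarith
  have hL₂0 : 0 < L₂ := by linarith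
  have hTΞ : ∀ x, T (Ξ x) = x := fun x => by
    simp only [hT, hΞ, graphShift, hGshift]
    module
  have hΞT : ∀ X, Ξ (T X) = X := fun X => by
    simp only [hT, hΞ, graphShift, hGshift]
    module
  have hlΞ : ∀ x, l (Ξ x) = l x - G x := fun x => by
    simp only [hΞ, graphShift, map_add, map_smul, hle, smul_eq_mul]; ring
  have hlX₀ : l (Ξ x₀) = 0 := by rw [hlΞ, hlx]; exact sub_eq_zero.2 hx₀.symm
  set R := r / L₂ with hR
  have hR0 : 0 < R := by positivity
  set H := ball (Ξ x₀) R ∩ {y | 0 < l y} with hH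
  have hHop : IsOpen H := isOpen_ball.inter (isOpen_lt continuous_const l.continuous)
  have hHconv : Convex ℝ H := (convex_ball _ _).inter
    (convex_halfSpace_gt l.toLinearMap.isLinear 0)
  have hTΩ : ∀ X ∈ H, T X ∈ Ω := by
    intro X hX
    have hb : T X ∈ ball x₀ r := by
      have h1 := lip₂ X (Ξ x₀)
      rw [hTΞ] at h1
      have h2 : dist X (Ξ x₀) < R := hX.1
      rw [mem_ball]
      calc dist (T X) x₀ ≤ L₂ * dist X (Ξ x₀) := h1
        _ < L₂ * R := by gcongr
        _ = r := by rw [hR]; field_simp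
    rw [hgr _ hb, ← hlx]
    have h3 : 0 < l X := hX.2
    rw [← hΞT X, hlΞ] at h3
    exact sub_pos.1 h3
  set U := Ξ ⁻¹' H with hU
  have hΞc : Continuous Ξ := Differentiable.continuous (𝕜 := ℝ) fun x => diff₁ x
  have hUop : IsOpen U := hHop.preimage hΞc
  have hUΩ : U ⊆ Ω := fun x hx => by
    have := hTΩ _ hx
    rwa [hTΞ] at this
  obtain ⟨b0, b1, b2, b3⟩ := bounds_of_ckHolderNorm_two_le hN
  -- The region `U` is bounded by a graph and need not be convex. The mean value inequality is
  -- therefore used in the flattened half-ball and transported back.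
  have hlip : ∀ {F : Type} [NormedAddCommGroup F] [NormedSpace ℝ F] (h : RSpace n → F),
      (∀ x ∈ U, DifferentiableAt ℝ h x) → (∀ x ∈ U, ‖fderiv ℝ h x‖ ≤ N) →
      ∀ x ∈ U, ∀ y ∈ U, ‖h x - h y‖ ≤ (N * L₂ * L₁) * dist x y := by
    intro F _ _ h hdiff hb x hx y hy
    have hTU : ∀ X ∈ H, T X ∈ U := fun X hX => by rw [hU, mem_preimage, hΞT]; exact hX
    have h1 := hHconv.norm_image_sub_le_of_norm_hasFDerivWithin_le (𝕜 := ℝ)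
      (f := fun X => h (T X)) (C := N * L₂)
      (fun X hX => ((hdiff _ (hTU X hX)).hasFDerivAt.comp X
        (diff₂ X).hasFDerivAt).hasFDerivWithinAt)
      (fun X hX => (ContinuousLinearMap.opNorm_comp_le _ _).trans
        (mul_le_mul (hb _ (hTU X hX)) (nrm₂ X) (norm_nonneg _) N.2)) hy hx
    simp only [hTΞ] at h1
    refine h1.trans ?_
    rw [mul_assoc _ L₁]
    gcongr
    rw [← dist_eq_norm]
    exact lip₁ x y
  have dd1 : ∀ x ∈ U, DifferentiableAt ℝ d x := fun x hx =>
    (hd.contDiffAt (hΩ.mem_nhds (hUΩ hx))).differentiableAt (by norm_num)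
  have dd2 : ∀ x ∈ U, DifferentiableAt ℝ (fderiv ℝ d) x := fun x hx =>
    ((hd.contDiffAt (hΩ.mem_nhds (hUΩ hx))).fderiv_right (m := 1) (by norm_num)).differentiableAt
      (by norm_num)
  have hNL : 0 ≤ N * L₂ * L₁ := by positivity
  have hdU : CkHolderOn γ (3 * N + N * L₂ * L₁) U 2 d := by
    refine ⟨HolderBdd.of_lipschitz hγ'.le hγ1' N.2 hNL (fun x hx => b0 x (hUΩ hx))
      (hlip d dd1 fun x hx => b1 x (hUΩ hx)), dd1,
      HolderBdd.of_lipschitz hγ'.le hγ1' N.2 hNL (fun x hx => b1 x (hUΩ hx))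
      (hlip _ dd2 fun x hx => b2 x (hUΩ hx)), dd2, fun x hx => (b2 x (hUΩ hx)).trans ?_,
      fun x hx y hy => (b3 x (hUΩ hx) y (hUΩ hy)).trans ?_⟩
    · linarith [N.2]
    · gcongr; linarith [N.2]
  obtain ⟨C₃, hC₃, H₃⟩ := CkHolderOn.comp (k := 1) (γ := γ) (A := U) (A' := H) hγ'.le hHop (F := ℝ)
    (3 * N + N * L₂ * L₁) L₂ L₂ hL₂0.le
  have hf : CkHolderOn γ C₃ H 2 fun X => d (T X) :=
    H₃ d T hdU (fun X hX => by rw [hU, mem_preimage, hΞT]; exact hX) (fun x _ y _ => lip₂ x y)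
      (fun x _ => diff₂ x) (ck₂.mono_set (subset_univ _))
  obtain ⟨C₄, F, hC₄, hF, hFf⟩ := exists_ckHolderOn_extend_halfBall hγ' he.le hlabs hle hlX₀ hC₃ hf
  set ρ := min r (R / 5 / L₁) with hρ
  have hρ0 : 0 < ρ := by positivity
  have hmaps : ∀ x ∈ ball x₀ ρ, Ξ x ∈ ball (Ξ x₀) (R / 5) := fun x hx => by
    rw [mem_ball] at hx ⊢
    calc dist (Ξ x) (Ξ x₀) ≤ L₁ * dist x x₀ := lip₁ x x₀
      _ < L₁ * (R / 5 / L₁) := by gcongr; exact hx.trans_le (min_le_right _ _)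
      _ = R / 5 := by field_simp
  obtain ⟨C₅, hC₅, H₅⟩ := CkHolderOn.comp (k := 1) (γ := γ) (A := ball (Ξ x₀) (R / 5))
    (A' := ball x₀ ρ) hγ'.le isOpen_ball (F := ℝ) C₄ L₁ L₁ hL₁0.le
  refine ⟨ρ, C₅, fun x => F (Ξ x), hρ0, hC₅, H₅ F Ξ hF hmaps (fun x _ y _ => lip₁ x y)
    (fun x _ => diff₁ x) (ck₁.mono_set (subset_univ _)), fun x hx hxΩ => ?_⟩
  have h1 : 0 < l (Ξ x) := by
    rw [hlΞ, sub_pos]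
    exact (hgr x (ball_subset_ball (min_le_left _ _) hx)).1 hxΩ
  simp only [hFf _ (hmaps x hx) h1, hTΞ]

/-- A `C^{2,γ}` function near `x₀` agrees near `x₀` with a globally defined function which is
strictly increasing in the direction `e`. -/
theorem exists_global_of_local {γ : ℝ} (hγ : 0 ≤ γ) (hγ1 : γ ≤ 1) {x₀ e : RSpace n} {ρ C c : ℝ}
    (hρ : 0 < ρ) (hC : 0 ≤ C) {F : RSpace n → ℝ} (hF : CkHolderOn γ C (ball x₀ ρ) 2 F)
    (hF0 : F x₀ = 0) (he : ‖e‖ = 1) (hc : 0 < c) (hFe : c ≤ fderiv ℝ F x₀ e) :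
    ∃ E ρ' C', 0 < ρ' ∧ ρ' ≤ ρ ∧ Differentiable ℝ E ∧ CkHolderOn γ C' univ 1 (fderiv ℝ E) ∧
      (∀ x, c / 2 ≤ fderiv ℝ E x e) ∧ ∀ x ∈ ball x₀ ρ', E x = F x := by
  set D := fderiv ℝ F x₀ with hD
  have hx₀ρ : x₀ ∈ ball x₀ ρ := mem_ball_self hρ
  set A : RSpace n → ℝ := fun x => D (x - x₀) with hA
  have hAd : ∀ x, HasFDerivAt A D x := fun x => by
    have := D.hasFDerivAt.comp x ((hasFDerivAt_id x).sub_const x₀)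
    rwa [ContinuousLinearMap.comp_id] at this
  -- The global function will be `A + χ_σ (F - A)`, where `A` is the linear Taylor polynomial of `F`
  -- at `x₀` and `χ_σ` is a bump at scale `σ`.
  set Rm : RSpace n → ℝ := fun x => F x + -A x with hRm
  have hRd : ∀ x ∈ ball x₀ ρ, HasFDerivAt Rm (fderiv ℝ F x - D) x := fun x hx => by
    have := (hF.2.1 x hx).hasFDerivAt.add (hAd x).neg
    rwa [← sub_eq_add_neg] at this
  have hDlip : ∀ x ∈ ball x₀ ρ, ‖fderiv ℝ F x - D‖ ≤ C * ‖x - x₀‖ := fun x hx =>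
    (convex_ball x₀ ρ).norm_image_sub_le_of_norm_fderiv_le (𝕜 := ℝ) hF.2.2.2.1 hF.2.2.2.2.1
      hx₀ρ hx
  have hRb : ∀ x ∈ ball x₀ ρ, |Rm x| ≤ C * ‖x - x₀‖ * ‖x - x₀‖ := by
    intro x hx
    have hsub : closedBall x₀ ‖x - x₀‖ ⊆ ball x₀ ρ := fun y hy => by
      rw [mem_closedBall] at hy
      rw [mem_ball, dist_eq_norm] at hx
      exact hy.trans_lt hx
    have h1 := (convex_closedBall x₀ ‖x - x₀‖).norm_image_sub_le_of_norm_hasFDerivWithin_le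
      (𝕜 := ℝ) (f := Rm) (C := C * ‖x - x₀‖) (fun y hy => (hRd y (hsub hy)).hasFDerivWithinAt)
      (fun y hy => (hDlip y (hsub hy)).trans (by
        gcongr; rw [← dist_eq_norm]; exact hy))
      (mem_closedBall_self (norm_nonneg _)) (y := x) (by rw [mem_closedBall, dist_eq_norm])
    have h0 : Rm x₀ = 0 := by simp [hRm, hF0, hA]
    rwa [h0, sub_zero] at h1
  let χ : ContDiffBump (0 : RSpace n) := ⟨1, 2, one_pos, one_lt_two⟩
  have hχs : HasCompactSupport χ := χ.hasCompactSupport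
  obtain ⟨K, hK, hχK⟩ := CkHolderOn.of_contDiff_compactSupport (k := 1) hγ hγ1 (χ : RSpace n → ℝ)
    (χ.contDiff) hχs
  -- On the ball of radius `2σ` the remainder is at most `4Cσ²` and its gradient at most `2Cσ`,
  -- while the bump has gradient at most `K/σ`. The perturbation thus has gradient at most `(4K + 2)
  -- C σ`, and `σ` makes this at most `c/2`.
  set σ := min (ρ / 4) (c / (2 * ((4 * K + 2) * C + 1))) with hσ
  have hσ0 : 0 < σ := by positivity
  have hσρ : σ ≤ ρ / 4 := min_le_left _ _
  have hσc : (4 * K + 2) * C * σ ≤ c / 2 := by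
    have h1 : σ ≤ c / (2 * ((4 * K + 2) * C + 1)) := min_le_right _ _
    rw [le_div_iff₀ (by positivity)] at h1
    have : 0 ≤ (4 * K + 2) * C := by positivity
    nlinarith
  set X : RSpace n → ℝ := fun x => χ (σ⁻¹ • (x - x₀)) with hX
  have hXd : ∀ x, HasFDerivAt X (σ⁻¹ • fderiv ℝ (χ : RSpace n → ℝ) (σ⁻¹ • (x - x₀))) x := by
    intro x
    have h1 : HasFDerivAt (fun x : RSpace n => σ⁻¹ • (x - x₀))
        (σ⁻¹ • ContinuousLinearMap.id ℝ (RSpace n)) x :=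
      ((hasFDerivAt_id x).sub_const x₀).const_smul σ⁻¹
    have h2 := (hχK.2.1 (σ⁻¹ • (x - x₀)) trivial).hasFDerivAt.comp x h1
    refine h2.congr_fderiv ?_
    rw [ContinuousLinearMap.comp_smul, ContinuousLinearMap.comp_id]
  have hX1 : ∀ x, dist x x₀ ≤ σ → X x = 1 := fun x hx => by
    refine χ.one_of_mem_closedBall ?_
    rw [mem_closedBall_zero_iff, norm_smul, norm_inv, Real.norm_of_nonneg hσ0.le, ← dist_eq_norm,
      inv_mul_le_iff₀ hσ0]
    change _ ≤ σ * 1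
    rwa [mul_one]
  have hX0 : ∀ x, 2 * σ ≤ dist x x₀ → X x = 0 := fun x hx => by
    refine χ.zero_of_le_dist ?_
    rw [dist_zero_right, norm_smul, norm_inv, Real.norm_of_nonneg hσ0.le, ← dist_eq_norm]
    change 2 ≤ _
    rw [le_inv_mul_iff₀ hσ0]
    linarith
  have hXsmooth : ContDiff ℝ (⊤ : ℕ∞) X :=
    χ.contDiff.comp ((contDiff_id.sub contDiff_const).const_smul σ⁻¹)
  have hXs : HasCompactSupport X := by
    refine HasCompactSupport.intro (isCompact_closedBall x₀ (2 * σ)) fun x hx => hX0 x ?_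
    rw [mem_closedBall, not_le] at hx
    exact hx.le
  obtain ⟨K', hK', hXK⟩ := CkHolderOn.of_contDiff_compactSupport (k := 2) hγ hγ1 X hXsmooth hXs
  set P : RSpace n → ℝ := fun x => X x * Rm x with hP
  have hP0 : ∀ x ∉ closedBall x₀ (2 * σ), P x = 0 := fun x hx => by
    rw [mem_closedBall, not_le] at hx
    simp only [hP, hX0 x hx.le, zero_mul]
  have hρ2 : closedBall x₀ (2 * σ) ⊆ ball x₀ ρ := closedBall_subset_ball (by linarith)
  have hAb : CkHolderOn γ (3 * (‖D‖ * ρ) + 2 * ‖D‖) (ball x₀ ρ) 2 fun x => -A x := by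
    have hAd' : ∀ x, HasFDerivAt (fun x => -A x) (-D) x := fun x => (hAd x).neg
    have hfd : fderiv ℝ (fun x => -A x) = fun _ => -D := funext fun x => (hAd' x).fderiv
    refine ⟨?_, fun x _ => (hAd' x).differentiableAt, ?_⟩
    · refine (HolderBdd.of_lipschitz hγ hγ1 (C := ‖D‖ * ρ) (L := ‖D‖) (by positivity)
        (norm_nonneg D) (fun x hx => ?_) fun x _ y _ => ?_).mono (by linarith [norm_nonneg D])
      · rw [norm_neg]
        refine (D.le_opNorm _).trans ?_
        gcongr
        rw [← dist_eq_norm]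
        exact le_of_lt hx
      · rw [dist_eq_norm, ← norm_neg]
        refine le_trans (le_of_eq ?_) (D.le_opNorm (x - y))
        congr 1
        simp only [hA, map_sub]
        ring
    · rw [hfd]
      refine CkHolderOn.const _ ?_
      rw [norm_neg]
      have : 0 ≤ ‖D‖ * ρ := by positivity
      linarith [norm_nonneg D]
  obtain ⟨C₁, hC₁, H₁⟩ := CkHolderOn.bilin (γ := γ) (k := 2) (A := ball x₀ ρ) isOpen_ball
    (ContinuousLinearMap.mul ℝ ℝ) K' (C + (3 * (‖D‖ * ρ) + 2 * ‖D‖))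
  have hPb : CkHolderOn γ C₁ (ball x₀ ρ) 2 P :=
    H₁ X Rm (hXK.mono_set (subset_univ _)) (hF.add isOpen_ball hAb)
  have hPu := CkHolderOn.univ_of_zero_off hγ hC₁ (δ := ρ / 2) (by positivity) isClosed_closedBall
    (K := closedBall x₀ (2 * σ)) (fun x hx => by
      refine ball_subset_ball' ?_
      rw [mem_closedBall] at hx
      linarith) P hPb hP0
  have hPn : ∀ x, ‖fderiv ℝ P x‖ ≤ c / 2 := by
    intro x
    by_cases hx : x ∈ closedBall x₀ (2 * σ)
    · have hxρ := hρ2 hx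
      have hx2 : ‖x - x₀‖ ≤ 2 * σ := by rw [← dist_eq_norm]; exact hx
      have h1 : HasFDerivAt P (X x • (fderiv ℝ F x - D) +
          Rm x • (σ⁻¹ • fderiv ℝ (χ : RSpace n → ℝ) (σ⁻¹ • (x - x₀)))) x :=
        (hXd x).mul (hRd x hxρ)
      rw [h1.fderiv]
      have hXle : ‖X x‖ ≤ 1 := by
        rw [Real.norm_of_nonneg χ.nonneg]; exact χ.le_one
      have hχn : ‖fderiv ℝ (χ : RSpace n → ℝ) (σ⁻¹ • (x - x₀))‖ ≤ K := hχK.2.2.1 _ trivial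
      have hRx : ‖Rm x‖ ≤ C * (2 * σ) * (2 * σ) := (hRb x hxρ).trans (by gcongr)
      calc _ ≤ ‖X x‖ * ‖fderiv ℝ F x - D‖ +
            ‖Rm x‖ * (σ⁻¹ * ‖fderiv ℝ (χ : RSpace n → ℝ) (σ⁻¹ • (x - x₀))‖) := by
            refine (norm_add_le _ _).trans ?_
            rw [norm_smul, norm_smul, norm_smul, norm_inv, Real.norm_of_nonneg hσ0.le]
        _ ≤ 1 * (C * (2 * σ)) + C * (2 * σ) * (2 * σ) * (σ⁻¹ * K) := by
            gcongr
            exact (hDlip x hxρ).trans (by gcongr)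
        _ = (4 * K + 2) * C * σ := by field_simp; ring
        _ ≤ c / 2 := hσc
    · have : P =ᶠ[nhds x] fun _ => 0 := by
        filter_upwards [isClosed_closedBall.isOpen_compl.mem_nhds hx] with y hy using hP0 y hy
      rw [this.fderiv_eq]
      simp only [fderiv_fun_const, Pi.zero_apply, norm_zero]
      positivity
  have hEd : ∀ x, HasFDerivAt (fun x => A x + P x) (D + fderiv ℝ P x) x := fun x =>
    (hAd x).add (hPu.2.1 x trivial).hasFDerivAt
  have hEfd : fderiv ℝ (fun x => A x + P x) = fun x => D + fderiv ℝ P x :=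
    funext fun x => (hEd x).fderiv
  refine ⟨fun x => A x + P x, σ, ‖D‖ + (C₁ + C₁ + 2 * C₁ / (ρ / 2) ^ γ), hσ0, by linarith, fun x => (hEd x).differentiableAt, ?_,
    fun x => ?_, fun x hx => ?_⟩
  · rw [hEfd]
    exact (CkHolderOn.const D le_rfl).add isOpen_univ hPu.2.2
  · rw [hEfd]
    have h1 := (fderiv ℝ P x).le_opNorm e
    rw [he, mul_one, Real.norm_eq_abs] at h1
    have h2 := neg_abs_le (fderiv ℝ P x e)
    rw [ContinuousLinearMap.add_apply]
    linarith [hPn x]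
  · simp only [hP, hX1 x (le_of_lt hx), hRm]
    ring

end Extension



/-! ### Geometry at a boundary point -/

section Boundary

variable {n : ℕ} {γ M : ℝ≥0} {s₀ r G : ℝ} {Ω : Set (RSpace n)} {d g : RSpace n → ℝ}
  {e x₀ p : RSpace n}

theorem sub_inner_smul_add_smul (he : ‖e‖ = 1) (x : RSpace n) (t : ℝ) :
    (x + t • e) - inner ℝ e (x + t • e) • e = x - inner ℝ e x • e := by
  rw [inner_add_right, inner_smul_right, real_inner_self_eq_norm_sq, he, one_pow, mul_one, add_smul]
  abel

theorem norm_sub_inner_smul_le (he : ‖e‖ = 1) (x : RSpace n) :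
    ‖x - inner ℝ e x • e‖ ≤ 2 * ‖x‖ := by
  have h := abs_real_inner_le_norm e x
  rw [he, one_mul] at h
  refine (norm_sub_le _ _).trans ?_
  rw [norm_smul, he, mul_one, Real.norm_eq_abs]
  linarith

theorem add_smul_mem_of_graph (he : ‖e‖ = 1)
    (hgr : ∀ x ∈ ball x₀ r, x ∈ Ω ↔ g (x - inner ℝ e x • e) < inner ℝ e x)
    (hp : g (p - inner ℝ e p • e) = inner ℝ e p) {t : ℝ} (ht : 0 < t)
    (hpt : p + t • e ∈ ball x₀ r) : p + t • e ∈ Ω := by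
  rw [hgr _ hpt, sub_inner_smul_add_smul he, hp, inner_add_right, inner_smul_right,
    real_inner_self_eq_norm_sq, he]
  linarith

theorem graph_eq_of_mem_frontier (hΩ : IsOpen Ω) (hg : Continuous g) (hr : 0 < r)
    (hgr : ∀ x ∈ ball x₀ r, x ∈ Ω ↔ g (x - inner ℝ e x • e) < inner ℝ e x)
    (hx₀ : x₀ ∈ frontier Ω) : g (x₀ - inner ℝ e x₀ • e) = inner ℝ e x₀ := by
  rw [hΩ.frontier_eq] at hx₀
  have h1 := mt (hgr x₀ (mem_ball_self hr)).2 hx₀.2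
  refine le_antisymm ?_ (not_lt.1 h1)
  have hc : Continuous fun x : RSpace n => inner ℝ e x - g (x - inner ℝ e x • e) := by fun_prop
  have h2 : x₀ ∈ closure (Ω ∩ ball x₀ r) := by
    rw [mem_closure_iff_nhds]
    intro U hU
    obtain ⟨y, hy⟩ := mem_closure_iff_nhds.1 hx₀.1 (U ∩ ball x₀ r)
      (Filter.inter_mem hU (ball_mem_nhds x₀ hr))
    exact ⟨y, hy.1.1, hy.2, hy.1.2⟩
  have h3 : Ω ∩ ball x₀ r ⊆ {x | 0 ≤ inner ℝ e x - g (x - inner ℝ e x • e)} := fun x hx =>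
    sub_nonneg.2 ((hgr x hx.2).1 hx.1).le
  exact sub_nonneg.1 (closure_minimal h3 (isClosed_le continuous_const hc) h2)

/-- A nearby point `z` of the complement lies on or below a `G`-Lipschitz graph, which forces `t ≤
(1 + 2G) |x₀ + t e - z|`; the `2` bounds the norm of the projection along `e`. Points outside the
ball are at distance at least `r/2 ≥ t`. -/
theorem infDist_compl_add_smul_ge (he : ‖e‖ = 1) (hG : 0 ≤ G)
    (hgl : ∀ x y, |g x - g y| ≤ G * ‖x - y‖) (hr : 0 < r)
    (hgr : ∀ x ∈ ball x₀ r, x ∈ Ω ↔ g (x - inner ℝ e x • e) < inner ℝ e x)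
    (hx₀ : g (x₀ - inner ℝ e x₀ • e) = inner ℝ e x₀) {t : ℝ} (ht : 0 ≤ t) (htr : t ≤ r / 2) :
    t / (1 + 2 * G) ≤ infDist (x₀ + t • e) Ωᶜ := by
  have hne : (Ωᶜ).Nonempty := ⟨x₀, fun h => by
    have := (hgr x₀ (mem_ball_self hr)).1 h
    linarith⟩
  rw [le_infDist hne]
  intro z hz
  rw [div_le_iff₀ (by positivity), dist_eq_norm]
  by_cases hzr : z ∈ ball x₀ r
  · have h1 := not_lt.1 (mt (hgr z hzr).2 hz)
    set v := x₀ + t • e - z with hv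
    have h2 := (le_abs_self _).trans (hgl (z - inner ℝ e z • e) (x₀ - inner ℝ e x₀ • e))
    have h3 : (z - inner ℝ e z • e) - (x₀ - inner ℝ e x₀ • e) = -(v - inner ℝ e v • e) := by
      rw [hv, inner_sub_right, sub_smul, ← sub_inner_smul_add_smul he x₀ t]
      abel
    rw [h3, norm_neg] at h2
    have h4 := norm_sub_inner_smul_le he v
    have h5 := (le_abs_self _).trans (abs_real_inner_le_norm e v)
    have h6 : inner ℝ e v = inner ℝ e x₀ + t - inner ℝ e z := by
      rw [hv, inner_sub_right, inner_add_right, inner_smul_right, real_inner_self_eq_norm_sq, he]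
      ring
    rw [he, one_mul, h6] at h5
    have h7 := mul_le_mul_of_nonneg_left h4 hG
    linarith
  · rw [mem_ball, not_lt, dist_comm, dist_eq_norm] at hzr
    have h1 : ‖x₀ - z‖ ≤ ‖x₀ + t • e - z‖ + t := by
      have : x₀ - z = (x₀ + t • e - z) - t • e := by abel
      rw [this]
      refine (norm_sub_le _ _).trans ?_
      rw [norm_smul t e, he, mul_one, Real.norm_of_nonneg ht]
    have h2 : t ≤ ‖x₀ + t • e - z‖ := by linarith
    nlinarith [norm_nonneg (x₀ + t • e - z)]

theorem infDist_compl_add_smul_le (he : ‖e‖ = 1) (hp : p ∉ Ω) {t : ℝ} (ht : 0 ≤ t) :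
    infDist (p + t • e) Ωᶜ ≤ t := by
  refine (infDist_le_dist_of_mem (mem_compl hp)).trans (le_of_eq ?_)
  rw [dist_eq_norm, add_sub_cancel_left, norm_smul, he, mul_one, Real.norm_of_nonneg ht]

theorem hasDerivAt_comp_add_smul {F : RSpace n → ℝ} {x : RSpace n} {t : ℝ}
    (hF : DifferentiableAt ℝ F (x + t • e)) :
    HasDerivAt (fun t => F (x + t • e)) (fderiv ℝ F (x + t • e) e) t := by
  have h1 : HasDerivAt (fun t : ℝ => x + t • e) e t := by
    simpa using ((hasDerivAt_id t).smul_const e).const_add x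
  exact hF.hasFDerivAt.comp_hasDerivAt t h1

/-- A `C^{2,γ}` function which agrees inside the domain with the distance to the boundary vanishes
on the boundary and has positive derivative in the direction transversal to it. -/
theorem eq_zero_and_le_fderiv_of_eq_infDist (he : ‖e‖ = 1) (hG : 0 ≤ G)
    (hgl : ∀ x y, |g x - g y| ≤ G * ‖x - y‖) (hr : 0 < r)
    (hgr : ∀ x ∈ ball x₀ r, x ∈ Ω ↔ g (x - inner ℝ e x • e) < inner ℝ e x)
    (hx₀ : g (x₀ - inner ℝ e x₀ • e) = inner ℝ e x₀) {F : RSpace n → ℝ}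
    (hF : DifferentiableAt ℝ F x₀) (hFd : ∀ x ∈ ball x₀ r, x ∈ Ω → F x = infDist x Ωᶜ) :
    F x₀ = 0 ∧ 1 / (1 + 2 * G) ≤ fderiv ℝ F x₀ e := by
  have hx₀Ω : x₀ ∉ Ω := fun h => by
    have := (hgr x₀ (mem_ball_self hr)).1 h
    linarith
  have hval : ∀ t, 0 < t → t ≤ r / 2 → F (x₀ + t • e) = infDist (x₀ + t • e) Ωᶜ :=
    fun t ht htr => by
      have hmem : x₀ + t • e ∈ ball x₀ r := by
        rw [mem_ball, dist_eq_norm, add_sub_cancel_left, norm_smul, he, mul_one,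
          Real.norm_of_nonneg ht.le]
        linarith
      exact hFd _ hmem (add_smul_mem_of_graph he hgr hx₀ ht hmem)
  have hder : HasDerivAt (fun t : ℝ => F (x₀ + t • e)) (fderiv ℝ F x₀ e) 0 := by
    have := hasDerivAt_comp_add_smul (F := F) (x := x₀) (t := 0) (e := e)
      (by rwa [zero_smul, add_zero])
    rwa [zero_smul, add_zero] at this
  have hsmall : ∀ᶠ t : ℝ in nhdsWithin 0 (Ioi 0), 0 < t ∧ t ≤ r / 2 := by
    filter_upwards [Ioc_mem_nhdsGT (half_pos hr)] with t ht using ht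
  have hF0 : F x₀ = 0 := by
    have h1 : Filter.Tendsto (fun t : ℝ => F (x₀ + t • e)) (nhdsWithin 0 (Ioi 0)) (nhds (F x₀)) := by
      have := hder.continuousAt.tendsto
      rw [zero_smul, add_zero] at this
      exact this.mono_left nhdsWithin_le_nhds
    have h2 : Filter.Tendsto (fun t : ℝ => t) (nhdsWithin 0 (Ioi 0)) (nhds 0) :=
      Filter.tendsto_id.mono_left nhdsWithin_le_nhds
    refine le_antisymm (le_of_tendsto_of_tendsto h1 h2 ?_) (ge_of_tendsto h1 ?_)
    · filter_upwards [hsmall] with t ht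
      rw [hval t ht.1 ht.2]
      exact infDist_compl_add_smul_le he hx₀Ω ht.1.le
    · filter_upwards [hsmall] with t ht
      rw [hval t ht.1 ht.2]
      exact infDist_nonneg
  refine ⟨hF0, ?_⟩
  have h3 := hasDerivWithinAt_iff_tendsto_slope.1 (hder.hasDerivWithinAt (s := Ioi 0))
  rw [sdiff_singleton_eq_self (by simp)] at h3
  refine ge_of_tendsto h3 ?_
  filter_upwards [hsmall] with t ht
  rw [slope_def_field, hval t ht.1 ht.2, zero_smul, add_zero, hF0, sub_zero, sub_zero,
    le_div_iff₀ ht.1]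
  refine le_trans (le_of_eq ?_) (infDist_compl_add_smul_ge he hG hgl hr hgr hx₀ ht.1.le ht.2)
  ring

theorem localHolderBound_of_mem_frontier (hn : 1 ≤ n) (hγ : 0 < γ) (hγ1 : γ ≤ 1) (hs₀ : 0 < s₀)
    (hΩ : IsC2HolderDomain γ Ω) (hΩb : Bornology.IsBounded Ω) (hd : IsRegularDistance γ Ω d)
    (hx₀ : x₀ ∈ frontier Ω) : LocalHolderBound γ M s₀ Ω d x₀ := by
  have hγ' : (0 : ℝ) < γ := hγ
  have hγ1' : (γ : ℝ) ≤ 1 := by exact_mod_cast hγ1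
  obtain ⟨hΩo, hΩg⟩ := hΩ
  obtain ⟨⟨hdc, hdn⟩, hpos, V, hV, hVf, hVd⟩ := hd
  obtain ⟨e, g, r, he, hr, ⟨hgc, hgn⟩, hgr⟩ := hΩg x₀ hx₀
  lift ckHolderNorm 2 γ Ω d to ℝ≥0 using hdn.ne with N hN
  lift ckHolderNorm 2 γ univ g to ℝ≥0 using hgn.ne with Ng hNg
  have hg := ckHolderOn_of_ckHolderNorm_le hγ1 isOpen_univ hgc hNg.symm.le subset_rfl convex_univ
  set G : ℝ := 4 * Ng with hG
  have hG0 : 0 ≤ G := by positivity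
  have hgl : ∀ x y, |g x - g y| ≤ G * ‖x - y‖ := fun x y =>
    convex_univ.norm_image_sub_le_of_norm_fderiv_le (𝕜 := ℝ) hg.2.1 hg.2.2.1.1 trivial trivial
  have hx₀g := graph_eq_of_mem_frontier hΩo (contDiffOn_univ.1 hgc).continuous hr hgr hx₀
  obtain ⟨ρ, C, F, hρ, hC, hF, hFd⟩ := exists_ckHolderOn_extend_boundary hγ hγ1 hΩo hdc hN.symm.le he
    hg hr hgr hx₀g
  obtain ⟨r₁, hr₁, hr₁V⟩ := Metric.isOpen_iff.1 hV x₀ (hVf hx₀)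
  have hmin : 0 < min (min r r₁) ρ := lt_min (lt_min hr hr₁) hρ
  obtain ⟨hF0, hFe⟩ := eq_zero_and_le_fderiv_of_eq_infDist he hG0 hgl hmin
    (fun x hx => hgr x (ball_subset_ball ((min_le_left _ _).trans (min_le_left _ _)) hx)) hx₀g
    (hF.2.1 x₀ (mem_ball_self hρ)) fun x hx hxΩ =>
      (hFd x (ball_subset_ball (min_le_right _ _) hx) hxΩ).trans (hVd x
        ⟨hr₁V (ball_subset_ball ((min_le_left _ _).trans (min_le_right _ _)) hx), hxΩ⟩)
  obtain ⟨E, ρ', C', hρ', hρρ, hE, hEC, hEe, hEF⟩ := exists_global_of_local hγ'.le hγ1' hρ hC hF hF0 he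
    (by positivity) hFe
  obtain ⟨L, ψ, J, hL, hψ⟩ := exists_isStraightening hγ'.le hγ1' he (by positivity) hE hEC hEe
  set R₁ := min (min r r₁) ρ' with hR₁
  have hR₁0 : 0 < R₁ := lt_min (lt_min hr hr₁) hρ'
  have hR₁r : R₁ ≤ r := (min_le_left _ _).trans (min_le_left _ _)
  have hR₁r₁ : R₁ ≤ r₁ := (min_le_left _ _).trans (min_le_right _ _)
  have hR₁ρ : R₁ ≤ ρ' := min_le_right _ _
  have hEd : ∀ x ∈ ball x₀ R₁, x ∈ Ω → d x = E x := fun x hx hxΩ => by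
    rw [hEF x (ball_subset_ball hR₁ρ hx), hFd x (ball_subset_ball (hR₁ρ.trans hρρ) hx) hxΩ]
  -- With this choice a point of the ball of radius `R`, pushed up to the graph along `e`, stays
  -- within `R₁/2` of `x₀`.
  set R := R₁ / (4 + 4 * G) with hR
  have hR0 : 0 < R := by positivity
  have hRR₁ : R * (2 + 2 * G) = R₁ / 2 := by rw [hR]; field_simp; ring
  have hRle : R ≤ R₁ := by nlinarith
  refine localHolderBound_of_isStraightening hn hγ hγ1 hs₀ hΩo hΩb hdc hpos N.2
    (fun x hx => (bounds_of_ckHolderNorm_two_le hN.symm.le).1 x hx) hL hψ hR0 (fun x hx => ?_)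
    fun x hx => hEd x (ball_subset_ball hRle hx)
  refine ⟨fun hxΩ => (hEd x (ball_subset_ball hRle hx) hxΩ) ▸ hpos x hxΩ, fun hxE => ?_⟩
  -- A point `x` outside `Ω` is pushed up along `e` to the point `p` of the graph. There `E p ≤ 0`,
  -- because `E (p + t e)` equals the distance to the complement and is at most `t`. Since `E`
  -- increases along `e`, this gives `E x ≤ E p ≤ 0`.
  by_contra hxΩ
  have hxr : x ∈ ball x₀ r := ball_subset_ball (hRle.trans hR₁r) hx
  have h1 := not_lt.1 (mt (hgr x hxr).2 hxΩ)
  set τ := g (x - inner ℝ e x • e) - inner ℝ e x with hτ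
  have hτ0 : 0 ≤ τ := sub_nonneg.2 h1
  rw [mem_ball, dist_eq_norm] at hx
  have hτle : τ ≤ (1 + 2 * G) * ‖x - x₀‖ := by
    have h2 := (le_abs_self _).trans (hgl (x - inner ℝ e x • e) (x₀ - inner ℝ e x₀ • e))
    have h3 : (x - inner ℝ e x • e) - (x₀ - inner ℝ e x₀ • e) =
        (x - x₀) - inner ℝ e (x - x₀) • e := by
      rw [inner_sub_right, sub_smul]; abel
    rw [h3, hx₀g] at h2
    have h4 := mul_le_mul_of_nonneg_left (norm_sub_inner_smul_le he (x - x₀)) hG0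
    have h6 := abs_real_inner_le_norm e (x - x₀)
    rw [he, one_mul] at h6
    have h7 : inner ℝ e (x - x₀) = inner ℝ e x - inner ℝ e x₀ := inner_sub_right _ _ _
    have h8 := neg_abs_le (inner ℝ e (x - x₀))
    linarith
  set p := x + τ • e with hp
  have hpg : g (p - inner ℝ e p • e) = inner ℝ e p := by
    rw [hp, sub_inner_smul_add_smul he, inner_add_right, inner_smul_right,
      real_inner_self_eq_norm_sq, he, hτ]
    ring
  have hpx : ‖p - x₀‖ < R₁ / 2 := by
    have h2 : p - x₀ = (x - x₀) + τ • e := by rw [hp]; abel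
    rw [h2, ← hRR₁]
    refine (norm_add_le _ _).trans_lt ?_
    rw [norm_smul, he, mul_one, Real.norm_of_nonneg hτ0]
    nlinarith
  have hpball : p ∈ ball x₀ R₁ := by rw [mem_ball, dist_eq_norm]; linarith
  have hpΩ : p ∉ Ω := fun h => by
    have := (hgr p (ball_subset_ball hR₁r hpball)).1 h
    linarith
  have hEp : E p ≤ 0 := by
    have hc : Continuous fun t : ℝ => E (p + t • e) := by
      have := hE.continuous
      fun_prop
    have h2 : Filter.Tendsto (fun t : ℝ => E (p + t • e)) (nhdsWithin 0 (Ioi 0)) (nhds (E p)) := by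
      have := hc.tendsto 0
      simp only [zero_smul, add_zero] at this
      exact this.mono_left nhdsWithin_le_nhds
    have h3 : Filter.Tendsto (fun t : ℝ => t) (nhdsWithin 0 (Ioi 0)) (nhds 0) :=
      Filter.tendsto_id.mono_left nhdsWithin_le_nhds
    refine le_of_tendsto_of_tendsto h2 h3 ?_
    filter_upwards [Ioc_mem_nhdsGT (half_pos hR₁0)] with t ht
    have hmem : p + t • e ∈ ball x₀ R₁ := by
      have h4 : p + t • e - x₀ = (p - x₀) + t • e := by abel
      rw [mem_ball, dist_eq_norm, h4]
      refine (norm_add_le _ _).trans_lt ?_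
      rw [norm_smul, he, mul_one, Real.norm_of_nonneg ht.1.le]
      linarith [ht.2]
    have hmΩ := add_smul_mem_of_graph he hgr hpg ht.1 (ball_subset_ball hR₁r hmem)
    rw [← hEd _ hmem hmΩ, hVd _ ⟨hr₁V (ball_subset_ball hR₁r₁ hmem), hmΩ⟩]
    exact infDist_compl_add_smul_le he hpΩ ht.1.le
  have hmono : Monotone fun t : ℝ => E (x + t • e) :=
    monotone_of_hasDerivAt_nonneg (fun t => hasDerivAt_comp_add_smul (hE _)) fun t => by
      refine le_trans ?_ (hEe _)
      positivity
  have h9 := hmono hτ0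
  simp only [zero_smul, add_zero] at h9
  linarith

end Boundary



/-! ### Extension to the closure, sums and multiples -/

section Extension

variable {X F : Type*} [PseudoMetricSpace X] [NormedAddCommGroup F] {γ C : ℝ} {A : Set X}

theorem HolderBdd.exists_tendsto_of_mem_closure [CompleteSpace F] {f : X → F} (hγ : 0 < γ)
    (hf : HolderBdd γ C A f) {x : X} (hx : x ∈ closure A) :
    ∃ y, Filter.Tendsto f (nhdsWithin x A) (nhds y) := by
  have := mem_closure_iff_nhdsWithin_neBot.1 hx
  refine cauchy_map_iff_exists_tendsto.1 (Metric.cauchy_iff.2 ⟨inferInstance, fun ε hε => ?_⟩)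
  have h0 : Filter.Tendsto (fun t : ℝ => |C| * (2 * t) ^ γ) (nhdsWithin 0 (Ioi 0)) (nhds 0) := by
    have hc : Continuous fun t : ℝ => |C| * (2 * t) ^ γ :=
      continuous_const.mul ((continuous_const.mul continuous_id).rpow_const fun _ => Or.inr hγ.le)
    have := hc.tendsto 0
    simp only [mul_zero, Real.zero_rpow hγ.ne'] at this
    exact this.mono_left nhdsWithin_le_nhds
  obtain ⟨t, ht, ht0⟩ := ((h0.eventually (gt_mem_nhds hε)).and self_mem_nhdsWithin).exists
  refine ⟨f '' (A ∩ ball x t), Filter.image_mem_map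
    (Filter.inter_mem self_mem_nhdsWithin (mem_nhdsWithin_of_mem_nhds (ball_mem_nhds x ht0))), ?_⟩
  rintro _ ⟨y, hy, rfl⟩ _ ⟨z, hz, rfl⟩
  rw [dist_eq_norm]
  refine (hf.2 y hy.1 z hz.1).trans_lt (lt_of_le_of_lt ?_ ht)
  have h2 : dist y z ≤ 2 * t := by
    have h3 := dist_triangle_right y z x
    have h4 := mem_ball.1 hy.2
    have h5 := mem_ball.1 hz.2
    linarith
  gcongr
  exact le_abs_self C

theorem HolderBdd.exists_extend_closure [CompleteSpace F] {f : X → F} (hγ : 0 < γ)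
    (hf : HolderBdd γ C A f) : ∃ g, HolderBdd γ C (closure A) g ∧ ∀ x ∈ A, g x = f x := by
  classical
  choose! g hg using fun x hx => hf.exists_tendsto_of_mem_closure hγ (x := x) hx
  refine ⟨fun x => if x ∈ A then f x else g x, ?_, fun x hx => if_pos hx⟩
  have hlim : ∀ x ∈ closure A, Filter.Tendsto f (nhdsWithin x A)
      (nhds (if x ∈ A then f x else g x)) := by
    intro x hx
    split_ifs with h
    · exact hf.continuousOn hγ x h
    · exact hg x hx
  constructor
  · intro x hx
    have := mem_closure_iff_nhdsWithin_neBot.1 hx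
    refine le_of_tendsto (hlim x hx).norm ?_
    filter_upwards [self_mem_nhdsWithin] with y hy using hf.1 y hy
  · intro x hx y hy
    have := mem_closure_iff_nhdsWithin_neBot.1 hx
    have := mem_closure_iff_nhdsWithin_neBot.1 hy
    have h1 := ((hlim x hx).comp (Filter.tendsto_fst (g := nhdsWithin y A))).sub
      ((hlim y hy).comp (Filter.tendsto_snd (f := nhdsWithin x A)))
    have h2 : Filter.Tendsto (fun p : X × X => C * dist p.1 p.2 ^ γ)
        (nhdsWithin x A ×ˢ nhdsWithin y A) (nhds (C * dist x y ^ γ)) := by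
      have hc : Continuous fun p : X × X => C * dist p.1 p.2 ^ γ :=
        continuous_const.mul (continuous_dist.rpow_const fun _ => Or.inr hγ.le)
      have h3 := hc.tendsto (x, y)
      rw [nhds_prod_eq] at h3
      exact h3.mono_left (Filter.prod_mono nhdsWithin_le_nhds nhdsWithin_le_nhds)
    refine le_of_tendsto_of_tendsto h1.norm h2 ?_
    filter_upwards [Filter.prod_mem_prod (self_mem_nhdsWithin (a := x) (s := A))
      (self_mem_nhdsWithin (a := y) (s := A))] with p hp
    exact hf.2 p.1 hp.1 p.2 hp.2

theorem HolderBdd.sum {ι : Type*} {c : ι → ℝ} {f : ι → X → F} (t : Finset ι)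
    (h : ∀ i ∈ t, HolderBdd γ (c i) A (f i)) :
    HolderBdd γ (∑ i ∈ t, c i) A fun x => ∑ i ∈ t, f i x := by
  refine ⟨fun x hx => norm_sum_le_of_le t fun i hi => (h i hi).1 x hx, fun x hx y hy => ?_⟩
  rw [← Finset.sum_sub_distrib, Finset.sum_mul]
  exact norm_sum_le_of_le t fun i hi => (h i hi).2 x hx y hy

theorem HolderBdd.const_mul {f : X → ℝ} {c : ℝ} (hc : 0 ≤ c) (h : HolderBdd γ C A f) :
    HolderBdd γ (c * C) A fun x => c * f x := by
  refine ⟨fun x hx => ?_, fun x hx y hy => ?_⟩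
  · rw [norm_mul, Real.norm_of_nonneg hc]
    exact mul_le_mul_of_nonneg_left (h.1 x hx) hc
  · rw [← mul_sub, norm_mul, Real.norm_of_nonneg hc, mul_assoc]
    exact mul_le_mul_of_nonneg_left (h.2 x hx y hy) hc

theorem CkHolderOn.const_smul {V : Type} [NormedAddCommGroup V] [NormedSpace ℝ V] {A : Set V}
    {c : ℝ} (hc : 0 ≤ c) {k : ℕ} : ∀ {F : Type} [NormedAddCommGroup F] [NormedSpace ℝ F]
    {f : V → F}, CkHolderOn γ C A k f → CkHolderOn γ (c * C) A k fun x => c • f x := by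
  have base : ∀ {F : Type} [NormedAddCommGroup F] [NormedSpace ℝ F] {f : V → F},
      HolderBdd γ C A f → HolderBdd γ (c * C) A fun x => c • f x := by
    intro F _ _ f h
    refine ⟨fun x hx => ?_, fun x hx y hy => ?_⟩
    · rw [norm_smul, Real.norm_of_nonneg hc]
      exact mul_le_mul_of_nonneg_left (h.1 x hx) hc
    · rw [← smul_sub, norm_smul, Real.norm_of_nonneg hc, mul_assoc]
      exact mul_le_mul_of_nonneg_left (h.2 x hx y hy) hc
  induction k with
  | zero => intro F _ _ f h; exact base h
  | succ k ih =>
    intro F _ _ f h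
    refine ⟨base h.1, fun x hx => (h.2.1 x hx).const_smul c, ?_⟩
    have : (fderiv ℝ fun x => c • f x) = fun x => c • fderiv ℝ f x := by
      ext1 x
      exact congrFun (fderiv_const_smul_field (𝕜 := ℝ) (R := ℝ) (f := f) c) x
    rw [this]
    exact ih h.2.2

end Extension

/-! ### Partition of unity and conclusion -/

section Global

variable {n : ℕ} {γ M : ℝ≥0} {s s₀ : ℝ} {Ω : Set (RSpace n)} {d : RSpace n → ℝ}
  {μ : sphere (0 : RSpace n) 1 → ℝ}

/-- The norm adds the supremum and the seminorm, each at most `C`. -/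
theorem ckHolderNorm_zero_le_of_holderBdd {A : Set (RSpace n)} {f : RSpace n → ℝ} {C : ℝ≥0}
    (h : HolderBdd γ C A f) : ckHolderNorm 0 γ A f ≤ 2 * C := by
  have hi : iteratedFDeriv ℝ 0 f = (continuousMultilinearCurryFin0 ℝ (RSpace n) ℝ).symm ∘ f :=
    iteratedFDeriv_zero_eq_comp
  unfold ckHolderNorm
  rw [two_mul]
  refine add_le_add ?_ (HolderWith.eHolderNorm_le fun x y => ?_)
  · rw [zero_add, Finset.sum_range_one]
    refine iSup₂_le fun x hx => ?_
    rw [enorm_le_coe_iff_norm_le, norm_iteratedFDeriv_zero]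
    exact h.1 x hx
  · rw [hi]
    simp only [Function.comp_apply]
    rw [LinearIsometryEquiv.edist_map, edist_nndist, edist_nndist,
      ← ENNReal.coe_rpow_of_nonneg _ γ.coe_nonneg, ← ENNReal.coe_mul, ENNReal.coe_le_coe,
      ← NNReal.coe_le_coe]
    push_cast
    rw [dist_eq_norm]
    exact h.2 x x.2 y y.2

theorem stableOp_sum {ι : Type*} (t : Finset ι) {u : ι → RSpace n → ℝ} {x : RSpace n}
    (h : ∀ i ∈ t, Integrable (stableIntegrand s μ (u i) x)) :
    stableOp s μ (fun x => ∑ i ∈ t, u i x) x = ∑ i ∈ t, stableOp s μ (u i) x := by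
  have : stableIntegrand s μ (fun x => ∑ i ∈ t, u i x) x =
      fun y => ∑ i ∈ t, stableIntegrand s μ (u i) x y := by
    ext y
    simp only [stableIntegrand, ← Finset.sum_mul, ← Finset.sum_add_distrib, Finset.sum_div,
      Finset.sum_sub_distrib]
  rw [stableOp, this, integral_finsetSum t h, Finset.mul_sum]
  rfl

theorem stableOp_const_mul (c : ℝ) (u : RSpace n → ℝ) (x : RSpace n) :
    stableOp s μ (fun x => c * u x) x = c * stableOp s μ u x := by
  have : stableIntegrand s μ (fun x => c * u x) x = fun y => c * stableIntegrand s μ u x y := by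
    ext y
    simp only [stableIntegrand]
    ring
  rw [stableOp, this, integral_const_mul, stableOp]
  ring

/-- In `LocalHolderBound` the radius is fixed before the size `N` of the localised function. A
partition of unity subordinate to finitely many such balls can therefore be chosen first, and the
norms of the products `χ i * η` enter only afterwards. -/
theorem exists_holderBdd_stableOp (hn : 1 ≤ n) (hγ : 0 < γ) (hγ1 : γ ≤ 1) (hs₀ : 0 < s₀)
    (hΩ : IsC2HolderDomain γ Ω) (hΩb : Bornology.IsBounded Ω) (hd : IsRegularDistance γ Ω d)
    (M : ℝ≥0) (N : ℝ) :
    ∃ C, 0 ≤ C ∧ ∀ s, s₀ ≤ s → s < 1 → γ ≤ s → ∀ μ : sphere (0 : RSpace n) 1 → ℝ,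
      IsC1Sphere μ → sphereC1HolderNorm γ μ ≤ M →
      ∀ η : RSpace n → ℝ, ContDiff ℝ 2 η → CkHolderOn γ N univ 2 η →
      HolderBdd γ C Ω (stableOp s μ (Ω.indicator fun x => d x ^ s * η x)) := by
  have hγ1' : (γ : ℝ) ≤ 1 := by exact_mod_cast hγ1
  have hloc : ∀ x ∈ closure Ω, LocalHolderBound γ M s₀ Ω d x := by
    intro x hx
    by_cases hxΩ : x ∈ Ω
    · obtain ⟨⟨hdc, hdn⟩, hpos, -⟩ := hd
      lift ckHolderNorm 2 γ Ω d to ℝ≥0 using hdn.ne with N₀ hN₀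
      exact localHolderBound_of_mem hn hγ1 hs₀ hΩ.1 hdc hpos hN₀.symm.le hxΩ
    · refine localHolderBound_of_mem_frontier hn hγ hγ1 hs₀ hΩ hΩb hd ?_
      rw [hΩ.1.frontier_eq]
      exact ⟨hx, hxΩ⟩
  choose! ρ hρ H using hloc
  obtain ⟨t, ht, htc⟩ := hΩb.isCompact_closure.elim_nhds_subcover (fun x => ball x (ρ x))
    fun x hx => ball_mem_nhds x (hρ x hx)
  obtain ⟨χ, hχ⟩ := SmoothPartitionOfUnity.exists_isSubordinate (modelWithCornersSelf ℝ (RSpace n))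
    (isClosed_closure (s := Ω)) (fun i : t => ball (i : RSpace n) (ρ i)) (fun _ => isOpen_ball)
    (htc.trans (iUnion₂_subset fun x hx => subset_iUnion_of_subset ⟨x, hx⟩ subset_rfl))
  have hχs : ∀ i, ContDiff ℝ (⊤ : ℕ∞) (χ i) := fun i => (χ i).contMDiff.contDiff
  have hχc : ∀ i, HasCompactSupport (χ i) := fun i =>
    HasCompactSupport.of_support_subset_isCompact (isCompact_closedBall (i : RSpace n) (ρ i))
      ((subset_tsupport _).trans ((hχ i).trans ball_subset_closedBall))
  have hχ0 : ∀ i : t, ∀ x ∉ closedBall (i : RSpace n) (ρ i), χ i x = 0 := fun i x hx =>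
    image_eq_zero_of_notMem_tsupport fun h => hx (ball_subset_closedBall (hχ i h))
  choose K hK hχK using fun i => CkHolderOn.of_contDiff_compactSupport (k := 2) γ.2 hγ1' (χ i)
    (hχs i) (hχc i)
  choose K' hK' hχK' using fun i => CkHolderOn.bilin (γ := γ) (k := 2) (A := (univ : Set (RSpace n)))
    isOpen_univ (ContinuousLinearMap.mul ℝ ℝ) (K i) N
  choose C hC hCb using fun i : t => H i (ht i i.2) (K' i)
  refine ⟨∑ i, C i, Finset.sum_nonneg fun i _ => hC i, fun s hs hs1 hγs μ hμ hM η hη hηN => ?_⟩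
  have hηi : ∀ i, CkHolderOn γ (K' i) univ 2 fun x => χ i x * η x := fun i =>
    hχK' i _ _ (hχK i) hηN
  have hηs : ∀ i, ContDiff ℝ 2 fun x => χ i x * η x := fun i =>
    ((hχs i).of_le (WithTop.coe_le_coe.2 (le_top (a := (2 : ℕ∞))))).mul hη
  refine (HolderBdd.sum Finset.univ fun i _ => hCb i s hs hs1 hγs μ hμ hM _ (hηs i) (hηi i)
    fun x hx => by rw [hχ0 i x hx, zero_mul]).congr fun x hx => ?_
  obtain ⟨⟨hdc, hdn⟩, hpos, -⟩ := hd
  lift ckHolderNorm 2 γ Ω d to ℝ≥0 using hdn.ne with N₀ hN₀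
  rw [← stableOp_sum]
  · congr 1
    ext y
    by_cases hy : y ∈ Ω
    · simp only [indicator_of_mem hy]
      have h1 := χ.sum_eq_one (subset_closure hy)
      rw [finsum_eq_sum_of_fintype] at h1
      rw [← Finset.mul_sum, ← Finset.sum_mul, h1, one_mul]
    · simp only [indicator_of_notMem hy, Finset.sum_const_zero]
  · exact fun i _ => integrable_stableIntegrand_indicator hn (hs₀.trans_le hs) hs1 hμ
      (sphere_bounds_of_sphereC1HolderNorm_le hM).1 hΩ.1 hdc hpos N₀.2
      (fun x hx => (bounds_of_ckHolderNorm_two_le hN₀.symm.le).1 x hx) (hηs i)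
      (fun x => (hηi i).1.1 x trivial) hx

theorem stableOpHolderBound_of_holderBdd (hγ : 0 < γ) {u : RSpace n → ℝ} {C : ℝ≥0}
    (hi : ∀ x ∈ Ω, Integrable (stableIntegrand s μ u x)) (h : HolderBdd γ C Ω (stableOp s μ u)) :
    StableOpHolderBound s μ γ Ω u (2 * C) := by
  obtain ⟨F, hF, hFu⟩ := h.exists_extend_closure (NNReal.coe_pos.2 hγ)
  exact ⟨hi, F, hFu, ckHolderNorm_zero_le_of_holderBdd hF⟩

end Global

theorem proposition8p1 (n : ℕ) (hn : 1 ≤ n) (s₀ : ℝ) (hs₀ : 0 < s₀) (hs₀' : s₀ < 1)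
    (γ : ℝ≥0) (hγ : 0 < γ) (Ω : Set (RSpace n)) (hΩ : IsC2HolderDomain γ Ω)
    (hΩb : Bornology.IsBounded Ω) (d : RSpace n → ℝ) (hd : IsRegularDistance γ Ω d) (M : ℝ≥0) :
    ∃ C : ℝ≥0, ∀ s : ℝ, s₀ < s → s < 1 → (γ : ℝ) ≤ s →
      ∀ μ : sphere (0 : RSpace n) 1 → ℝ, IsC1Sphere μ → sphereC1HolderNorm γ μ ≤ M →
        StableOpHolderBound s μ γ Ω (Ω.indicator fun x => d x ^ s) C ∧
        ∀ η : RSpace n → ℝ, MemCkHolder 2 γ univ η →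
          StableOpHolderBound s μ γ Ω (Ω.indicator fun x => d x ^ s * η x)
            (C * ckHolderNorm 2 γ univ η) := by
  -- For `γ > 1` no admissible `s` exists, since `γ ≤ s < 1`.
  by_cases hγ1 : γ ≤ 1
  swap
  · refine ⟨0, fun s _ hs1 hγs => absurd ?_ hγ1⟩
    exact_mod_cast hγs.trans hs1.le
  -- The bound `4` is what `ckHolderOn_of_ckHolderNorm_le` gives for a function of norm one; the
  -- constant function `1` also satisfies it.
  obtain ⟨C, hC, H⟩ := exists_holderBdd_stableOp hn hγ hγ1 hs₀ hΩ hΩb hd M 4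
  lift C to ℝ≥0 using hC
  refine ⟨2 * C, fun s hs hs1 hγs μ hμ hM => ?_⟩
  obtain ⟨⟨hdc, hdn⟩, hpos, -⟩ := hd
  lift ckHolderNorm 2 γ Ω d to ℝ≥0 using hdn.ne with N₀ hN₀
  have hint : ∀ (η : RSpace n → ℝ) (N : ℝ), ContDiff ℝ 2 η → (∀ x, |η x| ≤ N) → ∀ x ∈ Ω,
      Integrable (stableIntegrand s μ (Ω.indicator fun x => d x ^ s * η x) x) :=
    fun η N hη hN x hx => integrable_stableIntegrand_indicator hn (hs₀.trans hs) hs1 hμ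
      (sphere_bounds_of_sphereC1HolderNorm_le hM).1 hΩ.1 hdc hpos N₀.2
      (fun x hx => (bounds_of_ckHolderNorm_two_le hN₀.symm.le).1 x hx) hη hN hx
  constructor
  · have h1 := H s hs.le hs1 hγs μ hμ hM (fun _ => 1) contDiff_const
      (CkHolderOn.const 1 (by norm_num))
    have h2 := hint (fun _ => 1) 1 contDiff_const (fun _ => by simp)
    simp only [mul_one] at h1 h2
    exact_mod_cast stableOpHolderBound_of_holderBdd hγ h2 h1
  · rintro η ⟨hη, hηn⟩
    lift ckHolderNorm 2 γ univ η to ℝ≥0 using hηn.ne with K hK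
    have hηK := ckHolderOn_of_ckHolderNorm_le hγ1 isOpen_univ hη hK.symm.le subset_rfl convex_univ
    rw [contDiffOn_univ] at hη
    have hb : ∀ x, |η x| ≤ K := fun x =>
      (bounds_of_ckHolderNorm_two_le hK.symm.le).1 x trivial
    -- By linearity `η` is normalised by its norm `K`. If `K = 0` then `η` vanishes identically, and
    -- the convention `0⁻¹ = 0` is harmless.
    have hη' : ∀ x, η x = K * ((K : ℝ)⁻¹ • η x) := fun x => by
      by_cases h0 : (K : ℝ) = 0
      · have := hb x
        rw [h0, abs_nonpos_iff] at this
        rw [this, h0, zero_mul]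
      · rw [smul_eq_mul, mul_inv_cancel_left₀ h0]
    have h1 := H s hs.le hs1 hγs μ hμ hM (fun x => (K : ℝ)⁻¹ • η x) (hη.const_smul _)
      ((hηK.const_smul (inv_nonneg.2 K.coe_nonneg)).mono (by
        rw [mul_left_comm]
        exact mul_le_of_le_one_right (by norm_num) (inv_mul_le_one (a := (K : ℝ)))))
    have h2 := (h1.const_mul K.coe_nonneg).congr (g := stableOp s μ (Ω.indicator fun x => d x ^ s * η x))
      fun x _ => by
        rw [← stableOp_const_mul]
        congr 1
        ext y
        by_cases hy : y ∈ Ω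
        · rw [indicator_of_mem hy, indicator_of_mem hy, mul_left_comm, ← hη']
        · rw [indicator_of_notMem hy, indicator_of_notMem hy, mul_zero]
    have h3 := stableOpHolderBound_of_holderBdd (C := K * C) hγ (hint η K hη hb)
      (by exact_mod_cast h2)
    convert h3 using 1
    push_cast
    ring
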